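/- **Theorem 2.1.** Let $d\ge 1$, $D\subset\mathbf R^d$, $\delta>0$ and $[D]_\delta=\{t+u:t\in D,\ \|u\|<\delta\}$. Let $X$ be a Gaussian random field with almost surely continuous paths on $[D]_\delta$, with $E X(t)=0$ and $E X(t)^2=1$ for $t\in[D]_\delta$, such that, uniformly over $t\in[D]_\delta$ (with $t+u\in[D]_\delta$), $$E[X(t)X(t+u)]=1-(1+o(1))\,\|u\|^\alpha L(\|u\|)\,r_t(u/\|u\|)\qquad\text{as }u\to0,$$ where $0<\alpha\le2$, $L$ is (measurable and) slowly varying at $0$, each $r_t:\mathbf S^{d-1}\to(0,\infty)$ is continuous, $\sup_{v\in\mathbf S^{d-1}}|r_t(v)-r_u(v)|\to0$ as $u\to t$ uniformly in $t\in[D]_\delta$, and $\sup_{t\in[D]_\delta,\,v\in\mathbf S^{d-1}}r_t(v)<\infty$. Put $\psi(c)=(2\pi c^2)^{-1/2}e^{-c^2/2}$ and $\Delta_c=\min\{x>0:x^\alpha L(x)=(2c^2)^{-1}\}$, and assume that this minimum exists for all large $c$ and that $\Delta_c\to0$ as $c\to\infty$ (both are automatic if $L$ is continuous on $(0,\infty)$).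 For each $t\in D$ there is a Gaussian random field $W_t$ on $[0,\infty)^d$, with almost surely continuous paths and $W_t(0)=0$ almost surely, such that, with $g_t(u)=\|u\|^\alpha r_t(u/\|u\|)$ and $g_t(0)=0$, $$E\,W_t(u)=-g_t(u)/2,\qquad \operatorname{Cov}(W_t(u),W_t(v))=[g_t(u)+g_t(v)-g_t(u-v)]/2.$$ Moreover, for every such $W_t$, $$H_K(t)=\int_0^\infty e^y\,P\Big\{\sup_{u\in[0,K]^d}W_t(u)>y\Big\}\,dy<\infty\quad(K>0),$$ and the limit $H(t)=\lim_{K\to\infty}K^{-d}H_K(t)$ exists, with $0<H(t)<\infty$. Furthermore: (i) Let $I_{t,\zeta}=\prod_{i=1}^d[t_i,t_i+\zeta)$. If $\inf_{t\in D,\,v\in\mathbf S^{d-1}}r_t(v)>0$ (which is automatic if $D$ is bounded), then, whenever $\ell_c\to\infty$ and $\ell_c=o(\Delta_c^{-1})$ as $c\to\infty$, $$P\Big\{\sup_{u\in I_{t,\ell_c\Delta_c}}X(u)>c\Big\}\sim\ell_c^d\,\psi(c)\,H(t)\qquad\text{uniformly over }t\in D.$$ (ii) If $D$ is bounded and Jordan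 measurable with positive volume, and $E[X(s)X(t)]<1$ for all distinct $s,t\in D$, then $H$ is integrable over $D$ and, as $c\to\infty$, $$P\Big\{\sup_{t\in D}X(t)>c\Big\}\sim\psi(c)\,\Delta_c^{-d}\int_D H(t)\,dt.$$ -/

import Mathlib

open MeasureTheory ProbabilityTheory Filter Topology Asymptotics
open scoped ENNReal

noncomputable section

/-- `ψ(c) = (2πc²)^{-1/2} exp(-c²/2)`. -/
def gaussTail (c : ℝ) : ℝ := (Real.sqrt (2 * Real.pi * c ^ 2))⁻¹ * Real.exp (-(c ^ 2) / 2)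

/-- The half-open cube `I_{t,ζ} = ∏ᵢ [tᵢ, tᵢ + ζ)`. -/
def cube {d : ℕ} (t : EuclideanSpace ℝ (Fin d)) (ζ : ℝ) : Set (EuclideanSpace ℝ (Fin d)) :=
  {u | ∀ i, t i ≤ u i ∧ u i < t i + ζ}

/-- The closed cube `[0, K]^d`. -/
def closedCube (d : ℕ) (K : ℝ) : Set (EuclideanSpace ℝ (Fin d)) :=
  {u | ∀ i, 0 ≤ u i ∧ u i ≤ K}

/-- The orthant `[0, ∞)^d`. -/
def orthant (d : ℕ) : Set (EuclideanSpace ℝ (Fin d)) := {u | ∀ i, 0 ≤ u i}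

/-- The event `{sup_{u ∈ S} Y(u) > c}`. The supremum is taken in the extended reals, so it is a
genuine supremum for every sample path and every `S`. -/
def supExceeds {T Ω : Type*} (Y : T → Ω → ℝ) (S : Set T) (c : ℝ) : Set Ω :=
  {ω | (c : EReal) < ⨆ u ∈ S, ((Y u ω : ℝ) : EReal)}

/-- `L` is a (measurable) function which is slowly varying at the origin. Only the values `L x` for
`x > 0` matter, and positivity is only needed near `0`. -/
structure SlowlyVaryingAtZero (L : ℝ → ℝ) : Prop where
  measurable : Measurable L
  eventually_pos : ∀ᶠ x in 𝓝[>] (0 : ℝ), 0 < L x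
  tendsto_ratio : ∀ lam : ℝ, 0 < lam → Tendsto (fun x => L (lam * x) / L x) (𝓝[>] 0) (𝓝 1)

/-- The solution set `{x > 0 : x^α L(x) = (2c²)⁻¹}`. -/
def scaleSet (α : ℝ) (L : ℝ → ℝ) (c : ℝ) : Set ℝ :=
  {x | 0 < x ∧ x ^ α * L x = (2 * c ^ 2)⁻¹}

/-- `Δ_c = min {x > 0 : x^α L(x) = (2c²)⁻¹}`. It is written as an infimum; that the minimum is
attained is a separate condition `IsLeast (scaleSet α L c) (scale α L c)`. -/
def scale (α : ℝ) (L : ℝ → ℝ) (c : ℝ) : ℝ := sInf (scaleSet α L c)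

/-- `‖u‖^α ρ(u/‖u‖)`, for a function `ρ` on the unit sphere. For `α > 0` its value at `u = 0`
is `0`. -/
def homog {d : ℕ} (α : ℝ) (ρ : EuclideanSpace ℝ (Fin d) → ℝ) (u : EuclideanSpace ℝ (Fin d)) : ℝ :=
  ‖u‖ ^ α * ρ (‖u‖⁻¹ • u)

/-- `W` is, under `P`, a continuous Gaussian random field on `[0, ∞)^d` with `W(0) = 0`, mean
`-‖u‖^α ρ(u/‖u‖)/2` and covariance
`[‖u‖^α ρ(u/‖u‖) + ‖v‖^α ρ(v/‖v‖) - ‖u-v‖^α ρ((u-v)/‖u-v‖)]/2`.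
The values of `W` outside the orthant are irrelevant. -/
structure IsTangentField {d : ℕ} {Ω : Type*} [MeasurableSpace Ω] (α : ℝ)
    (ρ : EuclideanSpace ℝ (Fin d) → ℝ) (W : EuclideanSpace ℝ (Fin d) → Ω → ℝ) (P : Measure Ω) :
    Prop where
  isProbabilityMeasure : IsProbabilityMeasure P
  isGaussian : IsGaussianProcess (fun u : orthant d => W u) P
  continuousOn : ∀ᵐ ω ∂P, ContinuousOn (fun u => W u ω) (orthant d)
  zero : ∀ᵐ ω ∂P, W 0 ω = 0
  mean : ∀ u ∈ orthant d, ∫ ω, W u ω ∂P = -(homog α ρ u) / 2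
  cov : ∀ u ∈ orthant d, ∀ v ∈ orthant d,
    covariance (W u) (W v) P = (homog α ρ u + homog α ρ v - homog α ρ (u - v)) / 2

/-- `H_K = ∫₀^∞ e^y P{sup_{u ∈ [0,K]^d} W(u) > y} dy`, with values in `[0, ∞]`. -/
def pickandsIntegral {d : ℕ} {Ω : Type*} [MeasurableSpace Ω]
    (W : EuclideanSpace ℝ (Fin d) → Ω → ℝ) (P : Measure Ω) (K : ℝ) : ℝ≥0∞ :=
  ∫⁻ y in Set.Ioi (0 : ℝ), ENNReal.ofReal (Real.exp y) * P (supExceeds W (closedCube d K) y)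

/-- `h = lim_{K → ∞} K^{-d} H_K`, where `H_K` is formed with the tangent field `W` determined (in
law) by `α` and `ρ`. The statement includes that such a field exists, and that for every such field
all the `H_K` are finite and the limit exists and is `h`. In particular `h` is determined uniquely
by `α` and `ρ`. -/
def IsPickandsValue {d : ℕ} (α : ℝ) (ρ : EuclideanSpace ℝ (Fin d) → ℝ) (h : ℝ) : Prop :=
  (∃ (Ω : Type) (_ : MeasurableSpace Ω) (P : Measure Ω) (W : EuclideanSpace ℝ (Fin d) → Ω → ℝ),
    IsTangentField α ρ W P) ∧
  ∀ (Ω : Type) (_ : MeasurableSpace Ω) (P : Measure Ω) (W : EuclideanSpace ℝ (Fin d) → Ω → ℝ),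
    IsTangentField α ρ W P →
      (∀ K : ℝ, 0 < K → pickandsIntegral W P K ≠ ∞) ∧
      Tendsto (fun K : ℝ => (pickandsIntegral W P K).toReal / K ^ d) atTop (𝓝 h)

/-- Bounded and Jordan measurable: the boundary can be covered by countably many rectangles of
arbitrarily small total volume, i.e. it is Lebesgue null. -/
def BoundedJordanMeasurable {d : ℕ} (D : Set (EuclideanSpace ℝ (Fin d))) : Prop :=
  Bornology.IsBounded D ∧ volume (frontier D) = 0

/-- `E[X(t)X(t+u)] = 1 - (1 + o(1)) ‖u‖^α L(‖u‖) r_t(u/‖u‖)` as `u → 0`, uniformly over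
`t ∈ U`, for `t` and `t + u` in `U`. -/
def LocalCovariance {d : ℕ} {Ω : Type*} [MeasurableSpace Ω] (P : Measure Ω)
    (X : EuclideanSpace ℝ (Fin d) → Ω → ℝ) (U : Set (EuclideanSpace ℝ (Fin d))) (α : ℝ)
    (L : ℝ → ℝ) (r : EuclideanSpace ℝ (Fin d) → EuclideanSpace ℝ (Fin d) → ℝ) : Prop :=
  ∀ ε > 0, ∃ η > 0, ∀ t ∈ U, ∀ u, t + u ∈ U → 0 < ‖u‖ → ‖u‖ < η →
    |1 - ∫ ω, X t ω * X (t + u) ω ∂P - ‖u‖ ^ α * L ‖u‖ * r t (‖u‖⁻¹ • u)| ≤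
      ε * (‖u‖ ^ α * L ‖u‖ * r t (‖u‖⁻¹ • u))

end

/-! Where `X` is close to a high level `c`, the field `c X` seen at spatial scale `Δ_c` looks like
the tangent field. The quantity to watch is the variogram `2c²(1 - ρ)` of `c X` (`vario`). By the
choice of `Δ_c` and slow variation, its value at `t + Δu`, `t + Δv` tends to `g_t(u - v)`, uniformly
in `t` (`tendsto_vario`).

Given this, exceedances over finitely many points follow by conditioning on one value. The variable
`Y = c² - c X(t)` has density `ψ(c) exp(y - y²/(2c²))` and is independent of the residuals of the
other values. So the probability equals `ψ(c)` times an explicit Gaussian functional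
(`measure_exists_gt`), and this functional converges to `E exp(max W)`. A compactness argument makes
the convergence uniform (`exists_expExceed_close`, `measure_finite_exceed`).

Chaining passes from finite sets to cubes. A small cell whose base value lies below `c - s/c` still
crosses `c` only with probability `ψ(c) e^{-s}` times an arbitrarily high negative power of `s` and
of the fineness of the cell (`exists_measure_cell_le`). Hence a cube of side `K Δ` exceeds `c` with
probability about `ψ(c) (1 + H_K)` (`exists_pickCube_approx`, `pickCube_eq`).

Large cubes are cut into blocks. Two cells exceed together with probability at most of order `ψ(c)
exp(-vario/32)`, which is summable over a grid. The double exceedances between distinct blocks of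
`N^d` cells are therefore only of surface order `N^{d-1}` per block (`exists_block_approx`).

The limit constant is obtained without any subadditivity argument. Two approximations of one and the
same probability are compared and divided by `ψ(c)`, which leaves a relation between constants
alone. This gives existence of the limit and its uniform continuity in `t`; positivity comes from
Bonferroni applied to widely spaced points (`exists_cube_asymptotics`, `exists_pickands_close`,
`exists_le_measure_cube`).

For the global statement `D` is covered by small cubes: a union bound from above, Bonferroni over
slightly shrunk cubes from below. The shrunk cubes are separated, so their correlation stays below
`1` and joint exceedances are exponentially rarer than single ones (`eventually_separated_le`).
Riemann sums then give the integral of `H`.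

Existence of the tangent field needs no analytic proof that its kernel is positive semidefinite: the
kernel is a limit of covariance matrices of vectors built from `X` (`tangentCov_posSemidef`). The
field is built on dyadic points from independent normals by Gram–Schmidt, and extended by
Kolmogorov's continuity argument (`exists_isTangentField`). -/

lemma supExceeds_eq {T Ω : Type*} (Y : T → Ω → ℝ) (S : Set T) (c : ℝ) :
    supExceeds Y S c = {ω | ∃ u ∈ S, c < Y u ω} := by
  ext ω
  simp [supExceeds, lt_iSup_iff]

/-! ### One-dimensional Gaussian tails. -/

lemma gaussTail_of_pos {c : ℝ} (hc : 0 < c) :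
    gaussTail c = (c * √(2 * Real.pi))⁻¹ * Real.exp (-(c ^ 2) / 2) := by
  rw [gaussTail, Real.sqrt_mul (by positivity), Real.sqrt_sq hc.le, mul_comm c]

lemma gaussTail_pos {c : ℝ} (hc : 0 < c) : 0 < gaussTail c := by
  rw [gaussTail_of_pos hc]; positivity

lemma gaussianPDFReal_zero_mean (v : NNReal) (x : ℝ) :
    gaussianPDFReal 0 v x = (√(2 * Real.pi * v))⁻¹ * Real.exp (-x ^ 2 / (2 * v)) := by
  simp [gaussianPDFReal]

/-- Mills' upper bound for the Gaussian tail. -/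
lemma gaussianReal_Ioi_le (v : NNReal) {x : ℝ} (hx : 0 < x) :
    gaussianReal 0 v (Set.Ioi x) ≤
      ENNReal.ofReal (√v / (x * √(2 * Real.pi)) * Real.exp (-x ^ 2 / (2 * v))) := by
  rcases eq_or_ne v 0 with rfl | hv
  · simp [gaussianReal_zero_var, hx.le]
  have hv0 : (0 : ℝ) < v := by positivity
  rw [gaussianReal_apply_eq_integral _ hv]
  refine ENNReal.ofReal_le_ofReal ?_
  have hder : ∀ t : ℝ, HasDerivAt (fun t : ℝ => -(v : ℝ) * Real.exp (-t ^ 2 / (2 * v)))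
      (t * Real.exp (-t ^ 2 / (2 * v))) t := by
    intro t
    have h1 : HasDerivAt (fun t : ℝ => -t ^ 2 / (2 * (v : ℝ))) (-(2 * t) / (2 * v)) t := by
      have := ((hasDerivAt_pow 2 t).neg).div_const (2 * (v : ℝ))
      simpa using this
    refine ((h1.exp).const_mul (-(v : ℝ))).congr_deriv ?_
    field_simp
  have htend : Tendsto (fun t : ℝ => -(v : ℝ) * Real.exp (-t ^ 2 / (2 * v))) atTop (𝓝 0) := by
    have h2 : Tendsto (fun t : ℝ => -t ^ 2 / (2 * (v : ℝ))) atTop atBot := by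
      have h3 : Tendsto (fun t : ℝ => t ^ 2 / (2 * (v : ℝ))) atTop atTop :=
        (tendsto_pow_atTop two_ne_zero).atTop_div_const (by positivity)
      refine (tendsto_neg_atTop_atBot.comp h3).congr fun t => ?_
      simp [neg_div]
    simpa using (Real.tendsto_exp_atBot.comp h2).const_mul (-(v : ℝ))
  have hint := integrableOn_Ioi_deriv_of_nonneg' (a := x) (fun t _ => hder t)
    (fun t ht => mul_nonneg (hx.trans ht).le (Real.exp_pos _).le) htend
  have hval := integral_Ioi_of_hasDerivAt_of_tendsto' (a := x) (fun t _ => hder t) hint htend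
  -- Multiplying the density by `t / x ≥ 1` on `(x, ∞)` makes it an exact derivative.
  have hle : ∫ t in Set.Ioi x, gaussianPDFReal 0 v t ≤
      ∫ t in Set.Ioi x, ((√(2 * Real.pi * v))⁻¹ / x) * (t * Real.exp (-t ^ 2 / (2 * v))) := by
    refine setIntegral_mono_on (integrable_gaussianPDFReal 0 v).integrableOn
      (hint.const_mul _) measurableSet_Ioi fun t ht => ?_
    rw [gaussianPDFReal_zero_mean]
    have : 1 ≤ t / x := (one_le_div hx).2 (Set.mem_Ioi.1 ht).le
    calc _ = ((√(2 * Real.pi * v))⁻¹ * Real.exp (-t ^ 2 / (2 * v))) * 1 := by ring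
      _ ≤ ((√(2 * Real.pi * v))⁻¹ * Real.exp (-t ^ 2 / (2 * v))) * (t / x) := by gcongr
      _ = _ := by ring
  refine hle.trans (le_of_eq ?_)
  rw [integral_const_mul, hval, Real.sqrt_mul (by positivity)]
  have : (v : ℝ) = √v * √v := (Real.mul_self_sqrt hv0.le).symm
  have hs : 0 < √(v : ℝ) := Real.sqrt_pos.2 hv0
  have hp : 0 < √(2 * Real.pi) := by positivity
  set e := Real.exp (-x ^ 2 / (2 * v)) with he
  field_simp
  rw [Real.sq_sqrt hv0.le]
  ring

/-- A centred Gaussian variable with variance at most `c² + w` exceeds `c² + b` with probability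
at most `4 ψ(c) exp(-b + w/2)`. -/
lemma measure_gaussian_gt_le {Ω : Type*} [MeasurableSpace Ω] {P : Measure Ω} {N : Ω → ℝ}
    (hN : HasGaussianLaw N P) (hmean : ∫ ω, N ω ∂P = 0) {c b w : ℝ} (hc : 0 < c)
    (hvar : ∫ ω, N ω ^ 2 ∂P ≤ c ^ 2 + w) (hw : w ≤ 3 * c ^ 2) (hb : -(c ^ 2) / 2 ≤ b) :
    P {ω | c ^ 2 + b < N ω} ≤ ENNReal.ofReal (4 * gaussTail c * Real.exp (-b + w / 2)) := by
  have := hN.isProbabilityMeasure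
  have hvar' : Var[N; P] = ∫ ω, N ω ^ 2 ∂P := by
    rw [variance_of_integral_eq_zero hN.aemeasurable hmean]
  have hmap := hN.map_eq_gaussianReal
  rw [hmean] at hmap
  have hset : P {ω | c ^ 2 + b < N ω} = gaussianReal 0 (Var[N; P]).toNNReal (Set.Ioi (c ^ 2 + b)) := by
    rw [← hmap, Measure.map_apply_of_aemeasurable hN.aemeasurable measurableSet_Ioi]
    rfl
  have hx : 0 < c ^ 2 + b := by nlinarith [sq_pos_of_pos hc]
  rw [hset]
  set v := (Var[N; P]).toNNReal with hv
  refine (gaussianReal_Ioi_le v hx).trans (ENNReal.ofReal_le_ofReal ?_)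
  have hvle : (v : ℝ) ≤ c ^ 2 + w := by
    rw [hv, Real.coe_toNNReal _ (variance_nonneg _ _), hvar']; exact hvar
  rcases eq_or_ne v 0 with h0 | h0
  · rw [h0]
    simp only [NNReal.coe_zero, Real.sqrt_zero, zero_div, zero_mul]
    have := gaussTail_pos hc
    positivity
  have hv0 : (0 : ℝ) < v := by positivity
  -- The constant 4: `w ≤ 3c²` bounds the standard deviation by `2c`, and `b ≥ -c²/2` keeps the
  -- threshold above `c²/2`.
  have h1 : √(v : ℝ) / ((c ^ 2 + b) * √(2 * Real.pi)) ≤ 4 * (c * √(2 * Real.pi))⁻¹ := by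
    have hs : √(v : ℝ) ≤ 2 * c := by
      rw [Real.sqrt_le_left (by positivity)]
      nlinarith
    have hp : 0 < √(2 * Real.pi) := by positivity
    rw [← div_eq_mul_inv, div_le_div_iff₀ (by positivity) (by positivity)]
    have : √(v : ℝ) * c ≤ 4 * (c ^ 2 + b) := by nlinarith
    nlinarith
  have h2 : -(c ^ 2 + b) ^ 2 / (2 * v) ≤ -(c ^ 2) / 2 + (-b + w / 2) := by
    have hcw : 0 < c ^ 2 + w := hv0.trans_le hvle
    have h3 : (c ^ 2 + b) ^ 2 / (c ^ 2 + w) ≤ (c ^ 2 + b) ^ 2 / v := by gcongr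
    -- After clearing the denominator the difference of the two sides is `(b - w)²`.
    have h4 : c ^ 2 + 2 * b - w ≤ (c ^ 2 + b) ^ 2 / (c ^ 2 + w) := by
      rw [le_div_iff₀ hcw]
      nlinarith [sq_nonneg (b - w)]
    have h5 : -(c ^ 2 + b) ^ 2 / (2 * v) = -((c ^ 2 + b) ^ 2 / v) / 2 := by
      field_simp
    rw [h5]; linarith
  calc _ ≤ 4 * (c * √(2 * Real.pi))⁻¹ * Real.exp (-(c ^ 2) / 2 + (-b + w / 2)) := by gcongr
    _ = _ := by rw [gaussTail_of_pos hc, Real.exp_add]; ring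

/-! ### Centred Gaussian fields of unit variance. -/

/-- Finite linear combinations of the values of a Gaussian process form a Gaussian process. -/
lemma IsGaussianProcess.sum_mul {T S ι Ω : Type*} [Fintype ι] [MeasurableSpace Ω] {P : Measure Ω}
    {Y : T → Ω → ℝ} (hY : IsGaussianProcess Y P) (t : ι → T) (a : S → ι → ℝ) :
    IsGaussianProcess (fun s ω => ∑ i, a s i * Y (t i) ω) P := by
  classical
  refine hY.of_isGaussianProcess fun s => ⟨Finset.univ.image t,
    ∑ i, a s i • ContinuousLinearMap.proj (⟨t i, by simp⟩ : Finset.univ.image t), fun ω => ?_⟩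
  simp

/-- A field which on `U` is Gaussian, centred, of unit variance and a.s. continuous. -/
structure UnitGaussianField {T Ω : Type*} [TopologicalSpace T] [MeasurableSpace Ω] (P : Measure Ω)
    (X : T → Ω → ℝ) (U : Set T) : Prop where
  isGaussian : IsGaussianProcess (fun t : U => X t) P
  continuousOn : ∀ᵐ ω ∂P, ContinuousOn (fun t => X t ω) U
  mean : ∀ t ∈ U, ∫ ω, X t ω ∂P = 0
  sq : ∀ t ∈ U, ∫ ω, X t ω ^ 2 ∂P = 1

/-- The correlation function of a centred field of unit variance. -/
noncomputable def corr {T Ω : Type*} [MeasurableSpace Ω] (P : Measure Ω) (X : T → Ω → ℝ)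
    (s t : T) : ℝ :=
  ∫ ω, X s ω * X t ω ∂P

lemma corr_comm {T Ω : Type*} [MeasurableSpace Ω] (P : Measure Ω) (X : T → Ω → ℝ) (s t : T) :
    corr P X s t = corr P X t s := by simp only [corr, mul_comm]

namespace UnitGaussianField

variable {T Ω : Type*} [TopologicalSpace T] [MeasurableSpace Ω] {P : Measure Ω}
  {X : T → Ω → ℝ} {U : Set T}

lemma isProbabilityMeasure (h : UnitGaussianField P X U) : IsProbabilityMeasure P :=
  h.isGaussian.isProbabilityMeasure

lemma hasGaussianLaw (h : UnitGaussianField P X U) {t : T} (ht : t ∈ U) :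
    HasGaussianLaw (X t) P := h.isGaussian.hasGaussianLaw_eval ⟨t, ht⟩

lemma memLp (h : UnitGaussianField P X U) {t : T} (ht : t ∈ U) : MemLp (X t) 2 P :=
  (h.hasGaussianLaw ht).memLp_two

lemma integrable_mul (h : UnitGaussianField P X U) {s t : T} (hs : s ∈ U) (ht : t ∈ U) :
    Integrable (fun ω => X s ω * X t ω) P := (h.memLp hs).integrable_mul (h.memLp ht)

lemma corr_self (h : UnitGaussianField P X U) {t : T} (ht : t ∈ U) : corr P X t t = 1 := by
  simpa [corr, pow_two] using h.sq t ht

lemma hasGaussianLaw_comb (h : UnitGaussianField P X U) {r p q : T} (hr : r ∈ U) (hp : p ∈ U)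
    (hq : q ∈ U) (a b e : ℝ) :
    HasGaussianLaw (fun ω => a * X r ω + b * X p ω + e * X q ω) P := by
  have := (IsGaussianProcess.sum_mul (S := Unit) h.isGaussian
    ![(⟨r, hr⟩ : U), ⟨p, hp⟩, ⟨q, hq⟩] (fun _ => ![a, b, e])).hasGaussianLaw_eval ()
  simpa [Fin.sum_univ_three] using this

lemma integral_comb (h : UnitGaussianField P X U) {r p q : T} (hr : r ∈ U) (hp : p ∈ U)
    (hq : q ∈ U) (a b e : ℝ) :
    ∫ ω, (a * X r ω + b * X p ω + e * X q ω) ∂P = 0 := by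
  have i1 := (h.hasGaussianLaw hr).integrable.const_mul a
  have i2 := (h.hasGaussianLaw hp).integrable.const_mul b
  have i3 := (h.hasGaussianLaw hq).integrable.const_mul e
  rw [integral_add (i1.fun_add i2) i3, integral_add i1 i2]
  simp [integral_const_mul, h.mean _ hr, h.mean _ hp, h.mean _ hq]

lemma integral_comb_sq (h : UnitGaussianField P X U) {r p q : T} (hr : r ∈ U) (hp : p ∈ U)
    (hq : q ∈ U) (a b e : ℝ) :
    ∫ ω, (a * X r ω + b * X p ω + e * X q ω) ^ 2 ∂P =
      a ^ 2 + b ^ 2 + e ^ 2 + 2 * a * b * corr P X r p + 2 * a * e * corr P X r q +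
        2 * b * e * corr P X p q := by
  have i1 := (h.integrable_mul hr hr).const_mul (a ^ 2)
  have i2 := (h.integrable_mul hp hp).const_mul (b ^ 2)
  have i3 := (h.integrable_mul hq hq).const_mul (e ^ 2)
  have i4 := (h.integrable_mul hr hp).const_mul (2 * a * b)
  have i5 := (h.integrable_mul hr hq).const_mul (2 * a * e)
  have i6 := (h.integrable_mul hp hq).const_mul (2 * b * e)
  have : ∀ ω, (a * X r ω + b * X p ω + e * X q ω) ^ 2 =
      a ^ 2 * (X r ω * X r ω) + b ^ 2 * (X p ω * X p ω) + e ^ 2 * (X q ω * X q ω)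
      + 2 * a * b * (X r ω * X p ω) + 2 * a * e * (X r ω * X q ω)
      + 2 * b * e * (X p ω * X q ω) := fun ω => by ring
  simp_rw [this]
  rw [integral_add ((((i1.fun_add i2).fun_add i3).fun_add i4).fun_add i5) i6,
    integral_add (((i1.fun_add i2).fun_add i3).fun_add i4) i5,
    integral_add ((i1.fun_add i2).fun_add i3) i4,
    integral_add (i1.fun_add i2) i3, integral_add i1 i2]
  simp only [integral_const_mul]
  have := h.corr_self hr
  have := h.corr_self hp
  have := h.corr_self hq
  simp only [corr] at *
  simp [*]

lemma corr_le_one (h : UnitGaussianField P X U) {s t : T} (hs : s ∈ U) (ht : t ∈ U) :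
    corr P X s t ≤ 1 := by
  have h1 := h.integral_comb_sq hs ht ht 1 (-1) 0
  have h2 : 0 ≤ ∫ ω, (1 * X s ω + (-1) * X t ω + 0 * X t ω) ^ 2 ∂P :=
    integral_nonneg fun ω => sq_nonneg _
  rw [h1] at h2
  linarith

lemma neg_one_le_corr (h : UnitGaussianField P X U) {s t : T} (hs : s ∈ U) (ht : t ∈ U) :
    -1 ≤ corr P X s t := by
  have h1 := h.integral_comb_sq hs ht ht 1 1 0
  have h2 : 0 ≤ ∫ ω, (1 * X s ω + 1 * X t ω + 0 * X t ω) ^ 2 ∂P :=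
    integral_nonneg fun ω => sq_nonneg _
  rw [h1] at h2
  linarith

end UnitGaussianField

/-! ### Slow variation at the origin. -/

namespace SlowlyVaryingAtZero

variable {L : ℝ → ℝ}

/-- The upper half of the uniform convergence theorem for slowly varying functions. -/
lemma eventually_le_of_mem_Icc (hL : SlowlyVaryingAtZero L) {ε : ℝ} (hε : 0 < ε) :
    ∀ᶠ x in 𝓝[>] (0 : ℝ), ∀ lam ∈ Set.Icc (1 / 2 : ℝ) 1, L (lam * x) ≤ (1 + ε) * L x := by
  by_contra hcon
  have hfreq : ∃ᶠ x in 𝓝[>] (0 : ℝ), ∃ lam ∈ Set.Icc (1 / 2 : ℝ) 1, (1 + ε) * L x < L (lam * x) := by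
    refine (not_eventually.1 hcon).mono fun x hx => ?_
    push Not at hx
    exact hx
  obtain ⟨x, hx, hxb⟩ := exists_seq_forall_of_frequently hfreq
  choose lam hlam hbad using hxb
  obtain ⟨hx0, hxpos⟩ := tendsto_nhdsWithin_iff.1 hx
  have hlx : Tendsto (fun n => lam n * x n) atTop (𝓝[>] (0 : ℝ)) := by
    refine tendsto_nhdsWithin_iff.2 ⟨?_, ?_⟩
    · refine squeeze_zero' ?_ ?_ hx0
      · filter_upwards [hxpos] with n hn
        exact mul_nonneg (by linarith [(hlam n).1]) (Set.mem_Ioi.1 hn).le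
      · filter_upwards [hxpos] with n hn
        exact mul_le_of_le_one_left (Set.mem_Ioi.1 hn).le (hlam n).2
    · filter_upwards [hxpos] with n hn
      exact mul_pos (lt_of_lt_of_le (by norm_num) (hlam n).1) hn
  -- `δ` is so small that comparing `L(x)` with `L(λx)` through a common third value, with relative
  -- error `δ` on either side, loses at most the factor `1 + ε`.
  obtain ⟨δ, hδ0, hδ1, hδ⟩ : ∃ δ : ℝ, 0 < δ ∧ δ < 1 ∧ (1 + δ) ≤ (1 + ε) * (1 - δ) := by
    refine ⟨ε / (2 + ε + ε), by positivity, by rw [div_lt_one (by positivity)]; linarith, ?_⟩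
    rw [← sub_nonneg]
    have : (1 + ε) * (1 - ε / (2 + ε + ε)) - (1 + ε / (2 + ε + ε)) = (ε ^ 2) / (2 + ε + ε) := by
      field_simp; ring
    rw [this]; positivity
  let ν : Measure ℝ := volume.restrict (Set.Icc (1 / 4 : ℝ) 1)
  have hmeas : ∀ y : ℝ, AEStronglyMeasurable (fun s => L (s * y) / L y) ν := fun y =>
    ((hL.measurable.comp (measurable_id.mul_const y)).div_const _).aestronglyMeasurable
  -- Pointwise convergence of the ratios implies convergence in measure over `s ∈ [1/4, 1]`, along
  -- any sequence tending to `0`. It is used for `x n` and for `lam n * x n`.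
  have key : ∀ y : ℕ → ℝ, Tendsto y atTop (𝓝[>] (0 : ℝ)) → ∀ᶠ n in atTop,
      volume {s | s ∈ Set.Icc (1 / 4 : ℝ) 1 ∧ δ ≤ |L (s * y n) / L (y n) - 1|} <
        ENNReal.ofReal (1 / 16) := by
    intro y hy
    have htm : TendstoInMeasure ν (fun n s => L (s * y n) / L (y n)) atTop (fun _ => 1) := by
      refine tendstoInMeasure_of_tendsto_ae (fun n => hmeas _) ?_
      refine (ae_restrict_iff' measurableSet_Icc).2 (ae_of_all _ fun s hs => ?_)
      exact (hL.tendsto_ratio s (by linarith [hs.1])).comp hy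
    have h1 := htm (ENNReal.ofReal δ) (by simpa using hδ0)
    have h2 := h1.eventually_lt_const (u := ENNReal.ofReal (1 / 16)) (by simp)
    filter_upwards [h2] with n hn
    refine lt_of_le_of_lt (le_of_eq ?_) hn
    have hset : MeasurableSet {s | ENNReal.ofReal δ ≤ edist (L (s * y n) / L (y n)) 1} :=
      measurableSet_le measurable_const (Measurable.edist
        ((hL.measurable.comp (measurable_id.mul_const _)).div_const _) measurable_const)
    rw [Measure.restrict_apply hset]
    congr 1
    ext s
    simp only [Set.mem_ofPred_eq, Set.mem_inter_iff, edist_dist, Real.dist_eq]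
    rw [ENNReal.ofReal_le_ofReal_iff (abs_nonneg _), and_comm]
  have hev := (key x hx).and ((key _ hlx).and ((hx.eventually hL.eventually_pos).and
    (hlx.eventually hL.eventually_pos)))
  obtain ⟨n, h1, h2, hp1, hp2⟩ := hev.exists
  obtain ⟨hl1, hl2⟩ := hlam n
  have hl0 : 0 < lam n := by linarith
  set A := {s | s ∈ Set.Icc (1 / 4 : ℝ) 1 ∧ δ ≤ |L (s * x n) / L (x n) - 1|} with hA
  set Bs := {s | s ∈ Set.Icc (1 / 4 : ℝ) 1 ∧
    δ ≤ |L (s * (lam n * x n)) / L (lam n * x n) - 1|} with hB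
  have hB' : volume ((fun s => (lam n)⁻¹ * s) ⁻¹' Bs) ≤ ENNReal.ofReal (1 / 16) := by
    rw [Real.volume_preimage_mul_left (inv_ne_zero hl0.ne'), inv_inv, abs_of_pos hl0]
    calc _ ≤ 1 * volume Bs := by gcongr; simpa using hl2
      _ ≤ _ := by simpa using h2.le
  -- `[λ/2, λ]` has length at least `1/4`, while the two exceptional sets together have measure at
  -- most `1/8`. So some `s` is good for both sequences, and `L(s x)` is close to both `L(x)` and
  -- `L(λx)`.
  have hJ : ¬ (Set.Icc (lam n / 2) (lam n) ⊆ A ∪ (fun s => (lam n)⁻¹ * s) ⁻¹' Bs) := by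
    intro hsub
    have := (measure_mono hsub).trans (measure_union_le (μ := volume) _ _)
    rw [Real.volume_Icc] at this
    have h3 : ENNReal.ofReal (lam n - lam n / 2) ≤ ENNReal.ofReal (1 / 16 + 1 / 16) := by
      rw [ENNReal.ofReal_add (by norm_num) (by norm_num)]
      exact this.trans (add_le_add h1.le hB')
    rw [ENNReal.ofReal_le_ofReal_iff (by norm_num)] at h3
    linarith
  obtain ⟨s, hs, hsn⟩ := Set.not_subset.1 hJ
  simp only [Set.mem_union, not_or, hA, hB, Set.mem_preimage, Set.mem_ofPred_eq, not_and,
    not_le] at hsn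
  have hsA := hsn.1 ⟨by linarith [hs.1], by linarith [hs.2]⟩
  have hsB := hsn.2 ⟨by
      rw [le_inv_mul_iff₀ hl0]; linarith [hs.1], by
      rw [inv_mul_le_iff₀ hl0]; linarith [hs.2]⟩
  have heq : (lam n)⁻¹ * s * (lam n * x n) = s * x n := by field_simp
  rw [heq] at hsB
  have e1 := (abs_lt.1 hsA).2
  have e2 := (abs_lt.1 hsB).1
  rw [sub_lt_iff_lt_add, div_lt_iff₀ hp1] at e1
  have e2' : 1 - δ < L (s * x n) / L (lam n * x n) := by linarith
  rw [lt_div_iff₀ hp2] at e2'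
  have e3 := hbad n
  have : (1 - δ) * ((1 + ε) * L (x n)) < (1 - δ) * L (lam n * x n) :=
    mul_lt_mul_of_pos_left e3 (by linarith)
  nlinarith

/-- Potter's bound. -/
lemma exists_potter (hL : SlowlyVaryingAtZero L) {η : ℝ} (hη : 0 < η) :
    ∃ x₀ > 0, ∀ x, 0 < x → x ≤ x₀ → 0 < L x ∧
      ∀ lam, 0 < lam → lam ≤ 1 → L (lam * x) ≤ 2 ^ η * lam ^ (-η) * L x := by
  have h2 : (1 : ℝ) < 2 ^ η := Real.one_lt_rpow one_lt_two hη
  have hev := (hL.eventually_le_of_mem_Icc (ε := 2 ^ η - 1) (by linarith)).and hL.eventually_pos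
  obtain ⟨x₁, hx₁, hsub⟩ := (mem_nhdsGT_iff_exists_Ioc_subset).1 hev
  refine ⟨x₁, hx₁, fun x hx hxx => ⟨(hsub ⟨hx, hxx⟩).2, ?_⟩⟩
  -- Induction over dyadic scales: every halving of the argument costs one factor `2^η`, which is
  -- the uniform bound with `ε = 2^η - 1`.
  have hind : ∀ k : ℕ, ∀ lam : ℝ, (1 / 2) ^ (k + 1) ≤ lam → lam ≤ 1 →
      L (lam * x) ≤ 2 ^ η * lam ^ (-η) * L x := by
    intro k
    induction k with
    | zero =>
      intro lam h1 h3
      have h4 := (hsub ⟨hx, hxx⟩).1 lam ⟨by simpa using h1, h3⟩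
      have hl0 : 0 < lam := by norm_num at h1; linarith
      have h5 : (1 : ℝ) ≤ lam ^ (-η) := Real.one_le_rpow_of_pos_of_le_one_of_nonpos hl0 h3 (by linarith)
      have hp := (hsub ⟨hx, hxx⟩).2
      calc _ ≤ 2 ^ η * 1 * L x := by linarith
        _ ≤ _ := by gcongr
    | succ k ih =>
      intro lam h1 h3
      rcases le_or_gt (1 / 2) lam with h | h
      · refine ih lam (le_trans ?_ h) h3
        exact pow_le_of_le_one (by norm_num) (by norm_num) (by simp)
      have hl0 : 0 < lam := lt_of_lt_of_le (by positivity) h1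
      have h4 := ih (2 * lam) (by rw [pow_succ] at h1; linarith) (by linarith)
      have h5 := (hsub (⟨by positivity, le_trans (mul_le_of_le_one_left hx.le (by linarith)) hxx⟩ :
        2 * lam * x ∈ Set.Ioc 0 x₁)).1 (1 / 2) ⟨le_rfl, by norm_num⟩
      have h6 : (1 / 2 : ℝ) * (2 * lam * x) = lam * x := by ring
      rw [h6] at h5
      have h7 : (2 * lam) ^ (-η) * 2 ^ η = lam ^ (-η) := by
        rw [Real.mul_rpow (by norm_num) hl0.le, mul_right_comm, ← Real.rpow_add (by norm_num)]
        simp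
      calc L (lam * x) ≤ 2 ^ η * L (2 * lam * x) := by linarith
        _ ≤ 2 ^ η * (2 ^ η * (2 * lam) ^ (-η) * L x) := by gcongr
        _ = 2 ^ η * ((2 * lam) ^ (-η) * 2 ^ η) * L x := by ring
        _ = _ := by rw [h7]
  intro lam h1 h3
  obtain ⟨k, hk⟩ := exists_pow_lt_of_lt_one h1 (by norm_num : (1 / 2 : ℝ) < 1)
  exact hind k lam ((pow_le_pow_of_le_one (by norm_num) (by norm_num) (Nat.le_succ k)).trans hk.le) h3

end SlowlyVaryingAtZero

/-! ### The scale `Δ_c` and the rescaled structure function. -/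

section Scale

variable {α : ℝ} {L : ℝ → ℝ}

/-- The rescaled local structure function `λ ↦ 2c² (λΔ)^α L(λΔ)`. -/
noncomputable def scaledStruct (α : ℝ) (L : ℝ → ℝ) (c lam : ℝ) : ℝ :=
  2 * c ^ 2 * ((lam * scale α L c) ^ α * L (lam * scale α L c))

lemma eventually_scale_pos (hmin : ∀ᶠ c in atTop, IsLeast (scaleSet α L c) (scale α L c)) :
    ∀ᶠ c in atTop, 0 < scale α L c := by
  filter_upwards [hmin] with c hc using hc.1.1

lemma eventually_scaledStruct_one
    (hmin : ∀ᶠ c in atTop, IsLeast (scaleSet α L c) (scale α L c)) :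
    ∀ᶠ c in atTop, scaledStruct α L c 1 = 1 := by
  filter_upwards [hmin, eventually_gt_atTop 0] with c hc hc0
  rw [scaledStruct, one_mul, hc.1.2]
  field_simp

lemma tendsto_scale_nhdsGT (hmin : ∀ᶠ c in atTop, IsLeast (scaleSet α L c) (scale α L c))
    (hscale : Tendsto (scale α L) atTop (𝓝 0)) : Tendsto (scale α L) atTop (𝓝[>] 0) :=
  tendsto_nhdsWithin_iff.2 ⟨hscale, eventually_scale_pos hmin⟩

/-- The normalisation is exact at `λ = 1`, so the factor `2c²` cancels and only `λ^α L(λΔ) / L(Δ)`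
remains. -/
lemma tendsto_scaledStruct (hL : SlowlyVaryingAtZero L)
    (hmin : ∀ᶠ c in atTop, IsLeast (scaleSet α L c) (scale α L c))
    (hscale : Tendsto (scale α L) atTop (𝓝 0)) {lam : ℝ} (hlam : 0 < lam) :
    Tendsto (fun c => scaledStruct α L c lam) atTop (𝓝 (lam ^ α)) := by
  have hs := tendsto_scale_nhdsGT hmin hscale
  have h1 := ((hL.tendsto_ratio lam hlam).comp hs).const_mul (lam ^ α)
  rw [mul_one] at h1
  refine h1.congr' ?_
  filter_upwards [eventually_scaledStruct_one hmin, eventually_scale_pos hmin,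
    hs.eventually hL.eventually_pos] with c h2 h3 h4
  rw [scaledStruct, one_mul] at h2
  rw [Function.comp_apply, scaledStruct, Real.mul_rpow hlam.le h3.le]
  calc _ = lam ^ α * (L (lam * scale α L c) / L (scale α L c)) *
        (2 * c ^ 2 * (scale α L c ^ α * L (scale α L c))) := by rw [h2, mul_one]
    _ = _ := by field_simp

/-- Potter's bound with reference point `ΛΔ`. Half of the exponent `α` is given up to absorb `L`,
which leaves a Hölder bound down to `λ = 0`, as chaining requires. -/
lemma scaledStruct_le (hα : 0 < α) (hL : SlowlyVaryingAtZero L)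
    (hmin : ∀ᶠ c in atTop, IsLeast (scaleSet α L c) (scale α L c))
    (hscale : Tendsto (scale α L) atTop (𝓝 0)) {Lam : ℝ} (hLam : 0 < Lam) :
    ∃ C > 0, ∀ᶠ c in atTop, ∀ lam, 0 < lam → lam ≤ Lam →
      0 < L (lam * scale α L c) ∧ scaledStruct α L c lam ≤ C * lam ^ (α / 2) := by
  obtain ⟨x₀, hx₀, hP⟩ := hL.exists_potter (half_pos hα)
  refine ⟨2 ^ (α / 2) * (Lam ^ α + 1) / Lam ^ (α / 2), by positivity, ?_⟩
  have h0 : Tendsto (fun c => Lam * scale α L c) atTop (𝓝 0) := by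
    simpa using hscale.const_mul Lam
  filter_upwards [eventually_scale_pos hmin, h0.eventually (ge_mem_nhds hx₀),
    (tendsto_scaledStruct hL hmin hscale hLam).eventually
      (ge_mem_nhds (lt_add_one (Lam ^ α)))] with c hs hle hst lam hl1 hl2
  obtain ⟨hp, hpot⟩ := hP (Lam * scale α L c) (by positivity) hle
  refine ⟨(hP (lam * scale α L c) (by positivity) (le_trans (by gcongr) hle)).1, ?_⟩
  have h1 := hpot (lam / Lam) (by positivity) ((div_le_one hLam).2 hl2)
  have e1 : lam / Lam * (Lam * scale α L c) = lam * scale α L c := by field_simp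
  rw [e1] at h1
  have e2 : lam * scale α L c = (lam / Lam) * (Lam * scale α L c) := e1.symm
  have e3 : (lam * scale α L c) ^ α = (lam / Lam) ^ α * (Lam * scale α L c) ^ α := by
    rw [e2, Real.mul_rpow (by positivity) (by positivity)]
  have e4 : (lam / Lam) ^ α * (lam / Lam) ^ (-(α / 2)) = (lam / Lam) ^ (α / 2) := by
    rw [← Real.rpow_add (by positivity)]; ring_nf
  rw [scaledStruct] at hst ⊢
  rw [e3]
  calc _ ≤ 2 * c ^ 2 * ((lam / Lam) ^ α * (Lam * scale α L c) ^ α *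
        (2 ^ (α / 2) * (lam / Lam) ^ (-(α / 2)) * L (Lam * scale α L c))) := by gcongr
    _ = 2 ^ (α / 2) * ((lam / Lam) ^ α * (lam / Lam) ^ (-(α / 2))) *
        (2 * c ^ 2 * ((Lam * scale α L c) ^ α * L (Lam * scale α L c))) := by ring
    _ = 2 ^ (α / 2) * (lam / Lam) ^ (α / 2) *
        (2 * c ^ 2 * ((Lam * scale α L c) ^ α * L (Lam * scale α L c))) := by rw [e4]
    _ ≤ 2 ^ (α / 2) * (lam / Lam) ^ (α / 2) * (Lam ^ α + 1) := by gcongr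
    _ = _ := by rw [Real.div_rpow hl1.le hLam.le]; ring

/-- Potter's bound is applied backwards, from `λΔ` down to `Δ` with ratio `1/λ`, where the structure
function equals `1`. The growth in `λ` makes distant cells nearly independent at level `c`. -/
lemma le_scaledStruct (hα : 0 < α) (hL : SlowlyVaryingAtZero L)
    (hmin : ∀ᶠ c in atTop, IsLeast (scaleSet α L c) (scale α L c)) :
    ∃ C > 0, ∃ η > 0, ∀ᶠ c in atTop, ∀ lam, 1 ≤ lam → lam * scale α L c ≤ η →
      0 < L (lam * scale α L c) ∧ C * lam ^ (α / 2) ≤ scaledStruct α L c lam := by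
  obtain ⟨x₀, hx₀, hP⟩ := hL.exists_potter (half_pos hα)
  refine ⟨(2 ^ (α / 2))⁻¹, by positivity, x₀, hx₀, ?_⟩
  filter_upwards [eventually_scale_pos hmin, eventually_scaledStruct_one hmin]
    with c hs hone lam hl1 hl2
  have hl0 : 0 < lam := by linarith
  obtain ⟨hp, hpot⟩ := hP (lam * scale α L c) (by positivity) hl2
  refine ⟨hp, ?_⟩
  have h1 := hpot lam⁻¹ (by positivity) (inv_le_one_of_one_le₀ hl1)
  have e1 : lam⁻¹ * (lam * scale α L c) = scale α L c := by field_simp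
  rw [e1, Real.inv_rpow hl0.le, Real.rpow_neg hl0.le, inv_inv] at h1
  rw [scaledStruct, one_mul] at hone
  rw [scaledStruct, inv_mul_le_iff₀ (by positivity), Real.mul_rpow hl0.le hs.le]
  have e2 : lam ^ α = lam ^ (α / 2) * lam ^ (α / 2) := by
    rw [← Real.rpow_add hl0]; ring_nf
  calc lam ^ (α / 2) = lam ^ (α / 2) * (2 * c ^ 2 * (scale α L c ^ α * L (scale α L c))) := by
        rw [hone, mul_one]
    _ ≤ lam ^ (α / 2) * (2 * c ^ 2 * (scale α L c ^ α *
        (2 ^ (α / 2) * lam ^ (α / 2) * L (lam * scale α L c)))) := by gcongr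
    _ = _ := by rw [e2]; ring

/-- The defining equation at `Δ`, with `L(Δ)` estimated by Potter from a fixed point, gives `1 ≤ K
c² Δ^{α/2}`. Thus the number of cells of size `Δ` grows only polynomially in `c` and loses against
`exp(-τ c² / 16)`. -/
lemma scale_inv_le (hα : 0 < α) (hL : SlowlyVaryingAtZero L)
    (hmin : ∀ᶠ c in atTop, IsLeast (scaleSet α L c) (scale α L c))
    (hscale : Tendsto (scale α L) atTop (𝓝 0)) :
    ∃ C > 0, ∃ n : ℕ, ∀ᶠ c in atTop, (scale α L c)⁻¹ ≤ C * c ^ n := by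
  obtain ⟨x₀, hx₀, hP⟩ := hL.exists_potter (half_pos hα)
  have hx₀p := (hP x₀ hx₀ le_rfl).1
  set K := 2 * (2 ^ (α / 2) * (x₀⁻¹) ^ (-(α / 2)) * L x₀) with hK
  have hK0 : 0 < K := by positivity
  obtain ⟨n, hn⟩ := exists_nat_ge (2 * (2 / α))
  refine ⟨K ^ (2 / α), by positivity, n, ?_⟩
  filter_upwards [eventually_scale_pos hmin, eventually_scaledStruct_one hmin,
    hscale.eventually (ge_mem_nhds hx₀), eventually_ge_atTop 1] with c hs hone hle hc
  have h1 := (hP x₀ hx₀ le_rfl).2 (scale α L c / x₀) (by positivity) ((div_le_one hx₀).2 hle)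
  rw [div_mul_cancel₀ _ hx₀.ne', div_eq_mul_inv (scale α L c), Real.mul_rpow hs.le (by positivity)] at h1
  rw [scaledStruct, one_mul] at hone
  have h2 : 1 ≤ K * c ^ 2 * scale α L c ^ (α / 2) := by
    have e1 : scale α L c ^ α * scale α L c ^ (-(α / 2)) = scale α L c ^ (α / 2) := by
      rw [← Real.rpow_add hs]; ring_nf
    calc 1 = 2 * c ^ 2 * (scale α L c ^ α * L (scale α L c)) := hone.symm
      _ ≤ 2 * c ^ 2 * (scale α L c ^ α *
        (2 ^ (α / 2) * (scale α L c ^ (-(α / 2)) * x₀⁻¹ ^ (-(α / 2))) * L x₀)) := by gcongr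
      _ = K * c ^ 2 * (scale α L c ^ α * scale α L c ^ (-(α / 2))) := by rw [hK]; ring
      _ = _ := by rw [e1]
  have h3 : ((scale α L c)⁻¹) ^ (α / 2) ≤ K * c ^ 2 := by
    rw [Real.inv_rpow hs.le, inv_le_iff_one_le_mul₀ (by positivity)]
    exact h2
  have h4 := Real.rpow_le_rpow (by positivity) h3 (by positivity : 0 ≤ 2 / α)
  rw [← Real.rpow_mul (by positivity), show α / 2 * (2 / α) = 1 by field_simp, Real.rpow_one,
    Real.mul_rpow hK0.le (by positivity)] at h4
  refine h4.trans ?_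
  gcongr
  rw [← Real.rpow_natCast c 2, ← Real.rpow_mul (by linarith), ← Real.rpow_natCast c n]
  exact Real.rpow_le_rpow_of_exponent_le hc (by push_cast; exact hn)

end Scale

/-! ### Locally stationary fields: the variogram of `c X` at scale `Δ`. -/

/-- The standing assumptions on a locally stationary Gaussian field on the `δ`-neighbourhood
of `D`. -/
structure LocallyStationaryField {d : ℕ} {Ω : Type*} [MeasurableSpace Ω] (P : Measure Ω)
    (D : Set (EuclideanSpace ℝ (Fin d))) (δ : ℝ) (X : EuclideanSpace ℝ (Fin d) → Ω → ℝ) (α : ℝ)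
    (L : ℝ → ℝ) (r : EuclideanSpace ℝ (Fin d) → EuclideanSpace ℝ (Fin d) → ℝ) : Prop where
  delta_pos : 0 < δ
  field : UnitGaussianField P X (Metric.thickening δ D)
  alpha_pos : 0 < α
  slow : SlowlyVaryingAtZero L
  isLeast : ∀ᶠ c in atTop, IsLeast (scaleSet α L c) (scale α L c)
  tendsto_scale : Tendsto (scale α L) atTop (𝓝 0)
  r_cont : ∀ t ∈ Metric.thickening δ D, ContinuousOn (r t) (Metric.sphere 0 1)
  r_pos : ∀ t ∈ Metric.thickening δ D, ∀ v ∈ Metric.sphere 0 1, 0 < r t v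
  r_unif : ∀ ε > 0, ∃ η > 0, ∀ t ∈ Metric.thickening δ D, ∀ u ∈ Metric.thickening δ D,
      dist u t < η → ∀ v ∈ Metric.sphere 0 1, |r t v - r u v| ≤ ε
  r_bdd : ∃ M : ℝ, ∀ t ∈ Metric.thickening δ D, ∀ v ∈ Metric.sphere 0 1, r t v ≤ M
  cov : LocalCovariance P X (Metric.thickening δ D) α L r

/-- `2c² (1 - ρ(p, q))`, the variogram of `c X`. -/
noncomputable def vario {T Ω : Type*} [MeasurableSpace Ω] (P : Measure Ω) (X : T → Ω → ℝ)
    (c : ℝ) (p q : T) : ℝ := 2 * c ^ 2 * (1 - corr P X p q)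

lemma vario_comm {T Ω : Type*} [MeasurableSpace Ω] (P : Measure Ω) (X : T → Ω → ℝ)
    (c : ℝ) (p q : T) : vario P X c p q = vario P X c q p := by
  rw [vario, corr_comm, vario]

lemma UnitGaussianField.vario_nonneg {T Ω : Type*} [TopologicalSpace T] [MeasurableSpace Ω]
    {P : Measure Ω} {X : T → Ω → ℝ} {U : Set T} (h : UnitGaussianField P X U) (c : ℝ) {p q : T}
    (hp : p ∈ U) (hq : q ∈ U) : 0 ≤ vario P X c p q :=
  mul_nonneg (by positivity) (sub_nonneg.2 (h.corr_le_one hp hq))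

lemma UnitGaussianField.vario_self {T Ω : Type*} [TopologicalSpace T] [MeasurableSpace Ω]
    {P : Measure Ω} {X : T → Ω → ℝ} {U : Set T} (h : UnitGaussianField P X U) (c : ℝ) {p : T}
    (hp : p ∈ U) : vario P X c p p = 0 := by
  simp [vario, h.corr_self hp]

namespace LocallyStationaryField

variable {d : ℕ} {Ω : Type*} [MeasurableSpace Ω] {P : Measure Ω}
  {D : Set (EuclideanSpace ℝ (Fin d))} {δ : ℝ} {X : EuclideanSpace ℝ (Fin d) → Ω → ℝ} {α : ℝ}
  {L : ℝ → ℝ} {r : EuclideanSpace ℝ (Fin d) → EuclideanSpace ℝ (Fin d) → ℝ}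

lemma mem_of_dist_lt {t p : EuclideanSpace ℝ (Fin d)}
    (ht : t ∈ D) (hp : dist p t < δ) : p ∈ Metric.thickening δ D :=
  Metric.mem_thickening_iff.2 ⟨t, ht, hp⟩

lemma exists_bound (h : LocallyStationaryField P D δ X α L r) :
    ∃ M : ℝ, 0 < M ∧ ∀ t ∈ Metric.thickening δ D, ∀ v ∈ Metric.sphere 0 1, r t v ≤ M := by
  obtain ⟨M, hM⟩ := h.r_bdd
  exact ⟨max M 1, by positivity, fun t ht v hv => (hM t ht v hv).trans (le_max_left _ _)⟩

lemma dir_mem_sphere {u : EuclideanSpace ℝ (Fin d)} (hu : u ≠ 0) :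
    ‖u‖⁻¹ • u ∈ Metric.sphere (0 : EuclideanSpace ℝ (Fin d)) 1 := by
  have : ‖u‖ ≠ 0 := norm_ne_zero_iff.2 hu
  simp [norm_smul, this]

lemma abs_vario_sub_le (h : LocallyStationaryField P D δ X α L r) {ε : ℝ} (hε : 0 < ε) :
    ∃ η > 0, ∀ c, 0 < scale α L c → ∀ p ∈ Metric.thickening δ D, ∀ q ∈ Metric.thickening δ D,
      q ≠ p → ‖q - p‖ < η →
      |vario P X c p q - scaledStruct α L c (‖q - p‖ / scale α L c) * r p (‖q - p‖⁻¹ • (q - p))| ≤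
        ε * (scaledStruct α L c (‖q - p‖ / scale α L c) * r p (‖q - p‖⁻¹ • (q - p))) := by
  obtain ⟨η, hη, hh⟩ := h.cov ε hε
  refine ⟨η, hη, fun c hs p hp q hq hpq hd => ?_⟩
  have h1 := hh p hp (q - p) (by simpa using hq) (norm_pos_iff.2 (sub_ne_zero.2 hpq)) hd
  rw [add_sub_cancel] at h1
  have e1 : ‖q - p‖ / scale α L c * scale α L c = ‖q - p‖ := div_mul_cancel₀ _ hs.ne'
  rw [scaledStruct, e1, vario]
  change |1 - corr P X p q - _| ≤ _ at h1
  set A := ‖q - p‖ ^ α * L ‖q - p‖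
  set R := r p (‖q - p‖⁻¹ • (q - p))
  have e2 : 2 * c ^ 2 * (1 - corr P X p q) - 2 * c ^ 2 * A * R =
      2 * c ^ 2 * (1 - corr P X p q - A * R) := by ring
  rw [e2, abs_mul, abs_of_nonneg (by positivity)]
  calc _ ≤ 2 * c ^ 2 * (ε * (A * R)) := by gcongr
    _ = _ := by ring

/-- The Hölder estimate of order `α/2`, in units of `Δ`, which feeds the chaining argument. -/
lemma vario_le (h : LocallyStationaryField P D δ X α L r) {Lam : ℝ} (hLam : 0 < Lam) :
    ∃ C > 0, ∀ᶠ c in atTop, ∀ p ∈ Metric.thickening δ D, ∀ q ∈ Metric.thickening δ D,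
      ‖q - p‖ ≤ Lam * scale α L c →
      vario P X c p q ≤ C * (‖q - p‖ / scale α L c) ^ (α / 2) := by
  obtain ⟨M, hM0, hM⟩ := h.exists_bound
  obtain ⟨η, hη, hV⟩ := h.abs_vario_sub_le one_pos
  obtain ⟨C, hC, hS⟩ := scaledStruct_le h.alpha_pos h.slow h.isLeast h.tendsto_scale hLam
  refine ⟨2 * C * M, by positivity, ?_⟩
  have h0 : Tendsto (fun c => Lam * scale α L c) atTop (𝓝 0) := by
    simpa using h.tendsto_scale.const_mul Lam
  filter_upwards [hS, eventually_scale_pos h.isLeast, h0.eventually (gt_mem_nhds hη),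
    eventually_gt_atTop 0] with c hc hs hlt hc0 p hp q hq hpq
  rcases eq_or_ne q p with rfl | hne
  · rw [h.field.vario_self c hq]; positivity
  have hn : 0 < ‖q - p‖ := norm_pos_iff.2 (sub_ne_zero.2 hne)
  have h1 := hV c hs p hp q hq hne (hpq.trans_lt hlt)
  obtain ⟨h2, h3⟩ := hc (‖q - p‖ / scale α L c) (by positivity) ((div_le_iff₀ hs).2 hpq)
  have hdir := dir_mem_sphere (sub_ne_zero.2 hne)
  have h4 := hM p hp _ hdir
  have h5 := h.r_pos p hp _ hdir
  have h6 : 0 ≤ scaledStruct α L c (‖q - p‖ / scale α L c) := by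
    rw [scaledStruct]; positivity
  set S := scaledStruct α L c (‖q - p‖ / scale α L c)
  set R := r p (‖q - p‖⁻¹ • (q - p))
  have h7 := (abs_le.1 h1).2
  have h8 : S * R ≤ (C * (‖q - p‖ / scale α L c) ^ (α / 2)) * M := by gcongr
  linarith

/-- The term `-1` makes the bound trivial at distances below `Δ`, where only nonnegativity of the
variogram is used. -/
lemma le_vario (h : LocallyStationaryField P D δ X α L r) {T : Set (EuclideanSpace ℝ (Fin d))}
    (hT : T ⊆ D) {r₀ : ℝ} (hr₀ : 0 < r₀) (hr : ∀ t ∈ T, ∀ v ∈ Metric.sphere 0 1, r₀ ≤ r t v) :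
    ∃ κ > 0, ∃ η > 0, η ≤ δ ∧ ∀ᶠ c in atTop, ∀ t ∈ T, ∀ p, dist p t < η → ∀ q, dist q t < η →
      κ * ((‖q - p‖ / scale α L c) ^ (α / 2) - 1) ≤ vario P X c p q := by
  obtain ⟨η₁, hη₁, hV⟩ := h.abs_vario_sub_le (half_pos one_pos)
  obtain ⟨η₂, hη₂, hu⟩ := h.r_unif (r₀ / 2) (by positivity)
  obtain ⟨C, hC, η₃, hη₃, hS⟩ := le_scaledStruct h.alpha_pos h.slow h.isLeast
  have hδ := h.delta_pos
  -- One factor `1/2` is the relative error allowed in the covariance expansion, the other comes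
  -- from `r p ≥ r₀ / 2` for `p` near `t`. The halves in `η` are there because `p` and `q` may lie
  -- on opposite sides of `t`.
  refine ⟨C * r₀ / 4, by positivity, min (min (η₁ / 2) η₂) (min (η₃ / 2) δ), by positivity,
    (min_le_right _ _).trans (min_le_right _ _), ?_⟩
  filter_upwards [hS, eventually_scale_pos h.isLeast] with c hc hs t ht p hp q hq
  simp only [lt_min_iff] at hp hq
  have htU : t ∈ Metric.thickening δ D := mem_of_dist_lt (hT ht) (by simpa using hδ)
  have hpU : p ∈ Metric.thickening δ D := mem_of_dist_lt (hT ht) hp.2.2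
  have hqU : q ∈ Metric.thickening δ D := mem_of_dist_lt (hT ht) hq.2.2
  have hα := h.alpha_pos
  rcases lt_or_ge (‖q - p‖ / scale α L c) 1 with hlt | hge
  · refine le_trans ?_ (h.field.vario_nonneg c hpU hqU)
    refine mul_nonpos_of_nonneg_of_nonpos (by positivity) (sub_nonpos.2 ?_)
    exact Real.rpow_le_one (by positivity) hlt.le (by positivity)
  have hne : q ≠ p := by
    rintro rfl
    simp at hge
    linarith
  have htri : ‖q - p‖ ≤ dist p t + dist q t := by
    rw [← dist_eq_norm, add_comm]; exact dist_triangle_right _ _ _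
  have h1 := hV c hs p hpU q hqU hne (by linarith [hp.1.1, hq.1.1])
  obtain ⟨-, h3⟩ := hc (‖q - p‖ / scale α L c) hge (by
    rw [div_mul_cancel₀ _ hs.ne']; linarith [hp.2.1, hq.2.1])
  have hdir := dir_mem_sphere (sub_ne_zero.2 hne)
  have h4 := hr t ht _ hdir
  have h5 := (abs_le.1 (hu t htU p hpU hp.1.2 _ hdir)).2
  have h6 : 0 ≤ C * (‖q - p‖ / scale α L c) ^ (α / 2) := by positivity
  set S := scaledStruct α L c (‖q - p‖ / scale α L c)
  set R := r p (‖q - p‖⁻¹ • (q - p))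
  have h7 := (abs_le.1 h1).1
  have h8 : (C * (‖q - p‖ / scale α L c) ^ (α / 2)) * (r₀ / 2) ≤ S * R := by
    gcongr
    · linarith
    · linarith
  have h9 : 0 ≤ C * r₀ / 4 := by positivity
  linarith

/-- The limit is taken with the parameters of `t` but around a displaced point `t'`. This freedom
lets one constant serve all cells of a larger cube, and later yields continuity of the constants in
`t`. -/
lemma tendsto_vario (h : LocallyStationaryField P D δ X α L r)
    (u v : EuclideanSpace ℝ (Fin d)) {ε : ℝ} (hε : 0 < ε) :
    ∃ η > 0, ∀ᶠ c in atTop, ∀ t ∈ D, ∀ t', dist t' t < η →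
      t' + scale α L c • u ∈ Metric.thickening δ D ∧ t' + scale α L c • v ∈ Metric.thickening δ D ∧
      |vario P X c (t' + scale α L c • u) (t' + scale α L c • v) - homog α (r t) (u - v)| ≤ ε := by
  have hδ := h.delta_pos
  have hnear : ∀ w : EuclideanSpace ℝ (Fin d), ∀ η > 0, ∀ᶠ c in atTop, ∀ t t', dist t' t < η / 2 →
      dist (t' + scale α L c • w) t < η := by
    intro w η hη
    have h0 : Tendsto (fun c => scale α L c • w) atTop (𝓝 0) := by
      simpa using h.tendsto_scale.smul_const w
    filter_upwards [(Metric.tendsto_nhds.1 h0) (η / 2) (by positivity)] with c hc t t' htt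
    calc dist (t' + scale α L c • w) t ≤ dist (t' + scale α L c • w) t' + dist t' t :=
          dist_triangle _ _ _
      _ < η := by simp at hc ⊢; linarith
  rcases eq_or_ne u v with rfl | huv
  · refine ⟨δ / 2, by positivity, ?_⟩
    filter_upwards [hnear u δ hδ] with c hc t ht t' htt
    have := mem_of_dist_lt ht (hc t t' htt)
    refine ⟨this, this, ?_⟩
    rw [h.field.vario_self c this]
    simp [homog, Real.zero_rpow h.alpha_pos.ne', hε.le]
  obtain ⟨M, hM0, hM⟩ := h.exists_bound
  have hw : u - v ≠ 0 := sub_ne_zero.2 huv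
  set lam := ‖u - v‖ with hlam
  have hl0 : 0 < lam := norm_pos_iff.2 hw
  set G := lam ^ α with hG
  have hG0 : 0 < G := by positivity
  -- Three errors are added below: the covariance expansion, the ratio of `L`, and the variation of
  -- `r` between `t` and the displaced point. They sum to `ε₁ ((G + 1) M + M + G)`.
  set ε₁ := ε / ((G + 1) * M + M + G) with hε₁
  have hε₁0 : 0 < ε₁ := by positivity
  obtain ⟨η₁, hη₁, hV⟩ := h.abs_vario_sub_le hε₁0
  obtain ⟨η₂, hη₂, hu⟩ := h.r_unif ε₁ hε₁0
  refine ⟨min η₂ δ / 2, by positivity, ?_⟩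
  have hST := tendsto_scaledStruct h.slow h.isLeast h.tendsto_scale hl0
  have h0 : Tendsto (fun c => scale α L c * lam) atTop (𝓝 0) := by
    simpa using h.tendsto_scale.mul_const lam
  filter_upwards [hnear u (min η₂ δ) (by positivity), hnear v (min η₂ δ) (by positivity),
    (Metric.tendsto_nhds.1 hST) (min ε₁ (min 1 G)) (by positivity), eventually_scale_pos h.isLeast,
    h0.eventually (gt_mem_nhds hη₁)] with c hcu hcv hS hs hlt t ht t' htt
  have htU : t ∈ Metric.thickening δ D := mem_of_dist_lt ht (by simpa using hδ)
  have hq := hcu t t' htt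
  have hp := hcv t t' htt
  simp only [lt_min_iff] at hp hq
  have hqU := mem_of_dist_lt ht hq.2
  have hpU := mem_of_dist_lt ht hp.2
  refine ⟨hqU, hpU, ?_⟩
  set p := t' + scale α L c • v with hpd
  set q := t' + scale α L c • u with hqd
  have hqp : q - p = scale α L c • (u - v) := by rw [hpd, hqd, smul_sub]; abel
  have hnorm : ‖q - p‖ = scale α L c * lam := by
    rw [hqp, norm_smul, Real.norm_of_nonneg hs.le]
  have hdireq : ‖q - p‖⁻¹ • (q - p) = lam⁻¹ • (u - v) := by
    rw [hnorm, hqp, smul_smul]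
    congr 1
    field_simp
  have hne : q ≠ p := by
    intro hcon
    rw [hcon, sub_self, norm_zero] at hnorm
    exact (mul_pos hs hl0).ne hnorm
  have h1 := hV c hs p hpU q hqU hne (by rw [hnorm]; exact hlt)
  have hratio : ‖q - p‖ / scale α L c = lam := by rw [hnorm]; field_simp
  rw [hdireq, hratio] at h1
  have hdir := dir_mem_sphere hw
  have h4 := hM p hpU _ hdir
  have h5 := h.r_pos p hpU _ hdir
  have h6 := hu t htU p hpU hp.1 _ hdir
  rw [vario_comm, homog]
  rw [Real.dist_eq] at hS
  have hS1 := hS.le.trans (min_le_left _ _)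
  have hS2 := abs_lt.1 (hS.trans_le ((min_le_right _ _).trans (min_le_left _ _)))
  have hS3 := abs_lt.1 (hS.trans_le ((min_le_right _ _).trans (min_le_right _ _)))
  rw [← hlam] at *
  set S := scaledStruct α L c lam
  set R := r p (lam⁻¹ • (u - v))
  set R' := r t (lam⁻¹ • (u - v))
  have e : vario P X c p q - G * R' = (vario P X c p q - S * R) + (S - G) * R + G * (R - R') := by
    ring
  rw [e]
  have b1 : ε₁ * (S * R) ≤ ε₁ * ((G + 1) * M) := by
    gcongr; linarith
  have b2 : |(S - G) * R| ≤ ε₁ * M := by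
    rw [abs_mul, abs_of_pos h5]; gcongr
  have b3 : |G * (R - R')| ≤ G * ε₁ := by
    rw [abs_mul, abs_of_pos hG0, abs_sub_comm]; gcongr
  calc _ ≤ |vario P X c p q - S * R| + |(S - G) * R| + |G * (R - R')| := by
        exact (abs_add_le _ _).trans (add_le_add_left (abs_add_le _ _) _)
    _ ≤ ε₁ * ((G + 1) * M) + ε₁ * M + G * ε₁ := by linarith
    _ = ε₁ * ((G + 1) * M + M + G) := by ring
    _ = ε := by rw [hε₁]; field_simp

end LocallyStationaryField

/-! ### Grids and half-open cells. -/

section Grid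

variable {d : ℕ}

lemma norm_le_sqrt_mul_of_coord {x : EuclideanSpace ℝ (Fin d)} {m : ℝ} (hm : 0 ≤ m)
    (h : ∀ i, |x i| ≤ m) : ‖x‖ ≤ √d * m := by
  rw [EuclideanSpace.norm_eq]
  have h1 : ∑ i, ‖x i‖ ^ 2 ≤ d * m ^ 2 := by
    calc ∑ i, ‖x i‖ ^ 2 ≤ ∑ _i : Fin d, m ^ 2 :=
          Finset.sum_le_sum fun i _ => pow_le_pow_left₀ (norm_nonneg _) (h i) 2
      _ = d * m ^ 2 := by simp
  calc √(∑ i, ‖x i‖ ^ 2) ≤ √(d * m ^ 2) := Real.sqrt_le_sqrt h1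
    _ = √d * m := by rw [Real.sqrt_mul (by positivity), Real.sqrt_sq hm]

lemma abs_coord_le_norm (x : EuclideanSpace ℝ (Fin d)) (i : Fin d) : |x i| ≤ ‖x‖ :=
  PiLp.norm_apply_le x i

/-- The point of the grid of mesh `ζ` with origin `t` and index `n`. -/
noncomputable def gridPoint (t : EuclideanSpace ℝ (Fin d)) (ζ : ℝ) (n : Fin d → ℕ) :
    EuclideanSpace ℝ (Fin d) := WithLp.toLp 2 fun i => t i + ζ * n i

@[simp] lemma gridPoint_apply (t : EuclideanSpace ℝ (Fin d)) (ζ : ℝ) (n : Fin d → ℕ) (i : Fin d) :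
    gridPoint t ζ n i = t i + ζ * n i := rfl

/-- The index of the cell of mesh `ζ` with origin `t` which contains `u`. -/
noncomputable def gridIndex (t : EuclideanSpace ℝ (Fin d)) (ζ : ℝ)
    (u : EuclideanSpace ℝ (Fin d)) (i : Fin d) : ℕ := ⌊(u i - t i) / ζ⌋₊

lemma gridPoint_zero (t : EuclideanSpace ℝ (Fin d)) (ζ : ℝ) : gridPoint t ζ 0 = t := by
  ext i; simp

lemma gridPoint_mem_cube (t : EuclideanSpace ℝ (Fin d)) {ζ : ℝ} (hζ : 0 < ζ) {N : ℕ}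
    {n : Fin d → ℕ} (hn : ∀ i, n i < N) : gridPoint t (ζ / N) n ∈ cube t ζ := by
  intro i
  rw [gridPoint_apply]
  have h1 : (n i : ℝ) < N := by exact_mod_cast hn i
  have hN : (0 : ℝ) < N := lt_of_le_of_lt (Nat.cast_nonneg _) h1
  constructor
  · have : 0 ≤ ζ / N * n i := by positivity
    linarith
  · have : ζ / N * n i < ζ / N * N := by gcongr
    rw [div_mul_cancel₀ _ hN.ne'] at this
    linarith

lemma gridIndex_lt {t u : EuclideanSpace ℝ (Fin d)} {ζ : ℝ} (hζ : 0 < ζ) (hu : u ∈ cube t ζ)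
    {N : ℕ} (hN : 0 < N) (i : Fin d) : gridIndex t (ζ / N) u i < N := by
  have h1 : 0 ≤ u i - t i := sub_nonneg.2 (hu i).1
  have hN' : (0 : ℝ) < N := by exact_mod_cast hN
  rw [gridIndex, Nat.floor_lt (by positivity), div_lt_iff₀ (by positivity),
    mul_div_cancel₀ _ hN'.ne']
  linarith [(hu i).2]

lemma gridPoint_gridIndex_le {t u : EuclideanSpace ℝ (Fin d)} {ζ : ℝ} (hζ : 0 < ζ)
    (hu : ∀ i, t i ≤ u i) : u ∈ cube (gridPoint t ζ (gridIndex t ζ u)) ζ := by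
  intro i
  have h1 : 0 ≤ u i - t i := sub_nonneg.2 (hu i)
  have h2 := Nat.floor_le (div_nonneg h1 hζ.le)
  have h3 := Nat.lt_floor_add_one ((u i - t i) / ζ)
  rw [le_div_iff₀ hζ] at h2
  rw [div_lt_iff₀ hζ] at h3
  rw [gridPoint_apply, gridIndex]
  constructor <;> linarith

lemma dist_le_of_mem_cube {t u v : EuclideanSpace ℝ (Fin d)} {ζ : ℝ} (hζ : 0 ≤ ζ)
    (hu : u ∈ cube t ζ) (hv : v ∈ cube t ζ) : ‖u - v‖ ≤ √d * ζ :=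
  norm_le_sqrt_mul_of_coord hζ fun i => by
    rw [PiLp.sub_apply, abs_le]
    constructor <;> linarith [(hu i).1, (hu i).2, (hv i).1, (hv i).2]

lemma base_mem_cube (t : EuclideanSpace ℝ (Fin d)) {ζ : ℝ} (hζ : 0 < ζ) : t ∈ cube t ζ :=
  fun _ => ⟨le_rfl, by linarith⟩

/-- Dyadic cells are nested, so halving the index leads to the parent cell. Successive roundings of
a point therefore form a chain that starts at the base point of the cube. -/
lemma gridIndex_div_two (t u : EuclideanSpace ℝ (Fin d)) (ζ : ℝ) (k : ℕ) (i : Fin d) :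
    gridIndex t (ζ / (2 ^ (k + 1) : ℕ)) u i / 2 = gridIndex t (ζ / (2 ^ k : ℕ)) u i := by
  rw [gridIndex, gridIndex, ← Nat.floor_div_natCast]
  congr 1
  push_cast
  rw [pow_succ]
  field_simp

lemma norm_gridPoint_sub_parent_le (t : EuclideanSpace ℝ (Fin d)) {ζ : ℝ} (hζ : 0 < ζ) (k : ℕ)
    (n : Fin d → ℕ) :
    ‖gridPoint t (ζ / (2 ^ (k + 1) : ℕ)) n - gridPoint t (ζ / (2 ^ k : ℕ)) (fun i => n i / 2)‖ ≤
      √d * (ζ / 2 ^ k) := by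
  refine norm_le_sqrt_mul_of_coord (by positivity) fun i => ?_
  rw [PiLp.sub_apply, gridPoint_apply, gridPoint_apply]
  have h1 : ((n i / 2 : ℕ) : ℝ) * 2 ≤ n i := by exact_mod_cast Nat.div_mul_le_self _ _
  have h2 : (n i : ℝ) ≤ ((n i / 2 : ℕ) : ℝ) * 2 + 1 := by
    have : n i ≤ n i / 2 * 2 + 1 := by omega
    exact_mod_cast this
  have e : t i + ζ / ((2 ^ (k + 1) : ℕ) : ℝ) * n i - (t i + ζ / ((2 ^ k : ℕ) : ℝ) * ((n i / 2 : ℕ) : ℝ))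
      = (ζ / 2 ^ k) * ((n i - ((n i / 2 : ℕ) : ℝ) * 2) / 2) := by
    push_cast
    rw [pow_succ]
    field_simp
    ring
  rw [e, abs_mul, abs_of_pos (by positivity)]
  refine mul_le_of_le_one_right (by positivity) ?_
  rw [abs_le]
  constructor <;> linarith

lemma tendsto_gridPoint {t u : EuclideanSpace ℝ (Fin d)} {ζ : ℝ} (hζ : 0 < ζ)
    (hu : ∀ i, t i ≤ u i) :
    Tendsto (fun k : ℕ => gridPoint t (ζ / (2 ^ k : ℕ)) (gridIndex t (ζ / (2 ^ k : ℕ)) u))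
      atTop (𝓝 u) := by
  rw [tendsto_iff_norm_sub_tendsto_zero]
  refine squeeze_zero (fun _ => norm_nonneg _) (g := fun k : ℕ => √d * (ζ * (1 / 2) ^ k))
    (fun k => ?_) ?_
  · have hz : 0 < ζ / (2 ^ k : ℕ) := by positivity
    have h1 := gridPoint_gridIndex_le hz hu
    have := dist_le_of_mem_cube hz.le (base_mem_cube _ hz) h1
    refine this.trans (le_of_eq ?_)
    push_cast
    simp [div_eq_mul_inv]
  · have := ((tendsto_pow_atTop_nhds_zero_of_lt_one (by norm_num : (0 : ℝ) ≤ 1 / 2)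
      (by norm_num)).const_mul ζ).const_mul √d
    simpa using this

end Grid

/-- Exponential smallness is traded for polynomial smallness of a freely chosen order, which is easy
to play off against numbers of cells. -/
lemma exp_neg_le_factorial_div_pow {z : ℝ} (hz : 0 < z) (m : ℕ) :
    Real.exp (-z) ≤ m.factorial / z ^ m := by
  rw [Real.exp_neg, inv_le_comm₀ (Real.exp_pos _) (by positivity), inv_div]
  exact Real.pow_div_factorial_le_exp z hz.le m

lemma tsum_ofReal_geometric_two (K : ℝ) (hK : 0 ≤ K) :
    ∑' k : ℕ, ENNReal.ofReal (K * (1 / 2) ^ k) = ENNReal.ofReal (2 * K) := by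
  rw [← ENNReal.ofReal_tsum_of_nonneg (fun k => by positivity)
    (summable_geometric_two.mul_left K), tsum_mul_left, tsum_geometric_two, mul_comm]

/-! ### Chaining inside a cell. -/

namespace UnitGaussianField

variable {d : ℕ} {Ω : Type*} [MeasurableSpace Ω] {P : Measure Ω}
  {X : EuclideanSpace ℝ (Fin d) → Ω → ℝ} {U : Set (EuclideanSpace ℝ (Fin d))}

/-- The increment of the field with its projection on `X t` removed. -/
noncomputable def residual (P : Measure Ω) (X : EuclideanSpace ℝ (Fin d) → Ω → ℝ)
    (t p q : EuclideanSpace ℝ (Fin d)) (ω : Ω) : ℝ :=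
  X p ω - X q ω - (corr P X t p - corr P X t q) * X t ω

/-- The residual is uncorrelated with `X t`, so adding `lam` times it to `c X t` raises the variance
`c²` by at most `lam² vario`. -/
lemma measure_residual_le (h : UnitGaussianField P X U) {t p q : EuclideanSpace ℝ (Fin d)}
    (ht : t ∈ U) (hp : p ∈ U) (hq : q ∈ U) {c lam b w : ℝ} (hc : 0 < c) (hb : 0 ≤ b)
    (hw : w ≤ 3 * c ^ 2) (hv : lam ^ 2 * vario P X c p q ≤ w) :
    P {ω | c ^ 2 + b < c * X t ω + lam * (c * residual P X t p q ω)} ≤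
      ENNReal.ofReal (4 * gaussTail c * Real.exp (-b + w / 2)) := by
  set a := c - lam * c * (corr P X t p - corr P X t q) with ha
  have e : ∀ ω, c * X t ω + lam * (c * residual P X t p q ω) =
      a * X t ω + (lam * c) * X p ω + (-(lam * c)) * X q ω := fun ω => by
    rw [residual, ha]; ring
  simp_rw [e]
  refine measure_gaussian_gt_le (h.hasGaussianLaw_comb ht hp hq _ _ _)
    (h.integral_comb ht hp hq _ _ _) hc ?_ hw (by nlinarith)
  rw [h.integral_comb_sq ht hp hq, ha]
  rw [vario] at hv
  nlinarith [sq_nonneg (lam * c * (corr P X t p - corr P X t q))]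

/-- Put `Y = c² - c X(t)` and follow the dyadic roundings of `u`, which end above `c` by continuity.
If every residual increment stayed below its weight times `Y/2`, the total would be at most `Y/2`,
the weights having sum at most `1`. As the projection contributes `ρ (c² - Y)` with `1/2 ≤ ρ ≤ 1`,
the field could not have passed `c`. -/
lemma exists_large_residual (h : UnitGaussianField P X U) {t : EuclideanSpace ℝ (Fin d)} {ζ : ℝ}
    (hζ : 0 < ζ) (hsub : cube t ζ ⊆ U) {c s τ : ℝ} (hc : 0 < c) (hs : 0 < s) (hτ0 : 0 < τ)
    (hτ1 : τ < 1) (hcorr : ∀ p ∈ cube t ζ, 1 / 2 ≤ corr P X t p) {ω : Ω}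
    (hω : ContinuousOn (fun t => X t ω) U) (h1 : X t ω ≤ c - s / c)
    (h2 : ∃ u ∈ cube t ζ, c < X u ω) :
    ∃ k : ℕ, ∃ n : Fin d → Fin (2 ^ (k + 1)),
      (1 - τ ^ 2) * τ ^ (2 * k) * ((c ^ 2 - c * X t ω) / 2) <
        c * residual P X t (gridPoint t (ζ / (2 ^ (k + 1) : ℕ)) (fun i => n i))
          (gridPoint t (ζ / (2 ^ k : ℕ)) (fun i => n i / 2)) ω := by
  obtain ⟨u, hu, hcu⟩ := h2
  have hut : ∀ i, t i ≤ u i := fun i => (hu i).1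
  set p : ℕ → EuclideanSpace ℝ (Fin d) :=
    fun k => gridPoint t (ζ / (2 ^ k : ℕ)) (gridIndex t (ζ / (2 ^ k : ℕ)) u) with hp
  have hpm : ∀ k, p k ∈ cube t ζ := fun k =>
    gridPoint_mem_cube t hζ fun i => gridIndex_lt hζ hu (by positivity) i
  have hp0 : p 0 = t := by
    have : gridIndex t (ζ / (2 ^ 0 : ℕ)) u = 0 := by
      ext i
      have := gridIndex_lt hζ hu (N := 2 ^ 0) (by positivity) i
      simpa using this
    simp only [hp, this, gridPoint_zero]
  have hlim : Tendsto (fun k => X (p k) ω) atTop (𝓝 (X u ω)) := by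
    have h3 := (hω u (hsub hu)).tendsto
    refine h3.comp (tendsto_nhdsWithin_iff.2 ⟨tendsto_gridPoint hζ hut, ?_⟩)
    exact Eventually.of_forall fun k => hsub (hpm k)
  obtain ⟨K, hK⟩ := (hlim.eventually (lt_mem_nhds hcu)).exists
  by_contra hcon
  push Not at hcon
  set Y := c ^ 2 - c * X t ω with hY
  have hYs : s ≤ Y := by
    have := mul_le_mul_of_nonneg_left h1 hc.le
    have e : c * (c - s / c) = c ^ 2 - s := by field_simp
    rw [e] at this
    linarith
  have hstep : ∀ k, c * residual P X t (p (k + 1)) (p k) ω ≤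
      (1 - τ ^ 2) * τ ^ (2 * k) * (Y / 2) := by
    intro k
    have h3 := hcon k fun i => ⟨gridIndex t (ζ / (2 ^ (k + 1) : ℕ)) u i,
      gridIndex_lt hζ hu (by positivity) i⟩
    simp only [gridIndex_div_two] at h3
    exact h3
  have hsum : ∀ k, c * residual P X t (p k) t ω ≤ (1 - (τ ^ 2) ^ k) * (Y / 2) := by
    intro k
    induction k with
    | zero => simp [hp0, residual]
    | succ k ih =>
      have e : residual P X t (p (k + 1)) t ω =
          residual P X t (p (k + 1)) (p k) ω + residual P X t (p k) t ω := by
        simp only [residual]; ring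
      have h3 := hstep k
      rw [pow_mul] at h3
      rw [e, pow_succ]
      nlinarith
  have h5 := hsum K
  have h6 : (1 - (τ ^ 2) ^ K) * (Y / 2) ≤ Y / 2 := by
    have : 0 ≤ (τ ^ 2) ^ K := by positivity
    nlinarith
  have h7 : residual P X t (p K) t ω = X (p K) ω - corr P X t (p K) * X t ω := by
    simp only [residual, h.corr_self (hsub (base_mem_cube t hζ))]; ring
  rw [h7] at h5
  have h8 := hcorr (p K) (hpm K)
  have h9 := h.corr_le_one (hsub (base_mem_cube t hζ)) (hsub (hpm K))
  have h10 : c * c < c * X (p K) ω := mul_lt_mul_of_pos_left hK hc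
  have h11 : c * (corr P X t (p K) * X t ω) = corr P X t (p K) * (c ^ 2 - Y) := by
    rw [hY]; ring
  nlinarith

/-- The probability that the field exceeds `c` in a cell, although it is at most `c - s / c` at
the base point of the cell. -/
theorem exists_measure_cell_le (d : ℕ) {β : ℝ} (hβ : 0 < β) :
    ∃ b₀ > 0, ∀ m : ℕ, (2 : ℝ) ^ d * (2 ^ (-(β / 8))) ^ m ≤ 1 / 2 → ∃ C > 0,
    ∀ {Ω : Type*} [MeasurableSpace Ω] {P : Measure Ω} {X : EuclideanSpace ℝ (Fin d) → Ω → ℝ}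
      {U : Set (EuclideanSpace ℝ (Fin d))} (_ : UnitGaussianField P X U)
      {t : EuclideanSpace ℝ (Fin d)} {ζ c B Lam s : ℝ}, 0 < ζ → cube t ζ ⊆ U → 1 ≤ c →
      (∀ p ∈ cube t ζ, ∀ q ∈ cube t ζ, vario P X c p q ≤ B * (‖q - p‖ / ζ) ^ β) →
      0 ≤ B → 4 ≤ Lam → Lam ^ 2 * B ≤ b₀ → 0 < s →
      P {ω | X t ω ≤ c - s / c ∧ ∃ u ∈ cube t ζ, c < X u ω} ≤
        ENNReal.ofReal (C * gaussTail c * Real.exp (-s) * ((Lam * s) ^ m)⁻¹) := by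
  -- In units of `τ`, a step of length `2^{-k}` has variogram of order `τ^{8k}`. The squared
  -- multipliers below cost `τ^{-6k}`, so a factor `τ^{2k}` is left.
  set τ : ℝ := 2 ^ (-(β / 8)) with hτ
  have hτ0 : 0 < τ := by positivity
  have hτ1 : τ < 1 := Real.rpow_lt_one_of_one_lt_of_neg (by norm_num) (by linarith)
  have hτ2 : τ ^ 2 < 1 := by nlinarith
  set A : ℝ := (√d) ^ β with hA
  have hA0 : 0 ≤ A := by positivity
  refine ⟨(1 - τ ^ 2) ^ 2 / (4 * (A + 1)), by
    have : 0 < 1 - τ ^ 2 := by linarith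
    positivity, fun m hm => ?_⟩
  refine ⟨2 * (4 * Real.exp (1 / 2) * 2 ^ d * (m.factorial * 2 ^ m)), by positivity, ?_⟩
  intro Ω _ P X U h t ζ c B Lam s hζ hsub hc hinc hB hLam hLB hs
  have hc0 : 0 < c := by linarith
  have hΛB : Lam ^ 2 * B * A ≤ (1 - τ ^ 2) ^ 2 / 4 := by
    rw [le_div_iff₀ (by positivity)] at hLB
    nlinarith [mul_nonneg (sq_nonneg Lam) hB]
  have hBA : B * A ≤ 1 := by
    have h1 : 1 * (B * A) ≤ Lam ^ 2 * (B * A) := by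
      gcongr; nlinarith
    have h2 : (1 - τ ^ 2) ^ 2 ≤ 1 := by nlinarith [sq_nonneg τ]
    nlinarith
  have hcorr : ∀ p ∈ cube t ζ, 1 / 2 ≤ corr P X t p := by
    intro p hp
    have h1 := hinc t (base_mem_cube t hζ) p hp
    have h2 : (‖p - t‖ / ζ) ^ β ≤ A := by
      refine Real.rpow_le_rpow (by positivity) ?_ hβ.le
      rw [div_le_iff₀ hζ]
      exact dist_le_of_mem_cube hζ.le hp (base_mem_cube t hζ)
    have h3 : vario P X c t p ≤ 1 := h1.trans ((mul_le_mul_of_nonneg_left h2 hB).trans hBA)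
    rw [vario] at h3
    have h4 := h.corr_le_one (hsub (base_mem_cube t hζ)) (hsub hp)
    have h5 : 1 ≤ c ^ 2 := one_le_pow₀ hc
    nlinarith [mul_nonneg (sub_nonneg.2 h5) (sub_nonneg.2 h4)]
  -- The residual of level `k` is multiplied by twice `Lam τ^{-k}` over its weight, so that a large
  -- residual outweighs the deficit `Y = c² - c X(t) ≥ s` by the factor `Lam τ^{-k}`. The
  -- combination then exceeds `c² + (Lam τ^{-k} - 1) s`.
  set S : (k : ℕ) → (Fin d → Fin (2 ^ (k + 1))) → Set Ω := fun k n =>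
    {ω | c ^ 2 + (Lam * τ⁻¹ ^ k - 1) * s < c * X t ω +
      (2 * (Lam * τ⁻¹ ^ k) / ((1 - τ ^ 2) * τ ^ (2 * k))) *
      (c * residual P X t (gridPoint t (ζ / (2 ^ (k + 1) : ℕ)) (fun i => n i))
          (gridPoint t (ζ / (2 ^ k : ℕ)) (fun i => n i / 2)) ω)} with hS
  have hLk : ∀ k : ℕ, 4 ≤ Lam * τ⁻¹ ^ k := fun k => by
    have : 1 ≤ τ⁻¹ ^ k := one_le_pow₀ ((one_le_inv₀ hτ0).2 hτ1.le)
    nlinarith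
  have hincl : {ω | X t ω ≤ c - s / c ∧ ∃ u ∈ cube t ζ, c < X u ω} ≤ᵐ[P] ⋃ k, ⋃ n, S k n := by
    filter_upwards [h.continuousOn] with ω hω hmem
    obtain ⟨h1, h2⟩ := hmem
    obtain ⟨k, n, hkn⟩ := h.exists_large_residual hζ hsub hc0 hs hτ0 hτ1 hcorr hω h1 h2
    refine Set.mem_iUnion₂.2 ⟨k, n, ?_⟩
    simp only [hS, Set.mem_ofPred_eq]
    set R := c * residual P X t (gridPoint t (ζ / (2 ^ (k + 1) : ℕ)) (fun i => n i))
          (gridPoint t (ζ / (2 ^ k : ℕ)) (fun i => n i / 2)) ω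
    have hw : 0 < (1 - τ ^ 2) * τ ^ (2 * k) := mul_pos (by linarith) (by positivity)
    set w := (1 - τ ^ 2) * τ ^ (2 * k)
    have hLk := hLk k
    set Λ := Lam * τ⁻¹ ^ k
    have hYs : s ≤ c ^ 2 - c * X t ω := by
      have := mul_le_mul_of_nonneg_left h1 hc0.le
      have e : c * (c - s / c) = c ^ 2 - s := by field_simp
      rw [e] at this
      linarith
    have h3 : Λ * (c ^ 2 - c * X t ω) < 2 * Λ / w * R := by
      have h4 := mul_lt_mul_of_pos_left hkn (by positivity : 0 < 2 * Λ / w)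
      have e : 2 * Λ / w * (w * ((c ^ 2 - c * X t ω) / 2)) = Λ * (c ^ 2 - c * X t ω) := by
        field_simp
      rwa [e] at h4
    nlinarith
  have hSk : ∀ k n, P (S k n) ≤
      ENNReal.ofReal (4 * gaussTail c * Real.exp (-((Lam * τ⁻¹ ^ k - 1) * s) + 1 / 2)) := by
    intro k n
    have hp : gridPoint t (ζ / (2 ^ (k + 1) : ℕ)) (fun i => n i) ∈ cube t ζ :=
      gridPoint_mem_cube t hζ fun i => (n i).2
    have hq : gridPoint t (ζ / (2 ^ k : ℕ)) (fun i => n i / 2) ∈ cube t ζ :=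
      gridPoint_mem_cube t hζ fun i => by
        have h1 := (n i).isLt
        have h2 := pow_succ 2 k
        omega
    refine h.measure_residual_le (hsub (base_mem_cube t hζ)) (hsub hp) (hsub hq) hc0
      (mul_nonneg (by linarith [hLk k]) hs.le) (by nlinarith) ?_
    have h1 := hinc _ hp _ hq
    have h2 := norm_gridPoint_sub_parent_le t hζ k (fun i => (n i : ℕ))
    rw [norm_sub_rev] at h2
    set p := gridPoint t (ζ / (2 ^ (k + 1) : ℕ)) (fun i => (n i : ℕ))
    set q := gridPoint t (ζ / (2 ^ k : ℕ)) (fun i => (n i : ℕ) / 2)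
    have h3 : (‖q - p‖ / ζ) ^ β ≤ A * τ ^ (8 * k) := by
      have e1 : τ ^ (8 * k) = (1 / 2 ^ k) ^ β := by
        rw [hτ, ← Real.rpow_natCast, ← Real.rpow_mul (by norm_num), one_div, ← inv_pow,
          ← Real.rpow_natCast (2 : ℝ)⁻¹, ← Real.rpow_mul (by norm_num), Real.inv_rpow (by norm_num),
          ← Real.rpow_neg (by norm_num)]
        congr 1
        push_cast
        ring
      rw [e1, hA, ← Real.mul_rpow (by positivity) (by positivity)]
      refine Real.rpow_le_rpow (by positivity) ?_ hβ.le
      rw [div_le_iff₀ hζ]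
      calc _ ≤ _ := h2
        _ = _ := by ring
    have hw : 0 < 1 - τ ^ 2 := by linarith
    calc (2 * (Lam * τ⁻¹ ^ k) / ((1 - τ ^ 2) * τ ^ (2 * k))) ^ 2 * vario P X c p q
        ≤ (2 * (Lam * τ⁻¹ ^ k) / ((1 - τ ^ 2) * τ ^ (2 * k))) ^ 2 * (B * (A * τ ^ (8 * k))) := by
          gcongr
          exact h1.trans (mul_le_mul_of_nonneg_left h3 hB)
      _ = (4 * (Lam ^ 2 * B * A) / (1 - τ ^ 2) ^ 2) * (τ ^ k) ^ 2 := by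
          rw [inv_pow, mul_comm 2 k, mul_comm 8 k, pow_mul, pow_mul]
          have : 0 < τ ^ k := by positivity
          set y := τ ^ k
          field_simp
          ring
      _ ≤ 1 * 1 ^ 2 := by
          gcongr
          · rw [div_le_one (by positivity)]; linarith
          · exact pow_le_one₀ hτ0.le hτ1.le
      _ = 1 := by norm_num
  calc P {ω | X t ω ≤ c - s / c ∧ ∃ u ∈ cube t ζ, c < X u ω}
      ≤ P (⋃ k, ⋃ n, S k n) := measure_mono_ae hincl
    _ ≤ ∑' k, P (⋃ n, S k n) := measure_iUnion_le _
    _ ≤ ∑' k : ℕ, ENNReal.ofReal ((4 * Real.exp (1 / 2) * 2 ^ d * (m.factorial * 2 ^ m)) *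
          gaussTail c * Real.exp (-s) * ((Lam * s) ^ m)⁻¹ * (1 / 2) ^ k) := by
        refine ENNReal.tsum_le_tsum fun k => ?_
        calc P (⋃ n, S k n) ≤ ∑ n, P (S k n) := measure_iUnion_fintype_le _ _
          _ ≤ ∑ _n : Fin d → Fin (2 ^ (k + 1)), ENNReal.ofReal (4 * gaussTail c *
              Real.exp (-((Lam * τ⁻¹ ^ k - 1) * s) + 1 / 2)) := Finset.sum_le_sum fun n _ => hSk k n
          _ = ENNReal.ofReal (((2 : ℝ) ^ (k + 1)) ^ d * (4 * gaussTail c *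
              Real.exp (-((Lam * τ⁻¹ ^ k - 1) * s) + 1 / 2))) := by
            rw [Finset.sum_const, Finset.card_univ, Fintype.card_fun, Fintype.card_fin,
              Fintype.card_fin, nsmul_eq_mul,
              ENNReal.ofReal_mul (p := ((2 : ℝ) ^ (k + 1)) ^ d) (by positivity)]
            congr 1
            rw [ENNReal.ofReal_pow (by positivity), ENNReal.ofReal_pow (by positivity)]
            simp
          _ ≤ _ := by
            refine ENNReal.ofReal_le_ofReal ?_
            have hψ := gaussTail_pos hc0
            have hz : 0 < Lam * τ⁻¹ ^ k / 2 * s := by have := hLk k; positivity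
            -- `Lam τ^{-k} ≥ 4` leaves room for `e^{-s}` together with half of the exponent.
            have h1 : Real.exp (-((Lam * τ⁻¹ ^ k - 1) * s) + 1 / 2) ≤
                Real.exp (1 / 2) * Real.exp (-s) * Real.exp (-(Lam * τ⁻¹ ^ k / 2 * s)) := by
              rw [← Real.exp_add, ← Real.exp_add]
              refine Real.exp_le_exp.2 ?_
              nlinarith [hLk k]
            have h2 := exp_neg_le_factorial_div_pow hz m
            -- The choice of `m`: the power `m` of `τ^k` beats the number `2^{(k+1)d}` of cells of
            -- level `k + 1` by a geometric factor.
            have h3 : ((2 : ℝ) ^ (k + 1)) ^ d * (τ ^ k) ^ m ≤ 2 ^ d * (1 / 2) ^ k := by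
              calc ((2 : ℝ) ^ (k + 1)) ^ d * (τ ^ k) ^ m = 2 ^ d * (2 ^ d * τ ^ m) ^ k := by
                    rw [mul_pow, ← pow_mul, ← pow_mul, ← pow_mul, ← pow_mul, mul_comm k m,
                      mul_comm d k, add_mul, one_mul, pow_add]
                    ring
                _ ≤ _ := by gcongr
            have h4 : (m.factorial : ℝ) / (Lam * τ⁻¹ ^ k / 2 * s) ^ m =
                m.factorial * 2 ^ m * ((Lam * s) ^ m)⁻¹ * (τ ^ k) ^ m := by
              rw [inv_pow]
              have : 0 < τ ^ k := by positivity
              set y := τ ^ k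
              have hL0 : 0 < Lam := by linarith
              have e : Lam * y⁻¹ / 2 * s = (Lam * s) * (y⁻¹ / 2) := by ring
              rw [e, mul_pow, div_pow, inv_pow]
              field_simp
            calc _ ≤ ((2 : ℝ) ^ (k + 1)) ^ d * (4 * gaussTail c *
                  (Real.exp (1 / 2) * Real.exp (-s) *
                    (m.factorial * 2 ^ m * ((Lam * s) ^ m)⁻¹ * (τ ^ k) ^ m))) := by
                  rw [← h4]; gcongr; exact h1.trans (by gcongr)
              _ = (4 * gaussTail c * Real.exp (1 / 2) * Real.exp (-s) *
                    (m.factorial * 2 ^ m * ((Lam * s) ^ m)⁻¹)) *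
                    (((2 : ℝ) ^ (k + 1)) ^ d * (τ ^ k) ^ m) := by ring
              _ ≤ (4 * gaussTail c * Real.exp (1 / 2) * Real.exp (-s) *
                    (m.factorial * 2 ^ m * ((Lam * s) ^ m)⁻¹)) * (2 ^ d * (1 / 2) ^ k) := by
                  have : 0 < Lam * s := by positivity
                  gcongr
              _ = _ := by ring
    _ = _ := by
        have hψ := gaussTail_pos hc0
        have : 0 < Lam * s := by positivity
        rw [tsum_ofReal_geometric_two _ (by positivity)]
        congr 1
        ring

end UnitGaussianField

/-! ### Single cells and pairs of cells. -/

/-- On the cell `cube t ζ` the variogram of `c X` is at most `B (|q - p| / ζ)^β`. -/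
def CellBound {d : ℕ} {Ω : Type*} [MeasurableSpace Ω] (P : Measure Ω)
    (X : EuclideanSpace ℝ (Fin d) → Ω → ℝ) (β c B : ℝ) (t : EuclideanSpace ℝ (Fin d)) (ζ : ℝ) :
    Prop :=
  ∀ p ∈ cube t ζ, ∀ q ∈ cube t ζ, vario P X c p q ≤ B * (‖q - p‖ / ζ) ^ β

lemma exists_two_pow_mul_le_half (d : ℕ) {β : ℝ} (hβ : 0 < β) :
    ∃ m₀ : ℕ, ∀ m ≥ m₀, (2 : ℝ) ^ d * (2 ^ (-(β / 8))) ^ m ≤ 1 / 2 := by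
  have hτ1 : (2 : ℝ) ^ (-(β / 8)) < 1 :=
    Real.rpow_lt_one_of_one_lt_of_neg (by norm_num) (by linarith)
  have hτ0 : (0 : ℝ) < 2 ^ (-(β / 8)) := by positivity
  have h := (tendsto_pow_atTop_nhds_zero_of_lt_one hτ0.le hτ1).const_mul ((2 : ℝ) ^ d)
  rw [mul_zero] at h
  obtain ⟨m₀, hm₀⟩ := eventually_atTop.1 (h.eventually (ge_mem_nhds (by norm_num : (0 : ℝ) < 1 / 2)))
  exact ⟨m₀, hm₀⟩

namespace UnitGaussianField

/-- A single cell exceeds `c` with probability `O(ψ(c))`, and two cells with base points `p`, `q`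
do so simultaneously with probability `O(ψ(c) exp(-c² (1 - ρ(p, q)) / 16))`. -/
theorem exists_measure_cells_le (d : ℕ) {β : ℝ} (hβ : 0 < β) :
    ∃ b₁ > 0, ∃ C > 0, ∀ {Ω : Type*} [MeasurableSpace Ω] {P : Measure Ω}
      {X : EuclideanSpace ℝ (Fin d) → Ω → ℝ} {U : Set (EuclideanSpace ℝ (Fin d))}
      (_ : UnitGaussianField P X U) {ζ c B : ℝ}, 0 < ζ → 2 ≤ c → 0 ≤ B → B ≤ b₁ →
      (∀ t, cube t ζ ⊆ U → CellBound P X β c B t ζ →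
        P {ω | ∃ u ∈ cube t ζ, c < X u ω} ≤ ENNReal.ofReal (C * gaussTail c)) ∧
      (∀ p q, cube p ζ ⊆ U → CellBound P X β c B p ζ → cube q ζ ⊆ U → CellBound P X β c B q ζ →
        P {ω | (∃ u ∈ cube p ζ, c < X u ω) ∧ ∃ u ∈ cube q ζ, c < X u ω} ≤
          ENNReal.ofReal (C * gaussTail c * Real.exp (-(vario P X c p q / 32)))) := by
  obtain ⟨b₀, hb₀, hcell⟩ := exists_measure_cell_le d hβ
  obtain ⟨m, hm⟩ := exists_two_pow_mul_le_half d hβ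
  obtain ⟨C, hC, hcell⟩ := hcell m (hm m le_rfl)
  -- The cell estimate is used with `Lam = 4`, whence `4² = 16`.
  refine ⟨b₀ / 16, by positivity, (4 * Real.exp 1 + C) * Real.exp 1 + (4 + 2 * C), by positivity, ?_⟩
  intro Ω _ P X U h ζ c B hζ hc hB hBb
  have hc0 : 0 < c := by linarith
  have hψ := gaussTail_pos hc0
  have htail : ∀ t, cube t ζ ⊆ U → CellBound P X β c B t ζ → ∀ s, 1 ≤ s →
      P {ω | X t ω ≤ c - s / c ∧ ∃ u ∈ cube t ζ, c < X u ω} ≤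
        ENNReal.ofReal (C * gaussTail c * Real.exp (-s)) := by
    intro t ht hB' s hs
    refine (hcell h hζ ht (by linarith) hB' hB le_rfl (by linarith) (by linarith)).trans
      (ENNReal.ofReal_le_ofReal ?_)
    refine mul_le_of_le_one_right (by positivity) ?_
    exact inv_le_one_of_one_le₀ (one_le_pow₀ (by linarith))
  have hsingle : ∀ t, cube t ζ ⊆ U → CellBound P X β c B t ζ →
        P {ω | ∃ u ∈ cube t ζ, c < X u ω} ≤
          ENNReal.ofReal ((4 * Real.exp 1 + C) * gaussTail c) := by
    intro t ht hB'
    have htU := ht (base_mem_cube t hζ)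
    have h1 : P {ω | c ^ 2 + (-1) < c * X t ω + 0 * X t ω + 0 * X t ω} ≤
        ENNReal.ofReal (4 * gaussTail c * Real.exp (-(-1) + 0 / 2)) := by
      refine measure_gaussian_gt_le (h.hasGaussianLaw_comb htU htU htU _ _ _)
        (h.integral_comb htU htU htU _ _ _) hc0 ?_ (by positivity) (by nlinarith)
      rw [h.integral_comb_sq htU htU htU]
      simp
    have hsub : {ω | ∃ u ∈ cube t ζ, c < X u ω} ⊆
        {ω | c ^ 2 + (-1) < c * X t ω + 0 * X t ω + 0 * X t ω} ∪
        {ω | X t ω ≤ c - 1 / c ∧ ∃ u ∈ cube t ζ, c < X u ω} := by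
      intro ω hω
      by_cases hx : X t ω ≤ c - 1 / c
      · exact Or.inr ⟨hx, hω⟩
      · left
        push Not at hx
        have := mul_lt_mul_of_pos_left hx hc0
        have e : c * (c - 1 / c) = c ^ 2 + (-1) := by field_simp; ring
        simp only [Set.mem_ofPred_eq]
        linarith
    refine (measure_mono hsub).trans ((measure_union_le _ _).trans
      ((add_le_add h1 (htail t ht hB' 1 le_rfl)).trans ?_))
    rw [← ENNReal.ofReal_add (by positivity) (by positivity)]
    refine ENNReal.ofReal_le_ofReal ?_
    have : Real.exp (-1) ≤ 1 := Real.exp_le_one_iff.2 (by norm_num)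
    have h2 : C * gaussTail c * Real.exp (-1) ≤ C * gaussTail c :=
      mul_le_of_le_one_right (by positivity) this
    simp only [neg_neg, zero_div, add_zero]
    linarith
  have he1 : 1 ≤ Real.exp 1 := Real.one_le_exp (by norm_num)
  refine ⟨fun t ht hB' => (hsingle t ht hB').trans (ENNReal.ofReal_le_ofReal ?_), ?_⟩
  · have : (4 * Real.exp 1 + C) * 1 ≤ (4 * Real.exp 1 + C) * Real.exp 1 := by gcongr
    exact mul_le_mul_of_nonneg_right (by linarith) hψ.le
  intro p q hp hBp hq hBq
  have hpU := hp (base_mem_cube p hζ)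
  have hqU := hq (base_mem_cube q hζ)
  -- With this normalisation `(c/2)(X p + X q)` has variance `c² - 8s`. If both base values exceed
  -- `c - s/c`, it exceeds `c² - s`, which has probability of order `ψ(c) e^{-3s}`. Otherwise a cell
  -- crosses `c` from a base value below `c - s/c`, which costs `e^{-s}`.
  set s := vario P X c p q / 32 with hs
  have hvs : 2 * c ^ 2 * (1 - corr P X p q) = 32 * s := by rw [hs, vario]; ring
  rcases lt_or_ge s 1 with hs1 | hs1
  · have hmono : P {ω | (∃ u ∈ cube p ζ, c < X u ω) ∧ ∃ u ∈ cube q ζ, c < X u ω} ≤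
        P {ω | ∃ u ∈ cube p ζ, c < X u ω} := measure_mono fun ω hω => hω.1
    refine (hmono.trans (hsingle p hp hBp)).trans (ENNReal.ofReal_le_ofReal ?_)
    have h1 : 1 ≤ Real.exp 1 * Real.exp (-s) := by
      rw [← Real.exp_add]; exact Real.one_le_exp (by linarith)
    calc (4 * Real.exp 1 + C) * gaussTail c = (4 * Real.exp 1 + C) * gaussTail c * 1 := by ring
      _ ≤ (4 * Real.exp 1 + C) * gaussTail c * (Real.exp 1 * Real.exp (-s)) := by gcongr
      _ = (4 * Real.exp 1 + C) * Real.exp 1 * gaussTail c * Real.exp (-s) := by ring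
      _ ≤ _ := by gcongr; linarith
  have hcm := h.neg_one_le_corr hpU hqU
  have hsc : s ≤ c ^ 2 / 8 := by nlinarith [sq_nonneg c]
  have h1 : P {ω | c ^ 2 + (-s) < (c / 2) * X p ω + (c / 2) * X q ω + 0 * X q ω} ≤
      ENNReal.ofReal (4 * gaussTail c * Real.exp (-(-s) + (-8 * s) / 2)) := by
    refine measure_gaussian_gt_le (h.hasGaussianLaw_comb hpU hqU hqU _ _ _)
      (h.integral_comb hpU hqU hqU _ _ _) hc0 ?_ (by nlinarith) (by nlinarith)
    rw [h.integral_comb_sq hpU hqU hqU]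
    nlinarith
  have hsub : {ω | (∃ u ∈ cube p ζ, c < X u ω) ∧ ∃ u ∈ cube q ζ, c < X u ω} ⊆
      {ω | c ^ 2 + (-s) < (c / 2) * X p ω + (c / 2) * X q ω + 0 * X q ω} ∪
      ({ω | X p ω ≤ c - s / c ∧ ∃ u ∈ cube p ζ, c < X u ω} ∪
        {ω | X q ω ≤ c - s / c ∧ ∃ u ∈ cube q ζ, c < X u ω}) := by
    intro ω hω
    by_cases hx : X p ω ≤ c - s / c
    · exact Or.inr (Or.inl ⟨hx, hω.1⟩)
    by_cases hy : X q ω ≤ c - s / c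
    · exact Or.inr (Or.inr ⟨hy, hω.2⟩)
    left
    push Not at hx hy
    have h3 := mul_lt_mul_of_pos_left hx hc0
    have h4 := mul_lt_mul_of_pos_left hy hc0
    have e : c * (c - s / c) = c ^ 2 + (-s) := by field_simp; ring
    simp only [Set.mem_ofPred_eq]
    linarith
  refine (measure_mono hsub).trans ((measure_union_le _ _).trans
    ((add_le_add h1 ((measure_union_le _ _).trans (add_le_add (htail p hp hBp s hs1)
      (htail q hq hBq s hs1)))).trans ?_))
  rw [← ENNReal.ofReal_add (by positivity) (by positivity),
    ← ENNReal.ofReal_add (by positivity) (by positivity)]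
  refine ENNReal.ofReal_le_ofReal ?_
  have h2 : Real.exp (-(-s) + (-8 * s) / 2) ≤ Real.exp (-s) := Real.exp_le_exp.2 (by linarith)
  calc _ ≤ 4 * gaussTail c * Real.exp (-s) + (C * gaussTail c * Real.exp (-s) +
        C * gaussTail c * Real.exp (-s)) := by gcongr
    _ = (4 + 2 * C) * gaussTail c * Real.exp (-s) := by ring
    _ ≤ _ := by
      have : 0 ≤ (4 * Real.exp 1 + C) * Real.exp 1 := by positivity
      exact mul_le_mul_of_nonneg_right (mul_le_mul_of_nonneg_right (by linarith) hψ.le)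
        (Real.exp_pos _).le

end UnitGaussianField

namespace LocallyStationaryField

variable {d : ℕ} {Ω : Type*} [MeasurableSpace Ω] {P : Measure Ω}
  {D : Set (EuclideanSpace ℝ (Fin d))} {δ : ℝ} {X : EuclideanSpace ℝ (Fin d) → Ω → ℝ} {α : ℝ}
  {L : ℝ → ℝ} {r : EuclideanSpace ℝ (Fin d) → EuclideanSpace ℝ (Fin d) → ℝ}

/-- Measured in cell units, the Hölder constant of a cell of side `a Δ` is `C a^{α/2}`. It is made
small by shrinking `a`, which is how the smallness conditions on `B` get satisfied. -/
lemma exists_cellBound (h : LocallyStationaryField P D δ X α L r) :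
    ∃ C > 0, ∀ᶠ c in atTop, ∀ a, 0 < a → a ≤ 1 → ∀ t, cube t (a * scale α L c) ⊆
      Metric.thickening δ D → CellBound P X (α / 2) c (C * a ^ (α / 2)) t (a * scale α L c) := by
  obtain ⟨C, hC, hV⟩ := h.vario_le (Lam := √d + 1) (by positivity)
  refine ⟨C, hC, ?_⟩
  filter_upwards [hV, eventually_scale_pos h.isLeast] with c hc hs a ha0 ha1 t ht p hp q hq
  have hd := dist_le_of_mem_cube (by positivity) hq hp
  have h1 := hc p (ht hp) q (ht hq) (hd.trans (by
    have : a * scale α L c ≤ 1 * scale α L c := by gcongr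
    nlinarith [Real.sqrt_nonneg (d : ℝ)]))
  refine h1.trans (le_of_eq ?_)
  rw [mul_assoc, ← Real.mul_rpow ha0.le (by positivity)]
  congr 2
  field_simp

end LocallyStationaryField

/-! ### Gaussian vectors and the functional `expExceed`. -/

lemma isOpen_exists_lt {ι : Type*} [Finite ι] (b : ι → ℝ) : IsOpen {x : EuclideanSpace ℝ ι | ∃ i, b i < x i} := by
  have : {x : EuclideanSpace ℝ ι | ∃ i, b i < x i} = ⋃ i, {x | b i < x i} := by
    ext x; simp
  rw [this]
  exact isOpen_iUnion fun i => isOpen_lt (by fun_prop) (by fun_prop)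

lemma frontier_exists_lt_subset {ι : Type*} [Finite ι] (b : ι → ℝ) :
    frontier {x : EuclideanSpace ℝ ι | ∃ i, b i < x i} ⊆ ⋃ i, {x | x i = b i} := by
  intro x hx
  rw [(isOpen_exists_lt b).frontier_eq] at hx
  have hcl : IsClosed {x : EuclideanSpace ℝ ι | ∃ i, b i ≤ x i} := by
    have : {x : EuclideanSpace ℝ ι | ∃ i, b i ≤ x i} = ⋃ i, {x | b i ≤ x i} := by
      ext x; simp
    rw [this]
    exact isClosed_iUnion_of_finite fun i => isClosed_le (by fun_prop) (by fun_prop)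
  have h1 : x ∈ {x : EuclideanSpace ℝ ι | ∃ i, b i ≤ x i} :=
    closure_minimal (fun y hy => by obtain ⟨i, hi⟩ := hy; exact ⟨i, hi.le⟩) hcl hx.1
  obtain ⟨i, hi⟩ := h1
  refine Set.mem_iUnion.2 ⟨i, le_antisymm ?_ hi⟩
  by_contra hlt
  exact hx.2 ⟨i, not_le.1 hlt⟩

/-- An integrable majorant for the integrands of `expExceed`. -/
noncomputable def expMajorant (ι : Type*) [Fintype ι] (R s y : ℝ) : ℝ :=
  (1 + Fintype.card ι * Real.exp (12 * R - 4 * s)) * Real.exp (-|y|)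

lemma lintegral_expMajorant_lt_top {ι : Type*} [Fintype ι] (R s : ℝ) :
    ∫⁻ y, ENNReal.ofReal (expMajorant ι R s y) < ∞ := by
  have h1 : Integrable (fun y : ℝ => Real.exp (-|y|)) := by
    rw [← integrableOn_univ, ← Set.Iic_union_Ioi (a := (0 : ℝ)), integrableOn_union]
    constructor
    · refine (integrableOn_exp_Iic 0).congr_fun (fun y hy => ?_) measurableSet_Iic
      simp [abs_of_nonpos (Set.mem_Iic.1 hy)]
    · refine (exp_neg_integrableOn_Ioi 0 one_pos).congr_fun (fun y hy => ?_) measurableSet_Ioi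
      simp [abs_of_pos (Set.mem_Ioi.1 hy)]
  exact (h1.const_mul _).lintegral_lt_top

lemma covariance_matrix_posSemidef {ι : Type*} [Fintype ι] {Ω : Type*} [MeasurableSpace Ω] {P : Measure Ω}
    [IsProbabilityMeasure P] {V : ι → Ω → ℝ} (hV : ∀ i, MemLp (V i) 2 P) {S : Matrix ι ι ℝ}
    (hS : ∀ i j, covariance (V i) (V j) P = S i j) : S.PosSemidef := by
  refine Matrix.PosSemidef.of_dotProduct_mulVec_nonneg ?_ fun x => ?_
  · ext i j
    simp [← hS, covariance_comm]
  · have h := variance_nonneg (fun ω => ∑ i, x i * V i ω) P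
    rw [variance_fun_sum (fun i => (hV i).const_mul (x i))] at h
    refine h.trans (le_of_eq ?_)
    simp only [covariance_const_mul_left, covariance_const_mul_right, hS, dotProduct,
      Matrix.mulVec, Finset.mul_sum, star_trivial]
    refine Finset.sum_congr rfl fun i _ => Finset.sum_congr rfl fun j _ => ?_
    ring

section MultivariateGaussian

variable {ι : Type*} [Fintype ι] [DecidableEq ι]

/-- The law of a Gaussian vector is determined by its mean vector and covariance matrix. -/
lemma HasGaussianLaw.map_toLp_eq {Ω : Type*} [MeasurableSpace Ω] {P : Measure Ω} {V : ι → Ω → ℝ}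
    (hV : HasGaussianLaw (fun ω i => V i ω) P) {m : EuclideanSpace ℝ ι} {S : Matrix ι ι ℝ}
    (hm : ∀ i, ∫ ω, V i ω ∂P = m i) (hS : ∀ i j, covariance (V i) (V j) P = S i j)
    (hpos : S.PosSemidef) :
    P.map (fun ω => WithLp.toLp 2 (fun i => V i ω)) = multivariateGaussian m S := by
  have hlaw : HasGaussianLaw (fun ω => WithLp.toLp 2 (fun i => V i ω)) P := hV.toLp_pi 2
  have := hlaw.isGaussian_map
  have hP := hV.isProbabilityMeasure
  apply IsGaussian.ext
  · simp only [id_eq, integral_id_multivariateGaussian]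
    rw [integral_map hlaw.aemeasurable (by fun_prop)]
    ext i
    have h1 := ContinuousLinearMap.integral_comp_comm
      (EuclideanSpace.proj i : EuclideanSpace ℝ ι →L[ℝ] ℝ) hlaw.integrable
    exact h1.symm.trans (hm i)
  · rw [← ContinuousLinearMap.toBilinForm_inj]
    refine LinearMap.BilinForm.ext_basis (EuclideanSpace.basisFun ι ℝ).toBasis fun i j => ?_
    rw [ContinuousLinearMap.toBilinForm_apply, ContinuousLinearMap.toBilinForm_apply,
      covarianceBilin_multivariateGaussian hpos,
      covarianceBilin_apply_eq_cov IsGaussian.memLp_two_id, covariance_map]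
    · have (i : ι) : ((fun u => inner ℝ ((EuclideanSpace.basisFun ι ℝ).toBasis i) u) ∘
          fun ω => WithLp.toLp 2 (fun i => V i ω)) = V i := by
        ext; simp [PiLp.inner_apply]
      simp_rw [this, hS]
      simp
    any_goals exact Measurable.aestronglyMeasurable (by fun_prop)
    exact hlaw.aemeasurable

lemma multivariateGaussian_map_add (μ a : EuclideanSpace ℝ ι) (S : Matrix ι ι ℝ) :
    (multivariateGaussian μ S).map (fun x => a + x) = multivariateGaussian (a + μ) S := by
  rw [multivariateGaussian, multivariateGaussian, Measure.map_map (by fun_prop) (by fun_prop)]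
  congr 1
  ext x : 1
  simp [add_assoc]

/-- Characteristic functions converge, then the portmanteau theorem applies. No densities occur, so
degenerate covariances are covered; the tangent vector is degenerate at the origin. -/
lemma tendsto_multivariateGaussian_measure {m : ℕ → EuclideanSpace ℝ ι}
    {m₀ : EuclideanSpace ℝ ι} {S : ℕ → Matrix ι ι ℝ} {S₀ : Matrix ι ι ℝ}
    (hm : Tendsto m atTop (𝓝 m₀)) (hS : Tendsto S atTop (𝓝 S₀)) (hpos : ∀ n, (S n).PosSemidef)
    (hpos₀ : S₀.PosSemidef) {G : Set (EuclideanSpace ℝ ι)}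
    (hG : multivariateGaussian m₀ S₀ (frontier G) = 0) :
    Tendsto (fun n => multivariateGaussian (m n) (S n) G) atTop
      (𝓝 (multivariateGaussian m₀ S₀ G)) := by
  let ν : ℕ → ProbabilityMeasure (EuclideanSpace ℝ ι) :=
    fun n => ⟨multivariateGaussian (m n) (S n), inferInstance⟩
  let ν₀ : ProbabilityMeasure (EuclideanSpace ℝ ι) :=
    ⟨multivariateGaussian m₀ S₀, inferInstance⟩
  have hlim : Tendsto ν atTop (𝓝 ν₀) := by
    refine ProbabilityMeasure.tendsto_of_tendsto_charFun fun t => ?_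
    simp only [ν, ν₀, ProbabilityMeasure.coe_mk, charFun_multivariateGaussian (hpos _),
      charFun_multivariateGaussian hpos₀]
    refine (Complex.continuous_exp.tendsto _).comp (Tendsto.sub ?_ ?_)
    · refine Tendsto.mul_const _ ?_
      exact (Complex.continuous_ofReal.tendsto _).comp ((tendsto_const_nhds).inner hm)
    · refine Tendsto.div_const ?_ _
      refine (Complex.continuous_ofReal.tendsto _).comp ?_
      have hcont : Continuous fun A : Matrix ι ι ℝ => t.ofLp ⬝ᵥ A.mulVec t.ofLp := by
        fun_prop
      exact (hcont.tendsto S₀).comp hS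
  exact ProbabilityMeasure.tendsto_measure_of_null_frontier_of_tendsto' hlim hG

/-- The functional `∫ e^{y - τ y² / 2} P{∃ i, ξ_i > s + κ_i y} dy` of a Gaussian vector `ξ` with
mean `m` and covariance `S`. -/
noncomputable def expExceed (τ s : ℝ) (κ : ι → ℝ) (m : EuclideanSpace ℝ ι) (S : Matrix ι ι ℝ) :
    ℝ≥0∞ :=
  ∫⁻ y : ℝ, ENNReal.ofReal (Real.exp (y - τ * y ^ 2 / 2)) *
    multivariateGaussian m S {x | ∃ i, s + κ i * y < x i}

lemma measurable_multivariateGaussian_exists_lt (s : ℝ) (κ : ι → ℝ) (m : EuclideanSpace ℝ ι)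
    (S : Matrix ι ι ℝ) :
    Measurable fun y : ℝ => multivariateGaussian m S {x | ∃ i, s + κ i * y < x i} := by
  have : MeasurableSet {p : ℝ × EuclideanSpace ℝ ι | ∃ i, s + κ i * p.1 < p.2 i} := by
    have e : {p : ℝ × EuclideanSpace ℝ ι | ∃ i, s + κ i * p.1 < p.2 i} =
        ⋃ i, {p | s + κ i * p.1 < p.2 i} := by ext p; simp
    rw [e]
    exact MeasurableSet.iUnion fun i => measurableSet_lt (by fun_prop) (by fun_prop)
  exact measurable_measure_prodMk_left this

lemma multivariateGaussian_exists_lt_le {R s y : ℝ} {κ : ι → ℝ} {m : EuclideanSpace ℝ ι}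
    {S : Matrix ι ι ℝ} (hS : S.PosSemidef) (hm : ∀ i, |m i| ≤ R) (hSR : ∀ i, S i i ≤ R)
    (hκ : ∀ i, 1 / 2 ≤ κ i) (hy : 0 ≤ y) :
    multivariateGaussian m S {x | ∃ i, s + κ i * y < x i} ≤
      ENNReal.ofReal (Fintype.card ι * Real.exp (12 * R - 4 * s - 2 * y)) := by
  have e : {x : EuclideanSpace ℝ ι | ∃ i, s + κ i * y < x i} = ⋃ i, {x | s + κ i * y < x i} := by
    ext x; simp
  rw [e]
  calc _ ≤ ∑ i, multivariateGaussian m S {x | s + κ i * y < x i} := measure_iUnion_fintype_le _ _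
    _ ≤ ∑ _i : ι, ENNReal.ofReal (Real.exp (12 * R - 4 * s - 2 * y)) := by
      refine Finset.sum_le_sum fun i _ => ?_
      have hmp := measurePreserving_eval_multivariateGaussian (μ := m) hS (i := i)
      have h1 : multivariateGaussian m S {x | s + κ i * y < x i} =
          gaussianReal (m i) (S i i).toNNReal (Set.Ioi (s + κ i * y)) := by
        rw [← hmp.map_eq, Measure.map_apply hmp.measurable measurableSet_Ioi]
        rfl
      rw [h1]
      -- The Chernoff exponent 4 and `κ ≥ 1/2` give decay `e^{-2y}`, which beats the weight `e^y`.
      -- Mean and variance contribute `4R + 8R = 12R`.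
      have h2 := measure_ge_le_exp_mul_mgf (μ := gaussianReal (m i) (S i i).toNNReal)
        (X := id) (t := 4) (s + κ i * y) (by norm_num) (integrable_exp_mul_gaussianReal 4)
      rw [mgf_id_gaussianReal, ← Real.exp_add] at h2
      rw [← ofReal_measureReal]
      refine ENNReal.ofReal_le_ofReal ((measureReal_mono (fun x hx => ?_)).trans
        (h2.trans (Real.exp_le_exp.2 ?_)))
      · exact (Set.mem_Ioi.1 hx).le
      · rw [Real.coe_toNNReal _ hS.diag_nonneg]
        have := hκ i
        have := (abs_le.1 (hm i)).2
        have := hSR i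
        nlinarith
    _ = _ := by
      rw [Finset.sum_const, Finset.card_univ, nsmul_eq_mul, ENNReal.ofReal_mul (by positivity)]
      simp

lemma expExceed_integrand_le {R s y τ : ℝ} {κ : ι → ℝ} {m : EuclideanSpace ℝ ι}
    {S : Matrix ι ι ℝ} (hτ : 0 ≤ τ) (hS : S.PosSemidef) (hm : ∀ i, |m i| ≤ R)
    (hSR : ∀ i, S i i ≤ R) (hκ : ∀ i, 1 / 2 ≤ κ i) :
    ENNReal.ofReal (Real.exp (y - τ * y ^ 2 / 2)) *
      multivariateGaussian m S {x | ∃ i, s + κ i * y < x i} ≤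
        ENNReal.ofReal (expMajorant ι R s y) := by
  have h0 : Real.exp (y - τ * y ^ 2 / 2) ≤ Real.exp y :=
    Real.exp_le_exp.2 (by have : 0 ≤ τ * y ^ 2 / 2 := by positivity
                          linarith)
  rcases le_total 0 y with hy | hy
  · refine (mul_le_mul' (ENNReal.ofReal_le_ofReal h0)
      (multivariateGaussian_exists_lt_le hS hm hSR hκ hy)).trans ?_
    rw [← ENNReal.ofReal_mul (Real.exp_pos _).le]
    refine ENNReal.ofReal_le_ofReal ?_
    rw [expMajorant, abs_of_nonneg hy]
    have e : Real.exp y * (Fintype.card ι * Real.exp (12 * R - 4 * s - 2 * y)) =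
        (Fintype.card ι * Real.exp (12 * R - 4 * s)) * Real.exp (-y) := by
      rw [mul_left_comm, ← Real.exp_add, mul_assoc, ← Real.exp_add]
      congr 2; ring
    rw [e]
    gcongr
    linarith
  · refine (mul_le_mul' (ENNReal.ofReal_le_ofReal h0) prob_le_one).trans ?_
    rw [mul_one]
    refine ENNReal.ofReal_le_ofReal ?_
    rw [expMajorant, abs_of_nonpos hy, neg_neg]
    refine le_mul_of_one_le_left (Real.exp_pos _).le ?_
    have : 0 ≤ Fintype.card ι * Real.exp (12 * R - 4 * s) := by positivity
    linarith

lemma expExceed_lt_top {τ s : ℝ} {κ : ι → ℝ} {m : EuclideanSpace ℝ ι} {S : Matrix ι ι ℝ}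
    (hτ : 0 ≤ τ) (hS : S.PosSemidef) (hκ : ∀ i, 1 / 2 ≤ κ i) : expExceed τ s κ m S < ∞ := by
  set R := ∑ i, |m i| + ∑ i, |S i i|
  have h1 : ∀ i, |m i| ≤ R := fun i =>
    (Finset.single_le_sum (f := fun i => |m i|) (fun _ _ => abs_nonneg _)
      (Finset.mem_univ i)).trans (le_add_of_nonneg_right (Finset.sum_nonneg fun _ _ => abs_nonneg _))
  have h2 : ∀ i, S i i ≤ R := fun i => (le_abs_self _).trans
    ((Finset.single_le_sum (f := fun i => |S i i|) (fun _ _ => abs_nonneg _)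
      (Finset.mem_univ i)).trans (le_add_of_nonneg_left (Finset.sum_nonneg fun _ _ => abs_nonneg _)))
  exact (lintegral_mono fun y => expExceed_integrand_le hτ hS h1 h2 hκ).trans_lt
    (lintegral_expMajorant_lt_top (ι := ι) R s)

/-- Substitute `y - s` for `y`: lowering the level by `s/c` costs a factor `e^s` in the limit. -/
lemma expExceed_shift (s : ℝ) (m : EuclideanSpace ℝ ι) (S : Matrix ι ι ℝ) :
    expExceed 0 s (fun _ => 1) m S =
      ENNReal.ofReal (Real.exp (-s)) * expExceed 0 0 (fun _ => 1) m S := by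
  rw [expExceed, expExceed, ← lintegral_add_right_eq_self _ (-s), ← lintegral_const_mul]
  · congr 1
    ext y
    rw [← mul_assoc, ← ENNReal.ofReal_mul (Real.exp_pos _).le, ← Real.exp_add]
    simp [add_comm]
  · exact Measurable.mul (by fun_prop) (measurable_multivariateGaussian_exists_lt _ _ _ _)

/-- Dominated convergence in `y`. For fixed `y` the Gaussian probabilities converge provided no
coordinate of the limit has an atom at the threshold, and this fails for countably many `y` only. -/
lemma tendsto_expExceed {τ : ℕ → ℝ} {κ : ℕ → ι → ℝ} {m : ℕ → EuclideanSpace ℝ ι}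
    {m₀ : EuclideanSpace ℝ ι} {S : ℕ → Matrix ι ι ℝ} {S₀ : Matrix ι ι ℝ} (s : ℝ)
    (hτ0 : ∀ n, 0 ≤ τ n) (hτ : Tendsto τ atTop (𝓝 0)) (hκ : Tendsto κ atTop (𝓝 fun _ => 1))
    (hm : Tendsto m atTop (𝓝 m₀)) (hS : Tendsto S atTop (𝓝 S₀)) (hpos : ∀ n, (S n).PosSemidef)
    (hpos₀ : S₀.PosSemidef) :
    Tendsto (fun n => expExceed (τ n) s (κ n) (m n) (S n)) atTop
      (𝓝 (expExceed 0 s (fun _ => 1) m₀ S₀)) := by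
  set R := ∑ i, |m₀ i| + ∑ i, |S₀ i i| + 1
  have hmi : ∀ i, Tendsto (fun n => m n i) atTop (𝓝 (m₀ i)) := fun i =>
    ((EuclideanSpace.proj i : EuclideanSpace ℝ ι →L[ℝ] ℝ).continuous.tendsto m₀).comp hm
  have hSij : ∀ i j, Tendsto (fun n => S n i j) atTop (𝓝 (S₀ i j)) := fun i j =>
    (tendsto_pi_nhds.1 ((tendsto_pi_nhds.1 hS) i)) j
  have hκi : ∀ i, Tendsto (fun n => κ n i) atTop (𝓝 1) := fun i => (tendsto_pi_nhds.1 hκ) i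
  have h1 : ∀ i, |m₀ i| < R := fun i => by
    have := Finset.single_le_sum (f := fun i => |m₀ i|) (fun _ _ => abs_nonneg _)
      (Finset.mem_univ i)
    have h' : 0 ≤ ∑ i, |S₀ i i| := Finset.sum_nonneg fun _ _ => abs_nonneg _
    simp only [R]; linarith
  have h2 : ∀ i, S₀ i i < R := fun i => by
    have := Finset.single_le_sum (f := fun i => |S₀ i i|) (fun _ _ => abs_nonneg _)
      (Finset.mem_univ i)
    have h' : 0 ≤ ∑ i, |m₀ i| := Finset.sum_nonneg fun _ _ => abs_nonneg _
    have := le_abs_self (S₀ i i)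
    simp only [R]; linarith
  have hev : ∀ᶠ n in atTop, (∀ i, |m n i| ≤ R) ∧ (∀ i, S n i i ≤ R) ∧ (∀ i, 1 / 2 ≤ κ n i) := by
    refine (eventually_all.2 fun i => ?_).and ((eventually_all.2 fun i => ?_).and
      (eventually_all.2 fun i => ?_))
    · exact (hmi i).abs.eventually (ge_mem_nhds (h1 i))
    · exact (hSij i i).eventually (ge_mem_nhds (h2 i))
    · exact (hκi i).eventually (le_mem_nhds (by norm_num))
  refine tendsto_lintegral_filter_of_dominated_convergence
    (fun y => ENNReal.ofReal (expMajorant ι R s y)) (Eventually.of_forall fun n => ?_) ?_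
    (lintegral_expMajorant_lt_top R s).ne ?_
  · exact Measurable.mul (by fun_prop) (measurable_multivariateGaussian_exists_lt _ _ _ _)
  · filter_upwards [hev] with n hn
    exact ae_of_all _ fun y => expExceed_integrand_le (hτ0 n) (hpos n) hn.1 hn.2.1 hn.2.2
  · have hcount : {y : ℝ | ∃ i, 0 < multivariateGaussian m₀ S₀ {x | x i = s + y}}.Countable := by
      have : {y : ℝ | ∃ i, 0 < multivariateGaussian m₀ S₀ {x | x i = s + y}} =
          ⋃ i, (fun y => s + y) ⁻¹' {z | 0 < multivariateGaussian m₀ S₀ {x | x i = z}} := by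
        ext y; simp
      rw [this]
      refine Set.countable_iUnion fun i => ?_
      exact (Measure.countable_meas_level_set_pos (μ := multivariateGaussian m₀ S₀)
        (g := fun x : EuclideanSpace ℝ ι => x i) (by fun_prop)).preimage (add_right_injective s)
    filter_upwards [hcount.ae_notMem volume] with y hy
    have hy0 : ∀ i, multivariateGaussian m₀ S₀ {x | x i = s + y} = 0 := by
      intro i
      by_contra hne
      exact hy ⟨i, pos_iff_ne_zero.2 hne⟩
    refine ENNReal.Tendsto.mul ?_ (Or.inr ?_) ?_ (Or.inr ENNReal.ofReal_ne_top)
    · refine ENNReal.tendsto_ofReal ((Real.continuous_exp.tendsto _).comp ?_)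
      have := ((hτ.mul_const (y ^ 2)).div_const 2).const_sub y
      simpa using this
    · exact measure_ne_top _ _
    -- The moving thresholds are absorbed into the mean vectors, so that all measures are evaluated
    -- on one fixed set.
    set a : ℕ → EuclideanSpace ℝ ι := fun n => WithLp.toLp 2 fun i => -(s + κ n i * y) with ha
    set a₀ : EuclideanSpace ℝ ι := WithLp.toLp 2 fun _ => -(s + 1 * y) with ha₀
    have hsh : ∀ (κ' : ι → ℝ) (μ : EuclideanSpace ℝ ι) (T : Matrix ι ι ℝ),
        multivariateGaussian μ T {x | ∃ i, s + κ' i * y < x i} =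
        multivariateGaussian ((WithLp.toLp 2 fun i => -(s + κ' i * y)) + μ) T
          {x | ∃ i, 0 < x i} := by
      intro κ' μ T
      rw [← multivariateGaussian_map_add, Measure.map_apply (by fun_prop)
        (isOpen_exists_lt fun _ => (0 : ℝ)).measurableSet]
      congr 1
      ext x
      simp only [Set.mem_preimage, Set.mem_ofPred_eq, PiLp.add_apply]
      refine exists_congr fun i => ?_
      constructor <;> intro h <;> linarith
    simp_rw [hsh]
    refine tendsto_multivariateGaussian_measure (m := fun n => a n + m n) (m₀ := a₀ + m₀)
      (Tendsto.add ?_ hm) hS hpos hpos₀ ?_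
    · refine ((PiLp.continuous_toLp 2 (fun _ : ι => ℝ)).tendsto _).comp ?_
      refine tendsto_pi_nhds.2 fun i => ?_
      exact (((hκi i).mul_const y).const_add s).neg
    · refine measure_mono_null (frontier_exists_lt_subset _) (measure_iUnion_null fun i => ?_)
      rw [← multivariateGaussian_map_add, Measure.map_apply (by fun_prop)
        (measurableSet_eq_fun (by fun_prop) (by fun_prop)), ← hy0 i]
      congr 1
      ext x
      simp only [Set.mem_preimage, Set.mem_ofPred_eq, PiLp.add_apply, ha₀]
      constructor <;> intro h <;> linarith

end MultivariateGaussian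

lemma posSemidef_of_tendsto {ι : Type*} [Fintype ι] {β : Type*} {l : Filter β} [l.NeBot]
    {S : β → Matrix ι ι ℝ} {S₀ : Matrix ι ι ℝ} (hS : ∀ i j, Tendsto (fun n => S n i j) l (𝓝 (S₀ i j)))
    (hpos : ∀ᶠ n in l, (S n).PosSemidef) : S₀.PosSemidef := by
  refine Matrix.PosSemidef.of_dotProduct_mulVec_nonneg ?_ fun x => ?_
  · ext i j
    simp only [Matrix.conjTranspose_apply, star_trivial]
    refine tendsto_nhds_unique (hS j i) ((hS i j).congr' ?_)
    filter_upwards [hpos] with n hn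
    simpa using (hn.isHermitian.apply i j).symm
  · have h : Tendsto (fun n => star x ⬝ᵥ (S n).mulVec x) l (𝓝 (star x ⬝ᵥ S₀.mulVec x)) := by
      simp only [dotProduct, Matrix.mulVec]
      refine tendsto_finsetSum _ fun i _ => Tendsto.const_mul _ ?_
      exact tendsto_finsetSum _ fun j _ => (hS i j).mul_const _
    refine ge_of_tendsto h ?_
    filter_upwards [hpos] with n hn
    exact hn.dotProduct_mulVec_nonneg x

/-- By compactness: counterexamples with `η = 1/(n + 1)` have parameters bounded by `R`, so along a
subsequence both functionals converge to the same limit. This yields uniformity over all `t ∈ D`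
even if `D` is unbounded. -/
theorem exists_expExceed_close (ι : Type*) [Fintype ι] [DecidableEq ι] (R s : ℝ) {ε : ℝ}
    (hε : 0 < ε) :
    ∃ η > 0, ∀ (τ : ℝ) (κ : ι → ℝ) (m m' : EuclideanSpace ℝ ι) (S S' : Matrix ι ι ℝ),
      0 ≤ τ → τ ≤ η → (∀ i, |κ i - 1| ≤ η) → S.PosSemidef → S'.PosSemidef →
      (∀ i, |m i| ≤ R) → (∀ i j, |S i j| ≤ R) → (∀ i, |m' i - m i| ≤ η) →
      (∀ i j, |S' i j - S i j| ≤ η) →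
      |(expExceed τ s κ m' S').toReal -
        Real.exp (-s) * (expExceed 0 0 (fun _ => 1) m S).toReal| ≤ ε := by
  by_contra hcon
  push Not at hcon
  have hpos : ∀ n : ℕ, (0 : ℝ) < 1 / ((n : ℝ) + 1) := fun n => Nat.one_div_pos_of_nat
  choose τ κ m m' S S' hτ0 hτ hκ hS hS' hm hSR hmm hSS hbad using fun n : ℕ => hcon _ (hpos n)
  set x : ℕ → (ι → ℝ) × (ι → ι → ℝ) := fun n => ((m n).ofLp, fun i j => S n i j) with hx
  have hbdd : ∀ n, x n ∈ Metric.closedBall (0 : (ι → ℝ) × (ι → ι → ℝ)) (|R|) := by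
    intro n
    rw [mem_closedBall_zero_iff, norm_prod_le_iff]
    refine ⟨(pi_norm_le_iff_of_nonneg (abs_nonneg R)).2 fun i => ?_,
      (pi_norm_le_iff_of_nonneg (abs_nonneg R)).2 fun i =>
        (pi_norm_le_iff_of_nonneg (abs_nonneg R)).2 fun j => ?_⟩
    · exact (hm n i).trans (le_abs_self R)
    · exact (hSR n i j).trans (le_abs_self R)
  obtain ⟨a, -, φ, hφ, hlim⟩ := tendsto_subseq_of_bounded Metric.isBounded_closedBall hbdd
  have hη : Tendsto (fun n => 1 / ((φ n : ℝ) + 1)) atTop (𝓝 0) :=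
    (tendsto_one_div_add_atTop_nhds_zero_nat (𝕜 := ℝ)).comp hφ.tendsto_atTop
  have hlim1 : ∀ i, Tendsto (fun n => m (φ n) i) atTop (𝓝 (a.1 i)) := fun i =>
    (tendsto_pi_nhds.1 ((Prod.tendsto_iff _ _).1 hlim).1) i
  have hlim2 : ∀ i j, Tendsto (fun n => S (φ n) i j) atTop (𝓝 (a.2 i j)) := fun i j =>
    (tendsto_pi_nhds.1 ((tendsto_pi_nhds.1 ((Prod.tendsto_iff _ _).1 hlim).2) i)) j
  have hshift : ∀ {f g : ℕ → ℝ} {b : ℝ}, Tendsto f atTop (𝓝 b) →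
      (∀ n, |g n - f n| ≤ 1 / ((φ n : ℝ) + 1)) → Tendsto g atTop (𝓝 b) := by
    intro f g b hf hfg
    have h0 : Tendsto (fun n => g n - f n) atTop (𝓝 0) :=
      squeeze_zero_norm hfg hη
    simpa using h0.add hf
  have hlim1' : ∀ i, Tendsto (fun n => m' (φ n) i) atTop (𝓝 (a.1 i)) := fun i =>
    hshift (hlim1 i) fun n => hmm (φ n) i
  have hlim2' : ∀ i j, Tendsto (fun n => S' (φ n) i j) atTop (𝓝 (a.2 i j)) := fun i j =>
    hshift (hlim2 i j) fun n => hSS (φ n) i j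
  have hκ' : Tendsto (fun n => κ (φ n)) atTop (𝓝 fun _ => 1) :=
    tendsto_pi_nhds.2 fun i => hshift (tendsto_const_nhds (x := (1 : ℝ))) fun n => hκ (φ n) i
  have hτ' : Tendsto (fun n => τ (φ n)) atTop (𝓝 0) :=
    squeeze_zero (fun n => hτ0 _) (fun n => hτ _) hη
  set S₀ : Matrix ι ι ℝ := Matrix.of a.2
  have hS₀ : S₀.PosSemidef := posSemidef_of_tendsto hlim2 (Eventually.of_forall fun n => hS _)
  have hvec : ∀ {f : ℕ → EuclideanSpace ℝ ι}, (∀ i, Tendsto (fun n => f n i) atTop (𝓝 (a.1 i))) →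
      Tendsto f atTop (𝓝 (WithLp.toLp 2 a.1)) := fun hf =>
    ((PiLp.continuous_toLp 2 (fun _ : ι => ℝ)).tendsto _).comp (tendsto_pi_nhds.2 hf)
  have hmat : ∀ {f : ℕ → Matrix ι ι ℝ}, (∀ i j, Tendsto (fun n => f n i j) atTop (𝓝 (a.2 i j))) →
      Tendsto f atTop (𝓝 S₀) := fun hf =>
    tendsto_pi_nhds.2 fun i => tendsto_pi_nhds.2 fun j => hf i j
  have t1 := tendsto_expExceed s (fun n => hτ0 (φ n)) hτ' hκ' (hvec hlim1') (hmat hlim2')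
    (fun n => hS' _) hS₀
  have t2 := tendsto_expExceed (τ := fun _ => 0) (κ := fun _ _ => 1) 0 (fun n => le_rfl)
    tendsto_const_nhds tendsto_const_nhds (hvec hlim1) (hmat hlim2) (fun n => hS _) hS₀
  have hfin : ∀ s, expExceed 0 s (fun _ => 1) (WithLp.toLp 2 a.1) S₀ ≠ ∞ := fun s =>
    (expExceed_lt_top le_rfl hS₀ fun _ => by norm_num).ne
  have t3 := ((ENNReal.tendsto_toReal (hfin s)).comp t1).sub
    (((ENNReal.tendsto_toReal (hfin 0)).comp t2).const_mul (Real.exp (-s)))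
  rw [expExceed_shift s, ENNReal.toReal_mul, ENNReal.toReal_ofReal (Real.exp_pos _).le,
    sub_self] at t3
  have t4 := (t3.abs).eventually (gt_mem_nhds (by simpa using hε))
  obtain ⟨n, hn⟩ := t4.exists
  exact absurd hn (not_lt.2 (hbad (φ n)).le)

/-! ### Conditioning on one value; the local limit theorem for finitely many points. -/

lemma gaussianPDF_shifted_eq {c : ℝ} (hc : 0 < c) (y : ℝ) :
    gaussianPDF (c ^ 2) (c ^ 2).toNNReal y =
      ENNReal.ofReal (gaussTail c) * ENNReal.ofReal (Real.exp (y - (c ^ 2)⁻¹ * y ^ 2 / 2)) := by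
  simp only [gaussianPDF]
  rw [← ENNReal.ofReal_mul (gaussTail_pos hc).le, gaussianPDFReal, gaussTail,
    mul_assoc (Real.sqrt _)⁻¹, ← Real.exp_add, Real.coe_toNNReal _ (sq_nonneg c)]
  -- Expanding `(y - c²)² / (2c²) = c²/2 - y + y²/(2c²)` makes `ψ(c)` an exact factor.
  congr 3
  field_simp
  ring

namespace UnitGaussianField

variable {T Ω : Type*} [TopologicalSpace T] [MeasurableSpace Ω] {P : Measure Ω}
  {X : T → Ω → ℝ} {U : Set T}

/-- Exceedance probabilities of a finite part of the field, by conditioning on its value at one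
point `t`. -/
theorem measure_exists_gt (h : UnitGaussianField P X U) {t : T} (ht : t ∈ U) {ι : Type*}
    [Fintype ι] [DecidableEq ι] {p : ι → T} (hp : ∀ i, p i ∈ U) {c : ℝ} (hc : 0 < c) (s : ℝ) :
    ∃ (m : EuclideanSpace ℝ ι) (S : Matrix ι ι ℝ), S.PosSemidef ∧
      (∀ i, m i = -vario P X c t (p i) / 2) ∧
      (∀ i j, S i j = (vario P X c t (p i) + vario P X c t (p j) - vario P X c (p i) (p j)) / 2 -
        vario P X c t (p i) * vario P X c t (p j) / (4 * c ^ 2)) ∧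
      P {ω | ∃ i, c + s / c < X (p i) ω} = ENNReal.ofReal (gaussTail c) *
        expExceed (c ^ 2)⁻¹ s (fun i => corr P X t (p i)) m S := by
  have hP := h.isProbabilityMeasure
  set κ : ι → ℝ := fun i => corr P X t (p i) with hκ
  -- `V i` is `c X(p i)` minus its projection on `X t`, recentred so that `V i - κ i Y = c X(p i) -
  -- c²`. Exceedance of `c + s/c` then reads `V i > s + κ i Y`.
  set V : ι → Ω → ℝ := fun i ω => c * X (p i) ω - c * κ i * X t ω - vario P X c t (p i) / 2 with hV
  set m : EuclideanSpace ℝ ι := WithLp.toLp 2 fun i => -vario P X c t (p i) / 2 with hm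
  set S : Matrix ι ι ℝ := fun i j => (vario P X c t (p i) + vario P X c t (p j) -
    vario P X c (p i) (p j)) / 2 - vario P X c t (p i) * vario P X c t (p j) / (4 * c ^ 2) with hS
  set Y : Ω → ℝ := fun ω => c ^ 2 - c * X t ω with hY
  -- the joint Gaussian family
  set q : Option ι → U := fun o => o.elim ⟨t, ht⟩ fun i => ⟨p i, hp i⟩
  set coef : Unit ⊕ ι → Option ι → ℝ := fun o o' => Sum.elim (fun _ => if o' = none then -c else 0)
    (fun i => if o' = none then -(c * κ i) else if o' = some i then c else 0) o with hcoef
  have hproc := IsGaussianProcess.sum_mul h.isGaussian q coef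
  have hYeq : ∀ ω, ∑ o, coef (Sum.inl ()) o * X (q o) ω = -(c * X t ω) := by
    intro ω
    simp [coef, q]
  have hVeq : ∀ i ω, ∑ o, coef (Sum.inr i) o * X (q o) ω = c * X (p i) ω - c * κ i * X t ω := by
    intro i ω
    simp [coef, q, Fintype.sum_option]
    ring
  have hjoint0 := (hproc.hasGaussianLaw Finset.univ).map_fun
    ((ContinuousLinearMap.pi fun _ : Unit => ContinuousLinearMap.proj
        (⟨Sum.inl (), Finset.mem_univ _⟩ : (Finset.univ : Finset (Unit ⊕ ι)))).prod
      (ContinuousLinearMap.pi fun i : ι => ContinuousLinearMap.proj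
        (⟨Sum.inr i, Finset.mem_univ _⟩ : (Finset.univ : Finset (Unit ⊕ ι)))) :
      (↥(Finset.univ : Finset (Unit ⊕ ι)) → ℝ) →L[ℝ] (Unit → ℝ) × (ι → ℝ))
  have hjoint : HasGaussianLaw (fun ω => ((fun _ : Unit => -(c * X t ω)),
      fun i => c * X (p i) ω - c * κ i * X t ω)) P := by
    refine hjoint0.congr (ae_of_all _ fun ω => ?_)
    refine Prod.ext (funext fun u => ?_) (funext fun i => ?_)
    · exact hYeq ω
    · exact hVeq i ω
  have hLt := h.memLp ht
  have hLp := fun i => h.memLp (hp i)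
  have hcovX : ∀ a ∈ U, ∀ b ∈ U, covariance (X a) (X b) P = corr P X a b := by
    intro a ha b hb
    rw [covariance_eq_sub (h.memLp ha) (h.memLp hb), h.mean a ha, h.mean b hb]
    simp [corr]
  have hZL : ∀ i, MemLp (fun ω => c * X (p i) ω - c * κ i * X t ω) 2 P := fun i =>
    ((hLp i).const_mul c).sub (hLt.const_mul _)
  have hcov0 : ∀ i, covariance (fun ω => -(c * X t ω))
      (fun ω => c * X (p i) ω - c * κ i * X t ω) P = 0 := by
    intro i
    rw [covariance_fun_neg_left, covariance_fun_sub_right (hLt.const_mul c) ((hLp i).const_mul c)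
      (hLt.const_mul _)]
    simp only [covariance_const_mul_left, covariance_const_mul_right,
      hcovX t ht _ (hp i), hcovX t ht t ht, h.corr_self ht, hκ]
    ring
  -- For jointly Gaussian families vanishing covariance is independence.
  have hindep0 := hjoint.indepFun_of_covariance_eval (fun _ i => hcov0 i)
  have hindep : IndepFun Y (fun ω => WithLp.toLp 2 (fun i => V i ω)) P := by
    have := hindep0.comp (φ := fun f : Unit → ℝ => c ^ 2 + f ())
      (ψ := fun g : ι → ℝ => WithLp.toLp 2 (fun i => g i - vario P X c t (p i) / 2))
      (by fun_prop) (by fun_prop)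
    exact this
  have hcovV : ∀ i j, covariance (V i) (V j) P = S i j := by
    intro i j
    simp only [hV]
    rw [covariance_sub_const_left ((hZL i).integrable (by norm_num)), covariance_sub_const_right ((hZL j).integrable (by norm_num)),
      covariance_fun_sub_fun_sub ((hLp i).const_mul c) (hLt.const_mul _) ((hLp j).const_mul c)
        (hLt.const_mul _)]
    simp only [covariance_const_mul_left, covariance_const_mul_right,
      hcovX _ (hp i) _ (hp j), hcovX t ht t ht, hcovX _ (hp i) t ht, hcovX t ht _ (hp j),
      h.corr_self ht, hκ, hS, vario, corr_comm P X (p i) t]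
    field_simp
    ring
  have hVlaw : HasGaussianLaw (fun ω i => V i ω) P := by
    have h1 := hjoint.snd
    have h2 := h1.isGaussian_map
    constructor
    have e : P.map (fun ω i => V i ω) = (P.map fun ω i => c * X (p i) ω - c * κ i * X t ω).map
        (fun x => x - fun i => vario P X c t (p i) / 2) := by
      rw [AEMeasurable.map_map_of_aemeasurable (by fun_prop) h1.aemeasurable]
      rfl
    rw [e]
    infer_instance
  have hpos : S.PosSemidef := covariance_matrix_posSemidef
    (fun i => (hZL i).sub (memLp_const _)) hcovV
  have hmean : ∀ i, ∫ ω, V i ω ∂P = m i := by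
    intro i
    have h1 : ∫ ω, (c * X (p i) ω - c * κ i * X t ω) ∂P = 0 := by
      rw [integral_sub (((hLp i).integrable (by norm_num)).const_mul c)
        ((hLt.integrable (by norm_num)).const_mul _), integral_const_mul, integral_const_mul,
        h.mean _ (hp i), h.mean t ht]
      ring
    simp only [hV]
    rw [integral_sub ((hZL i).integrable (by norm_num)) (integrable_const _), h1]
    simp [hm]
    ring
  have hmapV := _root_.HasGaussianLaw.map_toLp_eq hVlaw hmean hcovV hpos
  have hmapY : P.map Y = gaussianReal (c ^ 2) (c ^ 2).toNNReal := by
    have h1 : HasLaw (X t) (gaussianReal 0 1) P := by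
      have hl := h.hasGaussianLaw ht
      refine ⟨hl.aemeasurable, ?_⟩
      rw [hl.map_eq_gaussianReal, h.mean t ht, variance_of_integral_eq_zero hl.aemeasurable
        (h.mean t ht), h.sq t ht]
      simp
    have h2 := (gaussianReal_const_sub (gaussianReal_const_mul h1 c) (c ^ 2)).map_eq
    rw [Real.toNNReal_of_nonneg (sq_nonneg c)]
    simp only [mul_zero, sub_zero, mul_one] at h2
    exact h2
  refine ⟨m, S, hpos, fun i => rfl, fun i j => rfl, ?_⟩
  have hev : {ω | ∃ i, c + s / c < X (p i) ω} =
      (fun ω => (Y ω, WithLp.toLp 2 (fun i => V i ω))) ⁻¹'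
        {z : ℝ × EuclideanSpace ℝ ι | ∃ i, s + κ i * z.1 < z.2 i} := by
    ext ω
    simp only [Set.mem_ofPred_eq, Set.mem_preimage]
    refine exists_congr fun i => ?_
    have e : V i ω - κ i * Y ω = c * X (p i) ω - c ^ 2 := by
      simp only [hV, hY, vario]
      ring
    have e2 : c + s / c < X (p i) ω ↔ c ^ 2 + s < c * X (p i) ω := by
      rw [← mul_lt_mul_iff_right₀ hc]
      field_simp
    rw [e2]
    constructor <;> intro <;> linarith
  have hmeas : MeasurableSet {z : ℝ × EuclideanSpace ℝ ι | ∃ i, s + κ i * z.1 < z.2 i} := by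
    have e : {z : ℝ × EuclideanSpace ℝ ι | ∃ i, s + κ i * z.1 < z.2 i} =
        ⋃ i, {z | s + κ i * z.1 < z.2 i} := by ext z; simp
    rw [e]
    exact MeasurableSet.iUnion fun i => measurableSet_lt (by fun_prop) (by fun_prop)
  have hYm : AEMeasurable Y P := (hLt.1.aemeasurable.const_mul c).const_sub _
  have hVm : AEMeasurable (fun ω => WithLp.toLp 2 (fun i => V i ω)) P :=
    (hVlaw.toLp_pi 2).aemeasurable
  rw [hev, ← Measure.map_apply_of_aemeasurable (hYm.prodMk hVm) hmeas,
    (indepFun_iff_map_prod_eq_prod_map_map hYm hVm).1 hindep, hmapY, hmapV,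
    Measure.prod_apply hmeas, gaussianReal_of_var_ne_zero, lintegral_withDensity_eq_lintegral_mul,
    expExceed, ← lintegral_const_mul]
  · refine lintegral_congr fun y => ?_
    rw [Pi.mul_apply, gaussianPDF_shifted_eq hc, mul_assoc]
    rfl
  · exact Measurable.mul (by fun_prop) (measurable_multivariateGaussian_exists_lt _ _ _ _)
  · exact measurable_gaussianPDF _ _
  · exact measurable_multivariateGaussian_exists_lt _ _ _ _
  · intro h0
    have := congrArg NNReal.toReal h0
    simp at this
    exact hc.ne' this

end UnitGaussianField

/-- Means of the tangent field at finitely many points. -/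
noncomputable def tangentMean {d : ℕ} {ι : Type*} (α : ℝ) (ρ : EuclideanSpace ℝ (Fin d) → ℝ)
    (u : ι → EuclideanSpace ℝ (Fin d)) : EuclideanSpace ℝ ι :=
  WithLp.toLp 2 fun i => -(homog α ρ (u i)) / 2

/-- Covariances of the tangent field at finitely many points. -/
noncomputable def tangentCov {d : ℕ} {ι : Type*} (α : ℝ) (ρ : EuclideanSpace ℝ (Fin d) → ℝ)
    (u : ι → EuclideanSpace ℝ (Fin d)) : Matrix ι ι ℝ :=
  fun i j => (homog α ρ (u i) + homog α ρ (u j) - homog α ρ (u i - u j)) / 2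

/-- `E exp (max_i W(u i))`, for the tangent field `W`. -/
noncomputable def pick {d : ℕ} {ι : Type*} [Fintype ι] [DecidableEq ι] (α : ℝ)
    (ρ : EuclideanSpace ℝ (Fin d) → ℝ) (u : ι → EuclideanSpace ℝ (Fin d)) : ℝ≥0∞ :=
  expExceed 0 0 (fun _ => 1) (tangentMean α ρ u) (tangentCov α ρ u)

lemma homog_zero {d : ℕ} {α : ℝ} (hα : 0 < α) (ρ : EuclideanSpace ℝ (Fin d) → ℝ) :
    homog α ρ 0 = 0 := by
  simp [homog, Real.zero_rpow hα.ne']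

namespace LocallyStationaryField

variable {d : ℕ} {Ω : Type*} [MeasurableSpace Ω] {P : Measure Ω}
  {D : Set (EuclideanSpace ℝ (Fin d))} {δ : ℝ} {X : EuclideanSpace ℝ (Fin d) → Ω → ℝ} {α : ℝ}
  {L : ℝ → ℝ} {r : EuclideanSpace ℝ (Fin d) → EuclideanSpace ℝ (Fin d) → ℝ}

lemma exists_homog_le (h : LocallyStationaryField P D δ X α L r)
    (u : EuclideanSpace ℝ (Fin d)) : ∃ R, ∀ t ∈ D, |homog α (r t) u| ≤ R := by
  obtain ⟨M, hM0, hM⟩ := h.exists_bound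
  refine ⟨‖u‖ ^ α * M, fun t ht => ?_⟩
  have htU : t ∈ Metric.thickening δ D := mem_of_dist_lt ht (by simpa using h.delta_pos)
  rcases eq_or_ne u 0 with rfl | hu
  · rw [homog_zero h.alpha_pos]
    simp [Real.zero_rpow h.alpha_pos.ne']
  · have hdir := dir_mem_sphere hu
    rw [homog, abs_of_nonneg (mul_nonneg (by positivity) (h.r_pos t htU _ hdir).le)]
    gcongr
    exact hM t htU _ hdir

lemma homog_nonneg (h : LocallyStationaryField P D δ X α L r) {t : EuclideanSpace ℝ (Fin d)}
    (ht : t ∈ D) (u : EuclideanSpace ℝ (Fin d)) : 0 ≤ homog α (r t) u := by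
  have htU : t ∈ Metric.thickening δ D := mem_of_dist_lt ht (by simpa using h.delta_pos)
  rcases eq_or_ne u 0 with rfl | hu
  · rw [homog_zero h.alpha_pos]
  · exact mul_nonneg (by positivity) (h.r_pos t htU _ (dir_mem_sphere hu)).le

/-- Exceedances over finite sets of points at scale `Δ`: the prelimit mean and covariance are close
to those of the tangent field. -/
lemma exists_measure_eq_expExceed (h : LocallyStationaryField P D δ X α L r) {ι : Type*}
    [Fintype ι] [DecidableEq ι] (u : ι → EuclideanSpace ℝ (Fin d)) (s : ℝ) {ε : ℝ} (hε : 0 < ε) :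
    ∃ η > 0, ∀ᶠ c in atTop, ∀ t ∈ D, ∀ t', dist t' t < η →
      ∃ (κ : ι → ℝ) (m : EuclideanSpace ℝ ι) (S : Matrix ι ι ℝ), S.PosSemidef ∧
        0 ≤ (c ^ 2)⁻¹ ∧ (c ^ 2)⁻¹ ≤ ε ∧ (∀ i, |κ i - 1| ≤ ε) ∧
        (∀ i, |m i - tangentMean α (r t) u i| ≤ ε) ∧
        (∀ i j, |S i j - tangentCov α (r t) u i j| ≤ ε) ∧
        P {ω | ∃ i, c + s / c < X (t' + scale α L c • u i) ω} =
          ENNReal.ofReal (gaussTail c) * expExceed (c ^ 2)⁻¹ s κ m S := by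
  choose R hR using fun i => h.exists_homog_le (u i)
  have hε2 : 0 < ε / 2 := half_pos hε
  -- A covariance entry collects half of three variogram errors and one product term, at most `3ε/8
  -- + ε/4`. The cap `1` keeps the variograms below `R i + 1`, so that the product term divided by
  -- `c²` vanishes uniformly.
  set e := min (ε / 4) 1 with he
  have he0 : 0 < e := by positivity
  choose η₁ hη₁ hv₁ using fun i => h.tendsto_vario 0 (u i) he0
  choose η₂ hη₂ hv₂ using fun i : ι × ι => h.tendsto_vario (u i.1) (u i.2) he0
  choose η₃ hη₃ hv₃ using fun i => h.tendsto_vario (u i) 0 he0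
  obtain ⟨η, hη, hle⟩ : ∃ η > 0, (∀ i, η ≤ η₁ i) ∧ (∀ i, η ≤ η₂ i) ∧ (∀ i, η ≤ η₃ i) ∧ η ≤ δ := by
    have key : ∀ {κ : Type _} [Finite κ] (f : κ → ℝ), (∀ k, 0 < f k) → ∃ η > 0, ∀ k, η ≤ f k := by
      intro κ _ f hf
      rcases isEmpty_or_nonempty κ with hκ | hκ
      · exact ⟨1, one_pos, fun k => isEmptyElim k⟩
      · obtain ⟨k, hk⟩ := Finite.exists_min f
        exact ⟨f k, hf k, hk⟩
    obtain ⟨a, ha, ha'⟩ := key η₁ hη₁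
    obtain ⟨b, hb, hb'⟩ := key η₂ hη₂
    obtain ⟨c, hc, hc'⟩ := key η₃ hη₃
    have := h.delta_pos
    exact ⟨min (min a b) (min c δ), by positivity,
      fun i => ((min_le_left _ _).trans (min_le_left _ _)).trans (ha' i),
      fun i => ((min_le_left _ _).trans (min_le_right _ _)).trans (hb' i),
      fun i => ((min_le_right _ _).trans (min_le_left _ _)).trans (hc' i),
      (min_le_right _ _).trans (min_le_right _ _)⟩
  refine ⟨η, hη, ?_⟩
  have hsmall : ∀ B : ℝ, ∀ᶠ c : ℝ in atTop, B * (c ^ 2)⁻¹ ≤ ε / 4 := by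
    intro B
    have : Tendsto (fun c : ℝ => B * (c ^ 2)⁻¹) atTop (𝓝 (B * 0)) :=
      ((tendsto_pow_atTop two_ne_zero).inv_tendsto_atTop).const_mul B
    rw [mul_zero] at this
    exact this.eventually (ge_mem_nhds (by positivity))
  filter_upwards [eventually_all.2 hv₁, eventually_all.2 hv₂, eventually_all.2 hv₃,
    eventually_gt_atTop 0, hsmall 1, eventually_all.2 fun i => hsmall (R i + 1),
    eventually_all.2 fun i : ι × ι => hsmall ((R i.1 + 1) * (R i.2 + 1))]
    with c h1 h2 h3 hc hs1 hs2 hs3 t ht t' htt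
  have ht' : t' ∈ Metric.thickening δ D := mem_of_dist_lt ht (htt.trans_le hle.2.2.2)
  have k1 := fun i => h1 i t ht t' (htt.trans_le (hle.1 i))
  have k2 := fun i => h2 i t ht t' (htt.trans_le (hle.2.1 i))
  have k3 := fun i => h3 i t ht t' (htt.trans_le (hle.2.2.1 i))
  simp only [smul_zero, add_zero, zero_sub, sub_zero] at k1 k3
  have hp : ∀ i, t' + scale α L c • u i ∈ Metric.thickening δ D := fun i => (k3 i).1
  obtain ⟨m, S, hpos, hm, hS, hP⟩ := h.field.measure_exists_gt ht' hp hc s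
  have hv : ∀ i, |vario P X c t' (t' + scale α L c • u i) - homog α (r t) (u i)| ≤ e := by
    intro i
    rw [vario_comm]
    exact (k3 i).2.2
  have hv0 : ∀ i, 0 ≤ vario P X c t' (t' + scale α L c • u i) := fun i =>
    h.field.vario_nonneg c ht' (hp i)
  have hvR : ∀ i, vario P X c t' (t' + scale α L c • u i) ≤ R i + 1 := by
    intro i
    have a1 := (abs_le.1 (hv i)).2
    have a2 := (abs_le.1 (hR i t ht)).2
    have a3 : e ≤ 1 := min_le_right _ _
    linarith
  have he4 : e ≤ ε / 4 := min_le_left _ _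
  have hc2 : 0 < c ^ 2 := by positivity
  refine ⟨_, m, S, hpos, by positivity, by linarith, fun i => ?_, fun i => ?_, fun i j => ?_, hP⟩
  · have e1 : corr P X t' (t' + scale α L c • u i) - 1 =
        -(vario P X c t' (t' + scale α L c • u i) * (c ^ 2)⁻¹ / 2) := by
      rw [vario]; field_simp; ring
    rw [e1, abs_neg, abs_of_nonneg (by have := hv0 i; positivity)]
    have := mul_le_mul_of_nonneg_right (hvR i) (inv_pos.2 hc2).le
    linarith [hs2 i]
  · rw [hm i, tangentMean]
    have := abs_le.1 (hv i)
    rw [abs_le]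
    constructor <;> simp only <;> linarith
  · rw [hS i j, tangentCov]
    have a1 := abs_le.1 (hv i)
    have a2 := abs_le.1 (hv j)
    have a3 := abs_le.1 (k2 (i, j)).2.2
    have a4 : vario P X c t' (t' + scale α L c • u i) * vario P X c t' (t' + scale α L c • u j) /
        (4 * c ^ 2) ≤ ε / 4 := by
      have b1 := mul_le_mul (hvR i) (hvR j) (hv0 j) ((hv0 i).trans (hvR i))
      have b2 := mul_le_mul_of_nonneg_right b1 (inv_pos.2 hc2).le
      have b3 : 0 ≤ vario P X c t' (t' + scale α L c • u i) *
        vario P X c t' (t' + scale α L c • u j) * (c ^ 2)⁻¹ :=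
        mul_nonneg (mul_nonneg (hv0 i) (hv0 j)) (inv_pos.2 hc2).le
      have b4 := hs3 (i, j)
      rw [div_eq_mul_inv, mul_inv]
      simp only at b4
      nlinarith
    have a5 : 0 ≤ vario P X c t' (t' + scale α L c • u i) *
        vario P X c t' (t' + scale α L c • u j) / (4 * c ^ 2) :=
      div_nonneg (mul_nonneg (hv0 i) (hv0 j)) (by positivity)
    simp only at a3
    rw [abs_le]
    constructor <;> linarith

/-- The matrix is a limit of covariance matrices of genuine Gaussian vectors built from `X`, so the
form of `homog` need not be analysed. -/
lemma tangentCov_posSemidef (h : LocallyStationaryField P D δ X α L r) {ι : Type*}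
    [Fintype ι] [DecidableEq ι] (u : ι → EuclideanSpace ℝ (Fin d)) {t : EuclideanSpace ℝ (Fin d)}
    (ht : t ∈ D) : (tangentCov α (r t) u).PosSemidef := by
  have key : ∀ n : ℕ, ∃ S : Matrix ι ι ℝ, S.PosSemidef ∧
      ∀ i j, |S i j - tangentCov α (r t) u i j| ≤ 1 / ((n : ℝ) + 1) := by
    intro n
    obtain ⟨η, hη, hev⟩ := h.exists_measure_eq_expExceed u 0 (Nat.one_div_pos_of_nat (n := n))
    obtain ⟨c, hc⟩ := hev.exists
    obtain ⟨κ, m, S, hS, -, -, -, -, hSS, -⟩ := hc t ht t (by simpa using hη)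
    exact ⟨S, hS, hSS⟩
  choose S hS hSS using key
  refine posSemidef_of_tendsto (l := atTop) (fun i j => ?_) (Eventually.of_forall hS)
  have h0 : Tendsto (fun n => S n i j - tangentCov α (r t) u i j) atTop (𝓝 0) :=
    squeeze_zero_norm (fun n => hSS n i j) (tendsto_one_div_add_atTop_nhds_zero_nat (𝕜 := ℝ))
  simpa using h0.add_const (tangentCov α (r t) u i j)

lemma pick_ne_top (h : LocallyStationaryField P D δ X α L r) {ι : Type*}
    [Fintype ι] [DecidableEq ι] (u : ι → EuclideanSpace ℝ (Fin d)) {t : EuclideanSpace ℝ (Fin d)}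
    (ht : t ∈ D) : pick α (r t) u ≠ ∞ :=
  (expExceed_lt_top le_rfl (h.tangentCov_posSemidef u ht) fun _ => by norm_num).ne

/-- The local limit theorem for finitely many points. -/
theorem measure_finite_exceed (h : LocallyStationaryField P D δ X α L r) {ι : Type*}
    [Fintype ι] [DecidableEq ι] (u : ι → EuclideanSpace ℝ (Fin d)) (s : ℝ) {ε : ℝ} (hε : 0 < ε) :
    ∃ η > 0, ∀ᶠ c in atTop, ∀ t ∈ D, ∀ t', dist t' t < η →
      |P.real {ω | ∃ i, c + s / c < X (t' + scale α L c • u i) ω} -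
        gaussTail c * (Real.exp (-s) * (pick α (r t) u).toReal)| ≤ ε * gaussTail c := by
  choose R hR using fun i => h.exists_homog_le (u i)
  choose R' hR' using fun i : ι × ι => h.exists_homog_le (u i.1 - u i.2)
  set B := ∑ i, |R i| + ∑ i, |R' i| with hB
  have hRB : ∀ i, |R i| ≤ ∑ i, |R i| := fun i =>
    Finset.single_le_sum (f := fun i => |R i|) (fun _ _ => abs_nonneg _) (Finset.mem_univ i)
  have hRB' : ∀ i, |R' i| ≤ ∑ i, |R' i| := fun i =>
    Finset.single_le_sum (f := fun i => |R' i|) (fun _ _ => abs_nonneg _) (Finset.mem_univ i)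
  have hs1 : 0 ≤ ∑ i, |R i| := Finset.sum_nonneg fun _ _ => abs_nonneg _
  have hs2 : 0 ≤ ∑ i, |R' i| := Finset.sum_nonneg fun _ _ => abs_nonneg _
  obtain ⟨η', hη', hclose⟩ := exists_expExceed_close ι (2 * B) s hε
  obtain ⟨η, hη, hev⟩ := h.exists_measure_eq_expExceed u s hη'
  refine ⟨η, hη, ?_⟩
  filter_upwards [hev, eventually_gt_atTop 0] with c hc hc0 t ht t' htt
  obtain ⟨κ, m, S, hS, hτ0, hτ, hκ, hm, hSS, hP⟩ := hc t ht t' htt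
  have hψ := gaussTail_pos hc0
  have hb1 : ∀ i, |homog α (r t) (u i)| ≤ B := fun i => by
    linarith [hR i t ht, le_abs_self (R i), hRB i]
  have hb2 : ∀ i j, |homog α (r t) (u i - u j)| ≤ B := fun i j => by
    linarith [hR' (i, j) t ht, le_abs_self (R' (i, j)), hRB' (i, j)]
  have key := hclose _ κ (tangentMean α (r t) u) m (tangentCov α (r t) u) S hτ0 hτ hκ
    (h.tangentCov_posSemidef u ht) hS (fun i => ?_) (fun i j => ?_) hm hSS
  · rw [Measure.real, hP, ENNReal.toReal_mul, ENNReal.toReal_ofReal hψ.le, ← mul_sub, abs_mul,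
      abs_of_pos hψ, mul_comm]
    gcongr
    exact key
  · have := abs_le.1 (hb1 i)
    rw [tangentMean, abs_le]
    constructor <;> simp only <;> linarith
  · have a1 := abs_le.1 (hb1 i)
    have a2 := abs_le.1 (hb1 j)
    have a3 := abs_le.1 (hb2 i j)
    rw [tangentCov, abs_le]
    constructor <;> linarith

end LocallyStationaryField

/-! ### The local limit theorem for cubes of side `K Δ`. -/

/-- The grid of mesh `K / 2 ^ k` in the cube `[0, K)^d`. -/
noncomputable def dyadicGrid (d : ℕ) (K : ℝ) (k : ℕ) (n : Fin d → Fin (2 ^ k)) :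
    EuclideanSpace ℝ (Fin d) := gridPoint 0 (K / (2 ^ k : ℕ)) fun i => n i

/-- `E exp (sup_{u ∈ [0, K]^d} W(u))`, for the tangent field `W`. -/
noncomputable def pickCube {d : ℕ} (α : ℝ) (ρ : EuclideanSpace ℝ (Fin d) → ℝ) (K : ℝ) : ℝ≥0∞ :=
  ⨆ k : ℕ, pick α ρ (dyadicGrid d K k)

lemma add_smul_gridPoint {d : ℕ} (t : EuclideanSpace ℝ (Fin d)) (Δ ζ : ℝ) (N : ℕ)
    (n : Fin d → ℕ) :
    t + Δ • gridPoint 0 (ζ / N) n = gridPoint t (ζ * Δ / N) n := by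
  ext i
  simp
  ring

namespace LocallyStationaryField

variable {d : ℕ} {Ω : Type*} [MeasurableSpace Ω] {P : Measure Ω}
  {D : Set (EuclideanSpace ℝ (Fin d))} {δ : ℝ} {X : EuclideanSpace ℝ (Fin d) → Ω → ℝ} {α : ℝ}
  {L : ℝ → ℝ} {r : EuclideanSpace ℝ (Fin d) → EuclideanSpace ℝ (Fin d) → ℝ}

lemma cube_subset_thickening {D : Set (EuclideanSpace ℝ (Fin d))} {δ η ζ : ℝ}
    {t t' : EuclideanSpace ℝ (Fin d)} (ht : t ∈ D) (htt : dist t' t < η) (hζ : 0 < ζ)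
    (hsum : η + √d * ζ ≤ δ) : cube t' ζ ⊆ Metric.thickening δ D := by
  intro u hu
  refine mem_of_dist_lt ht ?_
  have h1 := dist_le_of_mem_cube hζ.le hu (base_mem_cube t' hζ)
  rw [← dist_eq_norm] at h1
  linarith [dist_triangle u t' t]

lemma eventually_mul_scale_le (h : LocallyStationaryField P D δ X α L r) (K : ℝ) {ε : ℝ}
    (hε : 0 < ε) : ∀ᶠ c in atTop, K * scale α L c ≤ ε := by
  have h0 : Tendsto (fun c => K * scale α L c) atTop (𝓝 0) := by
    simpa using h.tendsto_scale.const_mul K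
  exact h0.eventually (ge_mem_nhds hε)

/-- A crossing of `c` missed by the grid at the lowered level `c - s/c` happens in a cell whose base
value lies below that level. There are `(K/a)^d` cells of side `a Δ`, each contributing `O(a^{d+1}
ψ(c))`, so a fine grid misses little. -/
lemma exists_grid_approx (h : LocallyStationaryField P D δ X α L r) {K s ε : ℝ} (hK : 0 < K)
    (hs : 0 < s) (hε : 0 < ε) :
    ∃ k : ℕ, ∀ᶠ c in atTop, ∀ t', cube t' (K * scale α L c) ⊆ Metric.thickening δ D →
      P.real {ω | ∃ u ∈ cube t' (K * scale α L c), c < X u ω} ≤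
        P.real {ω | ∃ n, c + -s / c < X (t' + scale α L c • dyadicGrid d K k n) ω} +
          ε * gaussTail c := by
  have hP := h.field.isProbabilityMeasure
  set β := α / 2 with hβd
  have hβ : 0 < β := half_pos h.alpha_pos
  obtain ⟨b₀, hb₀, hcell⟩ := UnitGaussianField.exists_measure_cell_le d hβ
  obtain ⟨m₀, hm₀⟩ := exists_two_pow_mul_le_half d hβ
  -- The cell estimate gains `Lam^{-m}`, where `Lam` is of order `a^{-β/2}`. The choice `m β/2 ≥ d +
  -- 1` turns this into `a^{d+1}`.
  obtain ⟨m₁, hm₁⟩ := exists_nat_ge ((d + 1) / (β / 2))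
  set m := max m₀ m₁
  have hmβ : (d + 1 : ℝ) ≤ β / 2 * m := by
    rw [div_le_iff₀ (by positivity)] at hm₁
    have : (m₁ : ℝ) ≤ m := by exact_mod_cast le_max_right _ _
    nlinarith
  obtain ⟨C, hC, hcell⟩ := hcell m (hm₀ m (le_max_left _ _))
  obtain ⟨C₀, hC₀, hcb⟩ := h.exists_cellBound
  -- the constant in `Lam = A * a ^ (-β / 2)`
  set A := √(b₀ / C₀) with hA
  have hA0 : 0 < A := by positivity
  set E := C * ((A * s) ^ m)⁻¹ * K ^ d with hE
  have hE0 : 0 < E := by positivity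
  have ht : Tendsto (fun k : ℕ => K / (2 ^ k : ℕ)) atTop (𝓝 0) := by
    have := (tendsto_pow_atTop_nhds_zero_of_lt_one (r := (1 / 2 : ℝ)) (by norm_num)
      (by norm_num)).const_mul K
    rw [mul_zero] at this
    refine this.congr fun k => ?_
    push_cast
    rw [one_div, inv_pow, div_eq_mul_inv]
  have hbig : Tendsto (fun k : ℕ => A * (K / (2 ^ k : ℕ)) ^ (-(β / 2))) atTop atTop := by
    refine Tendsto.const_mul_atTop hA0 ?_
    refine (tendsto_rpow_neg_nhdsGT_zero (by linarith : -(β / 2) < 0)).comp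
      (tendsto_nhdsWithin_iff.2 ⟨ht, Eventually.of_forall fun k => ?_⟩)
    simp only [Set.mem_Ioi]
    positivity
  have hsmall : Tendsto (fun k : ℕ => E * (K / (2 ^ k : ℕ))) atTop (𝓝 0) := by
    simpa using ht.const_mul E
  obtain ⟨k, hk1, hk2, hk3⟩ := ((ht.eventually (ge_mem_nhds one_pos)).and
    ((hbig.eventually_ge_atTop 4).and (hsmall.eventually (ge_mem_nhds hε)))).exists
  refine ⟨k, ?_⟩
  filter_upwards [hcb, eventually_scale_pos h.isLeast, eventually_ge_atTop 1] with c hcb hΔ hc t' hsub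
  set Δ := scale α L c with hΔd
  set N : ℕ := 2 ^ k with hN
  have hN0 : (0 : ℝ) < N := by positivity
  set a := K / N with ha
  have ha0 : 0 < a := by positivity
  have hc0 : 0 < c := by linarith
  have hψ := gaussTail_pos hc0
  set g : (Fin d → Fin N) → EuclideanSpace ℝ (Fin d) := fun n => t' + Δ • dyadicGrid d K k n with hg
  have hgeq : ∀ n, g n = gridPoint t' (K * Δ / N) fun i => n i := fun n =>
    add_smul_gridPoint t' Δ K N _
  have hcellsub : ∀ n, cube (g n) (a * Δ) ⊆ cube t' (K * Δ) := by
    intro n u hu i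
    have h1 := hu i
    rw [hgeq, gridPoint_apply] at h1
    have h2 : ((n i : ℕ) : ℝ) + 1 ≤ N := by exact_mod_cast (n i).2
    have h3 : a * Δ = K * Δ / N := by rw [ha]; ring
    have h4 : K * Δ / N * N = K * Δ := by field_simp
    have h5 : 0 < K * Δ / N := by positivity
    rw [h3] at h1
    constructor
    · have : 0 ≤ K * Δ / N * (n i : ℕ) := by positivity
      linarith
    · nlinarith
  -- `Lam` is as large as the cell estimate permits: `Lam² B = b₀` for the Hölder constant `B = C₀
  -- a^β` of the cell.
  have hLam : (A * a ^ (-(β / 2))) ^ 2 * (C₀ * a ^ β) = b₀ := by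
    rw [mul_pow, hA, Real.sq_sqrt (by positivity), ← Real.rpow_natCast (a ^ _), ← Real.rpow_mul ha0.le]
    have : a ^ (-(β / 2) * (2 : ℕ)) * a ^ β = 1 := by
      rw [← Real.rpow_add ha0]
      simp
    calc b₀ / C₀ * a ^ (-(β / 2) * (2 : ℕ)) * (C₀ * a ^ β)
        = b₀ / C₀ * C₀ * (a ^ (-(β / 2) * (2 : ℕ)) * a ^ β) := by ring
      _ = b₀ := by rw [this]; field_simp
  have hbad : ∀ n, P.real {ω | X (g n) ω ≤ c - s / c ∧ ∃ u ∈ cube (g n) (a * Δ), c < X u ω} ≤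
      C * gaussTail c * ((A * s) ^ m)⁻¹ * a ^ (d + 1) := by
    intro n
    have h1 := hcell h.field (t := g n) (ζ := a * Δ) (c := c) (B := C₀ * a ^ β)
      (Lam := A * a ^ (-(β / 2))) (s := s) (by positivity) ((hcellsub n).trans hsub) hc
      (hcb a ha0 hk1 (g n) ((hcellsub n).trans hsub)) (by positivity) hk2 hLam.le hs
    have h2 := ENNReal.toReal_mono ENNReal.ofReal_ne_top h1
    rw [ENNReal.toReal_ofReal (by positivity)] at h2
    refine h2.trans ?_
    have h3 : ((A * a ^ (-(β / 2)) * s) ^ m)⁻¹ ≤ ((A * s) ^ m)⁻¹ * a ^ (d + 1) := by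
      have e1 : A * a ^ (-(β / 2)) * s = (A * s) * a ^ (-(β / 2)) := by ring
      rw [e1, mul_pow, mul_inv]
      gcongr
      rw [← Real.rpow_natCast (a ^ _), ← Real.rpow_mul ha0.le, ← Real.rpow_neg ha0.le,
        ← Real.rpow_natCast a]
      refine Real.rpow_le_rpow_of_exponent_ge ha0 hk1 ?_
      push_cast
      linarith
    have h4 : Real.exp (-s) ≤ 1 := Real.exp_le_one_iff.2 (by linarith)
    calc C * gaussTail c * Real.exp (-s) * ((A * a ^ (-(β / 2)) * s) ^ m)⁻¹
        ≤ C * gaussTail c * 1 * (((A * s) ^ m)⁻¹ * a ^ (d + 1)) := by gcongr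
      _ = _ := by ring
  have hincl : {ω | ∃ u ∈ cube t' (K * Δ), c < X u ω} ⊆
      {ω | ∃ n, c + -s / c < X (g n) ω} ∪
        ⋃ n, {ω | X (g n) ω ≤ c - s / c ∧ ∃ u ∈ cube (g n) (a * Δ), c < X u ω} := by
    rintro ω ⟨u, hu, hcu⟩
    have hKΔ : 0 < K * Δ := by positivity
    set n : Fin d → Fin N := fun i => ⟨gridIndex t' (K * Δ / N) u i,
      gridIndex_lt hKΔ hu (by positivity) i⟩ with hn
    have hmem : u ∈ cube (g n) (a * Δ) := by
      rw [hgeq, show a * Δ = K * Δ / N by rw [ha]; ring]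
      exact gridPoint_gridIndex_le (by positivity) fun i => (hu i).1
    rcases le_or_gt (X (g n) ω) (c - s / c) with hle | hgt
    · exact Or.inr (Set.mem_iUnion.2 ⟨n, hle, u, hmem, hcu⟩)
    · refine Or.inl ⟨n, ?_⟩
      rw [neg_div, ← sub_eq_add_neg]
      exact hgt
  refine (measureReal_mono hincl).trans ((measureReal_union_le _ _).trans ?_)
  refine add_le_add le_rfl ?_
  refine (measureReal_iUnion_fintype_le _).trans ?_
  refine (Finset.sum_le_sum fun n _ => hbad n).trans ?_
  rw [Finset.sum_const, Finset.card_univ, Fintype.card_fun, Fintype.card_fin, Fintype.card_fin,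
    nsmul_eq_mul]
  have e : ((N ^ d : ℕ) : ℝ) * (C * gaussTail c * ((A * s) ^ m)⁻¹ * a ^ (d + 1)) =
      E * a * gaussTail c := by
    have : (N : ℝ) ^ d * a ^ d = K ^ d := by
      rw [← mul_pow, ha]; congr 1; field_simp
    push_cast
    rw [hE, ← this, pow_succ]
    ring
  rw [e]
  gcongr

lemma dyadicGrid_mem {K : ℝ} (hK : 0 < K) (k : ℕ) (n : Fin d → Fin (2 ^ k)) :
    dyadicGrid d K k n ∈ cube (0 : EuclideanSpace ℝ (Fin d)) K :=
  gridPoint_mem_cube 0 hK fun i => (n i).2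

lemma add_smul_mem_cube {t u : EuclideanSpace ℝ (Fin d)} {K Δ : ℝ} (hΔ : 0 < Δ)
    (hu : u ∈ cube (0 : EuclideanSpace ℝ (Fin d)) K) : t + Δ • u ∈ cube t (K * Δ) := by
  intro i
  have h1 := hu i
  simp only [PiLp.zero_apply, zero_add] at h1
  simp only [PiLp.add_apply, PiLp.smul_apply, smul_eq_mul]
  constructor
  · nlinarith
  · nlinarith

/-- The local limit theorem for a cube whose side is of order `Δ`. -/
theorem exists_pickCube_approx (h : LocallyStationaryField P D δ X α L r) {K ε : ℝ} (hK : 0 < K)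
    (hε : 0 < ε) : (∃ B : ℝ, ∀ t ∈ D, pickCube α (r t) K ≤ ENNReal.ofReal B) ∧
    ∃ η > 0, ∀ᶠ c in atTop, ∀ t ∈ D, ∀ t', dist t' t < η →
      |P.real {ω | ∃ u ∈ cube t' (K * scale α L c), c < X u ω} -
        gaussTail c * (pickCube α (r t) K).toReal| ≤ ε * gaussTail c := by
  have hP := h.field.isProbabilityMeasure
  have hδ := h.delta_pos
  have hsubev : ∀ᶠ c in atTop, ∀ t ∈ D, ∀ t', dist t' t < δ / 2 →
      cube t' (K * scale α L c) ⊆ Metric.thickening δ D := by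
    filter_upwards [h.eventually_mul_scale_le (√d * K) (half_pos hδ),
      eventually_scale_pos h.isLeast] with c hc hΔ t ht t' htt
    exact cube_subset_thickening ht htt (by positivity) (by linarith)
  set q : ℕ → EuclideanSpace ℝ (Fin d) → ℝ := fun k t => (pick α (r t) (dyadicGrid d K k)).toReal
    with hq
  -- lower bounds
  have hlow : ∀ k, ∀ ε > 0, ∃ η > 0, ∀ᶠ c in atTop, ∀ t ∈ D, ∀ t', dist t' t < η →
      gaussTail c * (q k t - ε) ≤ P.real {ω | ∃ u ∈ cube t' (K * scale α L c), c < X u ω} := by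
    intro k ε hε
    obtain ⟨η, hη, hev⟩ := h.measure_finite_exceed (dyadicGrid d K k) 0 hε
    refine ⟨η, hη, ?_⟩
    filter_upwards [hev, eventually_scale_pos h.isLeast] with c hc hΔ t ht t' htt
    have h1 := (abs_le.1 (hc t ht t' htt)).1
    simp only [neg_zero, Real.exp_zero, one_mul, zero_div, add_zero] at h1
    have h2 : P.real {ω | ∃ n, c < X (t' + scale α L c • dyadicGrid d K k n) ω} ≤
        P.real {ω | ∃ u ∈ cube t' (K * scale α L c), c < X u ω} := by
      refine measureReal_mono ?_
      rintro ω ⟨n, hn⟩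
      exact ⟨_, add_smul_mem_cube hΔ (dyadicGrid_mem hK k n), hn⟩
    simp only [hq]
    linarith
  -- upper bounds
  have hup : ∀ s > 0, ∀ ε > 0, ∃ k, ∃ η > 0, ∀ᶠ c in atTop, ∀ t ∈ D, ∀ t', dist t' t < η →
      P.real {ω | ∃ u ∈ cube t' (K * scale α L c), c < X u ω} ≤
        gaussTail c * (Real.exp s * q k t + ε) := by
    intro s hs ε hε
    obtain ⟨k, hk⟩ := h.exists_grid_approx hK hs (half_pos hε)
    obtain ⟨η, hη, hev⟩ := h.measure_finite_exceed (dyadicGrid d K k) (-s) (half_pos hε)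
    refine ⟨k, min η (δ / 2), by positivity, ?_⟩
    filter_upwards [hk, hev, hsubev] with c h1 h2 h3 t ht t' htt
    rw [lt_min_iff] at htt
    have h4 := h1 t' (h3 t ht t' htt.2)
    have h5 := (abs_le.1 (h2 t ht t' htt.1)).2
    rw [neg_neg] at h5
    simp only [hq]
    linarith
  -- a uniform bound
  have hfinbd : ∀ k, ∃ B, ∀ t ∈ D, q k t ≤ B := by
    intro k
    obtain ⟨η, hη, hev⟩ := h.measure_finite_exceed (dyadicGrid d K k) 0 one_pos
    obtain ⟨c, hc, hΔ, hc0, hsub⟩ := (hev.and ((eventually_scale_pos h.isLeast).and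
      ((eventually_ge_atTop 2).and hsubev))).exists
    refine ⟨Fintype.card (Fin d → Fin (2 ^ k)) * 4 + 1, fun t ht => ?_⟩
    have h1 := (abs_le.1 (hc t ht t (by simpa using hη))).1
    have hψ := gaussTail_pos (by linarith : 0 < c)
    simp only [neg_zero, Real.exp_zero, one_mul, zero_div, add_zero] at h1
    have h2 : P.real {ω | ∃ n, c < X (t + scale α L c • dyadicGrid d K k n) ω} ≤
        Fintype.card (Fin d → Fin (2 ^ k)) * (4 * gaussTail c) := by
      have e : {ω | ∃ n, c < X (t + scale α L c • dyadicGrid d K k n) ω} =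
        ⋃ n, {ω | c < X (t + scale α L c • dyadicGrid d K k n) ω} := by ext; simp
      rw [e]
      refine (measureReal_iUnion_fintype_le _).trans ?_
      refine (Finset.sum_le_sum (g := fun _ => 4 * gaussTail c) fun n _ => ?_).trans (by simp)
      set p := t + scale α L c • dyadicGrid d K k n
      have hp : p ∈ Metric.thickening δ D := hsub t ht t (by simpa using half_pos hδ)
        (add_smul_mem_cube hΔ (dyadicGrid_mem hK k n))
      have hl := h.field.hasGaussianLaw_comb hp hp hp c 0 0
      have hi := h.field.integral_comb hp hp hp c 0 0
      have hsq := h.field.integral_comb_sq hp hp hp c 0 0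
      have h3 := measure_gaussian_gt_le hl hi (c := c) (w := 0) (b := 0) (by linarith)
        (by rw [hsq]; simp) (by positivity) (by nlinarith)
      have h4 := ENNReal.toReal_mono ENNReal.ofReal_ne_top h3
      rw [ENNReal.toReal_ofReal (by positivity)] at h4
      simp only [zero_mul, add_zero, neg_zero, zero_div, Real.exp_zero, mul_one] at h4
      refine le_trans (le_of_eq ?_) h4
      rw [Measure.real]
      congr 2
      ext ω
      simp only [Set.mem_ofPred_eq]
      rw [sq, mul_lt_mul_iff_right₀ (by linarith)]
    simp only [hq]
    have h5 : gaussTail c * (pick α (r t) (dyadicGrid d K k)).toReal ≤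
      gaussTail c * (Fintype.card (Fin d → Fin (2 ^ k)) * 4 + 1) := by linarith
    exact le_of_mul_le_mul_left h5 hψ
  -- The lower bound from grid `k'` and the upper bound from grid `k` concern the same probability.
  -- Dividing by `ψ(c)` at one suitable `c` gives an inequality between constants, uniform in `t`.
  have hcomp : ∀ s > 0, ∀ ε > 0, ∃ k, ∀ k', ∀ t ∈ D, q k' t ≤ Real.exp s * q k t + ε := by
    intro s hs ε hε
    obtain ⟨k, η, hη, hev⟩ := hup s hs (ε / 2) (half_pos hε)
    refine ⟨k, fun k' t ht => ?_⟩
    obtain ⟨η', hη', hev'⟩ := hlow k' (ε / 2) (half_pos hε)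
    obtain ⟨c, h1, h2, hc⟩ := (hev.and (hev'.and (eventually_gt_atTop 0))).exists
    have h3 := (h2 t ht t (by simpa using hη')).trans (h1 t ht t (by simpa using hη))
    have := le_of_mul_le_mul_left h3 (gaussTail_pos hc)
    linarith
  obtain ⟨B, hB0, hB⟩ : ∃ B : ℝ, 0 < B ∧ ∀ k, ∀ t ∈ D, q k t ≤ B := by
    obtain ⟨k, hk⟩ := hcomp 1 one_pos 1 one_pos
    obtain ⟨B, hB⟩ := hfinbd k
    refine ⟨Real.exp 1 * |B| + 1, by positivity, fun k' t ht => (hk k' t ht).trans ?_⟩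
    gcongr
    exact (hB t ht).trans (le_abs_self B)
  have hq_eq : ∀ k, ∀ t ∈ D, pick α (r t) (dyadicGrid d K k) = ENNReal.ofReal (q k t) := fun k t ht =>
    (ENNReal.ofReal_toReal (h.pick_ne_top _ ht)).symm
  have hle : ∀ t ∈ D, pickCube α (r t) K ≤ ENNReal.ofReal B := fun t ht =>
    iSup_le fun k => by rw [hq_eq k t ht]; exact ENNReal.ofReal_le_ofReal (hB k t ht)
  have hfin : ∀ t ∈ D, pickCube α (r t) K ≠ ∞ := fun t ht =>
    ((hle t ht).trans_lt ENNReal.ofReal_lt_top).ne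
  refine ⟨⟨B, hle⟩, ?_⟩
  -- choose `s` with `(exp s - 1) * B ≤ ε / 4`
  obtain ⟨s, hs, hsB⟩ : ∃ s > 0, (Real.exp s - 1) * B ≤ ε / 4 := by
    refine ⟨Real.log (1 + ε / (4 * B)), Real.log_pos (by linarith [div_pos hε (by positivity : 0 < 4 * B)]), ?_⟩
    rw [Real.exp_log (by positivity)]
    apply le_of_eq
    field_simp
    ring
  have hexp : ∀ k, ∀ t ∈ D, Real.exp s * q k t ≤ q k t + ε / 4 := by
    intro k t ht
    have h1 : (Real.exp s - 1) * q k t ≤ (Real.exp s - 1) * B := by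
      have := Real.add_one_le_exp s
      gcongr
      · linarith
      · exact hB k t ht
    linarith
  -- Grid `k₁` nearly attains the supremum over all grids and serves the lower bound; grid `k₂`
  -- approximates the cube from above at a level lowered by `s/c`.
  obtain ⟨k₁, hk₁⟩ := hcomp s hs (ε / 4) (by positivity)
  obtain ⟨k₂, η₂, hη₂, hev₂⟩ := hup s hs (ε / 4) (by positivity)
  obtain ⟨η₁, hη₁, hev₁⟩ := hlow k₁ (ε / 4) (by positivity)
  refine ⟨min η₁ η₂, by positivity, ?_⟩
  filter_upwards [hev₁, hev₂, eventually_gt_atTop 0] with c h1 h2 hc t ht t' htt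
  rw [lt_min_iff] at htt
  have hψ := gaussTail_pos hc
  have a1 := h1 t ht t' htt.1
  have a2 := h2 t ht t' htt.2
  have a3 : q k₂ t ≤ (pickCube α (r t) K).toReal :=
    ENNReal.toReal_mono (hfin t ht) (le_iSup (fun k => pick α (r t) (dyadicGrid d K k)) k₂)
  have a4 : (pickCube α (r t) K).toReal ≤ q k₁ t + ε / 2 := by
    have hq0 : 0 ≤ q k₁ t := ENNReal.toReal_nonneg
    refine ENNReal.toReal_le_of_le_ofReal (by positivity) (iSup_le fun k => ?_)
    rw [hq_eq k t ht]
    refine ENNReal.ofReal_le_ofReal ((hk₁ k t ht).trans ?_)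
    linarith [hexp k₁ t ht]
  have a5 := hexp k₂ t ht
  rw [abs_le]
  constructor
  · have : gaussTail c * ((pickCube α (r t) K).toReal - ε) ≤ gaussTail c * (q k₁ t - ε / 4) :=
      mul_le_mul_of_nonneg_left (by linarith) hψ.le
    linarith
  · have : gaussTail c * (Real.exp s * q k₂ t + ε / 4) ≤
        gaussTail c * ((pickCube α (r t) K).toReal + ε) :=
      mul_le_mul_of_nonneg_left (by linarith) hψ.le
    linarith

end LocallyStationaryField

/-! ### Identification of the constant with the Pickands integral of a tangent field. -/

lemma exists_lt_of_mem_closure {E : Type*} [TopologicalSpace E] {f : E → ℝ} {U S : Set E} {u : E}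
    (hf : ContinuousOn f U) (hS : S ⊆ U) (hu : u ∈ U) (huS : u ∈ closure S) {y : ℝ} (hy : y < f u) :
    ∃ v ∈ S, y < f v := by
  have h1 : ∀ᶠ v in 𝓝[U] u, y < f v := (hf u hu).eventually (lt_mem_nhds hy)
  have h2 : (𝓝[S] u).NeBot := mem_closure_iff_nhdsWithin_neBot.1 huS
  obtain ⟨v, hv1, hv2⟩ := ((h1.filter_mono (nhdsWithin_mono u hS)).and self_mem_nhdsWithin).exists
  exact ⟨v, hv2, hv1⟩

lemma dyadicGrid_succ {d : ℕ} (K : ℝ) (k : ℕ) (n : Fin d → Fin (2 ^ k)) :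
    ∃ n', dyadicGrid d K (k + 1) n' = dyadicGrid d K k n := by
  refine ⟨fun i => ⟨2 * n i, by have := (n i).2; rw [pow_succ]; omega⟩, ?_⟩
  ext i
  simp only [dyadicGrid, gridPoint_apply]
  push_cast
  field_simp
  ring

lemma closedCube_subset_closure {d : ℕ} {K : ℝ} (hK : 0 < K) :
    closedCube d K ⊆ closure (⋃ k, Set.range (dyadicGrid d K k)) := by
  have h1 : cube (0 : EuclideanSpace ℝ (Fin d)) K ⊆ closure (⋃ k, Set.range (dyadicGrid d K k)) := by
    intro u hu
    refine mem_closure_of_tendsto (tendsto_gridPoint hK fun i => (hu i).1)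
      (Eventually.of_forall fun k => Set.mem_iUnion.2 ⟨k, ?_⟩)
    exact ⟨fun i => ⟨gridIndex 0 (K / (2 ^ k : ℕ)) u i, gridIndex_lt hK hu (by positivity) i⟩, rfl⟩
  intro u hu
  rw [← closure_closure]
  refine closure_mono h1 ?_
  -- The dyadic grids lie in the half-open cube; the far faces are reached by scaling towards the
  -- origin.
  have ht : Tendsto (fun n : ℕ => (1 - 1 / ((n : ℝ) + 1)) • u) atTop (𝓝 u) := by
    have h0 := (tendsto_one_div_add_atTop_nhds_zero_nat (𝕜 := ℝ)).const_sub 1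
    simpa using h0.smul_const u
  refine mem_closure_of_tendsto ht (Eventually.of_forall fun n i => ?_)
  have hn : (0 : ℝ) < 1 / ((n : ℝ) + 1) := Nat.one_div_pos_of_nat
  have hn1 : 1 / ((n : ℝ) + 1) ≤ 1 := by
    rw [div_le_one (by positivity)]
    linarith [(Nat.cast_nonneg n : (0 : ℝ) ≤ n)]
  have := hu i
  simp only [PiLp.zero_apply, zero_add, PiLp.smul_apply, smul_eq_mul]
  constructor
  · exact mul_nonneg (by linarith) this.1
  · nlinarith

lemma dyadicGrid_mem_closedCube {d : ℕ} {K : ℝ} (hK : 0 < K) (k : ℕ) (n : Fin d → Fin (2 ^ k)) :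
    dyadicGrid d K k n ∈ closedCube d K := by
  intro i
  have := gridPoint_mem_cube (0 : EuclideanSpace ℝ (Fin d)) hK (n := fun i => n i)
    (fun i => (n i).2) i
  simp only [PiLp.zero_apply, zero_add] at this
  exact ⟨this.1, this.2.le⟩

lemma closedCube_subset_orthant (d : ℕ) (K : ℝ) : closedCube d K ⊆ orthant d := fun _ hu i => (hu i).1

lemma dyadicGrid_zero_index {d : ℕ} (K : ℝ) (k : ℕ) :
    dyadicGrid d K k (fun _ => ⟨0, by positivity⟩) = 0 := by
  ext i
  simp [dyadicGrid]

lemma lintegral_exp_Iic_zero : ∫⁻ y in Set.Iic (0 : ℝ), ENNReal.ofReal (Real.exp y) = 1 := by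
  rw [← ofReal_integral_eq_lintegral_ofReal (integrableOn_exp_Iic 0)
    (ae_of_all _ fun y => (Real.exp_pos y).le), integral_exp_Iic_zero, ENNReal.ofReal_one]

namespace IsTangentField

variable {d : ℕ} {Ω : Type*} [MeasurableSpace Ω] {α : ℝ} {ρ : EuclideanSpace ℝ (Fin d) → ℝ}
  {W : EuclideanSpace ℝ (Fin d) → Ω → ℝ} {P : Measure Ω}

lemma hasGaussianLaw_pi (h : IsTangentField α ρ W P) {ι : Type*} [Fintype ι] [DecidableEq ι]
    {u : ι → EuclideanSpace ℝ (Fin d)} (hu : ∀ i, u i ∈ orthant d) :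
    HasGaussianLaw (fun ω i => W (u i) ω) P := by
  have h1 := IsGaussianProcess.sum_mul h.isGaussian (fun i => (⟨u i, hu i⟩ : orthant d))
    (fun i j : ι => if j = i then (1 : ℝ) else 0)
  have h2 := (h1.hasGaussianLaw Finset.univ).map_fun
    (ContinuousLinearMap.pi fun i : ι => ContinuousLinearMap.proj
        (⟨i, Finset.mem_univ _⟩ : (Finset.univ : Finset ι)) :
      (↥(Finset.univ : Finset ι) → ℝ) →L[ℝ] (ι → ℝ))
  refine h2.congr (ae_of_all _ fun ω => funext fun i => ?_)
  simp [Finset.restrict]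

lemma measure_exists_lt_eq (h : IsTangentField α ρ W P) {ι : Type*} [Fintype ι] [DecidableEq ι]
    {u : ι → EuclideanSpace ℝ (Fin d)} (hu : ∀ i, u i ∈ orthant d) (y : ℝ) :
    P {ω | ∃ i, y < W (u i) ω} = multivariateGaussian (tangentMean α ρ u) (tangentCov α ρ u)
      {x | ∃ i, 0 + 1 * y < x i} := by
  have := h.isProbabilityMeasure
  have hV := h.hasGaussianLaw_pi hu
  have hS : ∀ i j, covariance (W (u i)) (W (u j)) P = tangentCov α ρ u i j := fun i j =>
    h.cov _ (hu i) _ (hu j)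
  have hpos : (tangentCov α ρ u).PosSemidef :=
    covariance_matrix_posSemidef (fun i => (hV.eval i).memLp_two) hS
  rw [← _root_.HasGaussianLaw.map_toLp_eq (V := fun i => W (u i)) hV
    (m := tangentMean α ρ u) (fun i => h.mean _ (hu i)) hS hpos,
    Measure.map_apply_of_aemeasurable (hV.toLp_pi 2).aemeasurable
      (isOpen_exists_lt fun _ => 0 + 1 * y).measurableSet]
  simp

/-- The constant of the local limit theorem in terms of an arbitrary tangent field. -/
theorem pickCube_eq (h : IsTangentField α ρ W P) {K : ℝ} (hK : 0 < K) :
    pickCube α ρ K = 1 + pickandsIntegral W P K := by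
  have hP := h.isProbabilityMeasure
  have hmem : ∀ k n, dyadicGrid d K k n ∈ orthant d := fun k n =>
    closedCube_subset_orthant d K (dyadicGrid_mem_closedCube hK k n)
  set F : ℕ → ℝ → ℝ≥0∞ := fun k y => P {ω | ∃ n, y < W (dyadicGrid d K k n) ω} with hF
  have hFeq : ∀ k y, F k y = multivariateGaussian (tangentMean α ρ (dyadicGrid d K k))
      (tangentCov α ρ (dyadicGrid d K k)) {x | ∃ i, 0 + 1 * y < x i} := fun k y =>
    h.measure_exists_lt_eq (hmem k) y
  have hFm : ∀ k, Measurable (F k) := fun k => by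
    have : F k = fun y => multivariateGaussian (tangentMean α ρ (dyadicGrid d K k))
      (tangentCov α ρ (dyadicGrid d K k)) {x | ∃ i, 0 + 1 * y < x i} := funext (hFeq k)
    rw [this]
    exact measurable_multivariateGaussian_exists_lt 0 (fun _ => 1) _ _
  -- Dyadic grids increase with `k`, so suprema over grids pass through probabilities and integrals
  -- by monotone convergence.
  have hmonoset : ∀ y, Monotone fun k => {ω | ∃ n, y < W (dyadicGrid d K k n) ω} := by
    intro y
    refine monotone_nat_of_le_succ fun k => ?_
    rintro ω ⟨n, hn⟩
    obtain ⟨n', hn'⟩ := dyadicGrid_succ K k n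
    exact ⟨n', by rw [hn']; exact hn⟩
  have hsup : ∀ y, P (supExceeds W (closedCube d K) y) = ⨆ k, F k y := by
    intro y
    rw [← (hmonoset y).measure_iUnion]
    refine measure_congr ?_
    filter_upwards [h.continuousOn] with ω hω
    refine propext ?_
    change ω ∈ supExceeds W (closedCube d K) y ↔ ω ∈ ⋃ k, {ω | ∃ n, y < W (dyadicGrid d K k n) ω}
    rw [supExceeds_eq, Set.mem_iUnion]
    constructor
    · rintro ⟨u, hu, hyu⟩
      obtain ⟨v, hv, hyv⟩ := exists_lt_of_mem_closure hω
        (S := ⋃ k, Set.range (dyadicGrid d K k))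
        (by rintro v hv
            obtain ⟨k, n, rfl⟩ := Set.mem_iUnion.1 hv
            exact hmem k n)
        (closedCube_subset_orthant d K hu) (closedCube_subset_closure hK hu) hyu
      obtain ⟨k, n, rfl⟩ := Set.mem_iUnion.1 hv
      exact ⟨k, n, hyv⟩
    · rintro ⟨k, n, hn⟩
      exact ⟨_, dyadicGrid_mem_closedCube hK k n, hn⟩
  -- For `y < 0` the event is almost sure because `W 0 = 0` and `0` is a grid point; this half-line
  -- contributes `∫_{-∞}^0 e^y dy = 1`.
  have hpick : ∀ k, pick α ρ (dyadicGrid d K k) =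
      1 + ∫⁻ y in Set.Ioi (0 : ℝ), ENNReal.ofReal (Real.exp y) * F k y := by
    intro k
    have e1 : pick α ρ (dyadicGrid d K k) = ∫⁻ y, ENNReal.ofReal (Real.exp y) * F k y := by
      refine lintegral_congr fun y => ?_
      rw [hFeq, zero_mul, zero_div, sub_zero]
    rw [e1, ← lintegral_add_compl _ (measurableSet_Iic (a := (0 : ℝ))), Set.compl_Iic]
    congr 1
    rw [← lintegral_exp_Iic_zero, ← restrict_Iio_eq_restrict_Iic]
    refine setLIntegral_congr_fun measurableSet_Iio fun y hy => ?_
    have : F k y = 1 := by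
      refine le_antisymm prob_le_one ?_
      have h1 : P {ω | W 0 ω = 0} = 1 := by
        rw [← prob_compl_eq_zero_iff₀]
        · exact h.zero
        · exact ((h.isGaussian.hasGaussianLaw_eval
            (⟨0, fun i => le_rfl⟩ : orthant d)).aemeasurable.nullMeasurable
            (measurableSet_singleton 0))
      rw [← h1]
      refine measure_mono fun ω hω => ⟨fun _ => ⟨0, by positivity⟩, ?_⟩
      rw [dyadicGrid_zero_index]
      have hω' : W 0 ω = 0 := hω
      rw [hω']
      exact hy
    simp [this]
  rw [pickCube, pickandsIntegral]
  simp_rw [hpick, hsup, ENNReal.mul_iSup]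
  have hm : ∀ k, Measurable fun y : ℝ => ENNReal.ofReal (Real.exp y) * F k y := fun k =>
    Measurable.mul (by fun_prop) (hFm k)
  rw [lintegral_iSup hm, ENNReal.add_iSup]
  intro k k' hkk y
  dsimp only
  gcongr
  exact measure_mono (hmonoset y hkk)

end IsTangentField

/-! ### Bonferroni's inequality and sums over pairs of cells. -/

lemma UnitGaussianField.nullMeasurableSet_exists_lt {d : ℕ} {Ω : Type*} [MeasurableSpace Ω]
    {P : Measure Ω} {X : EuclideanSpace ℝ (Fin d) → Ω → ℝ} {U : Set (EuclideanSpace ℝ (Fin d))}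
    (h : UnitGaussianField P X U) {S : Set (EuclideanSpace ℝ (Fin d))} (hS : S ⊆ U) (c : ℝ) :
    NullMeasurableSet {ω | ∃ u ∈ S, c < X u ω} P := by
  -- For a continuous path a strict exceedance somewhere on `S` also occurs on a countable dense
  -- subset.
  obtain ⟨A, hAS, hA, hSA⟩ :=
    (TopologicalSpace.IsSeparable.of_separableSpace S).exists_countable_dense_subset
  have h1 : NullMeasurableSet (⋃ u ∈ A, {ω | c < X u ω}) P :=
    NullMeasurableSet.biUnion hA fun u hu =>
      (h.hasGaussianLaw (hS (hAS hu))).aemeasurable.nullMeasurable measurableSet_Ioi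
  refine h1.congr ?_
  filter_upwards [h.continuousOn] with ω hω
  refine propext ?_
  change ω ∈ (⋃ u ∈ A, {ω | c < X u ω}) ↔ ∃ u ∈ S, c < X u ω
  simp only [Set.mem_iUnion, Set.mem_ofPred_eq, exists_prop]
  constructor
  · rintro ⟨u, hu, hc⟩
    exact ⟨u, hAS hu, hc⟩
  · rintro ⟨u, hu, hc⟩
    exact exists_lt_of_mem_closure hω (hAS.trans hS) (hS hu) (hSA hu) hc

/-- Bonferroni's inequality. -/
lemma sum_measureReal_le_add {Ω ι : Type*} [MeasurableSpace Ω] {P : Measure Ω} [IsFiniteMeasure P]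
    [DecidableEq ι] (s : Finset ι) {E : ι → Set Ω} (hE : ∀ i ∈ s, NullMeasurableSet (E i) P) :
    ∑ i ∈ s, P.real (E i) ≤ P.real (⋃ i ∈ s, E i) +
      ∑ i ∈ s, ∑ j ∈ s, if i = j then 0 else P.real (E i ∩ E j) := by
  induction s using Finset.induction_on with
  | empty => simp
  | insert a s ha ih =>
    have ih := ih fun i hi => hE i (Finset.mem_insert_of_mem hi)
    rw [Finset.sum_insert ha, Finset.sum_insert ha, Finset.set_biUnion_insert,
      Finset.sum_insert ha]
    have h1 := measureReal_union_add_inter₀ (s := E a)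
      (NullMeasurableSet.biUnion (μ := P) s.countable_toSet
        fun i hi => hE i (Finset.mem_insert_of_mem hi)) (measure_ne_top _ _) (measure_ne_top _ _)
    have h2 : P.real (E a ∩ ⋃ i ∈ s, E i) ≤ ∑ j ∈ s, if a = j then 0 else P.real (E a ∩ E j) := by
      rw [Set.inter_iUnion₂]
      refine (measureReal_biUnion_finset_le _ _).trans (Finset.sum_le_sum fun j hj => ?_)
      rw [if_neg (by rintro rfl; exact ha hj)]
    have h3 : ∑ i ∈ s, ∑ j ∈ s, (if i = j then 0 else P.real (E i ∩ E j)) ≤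
        ∑ i ∈ s, ∑ j ∈ insert a s, if i = j then 0 else P.real (E i ∩ E j) := by
      refine Finset.sum_le_sum fun i _ => ?_
      refine Finset.sum_le_sum_of_subset_of_nonneg (Finset.subset_insert _ _) fun j _ _ => ?_
      split_ifs
      · exact le_rfl
      · exact measureReal_nonneg
    simp only [Finset.mem_coe] at h1
    simp only [if_true, zero_add]
    linarith

/-- Summation over pairs of multi-indices which differ in some coordinate. -/
lemma sum_sum_prod_le {d : ℕ} {κ κ' : Type*} [Fintype κ] [DecidableEq κ'] (e : κ → κ')
    {F : κ → κ → ℝ} (hF : ∀ x y, 0 ≤ F x y) :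
    ∑ a : Fin d → κ, ∑ b : Fin d → κ,
        (if (fun k => e (a k)) = (fun k => e (b k)) then 0 else ∏ k, F (a k) (b k)) ≤
      d * ((∑ x, ∑ y, F x y) ^ (d - 1) * ∑ x, ∑ y, if e x = e y then 0 else F x y) := by
  classical
  have hprod : ∀ G : Fin d → κ → κ → ℝ, ∑ a : Fin d → κ, ∑ b : Fin d → κ, ∏ k, G k (a k) (b k) =
      ∏ k, ∑ x, ∑ y, G k x y := by
    intro G
    rw [Finset.prod_univ_sum, Fintype.piFinset_univ]
    refine Finset.sum_congr rfl fun a _ => ?_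
    rw [Finset.prod_univ_sum, Fintype.piFinset_univ]
  -- `G l` changes only the factor of coordinate `l`, making it vanish when the images under `e`
  -- agree there. A pair of distinct image multi-indices is counted by some `l`, and each `l`-sum
  -- factorises over the coordinates.
  set G : Fin d → Fin d → κ → κ → ℝ := fun l k x y =>
    if k = l then (if e x = e y then 0 else F x y) else F x y with hG
  have hG0 : ∀ l k x y, 0 ≤ G l k x y := by
    intro l k x y
    simp only [hG]
    split_ifs <;> simp [hF]
  have h1 : ∀ a b : Fin d → κ,
      (if (fun k => e (a k)) = (fun k => e (b k)) then 0 else ∏ k, F (a k) (b k)) ≤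
        ∑ l, ∏ k, G l k (a k) (b k) := by
    intro a b
    have h0 : ∀ l, 0 ≤ ∏ k, G l k (a k) (b k) := fun l => Finset.prod_nonneg fun k _ => hG0 _ _ _ _
    split_ifs with hab
    · exact Finset.sum_nonneg fun l _ => h0 l
    · obtain ⟨l, hl⟩ := Function.ne_iff.1 hab
      refine le_trans (le_of_eq ?_) (Finset.single_le_sum (fun l _ => h0 l) (Finset.mem_univ l))
      refine Finset.prod_congr rfl fun k _ => ?_
      simp only [hG]
      split_ifs with h1 h2
      · exact absurd (h1 ▸ h2) hl
      · rfl
      · rfl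
  refine (Finset.sum_le_sum fun a _ => Finset.sum_le_sum fun b _ => h1 a b).trans (le_of_eq ?_)
  rw [Finset.sum_congr rfl fun a _ => Finset.sum_comm, Finset.sum_comm]
  have h2 : ∀ l, ∑ a : Fin d → κ, ∑ b : Fin d → κ, ∏ k, G l k (a k) (b k) =
      (∑ x, ∑ y, F x y) ^ (d - 1) * ∑ x, ∑ y, if e x = e y then 0 else F x y := by
    intro l
    rw [hprod, ← Finset.prod_erase_mul _ _ (Finset.mem_univ l)]
    congr 1
    · rw [Finset.prod_congr rfl (g := fun _ => ∑ x, ∑ y, F x y)]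
      · simp
      · intro k hk
        simp only [hG, if_neg (Finset.ne_of_mem_erase hk)]
    · simp [hG]
  rw [Finset.sum_congr rfl fun l _ => h2 l]
  simp

/-- A summable decay profile on the integers. -/
noncomputable def decay (z : ℝ) : ℝ := ((1 + |z|) ^ 2)⁻¹

lemma decay_nonneg (z : ℝ) : 0 ≤ decay z := by unfold decay; positivity

/-- One constant for all finite families of distinct integers, so that later bounds depend on the
number of blocks and their length only through explicit powers. -/
lemma exists_sum_decay_le : ∃ S > 0, ∀ {κ : Type} (s : Finset κ) (f : κ → ℤ), Set.InjOn f s →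
    ∑ x ∈ s, decay (f x) ≤ S := by
  have hnat : Summable fun n : ℕ => decay (n : ℝ) := by
    have := (summable_nat_add_iff 1).2 (Real.summable_nat_pow_inv.2 (by norm_num : 1 < 2))
    refine this.congr fun n => ?_
    rw [decay, abs_of_nonneg (Nat.cast_nonneg n)]
    push_cast
    rw [add_comm]
  have hsum : Summable fun n : ℤ => decay (n : ℝ) := by
    refine Summable.of_nat_of_neg (by simpa using hnat) ?_
    refine hnat.congr fun n => ?_
    simp [decay]
  refine ⟨∑' n : ℤ, decay (n : ℝ) + 1, ?_, fun {κ} s f hf => ?_⟩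
  · have : 0 ≤ ∑' n : ℤ, decay (n : ℝ) := tsum_nonneg fun n => decay_nonneg _
    linarith
  · rw [← Finset.sum_image (f := fun n : ℤ => decay n) hf]
    have := hsum.sum_le_tsum (s.image f) fun n _ => decay_nonneg _
    linarith

lemma sum_sum_decay_sq_le {S : ℝ}
    (hsum : ∀ {κ : Type} (s : Finset κ) (f : κ → ℤ), Set.InjOn f s → ∑ x ∈ s, decay (f x) ≤ S)
    {κ : Type} [Fintype κ] (f : κ → ℤ) (hf : Function.Injective f) :
    ∑ x, ∑ y, decay (f y - f x) ^ 2 ≤ Fintype.card κ * S := by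
  have : ∀ x, ∑ y, decay (f y - f x) ^ 2 ≤ S := by
    intro x
    have h1 := hsum Finset.univ (fun y => f y - f x) (by
      intro a _ b _ hab
      exact hf (by simpa using hab))
    refine le_trans (Finset.sum_le_sum fun y _ => ?_) h1
    have h2 : decay (f y - f x) ≤ 1 := by
      rw [decay]
      refine inv_le_one_of_one_le₀ (one_le_pow₀ ?_)
      linarith [abs_nonneg ((f y : ℝ) - f x)]
    have h3 := decay_nonneg ((f y : ℝ) - f x)
    push_cast
    nlinarith
  refine (Finset.sum_le_sum fun x _ => this x).trans ?_
  simp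

lemma block_index_injective (M N : ℕ) :
    Function.Injective fun x : Fin M × Fin N => ((N * x.1 + x.2 : ℕ) : ℤ) := by
  intro x y hxy
  have h0 : N * (x.1 : ℕ) + x.2 = N * y.1 + y.2 := by
    simp only at hxy
    exact_mod_cast hxy
  have hx := x.2.2
  have hN : 0 < N := by omega
  have h1 : (x.1 : ℕ) = y.1 := by
    have := congrArg (· / N) h0
    simpa [Nat.mul_add_div hN, Nat.div_eq_of_lt x.2.2, Nat.div_eq_of_lt y.2.2] using this
  have h2 : (x.2 : ℕ) = y.2 := by rw [h1] at h0; omega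
  exact Prod.ext (Fin.ext h1) (Fin.ext h2)

/-- Pairs of points in distinct blocks of length `N`. -/
lemma sum_sum_decay_sq_block_le {S : ℝ} (hS : 0 < S)
    (hsum : ∀ {κ : Type} (s : Finset κ) (f : κ → ℤ), Set.InjOn f s → ∑ x ∈ s, decay (f x) ≤ S)
    (M N : ℕ) :
    ∑ x : Fin M × Fin N, ∑ y : Fin M × Fin N, (if x.1 = y.1 then 0 else
      decay (((N * y.1 + y.2 : ℕ) : ℤ) - ((N * x.1 + x.2 : ℕ) : ℤ)) ^ 2) ≤ M * (2 * S ^ 2) := by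
  set f : Fin M × Fin N → ℤ := fun x => ((N * x.1 + x.2 : ℕ) : ℤ) with hf
  have hinj : Function.Injective f := block_index_injective M N
  -- A point of another block is at least as far away as one of the two ends of the own block. One
  -- of the two factors `decay` is therefore bounded by `w`, whose sum over a block is at most `2S`.
  -- This boundary effect gives `O(M)` in place of `O(M N)`.
  set w : Fin N → ℝ := fun p => decay ((p : ℕ) : ℤ) + decay ((N - 1 - (p : ℕ) : ℤ)) with hw
  have hw0 : ∀ p, 0 ≤ w p := fun p => add_nonneg (decay_nonneg _) (decay_nonneg _)
  have hpt : ∀ x y : Fin M × Fin N, (if x.1 = y.1 then 0 else decay (f y - f x) ^ 2) ≤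
      w x.2 * decay (f y - f x) := by
    intro x y
    have hd := decay_nonneg ((f y : ℝ) - f x)
    split_ifs with hxy
    · exact mul_nonneg (hw0 _) hd
    · rw [sq]
      refine mul_le_mul_of_nonneg_right ?_ hd
      have hne : (x.1 : ℕ) ≠ y.1 := fun h => hxy (Fin.ext h)
      have hx := x.2.2
      have hy := y.2.2
      rcases lt_or_gt_of_ne hne with hlt | hgt
      · have h1 : f x + (N - 1 - (x.2 : ℕ)) ≤ f y := by
          simp only [hf]
          have : N * (x.1 : ℕ) + N ≤ N * y.1 := by nlinarith
          push_cast
          have : (N : ℤ) * (x.1 : ℕ) + N ≤ N * (y.1 : ℕ) := by exact_mod_cast this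
          omega
        have h2 : ((N - 1 - (x.2 : ℕ) : ℤ) : ℝ) ≤ (f y : ℝ) - f x := by
          have : ((f x + (N - 1 - (x.2 : ℕ)) : ℤ) : ℝ) ≤ f y := by exact_mod_cast h1
          push_cast at this ⊢
          linarith
        have h3 : (0 : ℝ) ≤ ((N - 1 - (x.2 : ℕ) : ℤ) : ℝ) := by
          have : (0 : ℤ) ≤ N - 1 - (x.2 : ℕ) := by omega
          exact_mod_cast this
        refine le_trans ?_ (le_add_of_nonneg_left (decay_nonneg _))
        rw [decay, decay, abs_of_nonneg h3, abs_of_nonneg (h3.trans h2)]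
        gcongr
      · have h1 : f y + (x.2 : ℕ) ≤ f x := by
          simp only [hf]
          have : N * (y.1 : ℕ) + N ≤ N * x.1 := by nlinarith
          push_cast
          have : (N : ℤ) * (y.1 : ℕ) + N ≤ N * (x.1 : ℕ) := by exact_mod_cast this
          omega
        have h2 : (((x.2 : ℕ) : ℤ) : ℝ) ≤ f x - f y := by
          have : ((f y + (x.2 : ℕ) : ℤ) : ℝ) ≤ f x := by exact_mod_cast h1
          push_cast at this ⊢
          linarith
        have h3 : (0 : ℝ) ≤ (((x.2 : ℕ) : ℤ) : ℝ) := by positivity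
        refine le_trans ?_ (le_add_of_nonneg_right (decay_nonneg _))
        rw [decay, decay, abs_of_nonneg h3, abs_sub_comm, abs_of_nonneg (h3.trans h2)]
        gcongr
  have hin : ∀ x, ∑ y, w x.2 * decay (f y - f x) ≤ w x.2 * S := by
    intro x
    rw [← Finset.mul_sum]
    refine mul_le_mul_of_nonneg_left ?_ (hw0 _)
    have := hsum Finset.univ (fun y => f y - f x) (by
      intro a _ b _ hab
      exact hinj (by simpa using hab))
    refine le_trans (le_of_eq ?_) this
    push_cast
    rfl
  calc _ ≤ ∑ x : Fin M × Fin N, w x.2 * S :=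
        Finset.sum_le_sum fun x _ => (Finset.sum_le_sum fun y _ => hpt x y).trans (hin x)
    _ = M * ((∑ p, w p) * S) := by
        rw [Fintype.sum_prod_type]
        simp [Finset.sum_mul]
    _ ≤ M * (2 * S ^ 2) := by
        have h1 := hsum Finset.univ (fun p : Fin N => ((p : ℕ) : ℤ)) (by
          intro a _ b _ hab
          exact Fin.ext (by simpa using hab))
        have h2 := hsum Finset.univ (fun p : Fin N => (N - 1 - (p : ℕ) : ℤ)) (by
          intro a _ b _ hab
          exact Fin.ext (by simpa using hab))
        have h3 : ∑ p, w p ≤ 2 * S := by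
          rw [Finset.sum_add_distrib]
          linarith
        refine mul_le_mul_of_nonneg_left ?_ (by positivity)
        nlinarith

/-- A stretched exponential decays faster than any power, including the power `4d` needed to
factorise over coordinates. -/
lemma exists_exp_neg_rpow_le {κ β : ℝ} (hκ : 0 < κ) (hβ : 0 < β) (n : ℕ) :
    ∃ C > 0, ∀ x, 0 ≤ x → Real.exp (-(κ * x ^ β)) ≤ C * ((1 + x) ^ n)⁻¹ := by
  obtain ⟨m, hm⟩ := exists_nat_ge (n / β)
  rw [div_le_iff₀ hβ] at hm
  refine ⟨2 ^ n * (1 + m.factorial / κ ^ m), by positivity, fun x hx => ?_⟩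
  rw [← div_eq_mul_inv, le_div_iff₀ (by positivity)]
  rcases le_or_gt x 1 with h1 | h1
  · have h2 : Real.exp (-(κ * x ^ β)) ≤ 1 := Real.exp_le_one_iff.2 (by
      have := Real.rpow_nonneg hx β
      nlinarith)
    have h3 : (1 + x) ^ n ≤ 2 ^ n := by gcongr; linarith
    have h4 : (0 : ℝ) ≤ m.factorial / κ ^ m := by positivity
    have h5 : (0 : ℝ) < 2 ^ n := by positivity
    calc Real.exp (-(κ * x ^ β)) * (1 + x) ^ n ≤ 1 * 2 ^ n := by gcongr
      _ ≤ _ := by nlinarith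
  · have hx0 : 0 < x := by linarith
    have h2 := exp_neg_le_factorial_div_pow (z := κ * x ^ β) (by positivity) m
    have h3 : x ^ n ≤ (x ^ β) ^ m := by
      rw [← Real.rpow_natCast (x ^ β), ← Real.rpow_mul hx, ← Real.rpow_natCast x]
      exact Real.rpow_le_rpow_of_exponent_le h1.le (by linarith)
    have h4 : (1 + x) ^ n ≤ 2 ^ n * (x ^ β) ^ m := by
      calc (1 + x) ^ n ≤ (2 * x) ^ n := by gcongr; linarith
        _ = 2 ^ n * x ^ n := mul_pow _ _ _
        _ ≤ _ := by gcongr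
    have h5 : 0 < (x ^ β) ^ m := by positivity
    calc Real.exp (-(κ * x ^ β)) * (1 + x) ^ n
        ≤ m.factorial / (κ * x ^ β) ^ m * (2 ^ n * (x ^ β) ^ m) := by gcongr
      _ = 2 ^ n * (m.factorial / κ ^ m) := by rw [mul_pow]; field_simp
      _ ≤ _ := by gcongr; linarith

/-- The exponent `4d` provides a factor of order 4, that is `decay²`, in each of the `d`
coordinates; the radial bound becomes a product. -/
lemma decay_pow_le_of_abs_le {d : ℕ} {x : ℝ} {z : Fin d → ℝ} (hz : ∀ k, |z k| ≤ x) :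
    ((1 + x) ^ (4 * d))⁻¹ ≤ ∏ k, decay (z k) ^ 2 := by
  have e : ∏ k, decay (z k) ^ 2 = (∏ k, (1 + |z k|) ^ 4)⁻¹ := by
    rw [← Finset.prod_inv_distrib]
    refine Finset.prod_congr rfl fun k _ => ?_
    rw [decay, inv_pow, ← pow_mul]
  rw [e]
  refine inv_anti₀ (Finset.prod_pos fun k _ => by positivity) ?_
  refine (Finset.prod_le_prod (fun k _ => by positivity) (g := fun _ => (1 + x) ^ 4)
    fun k _ => ?_).trans (by simp [pow_mul])
  gcongr
  exact hz k

/-! ### Pairs of cells of a common grid. -/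

namespace LocallyStationaryField

variable {d : ℕ} {Ω : Type*} [MeasurableSpace Ω] {P : Measure Ω}
  {D : Set (EuclideanSpace ℝ (Fin d))} {δ : ℝ} {X : EuclideanSpace ℝ (Fin d) → Ω → ℝ} {α : ℝ}
  {L : ℝ → ℝ} {r : EuclideanSpace ℝ (Fin d) → EuclideanSpace ℝ (Fin d) → ℝ}

/-- Cells of a fixed small size, in units of `Δ`, to which the estimates for single cells and for
pairs of cells apply. -/
lemma exists_cell_size (h : LocallyStationaryField P D δ X α L r) :
    ∃ a₀ > 0, ∃ C > 0, ∀ᶠ c in atTop, ∀ a, 0 < a → a ≤ a₀ →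
      (∀ p, cube p (a * scale α L c) ⊆ Metric.thickening δ D →
        P.real {ω | ∃ u ∈ cube p (a * scale α L c), c < X u ω} ≤ C * gaussTail c) ∧
      ∀ p q, cube p (a * scale α L c) ⊆ Metric.thickening δ D →
        cube q (a * scale α L c) ⊆ Metric.thickening δ D →
        P.real {ω | (∃ u ∈ cube p (a * scale α L c), c < X u ω) ∧
          ∃ u ∈ cube q (a * scale α L c), c < X u ω} ≤
          C * gaussTail c * Real.exp (-(vario P X c p q / 32)) := by
  have hβ : 0 < α / 2 := half_pos h.alpha_pos
  obtain ⟨b₁, hb₁, C, hC, hcells⟩ := UnitGaussianField.exists_measure_cells_le d hβ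
  obtain ⟨C₀, hC₀, hcb⟩ := h.exists_cellBound
  -- The second entry is the solution of `C₀ a^{α/2} = b₁`.
  refine ⟨min 1 ((b₁ / C₀) ^ (α / 2)⁻¹), by positivity, C, hC, ?_⟩
  filter_upwards [hcb, eventually_scale_pos h.isLeast, eventually_ge_atTop 2] with c hcb hΔ hc a ha ha1
  have ha1' := ha1.trans (min_le_left _ _)
  have hB : C₀ * a ^ (α / 2) ≤ b₁ := by
    have h1 : a ^ (α / 2) ≤ ((b₁ / C₀) ^ (α / 2)⁻¹) ^ (α / 2) := by
      gcongr
      exact ha1.trans (min_le_right _ _)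
    rw [← Real.rpow_mul (by positivity), inv_mul_cancel₀ hβ.ne', Real.rpow_one,
      le_div_iff₀ hC₀] at h1
    linarith
  obtain ⟨h1, h2⟩ := hcells h.field (ζ := a * scale α L c) (c := c) (B := C₀ * a ^ (α / 2))
    (by positivity) hc (by positivity) hB
  have hψ := gaussTail_pos (by linarith : 0 < c)
  refine ⟨fun p hp => ?_, fun p q hp hq => ?_⟩
  · have := ENNReal.toReal_mono ENNReal.ofReal_ne_top (h1 p hp (hcb a ha ha1' p hp))
    rwa [ENNReal.toReal_ofReal (by positivity)] at this
  · have := ENNReal.toReal_mono ENNReal.ofReal_ne_top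
      (h2 p q hp (hcb a ha ha1' p hp) hq (hcb a ha ha1' q hq))
    rwa [ENNReal.toReal_ofReal (by positivity)] at this

/-- Pairs of cells of a common grid near a point where `r` is bounded below. -/
lemma exists_pair_le (h : LocallyStationaryField P D δ X α L r)
    {T : Set (EuclideanSpace ℝ (Fin d))} (hT : T ⊆ D) {r₀ : ℝ} (hr₀ : 0 < r₀)
    (hr : ∀ t ∈ T, ∀ v ∈ Metric.sphere 0 1, r₀ ≤ r t v) :
    ∃ a > 0, ∃ C > 0, ∃ η > 0, η + √d * η ≤ δ ∧ ∀ᶠ c in atTop, ∀ t ∈ T, ∀ t', dist t' t < η →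
      ∀ m n : Fin d → ℕ,
      (∀ k, (m k + 1) * (a * scale α L c) ≤ η) → (∀ k, (n k + 1) * (a * scale α L c) ≤ η) →
      P.real {ω | (∃ u ∈ cube (gridPoint t' (a * scale α L c) m) (a * scale α L c), c < X u ω) ∧
          ∃ u ∈ cube (gridPoint t' (a * scale α L c) n) (a * scale α L c), c < X u ω} ≤
        C * gaussTail c * ∏ k, decay ((n k : ℝ) - m k) ^ 2 := by
  have hβ : 0 < α / 2 := half_pos h.alpha_pos
  obtain ⟨a, ha, C, hC, hcells⟩ := h.exists_cell_size
  obtain ⟨κ, hκ, η₀, hη₀, hη₀δ, hvar⟩ := h.le_vario hT hr₀ hr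
  obtain ⟨C', hC', hexp⟩ := exists_exp_neg_rpow_le (κ := κ / 32 * a ^ (α / 2)) (by positivity) hβ (4 * d)
  -- With this choice `η + √d η = η₀ / 2`, so a cube of side `η` based within `η` of `t` stays
  -- inside the range of the variogram bound.
  set η := η₀ / (2 * (1 + √d)) with hη
  have hη0 : 0 < η := by positivity
  have hηs : η + √d * η = η₀ / 2 := by rw [hη]; field_simp
  refine ⟨a, ha, C * (Real.exp (κ / 32) * C'), by positivity, η, hη0, by linarith, ?_⟩
  filter_upwards [hcells, hvar, eventually_scale_pos h.isLeast, eventually_gt_atTop 0]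
    with c hcells hvar hΔ hc t ht t' htt m n hm hn
  have hψ := gaussTail_pos hc
  set Δ := scale α L c with hΔd
  have haΔ : 0 < a * Δ := by positivity
  have hsub : ∀ m : Fin d → ℕ, (∀ k, (m k + 1) * (a * Δ) ≤ η) →
      cube (gridPoint t' (a * Δ) m) (a * Δ) ⊆ cube t' η := by
    intro m hm u hu i
    have h1 := hu i
    have h2 := hm i
    rw [gridPoint_apply] at h1
    have h3 : 0 ≤ a * Δ * (m i : ℝ) := by positivity
    constructor <;> nlinarith
  have hU : cube t' η ⊆ Metric.thickening δ D :=
    cube_subset_thickening (hT ht) htt hη0 (by linarith)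
  have hnear : ∀ m : Fin d → ℕ, (∀ k, (m k + 1) * (a * Δ) ≤ η) →
      dist (gridPoint t' (a * Δ) m) t < η₀ := by
    intro m hm
    have h1 := dist_le_of_mem_cube hη0.le (hsub m hm (base_mem_cube _ haΔ)) (base_mem_cube t' hη0)
    rw [← dist_eq_norm] at h1
    linarith [dist_triangle (gridPoint t' (a * Δ) m) t' t]
  have h1 := (hcells a ha le_rfl).2 _ _ ((hsub m hm).trans hU) ((hsub n hn).trans hU)
  refine h1.trans ?_
  suffices hkey : Real.exp (-(vario P X c (gridPoint t' (a * Δ) m) (gridPoint t' (a * Δ) n) / 32)) ≤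
      Real.exp (κ / 32) * (C' * ∏ k, decay ((n k : ℝ) - m k) ^ 2) by
    calc _ ≤ C * gaussTail c * (Real.exp (κ / 32) * (C' * ∏ k, decay ((n k : ℝ) - m k) ^ 2)) := by
          gcongr
      _ = _ := by ring
  set x := ‖gridPoint t' (a * Δ) n - gridPoint t' (a * Δ) m‖ / (a * Δ) with hx
  have hx0 : 0 ≤ x := by positivity
  have h2 := hvar t ht _ (hnear m hm) _ (hnear n hn)
  have h3 : ‖gridPoint t' (a * Δ) n - gridPoint t' (a * Δ) m‖ / Δ = a * x := by
    rw [hx]; field_simp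
  rw [h3, Real.mul_rpow ha.le hx0] at h2
  have hcoord : ∀ k, |(n k : ℝ) - m k| ≤ x := by
    intro k
    have h4 := abs_coord_le_norm (gridPoint t' (a * Δ) n - gridPoint t' (a * Δ) m) k
    rw [PiLp.sub_apply, gridPoint_apply, gridPoint_apply] at h4
    have e : t' k + a * Δ * (n k : ℝ) - (t' k + a * Δ * (m k : ℝ)) =
      (a * Δ) * ((n k : ℝ) - m k) := by ring
    rw [e, abs_mul, abs_of_pos haΔ] at h4
    rw [hx, le_div_iff₀ haΔ]
    linarith
  calc Real.exp (-(vario P X c (gridPoint t' (a * Δ) m) (gridPoint t' (a * Δ) n) / 32))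
      ≤ Real.exp (κ / 32 + -(κ / 32 * a ^ (α / 2) * x ^ (α / 2))) := by
        rw [Real.exp_le_exp]
        linarith
    _ = Real.exp (κ / 32) * Real.exp (-(κ / 32 * a ^ (α / 2) * x ^ (α / 2))) := Real.exp_add _ _
    _ ≤ Real.exp (κ / 32) * (C' * ((1 + x) ^ (4 * d))⁻¹) := by gcongr; exact hexp x hx0
    _ ≤ _ := by
        gcongr
        exact decay_pow_le_of_abs_le hcoord

end LocallyStationaryField

/-! ### From cells to large cubes: blocks, and existence and positivity of the limit constant. -/

namespace LocallyStationaryField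

variable {d : ℕ} {Ω : Type*} [MeasurableSpace Ω] {P : Measure Ω}
  {D : Set (EuclideanSpace ℝ (Fin d))} {δ : ℝ} {X : EuclideanSpace ℝ (Fin d) → Ω → ℝ} {α : ℝ}
  {L : ℝ → ℝ} {r : EuclideanSpace ℝ (Fin d) → EuclideanSpace ℝ (Fin d) → ℝ}

/-- The tangent vector at the origin is degenerate, so the exceedance probability is `1` for `y <
0`, and that half-line alone contributes `1`. -/
lemma one_le_pick_zero (h : LocallyStationaryField P D δ X α L r)
    {t : EuclideanSpace ℝ (Fin d)} (ht : t ∈ D) :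
    1 ≤ pick α (r t) (fun _ : Unit => (0 : EuclideanSpace ℝ (Fin d))) := by
  have hz : homog α (r t) 0 = 0 := homog_zero h.alpha_pos _
  set m := tangentMean α (r t) (fun _ : Unit => (0 : EuclideanSpace ℝ (Fin d)))
  set S := tangentCov α (r t) (fun _ : Unit => (0 : EuclideanSpace ℝ (Fin d)))
  have hm : m () = 0 := by simp [m, tangentMean, hz]
  have hS : S () () = 0 := by simp [S, tangentCov, hz]
  have hpos : S.PosSemidef := h.tangentCov_posSemidef _ ht
  have hmp := measurePreserving_eval_multivariateGaussian (μ := m) hpos (i := ())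
  rw [hm, hS, Real.toNNReal_zero, gaussianReal_zero_var] at hmp
  rw [pick, ← lintegral_exp_Iic_zero, ← restrict_Iio_eq_restrict_Iic, expExceed]
  refine le_trans (le_of_eq ?_) (setLIntegral_le_lintegral (Set.Iio 0) _)
  refine setLIntegral_congr_fun measurableSet_Iio fun y hy => ?_
  have h1 : multivariateGaussian m S {x | ∃ i, 0 + 1 * y < x i} = 1 := by
    have e : {x : EuclideanSpace ℝ Unit | ∃ i, 0 + 1 * y < x i} = (fun x => x ()) ⁻¹' Set.Ioi y := by
      ext x
      simp only [zero_add, one_mul, Set.mem_ofPred_eq, Set.mem_preimage, Set.mem_Ioi]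
      exact ⟨fun ⟨_, h⟩ => h, fun h => ⟨(), h⟩⟩
    rw [e, hmp.measure_preimage measurableSet_Ioi.nullMeasurableSet,
      Measure.dirac_apply' _ measurableSet_Ioi]
    exact Set.indicator_of_mem (show (0 : ℝ) ∈ Set.Ioi y from hy) _
  simp only
  rw [h1]
  simp

/-- The finite local limit theorem for a single point; its constant is at least `1` and half of it
is given away. -/
lemma exists_measure_point_ge (h : LocallyStationaryField P D δ X α L r) :
    ∃ η > 0, ∀ᶠ c in atTop, ∀ t ∈ D, ∀ t', dist t' t < η →
      gaussTail c / 2 ≤ P.real {ω | c < X t' ω} := by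
  obtain ⟨η, hη, hev⟩ := h.measure_finite_exceed (fun _ : Unit => (0 : EuclideanSpace ℝ (Fin d))) 0
    (half_pos one_pos)
  refine ⟨η, hη, ?_⟩
  filter_upwards [hev, eventually_gt_atTop 0] with c hc hc0 t ht t' htt
  have h1 := (abs_le.1 (hc t ht t' htt)).1
  have h2 : 1 ≤ (pick α (r t) (fun _ : Unit => (0 : EuclideanSpace ℝ (Fin d)))).toReal := by
    rw [← ENNReal.toReal_one]
    exact ENNReal.toReal_mono (h.pick_ne_top _ ht) (h.one_le_pick_zero ht)
  have hψ := gaussTail_pos hc0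
  simp only [zero_div, add_zero, smul_zero, neg_zero, Real.exp_zero, one_mul, exists_const] at h1
  nlinarith

end LocallyStationaryField

lemma gridPoint_gridPoint {d : ℕ} (t : EuclideanSpace ℝ (Fin d)) (ζ : ℝ) (N : ℕ) (i p : Fin d → ℕ) :
    gridPoint (gridPoint t (N * ζ) i) ζ p = gridPoint t ζ fun k => N * i k + p k := by
  ext k
  simp
  ring

lemma cube_eq_iUnion {d : ℕ} (t : EuclideanSpace ℝ (Fin d)) {ζ : ℝ} (hζ : 0 < ζ) {N : ℕ}
    (hN : 0 < N) :
    cube t (N * ζ) = ⋃ n : Fin d → Fin N, cube (gridPoint t ζ fun k => n k) ζ := by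
  have hN' : (0 : ℝ) < N := by exact_mod_cast hN
  have e : (N : ℝ) * ζ / N = ζ := by field_simp
  ext u
  rw [Set.mem_iUnion]
  constructor
  · intro hu
    refine ⟨fun i => ⟨gridIndex t ζ u i, ?_⟩, gridPoint_gridIndex_le hζ fun i => (hu i).1⟩
    have := gridIndex_lt (by positivity) hu hN i
    rwa [e] at this
  · rintro ⟨n, hn⟩ k
    have h1 := hn k
    rw [gridPoint_apply] at h1
    have h2 : ((n k : ℕ) : ℝ) + 1 ≤ N := by exact_mod_cast (n k).2
    have h3 : 0 ≤ ζ * (n k : ℕ) := by positivity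
    constructor <;> nlinarith

namespace LocallyStationaryField

variable {d : ℕ} {Ω : Type*} [MeasurableSpace Ω] {P : Measure Ω}
  {D : Set (EuclideanSpace ℝ (Fin d))} {δ : ℝ} {X : EuclideanSpace ℝ (Fin d) → Ω → ℝ} {α : ℝ}
  {L : ℝ → ℝ} {r : EuclideanSpace ℝ (Fin d) → EuclideanSpace ℝ (Fin d) → ℝ}

/-- Decomposition of a large cube into blocks: the double exceedances are negligible. -/
theorem exists_block_approx (h : LocallyStationaryField P D δ X α L r)
    {T : Set (EuclideanSpace ℝ (Fin d))} (hT : T ⊆ D) {r₀ : ℝ} (hr₀ : 0 < r₀)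
    (hr : ∀ t ∈ T, ∀ v ∈ Metric.sphere 0 1, r₀ ≤ r t v) :
    ∃ a > 0, ∃ C > 0, ∀ N : ℕ, 0 < N → ∃ η > 0, ∀ᶠ c in atTop, ∀ t ∈ T, ∀ t', dist t' t < η →
      ∀ M : ℕ, 0 < M → M * (N * (a * scale α L c)) ≤ η →
      |P.real {ω | ∃ u ∈ cube t' (M * (N * (a * scale α L c))), c < X u ω} -
        M ^ d * (gaussTail c * (pickCube α (r t) (N * a)).toReal)| ≤
        C * M ^ d * (N ^ d / N) * gaussTail c := by
  classical
  have hP := h.field.isProbabilityMeasure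
  obtain ⟨a, ha, C, hC, η₁, hη₁, hη₁δ, hpair⟩ := h.exists_pair_le hT hr₀ hr
  obtain ⟨S, hS, hsum⟩ := exists_sum_decay_le
  -- The summand `1` pays for the error `1/N` made in each block, the remaining term for the double
  -- exceedances.
  refine ⟨a, ha, 1 + C * (d * (S ^ (d - 1) * (2 * S ^ 2))), by positivity, fun N hN => ?_⟩
  have hN' : (0 : ℝ) < N := by exact_mod_cast hN
  have hN1 : (1 : ℝ) ≤ N := by exact_mod_cast hN
  obtain ⟨-, η₂, hη₂, hblock⟩ := h.exists_pickCube_approx (K := N * a) (ε := 1 / N) (by positivity)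
    (by positivity)
  set η := min η₁ (η₂ / (1 + √d)) with hη
  refine ⟨η, by positivity, ?_⟩
  filter_upwards [hpair, hblock, eventually_scale_pos h.isLeast, eventually_gt_atTop 0]
    with c hpair hblock hΔ hc t ht t' htt M hM hMη
  have hψ := gaussTail_pos hc
  set ζ := a * scale α L c with hζ
  have hζ0 : 0 < ζ := by positivity
  have hNa : (N : ℝ) * a * scale α L c = N * ζ := by rw [hζ]; ring
  have hM' : (0 : ℝ) < M := by exact_mod_cast hM
  rw [hNa] at hblock
  set b : (Fin d → Fin M) → EuclideanSpace ℝ (Fin d) := fun i => gridPoint t' (N * ζ) fun k => i k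
  set E : (Fin d → Fin M) → Set Ω := fun i => {ω | ∃ u ∈ cube (b i) (N * ζ), c < X u ω} with hE
  have hcubeU : cube t' (M * (N * ζ)) ⊆ Metric.thickening δ D := by
    refine cube_subset_thickening (hT ht) (htt.trans_le (min_le_left _ _)) (by positivity) ?_
    have : M * (N * ζ) ≤ η₁ := hMη.trans (min_le_left _ _)
    nlinarith [Real.sqrt_nonneg (d : ℝ)]
  have hdecomp := cube_eq_iUnion t' (ζ := N * ζ) (by positivity) hM
  have hEU : {ω | ∃ u ∈ cube t' (M * (N * ζ)), c < X u ω} = ⋃ i ∈ Finset.univ, E i := by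
    rw [hdecomp]
    ext ω
    simp only [Set.mem_iUnion, Set.mem_ofPred_eq, hE, Finset.mem_univ, exists_prop, true_and]
    constructor
    · rintro ⟨u, ⟨i, hi⟩, hu⟩
      exact ⟨i, u, hi, hu⟩
    · rintro ⟨i, u, hi, hu⟩
      exact ⟨u, ⟨i, hi⟩, hu⟩
  have hbsub : ∀ i, cube (b i) (N * ζ) ⊆ cube t' (M * (N * ζ)) := fun i => by
    rw [hdecomp]
    exact Set.subset_iUnion (fun n : Fin d → Fin M => cube (gridPoint t' (N * ζ) fun k => n k) (N * ζ)) i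
  have hb1 : ∀ i, |P.real (E i) - gaussTail c * (pickCube α (r t) (N * a)).toReal| ≤
      1 / N * gaussTail c := by
    intro i
    refine hblock t (hT ht) (b i) ?_
    have h1 := dist_le_of_mem_cube (by positivity) (hbsub i (base_mem_cube _ (by positivity)))
      (base_mem_cube t' (by positivity))
    rw [← dist_eq_norm] at h1
    have h2 : √d * (M * (N * ζ)) ≤ √d * η := by gcongr
    have h3 : η * (1 + √d) ≤ η₂ := by
      rw [← le_div_iff₀ (by positivity)]
      exact min_le_right _ _
    nlinarith [dist_triangle (b i) t' t]
  have hsumE : |∑ i, P.real (E i) - M ^ d * (gaussTail c * (pickCube α (r t) (N * a)).toReal)| ≤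
      M ^ d * (1 / N * gaussTail c) := by
    have e : (M : ℝ) ^ d * (gaussTail c * (pickCube α (r t) (N * a)).toReal) =
        ∑ _i : Fin d → Fin M, gaussTail c * (pickCube α (r t) (N * a)).toReal := by simp
    rw [e, ← Finset.sum_sub_distrib]
    refine (Finset.abs_sum_le_sum_abs _ _).trans ((Finset.sum_le_sum fun i _ => hb1 i).trans ?_)
    simp
  have hup : P.real (⋃ i ∈ Finset.univ, E i) ≤ ∑ i, P.real (E i) :=
    measureReal_biUnion_finset_le _ _
  have hlow := sum_measureReal_le_add (P := P) Finset.univ (E := E) fun i _ =>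
    h.field.nullMeasurableSet_exists_lt ((hbsub i).trans hcubeU) c
  -- In each coordinate a cell has integer label `N i + p`, with block `i` and position `p` inside
  -- the block. Cells of different blocks have different `i` in some coordinate.
  set F : Fin M × Fin N → Fin M × Fin N → ℝ := fun x y =>
    decay ((((N * y.1 + y.2 : ℕ) : ℤ) : ℝ) - ((N * x.1 + x.2 : ℕ) : ℤ)) ^ 2 with hF
  have hF0 : ∀ x y, 0 ≤ F x y := fun x y => sq_nonneg _
  have hbound : ∀ (i p : (Fin d → ℕ)), (∀ k, i k < M) → (∀ k, p k < N) →
      ∀ k, (((N * i k + p k : ℕ) : ℝ) + 1) * ζ ≤ η₁ := by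
    intro i p hi hp k
    have h1 : N * i k + p k + 1 ≤ M * N := by
      have h2 : N * (i k + 1) ≤ N * M := Nat.mul_le_mul_left _ (hi k)
      have h3 := hp k
      rw [mul_comm M N]
      linarith
    have h2 : ((N * i k + p k : ℕ) : ℝ) + 1 ≤ M * N := by exact_mod_cast h1
    calc (((N * i k + p k : ℕ) : ℝ) + 1) * ζ ≤ M * N * ζ := by gcongr
      _ = M * (N * ζ) := by ring
      _ ≤ η₁ := hMη.trans (min_le_left _ _)
  have hpairE : ∀ i j, P.real (E i ∩ E j) ≤ C * gaussTail c *
      ∑ p : Fin d → Fin N, ∑ q : Fin d → Fin N, ∏ k, F (i k, p k) (j k, q k) := by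
    intro i j
    set cell : (Fin d → Fin M) → (Fin d → Fin N) → Set Ω := fun i p =>
      {ω | ∃ u ∈ cube (gridPoint t' ζ fun k => N * i k + p k) ζ, c < X u ω} with hcell
    have hEcell : ∀ i, E i ⊆ ⋃ p, cell i p := by
      rintro i ω ⟨u, hu, hcu⟩
      rw [cube_eq_iUnion _ hζ0 hN, Set.mem_iUnion] at hu
      obtain ⟨p, hp⟩ := hu
      refine Set.mem_iUnion.2 ⟨p, u, ?_, hcu⟩
      rwa [gridPoint_gridPoint] at hp
    have h1 : E i ∩ E j ⊆ ⋃ p, ⋃ q, cell i p ∩ cell j q := by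
      rintro ω ⟨h1, h2⟩
      obtain ⟨p, hp⟩ := Set.mem_iUnion.1 (hEcell i h1)
      obtain ⟨q, hq⟩ := Set.mem_iUnion.1 (hEcell j h2)
      exact Set.mem_iUnion.2 ⟨p, Set.mem_iUnion.2 ⟨q, hp, hq⟩⟩
    refine (measureReal_mono h1).trans ((measureReal_iUnion_fintype_le _).trans ?_)
    rw [Finset.mul_sum]
    refine Finset.sum_le_sum fun p _ => (measureReal_iUnion_fintype_le _).trans ?_
    rw [Finset.mul_sum]
    refine Finset.sum_le_sum fun q _ => ?_
    have h2 := hpair t ht t' (htt.trans_le (min_le_left _ _)) (fun k => N * i k + p k)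
      (fun k => N * j k + q k)
      (hbound (fun k => i k) (fun k => p k) (fun k => (i k).2) fun k => (p k).2)
      (hbound (fun k => j k) (fun k => q k) (fun k => (j k).2) fun k => (q k).2)
    exact h2
  have htotal : ∑ i, ∑ j, (if i = j then 0 else P.real (E i ∩ E j)) ≤
      C * gaussTail c * (d * ((M * N * S) ^ (d - 1) * (M * (2 * S ^ 2)))) := by
    have h1 : ∑ i, ∑ j, (if i = j then 0 else P.real (E i ∩ E j)) ≤
        C * gaussTail c * ∑ i : Fin d → Fin M, ∑ j : Fin d → Fin M, ∑ p : Fin d → Fin N, ∑ q : Fin d → Fin N,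
          if i = j then 0 else ∏ k, F (i k, p k) (j k, q k) := by
      rw [Finset.mul_sum]
      refine Finset.sum_le_sum fun i _ => ?_
      rw [Finset.mul_sum]
      refine Finset.sum_le_sum fun j _ => ?_
      split_ifs with hij
      · simp
      · exact hpairE i j
    have h2 : ∑ i : Fin d → Fin M, ∑ j : Fin d → Fin M, ∑ p : Fin d → Fin N, ∑ q : Fin d → Fin N,
          (if i = j then 0 else ∏ k, F (i k, p k) (j k, q k)) =
        ∑ x : Fin d → Fin M × Fin N, ∑ y : Fin d → Fin M × Fin N,
          if (fun k => (x k).1) = (fun k => (y k).1) then 0 else ∏ k, F (x k) (y k) := by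
      have hsplit : ∀ f : (Fin d → Fin M × Fin N) → ℝ, ∑ x, f x =
          ∑ i : Fin d → Fin M, ∑ p : Fin d → Fin N, f fun k => (i k, p k) := by
        intro f
        rw [← Fintype.sum_prod_type' (f := fun (i : Fin d → Fin M) (p : Fin d → Fin N) =>
          f fun k => (i k, p k))]
        exact ((Equiv.arrowProdEquivProdArrow (Fin d) _ _).symm.sum_comp f).symm
      rw [hsplit]
      refine Finset.sum_congr rfl fun i _ => ?_
      rw [Finset.sum_comm]
      refine Finset.sum_congr rfl fun p _ => ?_
      rw [hsplit]
    have h3 := sum_sum_prod_le (d := d) (Prod.fst : Fin M × Fin N → Fin M) hF0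
    have h4 : ∑ x, ∑ y, F x y ≤ M * N * S := by
      have := sum_sum_decay_sq_le hsum _ (block_index_injective M N)
      simpa [hF] using this
    have h5 : ∑ x, ∑ y, (if x.1 = y.1 then 0 else F x y) ≤ M * (2 * S ^ 2) :=
      sum_sum_decay_sq_block_le hS hsum M N
    have h6 : 0 ≤ ∑ x, ∑ y, F x y := Finset.sum_nonneg fun x _ => Finset.sum_nonneg fun y _ => hF0 x y
    have h7 : 0 ≤ ∑ x, ∑ y, (if x.1 = y.1 then 0 else F x y) :=
      Finset.sum_nonneg fun x _ => Finset.sum_nonneg fun y _ => by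
        split_ifs
        · exact le_rfl
        · exact hF0 x y
    refine h1.trans (mul_le_mul_of_nonneg_left ?_ (by positivity))
    rw [h2]
    refine h3.trans ?_
    gcongr
  have hfinal : (d : ℝ) * ((M * N * S) ^ (d - 1) * (M * (2 * S ^ 2))) =
      d * (S ^ (d - 1) * (2 * S ^ 2)) * M ^ d * (N ^ d / N) := by
    rcases Nat.eq_zero_or_pos d with rfl | hd
    · simp
    · obtain ⟨e, rfl⟩ := Nat.exists_eq_add_of_lt hd
      simp only [zero_add, Nat.add_sub_cancel, mul_pow, pow_succ]
      field_simp
  have hone : (M : ℝ) ^ d * (1 / N * gaussTail c) ≤ M ^ d * (N ^ d / N) * gaussTail c := by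
    rw [← mul_assoc]
    gcongr
    exact one_le_pow₀ hN1
  rw [hEU]
  rw [hfinal] at htotal
  have e1 : C * gaussTail c * (d * (S ^ (d - 1) * (2 * S ^ 2)) * M ^ d * (N ^ d / N)) =
    C * (d * (S ^ (d - 1) * (2 * S ^ 2))) * M ^ d * (N ^ d / N) * gaussTail c := by ring
  rw [e1] at htotal
  have h0 : 0 ≤ C * (d * (S ^ (d - 1) * (2 * S ^ 2))) * M ^ d * (N ^ d / N) * gaussTail c := by
    positivity
  have hs := abs_le.1 hsumE
  rw [abs_le]
  constructor <;> nlinarith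

end LocallyStationaryField

/-- The constant `H` of the tangent field with parameters `α` and `ρ`. -/
noncomputable def pickands {d : ℕ} (α : ℝ) (ρ : EuclideanSpace ℝ (Fin d) → ℝ) : ℝ :=
  limUnder atTop fun K : ℝ => (pickCube α ρ K).toReal / K ^ d

namespace LocallyStationaryField

variable {d : ℕ} {Ω : Type*} [MeasurableSpace Ω] {P : Measure Ω}
  {D : Set (EuclideanSpace ℝ (Fin d))} {δ : ℝ} {X : EuclideanSpace ℝ (Fin d) → Ω → ℝ} {α : ℝ}
  {L : ℝ → ℝ} {r : EuclideanSpace ℝ (Fin d) → EuclideanSpace ℝ (Fin d) → ℝ}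

set_option maxHeartbeats 800000 in
/-- A lower bound for large cubes, from widely spaced points. -/
theorem exists_le_measure_cube (h : LocallyStationaryField P D δ X α L r)
    {T : Set (EuclideanSpace ℝ (Fin d))} (hT : T ⊆ D) {r₀ : ℝ} (hr₀ : 0 < r₀)
    (hr : ∀ t ∈ T, ∀ v ∈ Metric.sphere 0 1, r₀ ≤ r t v) :
    ∃ K > 0, ∃ η > 0, ∀ᶠ c in atTop, ∀ t ∈ T, ∀ t', dist t' t < η →
      ∀ M : ℕ, 0 < M → M * (K * scale α L c) ≤ η →
      M ^ d * (gaussTail c / 4) ≤ P.real {ω | ∃ u ∈ cube t' (M * (K * scale α L c)), c < X u ω} := by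
  classical
  have hP := h.field.isProbabilityMeasure
  obtain ⟨a, ha, C, hC, η₁, hη₁, hη₁δ, hpair⟩ := h.exists_pair_le hT hr₀ hr
  obtain ⟨S, hS, hsum⟩ := exists_sum_decay_le
  obtain ⟨η₂, hη₂, hpoint⟩ := h.exists_measure_point_ge
  -- The spacing `J`, in cells, is so large that all pair probabilities together take at most half
  -- of the first-order term `M^d ψ(c)/2`.
  obtain ⟨J, hJ⟩ := exists_nat_ge (max 1 (4 * (C * (d * S ^ d))))
  have hJ1 : (1 : ℝ) ≤ J := (le_max_left _ _).trans hJ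
  have hJC : 4 * (C * (d * S ^ d)) ≤ J := (le_max_right _ _).trans hJ
  have hJ0 : (0 : ℝ) < J := by linarith
  have hJ1' : 1 ≤ J := by exact_mod_cast hJ1
  set η := min η₁ (η₂ / (1 + √d)) with hη
  refine ⟨J * a, by positivity, η, by positivity, ?_⟩
  filter_upwards [hpair, hpoint, eventually_scale_pos h.isLeast, eventually_gt_atTop 0]
    with c hpair hpoint hΔ hc t ht t' htt M hM hMη
  have hψ := gaussTail_pos hc
  rw [mul_assoc (J : ℝ)] at hMη ⊢
  set ζ := a * scale α L c with hζ
  have hζ0 : 0 < ζ := by positivity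
  have hM' : (0 : ℝ) < M := by exact_mod_cast hM
  set b : (Fin d → Fin M) → EuclideanSpace ℝ (Fin d) := fun i => gridPoint t' ζ fun k => J * i k
  have hbmem : ∀ i, b i ∈ cube t' (M * (J * ζ)) := by
    intro i k
    have h2 : ((i k : ℕ) : ℝ) + 1 ≤ M := by exact_mod_cast (i k).2
    simp only [b, gridPoint_apply]
    push_cast
    constructor
    · have : 0 ≤ ζ * (J * (i k : ℕ)) := by positivity
      linarith
    · have : ζ * (J * (i k : ℕ)) < M * (J * ζ) := by
        have : 0 < J * ζ := by positivity
        nlinarith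
      linarith
  have hcubeU : cube t' (M * (J * ζ)) ⊆ Metric.thickening δ D := by
    refine cube_subset_thickening (hT ht) (htt.trans_le (min_le_left _ _)) (by positivity) ?_
    have : M * (J * ζ) ≤ η₁ := hMη.trans (min_le_left _ _)
    nlinarith [Real.sqrt_nonneg (d : ℝ)]
  set E : (Fin d → Fin M) → Set Ω := fun i => {ω | c < X (b i) ω} with hE
  have hEge : ∀ i, gaussTail c / 2 ≤ P.real (E i) := by
    intro i
    refine hpoint t (hT ht) (b i) ?_
    have h1 := dist_le_of_mem_cube (by positivity) (hbmem i) (base_mem_cube t' (by positivity))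
    rw [← dist_eq_norm] at h1
    have h2 : √d * (M * (J * ζ)) ≤ √d * η := by gcongr
    have h3 : η * (1 + √d) ≤ η₂ := by
      rw [← le_div_iff₀ (by positivity)]
      exact min_le_right _ _
    nlinarith [dist_triangle (b i) t' t]
  have hlow := sum_measureReal_le_add (P := P) Finset.univ (E := E) fun i _ =>
    (h.field.hasGaussianLaw (hcubeU (hbmem i))).aemeasurable.nullMeasurable measurableSet_Ioi
  have hincl : (⋃ i ∈ Finset.univ, E i) ⊆ {ω | ∃ u ∈ cube t' (M * (J * ζ)), c < X u ω} := by
    intro ω hω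
    simp only [Set.mem_iUnion, Finset.mem_univ, exists_prop, true_and] at hω
    obtain ⟨i, hi⟩ := hω
    exact ⟨b i, hbmem i, hi⟩
  set F : Fin M → Fin M → ℝ := fun x y =>
    decay ((((J * y : ℕ) : ℤ) : ℝ) - ((J * x : ℕ) : ℤ)) ^ 2 with hF
  have hF0 : ∀ x y, 0 ≤ F x y := fun x y => sq_nonneg _
  have hbound : ∀ i : Fin d → Fin M, ∀ k, (((J * i k : ℕ) : ℝ) + 1) * ζ ≤ η₁ := by
    intro i k
    have h2 : ((i k : ℕ) : ℝ) + 1 ≤ M := by exact_mod_cast (i k).2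
    push_cast
    calc ((J : ℝ) * (i k : ℕ) + 1) * ζ ≤ M * J * ζ := by
          gcongr
          nlinarith
      _ = M * (J * ζ) := by ring
      _ ≤ η₁ := hMη.trans (min_le_left _ _)
  have hpairE : ∀ i j, P.real (E i ∩ E j) ≤ C * gaussTail c * ∏ k, F (i k) (j k) := by
    intro i j
    refine (measureReal_mono ?_).trans
      (hpair t ht t' (htt.trans_le (min_le_left _ _)) _ _ (hbound i) (hbound j))
    rintro ω ⟨h1, h2⟩
    exact ⟨⟨_, base_mem_cube _ hζ0, h1⟩, _, base_mem_cube _ hζ0, h2⟩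
  have h4 : ∑ x, ∑ y, F x y ≤ M * S := by
    have := sum_sum_decay_sq_le hsum (fun x : Fin M => ((J * x : ℕ) : ℤ)) (by
      intro x y hxy
      have h0 : J * (x : ℕ) = J * y := by
        simp only at hxy
        exact_mod_cast hxy
      exact Fin.ext (Nat.eq_of_mul_eq_mul_left hJ1' h0))
    simpa [hF] using this
  have h5 : ∑ x, ∑ y, (if x = y then 0 else F x y) ≤ M * (S / J) := by
    -- Of the two factors `decay (J z)` with `|z| ≥ 1`, one is at most `decay z` and is summed, the
    -- other is at most `1/J` and supplies the gain.
    have hx : ∀ x : Fin M, ∑ y, (if x = y then 0 else F x y) ≤ S / J := by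
      intro x
      have h1 := hsum Finset.univ (fun y : Fin M => ((y : ℕ) : ℤ) - (x : ℕ)) (by
        intro y _ z _ hyz
        exact Fin.ext (by simpa using hyz))
      rw [div_eq_mul_inv]
      refine le_trans ?_ (mul_le_mul_of_nonneg_right h1 (by positivity))
      rw [Finset.sum_mul]
      refine Finset.sum_le_sum fun y _ => ?_
      split_ifs with hxy
      · exact mul_nonneg (decay_nonneg _) (by positivity)
      · have hne : (1 : ℝ) ≤ |((y : ℕ) : ℝ) - (x : ℕ)| := by
          have h2 : ((y : ℕ) : ℤ) - (x : ℕ) ≠ 0 := by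
            intro h0
            exact hxy (Fin.ext (by omega))
          have := Int.one_le_abs h2
          exact_mod_cast this
        have e1 : (((J * y : ℕ) : ℤ) : ℝ) - ((J * x : ℕ) : ℤ) = J * (((y : ℕ) : ℝ) - (x : ℕ)) := by
          push_cast; ring
        have e2 : (((((y : ℕ) : ℤ) - (x : ℕ) : ℤ)) : ℝ) = ((y : ℕ) : ℝ) - (x : ℕ) := by push_cast; rfl
        simp only [hF]
        rw [e1, e2, sq]
        set z := ((y : ℕ) : ℝ) - (x : ℕ)
        have hz : |z| ≤ J * |z| := by nlinarith [abs_nonneg z]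
        refine mul_le_mul ?_ ?_ (decay_nonneg _) (decay_nonneg _)
        · rw [decay, decay, abs_mul, abs_of_pos hJ0]
          gcongr
        · rw [decay, abs_mul, abs_of_pos hJ0]
          gcongr
          nlinarith
    refine (Finset.sum_le_sum fun x _ => hx x).trans ?_
    simp
  have h6 : 0 ≤ ∑ x, ∑ y, F x y := Finset.sum_nonneg fun x _ => Finset.sum_nonneg fun y _ => hF0 x y
  have h7 : 0 ≤ ∑ x, ∑ y, (if x = y then 0 else F x y) :=
    Finset.sum_nonneg fun x _ => Finset.sum_nonneg fun y _ => by
      split_ifs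
      · exact le_rfl
      · exact hF0 x y
  have htotal : ∑ i, ∑ j, (if i = j then 0 else P.real (E i ∩ E j)) ≤
      C * gaussTail c * (d * ((M * S) ^ (d - 1) * (M * (S / J)))) := by
    have h3 := sum_sum_prod_le (d := d) (id : Fin M → Fin M) hF0
    have h1 : ∑ i, ∑ j, (if i = j then 0 else P.real (E i ∩ E j)) ≤
        C * gaussTail c * ∑ i : Fin d → Fin M, ∑ j : Fin d → Fin M,
          if (fun k => id (i k)) = (fun k => id (j k)) then 0 else ∏ k, F (i k) (j k) := by
      rw [Finset.mul_sum]
      refine Finset.sum_le_sum fun i _ => ?_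
      rw [Finset.mul_sum]
      refine Finset.sum_le_sum fun j _ => ?_
      simp only [id]
      split_ifs with hij
      · simp
      · exact hpairE i j
    refine h1.trans (mul_le_mul_of_nonneg_left (h3.trans ?_) (by positivity))
    simp only [id]
    gcongr
  have hfinal : (d : ℝ) * ((M * S) ^ (d - 1) * (M * (S / J))) = d * S ^ d / J * M ^ d := by
    rcases Nat.eq_zero_or_pos d with rfl | hd
    · simp
    · obtain ⟨e, rfl⟩ := Nat.exists_eq_add_of_lt hd
      simp only [zero_add, Nat.add_sub_cancel, mul_pow, pow_succ]
      field_simp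
  rw [hfinal] at htotal
  have h8 : C * (d * S ^ d / J) ≤ 1 / 4 := by
    rw [← mul_div_assoc, div_le_iff₀ hJ0]
    linarith
  have h9 : C * gaussTail c * (d * S ^ d / J * M ^ d) ≤ M ^ d * (gaussTail c / 4) := by
    have : 0 ≤ gaussTail c * (M : ℝ) ^ d := by positivity
    nlinarith
  have h10 : M ^ d * (gaussTail c / 2) ≤ ∑ i, P.real (E i) := by
    have e : (M : ℝ) ^ d * (gaussTail c / 2) = ∑ _i : Fin d → Fin M, gaussTail c / 2 := by simp
    rw [e]
    exact Finset.sum_le_sum fun i _ => hEge i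
  have h11 := measureReal_mono hincl (μ := P)
  linarith

end LocallyStationaryField

namespace LocallyStationaryField

variable {d : ℕ} {Ω : Type*} [MeasurableSpace Ω] {P : Measure Ω}
  {D : Set (EuclideanSpace ℝ (Fin d))} {δ : ℝ} {X : EuclideanSpace ℝ (Fin d) → Ω → ℝ} {α : ℝ}
  {L : ℝ → ℝ} {r : EuclideanSpace ℝ (Fin d) → EuclideanSpace ℝ (Fin d) → ℝ}

lemma cube_mono_side {t : EuclideanSpace ℝ (Fin d)} {ζ ζ' : ℝ} (h : ζ ≤ ζ') :
    cube t ζ ⊆ cube t ζ' := fun _ hu i => ⟨(hu i).1, (hu i).2.trans_le (by linarith)⟩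

set_option maxHeartbeats 1000000 in
/-- Cubes of side `K Δ` with `K` large, compared with blocks of a fixed size. -/
lemma exists_cube_approx_block (h : LocallyStationaryField P D δ X α L r)
    {T : Set (EuclideanSpace ℝ (Fin d))} (hT : T ⊆ D) {r₀ : ℝ} (hr₀ : 0 < r₀)
    (hr : ∀ t ∈ T, ∀ v ∈ Metric.sphere 0 1, r₀ ≤ r t v) :
    ∃ B > 0, ∃ f : ℕ → EuclideanSpace ℝ (Fin d) → ℝ, (∀ N, ∀ t ∈ T, f N t ≤ B) ∧
      ∀ ε > 0, ∃ N, ∃ K₀ > 0, ∃ η > 0, ∀ᶠ c in atTop, ∀ t ∈ T, ∀ t', dist t' t < η → ∀ K, K₀ ≤ K →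
        K * scale α L c ≤ η →
        |P.real {ω | ∃ u ∈ cube t' (K * scale α L c), c < X u ω} - gaussTail c * (K ^ d * f N t)| ≤
          ε * K ^ d * gaussTail c := by
  have hP := h.field.isProbabilityMeasure
  obtain ⟨a, ha, C, hC, hblock⟩ := h.exists_block_approx hT hr₀ hr
  set A : ℝ → EuclideanSpace ℝ (Fin d) → ℝ := fun K t => (pickCube α (r t) K).toReal with hA
  set f : ℕ → EuclideanSpace ℝ (Fin d) → ℝ := fun N t =>
    A (((N + 1 : ℕ) : ℝ) * a) t / (((N + 1 : ℕ) : ℝ) * a) ^ d with hf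
  have hf0 : ∀ N t, 0 ≤ f N t := fun N t => div_nonneg ENNReal.toReal_nonneg (by positivity)
  -- a uniform bound
  obtain ⟨B, hB0, hB⟩ : ∃ B > 0, ∀ N, ∀ t ∈ T, f N t ≤ B := by
    obtain ⟨⟨B₁, hB₁⟩, -⟩ := h.exists_pickCube_approx (K := a) (ε := 1) ha one_pos
    refine ⟨(|B₁| + C + 1) / a ^ d, by positivity, fun N t ht => ?_⟩
    have hN : (0 : ℝ) < ((N + 1 : ℕ) : ℝ) := by positivity
    have hN1 : (1 : ℝ) ≤ ((N + 1 : ℕ) : ℝ) := by push_cast; linarith [(Nat.cast_nonneg N : (0:ℝ) ≤ N)]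
    -- With blocks of a single cell the estimate compares the constant of side `(N + 1) a` with `(N
    -- + 1)^d` times that of side `a`, which gives a bound independent of `N`.
    obtain ⟨η₁, hη₁, h1⟩ := hblock 1 one_pos
    obtain ⟨-, η₂, hη₂, h2⟩ := h.exists_pickCube_approx (K := ((N + 1 : ℕ) : ℝ) * a) (ε := 1)
      (by positivity) one_pos
    obtain ⟨c, h1, h2, hΔ, hc⟩ := (h1.and (h2.and ((h.eventually_mul_scale_le
      (((N + 1 : ℕ) : ℝ) * a) hη₁).and (eventually_gt_atTop 0)))).exists
    have hψ := gaussTail_pos hc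
    have k1 := h1 t ht t (by simpa using hη₁) (N + 1) (Nat.succ_pos N)
      (by rw [Nat.cast_one, one_mul, ← mul_assoc]; exact hΔ)
    have k2 := h2 t (hT ht) t (by simpa using hη₂)
    rw [Nat.cast_one, one_mul, one_mul, one_pow, div_one, mul_one, ← mul_assoc] at k1
    have k3 : A a t ≤ |B₁| := ENNReal.toReal_le_of_le_ofReal (abs_nonneg _)
      ((hB₁ t (hT ht)).trans (ENNReal.ofReal_le_ofReal (le_abs_self _)))
    have k4 : gaussTail c * A (((N + 1 : ℕ) : ℝ) * a) t ≤
        gaussTail c * ((((N + 1 : ℕ) : ℝ)) ^ d * (|B₁| + C + 1)) := by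
      have e1 := (abs_le.1 k1).2
      have e2 := (abs_le.1 k2).1
      have e3 : (1 : ℝ) ≤ ((N + 1 : ℕ) : ℝ) ^ d := one_le_pow₀ hN1
      have e4 : ((N + 1 : ℕ) : ℝ) ^ d * (gaussTail c * A a t) ≤
        ((N + 1 : ℕ) : ℝ) ^ d * (gaussTail c * |B₁|) := by gcongr
      have e5 : 1 * gaussTail c ≤ ((N + 1 : ℕ) : ℝ) ^ d * gaussTail c := by gcongr
      simp only [hA] at e4 ⊢
      linarith
    have k5 := le_of_mul_le_mul_left k4 hψ
    simp only [hf]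
    rw [div_le_div_iff₀ (by positivity) (by positivity), mul_pow]
    have : 0 < a ^ d := by positivity
    nlinarith
  refine ⟨B, hB0, f, hB, fun ε hε => ?_⟩
  -- choice of `N`
  set C' := C / a ^ d with hC'
  have hinv : Tendsto (fun N : ℕ => 1 / ((N : ℝ) + 1)) atTop (𝓝 0) :=
    tendsto_one_div_add_atTop_nhds_zero_nat (𝕜 := ℝ)
  have hlim : Tendsto (fun N : ℕ => ((1 + 1 / ((N : ℝ) + 1)) ^ d - 1) * B +
      (1 + 1 / ((N : ℝ) + 1)) ^ d * (C' * (1 / ((N : ℝ) + 1))) +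
      (1 - (1 - 1 / ((N : ℝ) + 1)) ^ d) * B) atTop (𝓝 0) := by
    have h1 := (hinv.const_add 1).pow d
    have h2 := (hinv.const_sub 1).pow d
    have h3 := (((h1.sub_const 1).mul_const B).add (h1.mul (hinv.const_mul C'))).add
      ((h2.const_sub 1).mul_const B)
    simpa using h3
  obtain ⟨N, hN⟩ := (hlim.eventually (ge_mem_nhds hε)).exists
  set n : ℝ := ((N + 1 : ℕ) : ℝ) with hn
  have hnN : (N : ℝ) + 1 = n := by rw [hn]; push_cast; rfl
  have hn0 : 0 < n := by rw [hn]; positivity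
  have hn1 : 1 ≤ n := by rw [← hnN]; linarith [(Nat.cast_nonneg N : (0:ℝ) ≤ N)]
  simp only [hnN] at hN
  obtain ⟨η, hη, hev⟩ := hblock (N + 1) (Nat.succ_pos N)
  -- From this size on a cube contains at least `n` blocks per direction. Squeezing it between `M`
  -- and `M + 1` blocks then costs only factors `(1 ± 1/n)^d`.
  refine ⟨N, n * (n * a), by positivity, η / 2, by positivity, ?_⟩
  filter_upwards [hev, eventually_scale_pos h.isLeast, eventually_gt_atTop 0,
    h.eventually_mul_scale_le (√d * 1) (ε := 1) one_pos] with c hev hΔ hc _ t ht t' htt K hK hKη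
  have hψ := gaussTail_pos hc
  have hna : 0 < n * a := by positivity
  have hK0 : 0 < K := lt_of_lt_of_le (by positivity) hK
  set M := ⌊K / (n * a)⌋₊ with hM
  have hMn : n ≤ M := by
    have : N + 1 ≤ M := Nat.le_floor (by rw [le_div_iff₀ hna]; exact hK)
    rw [hn]
    exact_mod_cast this
  have hM1 : M * (n * a) ≤ K := by
    rw [← le_div_iff₀ hna]
    exact Nat.floor_le (by positivity)
  have hM2 : K < (M + 1) * (n * a) := by
    rw [← div_lt_iff₀ hna]
    exact Nat.lt_floor_add_one _
  have hM0 : 0 < M := by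
    have : (0 : ℝ) < M := hn0.trans_le hMn
    exact_mod_cast this
  have hfeq : A (n * a) t = (n * a) ^ d * f N t := by
    have : f N t = A (n * a) t / (n * a) ^ d := rfl
    rw [this]
    field_simp
  -- the estimate for `m` blocks
  have hmain : ∀ m : ℕ, 0 < m → m * (n * (a * scale α L c)) ≤ η →
      |P.real {ω | ∃ u ∈ cube t' (m * (n * (a * scale α L c))), c < X u ω} -
        gaussTail c * ((m * (n * a)) ^ d * f N t)| ≤
        gaussTail c * ((m * (n * a)) ^ d * (C' * (1 / n))) := by
    intro m hm hmη
    have := hev t ht t' (htt.trans (by linarith)) m hm hmη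
    rw [← hn] at this
    change |_ - _ * (_ * A (n * a) t)| ≤ _ at this
    rw [hfeq] at this
    refine le_trans (le_of_eq ?_) (this.trans (le_of_eq ?_))
    · congr 2
      rw [mul_pow (m : ℝ)]
      ring
    · rw [hC', mul_pow (m : ℝ), mul_pow n]
      field_simp
  have hsmall : M * (n * (a * scale α L c)) ≤ K * scale α L c := by
    calc M * (n * (a * scale α L c)) = M * (n * a) * scale α L c := by ring
      _ ≤ _ := by gcongr
  have hbig : K * scale α L c ≤ (M + 1 : ℕ) * (n * (a * scale α L c)) := by
    calc K * scale α L c ≤ (M + 1) * (n * a) * scale α L c := by gcongr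
      _ = _ := by push_cast; ring
  have hbigη : (M + 1 : ℕ) * (n * (a * scale α L c)) ≤ η := by
    have h1 : n * (a * scale α L c) ≤ M * (n * (a * scale α L c)) := by
      have : (1 : ℝ) ≤ M := hn1.trans hMn
      have : 0 < n * (a * scale α L c) := by positivity
      nlinarith
    push_cast
    linarith
  have k1 := (abs_le.1 (hmain M hM0 (hsmall.trans (hKη.trans (by linarith))))).1
  have k2 := (abs_le.1 (hmain (M + 1) (Nat.succ_pos M) hbigη)).2
  have k3 : P.real {ω | ∃ u ∈ cube t' (M * (n * (a * scale α L c))), c < X u ω} ≤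
      P.real {ω | ∃ u ∈ cube t' (K * scale α L c), c < X u ω} :=
    measureReal_mono fun ω ⟨u, hu, hcu⟩ => ⟨u, cube_mono_side hsmall hu, hcu⟩
  have k4 : P.real {ω | ∃ u ∈ cube t' (K * scale α L c), c < X u ω} ≤
      P.real {ω | ∃ u ∈ cube t' ((M + 1 : ℕ) * (n * (a * scale α L c))), c < X u ω} :=
    measureReal_mono fun ω ⟨u, hu, hcu⟩ => ⟨u, cube_mono_side hbig hu, hcu⟩
  have hnaK : n * a ≤ K * (1 / n) := by
    rw [mul_one_div, le_div_iff₀ hn0]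
    linarith
  have hup : (((M + 1 : ℕ) : ℝ) * (n * a)) ^ d ≤ K ^ d * (1 + 1 / n) ^ d := by
    rw [← mul_pow]
    refine pow_le_pow_left₀ (by positivity) ?_ d
    push_cast
    linarith
  have hn1' : 1 / n ≤ 1 := by rw [div_le_one hn0]; exact hn1
  have hdown : K ^ d * (1 - 1 / n) ^ d ≤ ((M : ℝ) * (n * a)) ^ d := by
    rw [← mul_pow]
    refine pow_le_pow_left₀ (mul_nonneg hK0.le (by linarith)) ?_ d
    linarith
  have hdown' : ((M : ℝ) * (n * a)) ^ d ≤ K ^ d := by gcongr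
  have hC'0 : 0 < C' := by positivity
  have hfB := hB N t ht
  have hf0' := hf0 N t
  have hKd : 0 < K ^ d := by positivity
  set x := 1 / n with hx
  have hx0 : 0 < x := by positivity
  have hp1 : 1 ≤ (1 + x) ^ d := one_le_pow₀ (by linarith)
  have hp2 : (1 - x) ^ d ≤ 1 := pow_le_one₀ (by linarith) (by linarith)
  have g1 : ((1 + x) ^ d - 1) * f N t ≤ ((1 + x) ^ d - 1) * B :=
    mul_le_mul_of_nonneg_left hfB (by linarith)
  have g2 : (1 - (1 - x) ^ d) * f N t ≤ (1 - (1 - x) ^ d) * B :=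
    mul_le_mul_of_nonneg_left hfB (by linarith)
  have g3 : 0 ≤ ((1 + x) ^ d - 1) * B := mul_nonneg (by linarith) hB0.le
  have g4 : 0 ≤ (1 - (1 - x) ^ d) * B := mul_nonneg (by linarith) hB0.le
  have g5 : C' * x ≤ (1 + x) ^ d * (C' * x) := by
    exact le_mul_of_one_le_left (by positivity) hp1
  rw [abs_le]
  constructor
  · have e1 : K ^ d * (f N t - ε) ≤ ((M : ℝ) * (n * a)) ^ d * f N t -
        ((M : ℝ) * (n * a)) ^ d * (C' * x) := by
      have e2 : K ^ d * (1 - x) ^ d * f N t ≤ ((M : ℝ) * (n * a)) ^ d * f N t := by gcongr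
      have e3 : ((M : ℝ) * (n * a)) ^ d * (C' * x) ≤ K ^ d * (C' * x) := by gcongr
      have e4 : K ^ d * (f N t - ε) ≤ K ^ d * ((1 - x) ^ d * f N t - C' * x) :=
        mul_le_mul_of_nonneg_left (by linarith) hKd.le
      linarith
    have e5 := mul_le_mul_of_nonneg_left e1 hψ.le
    linarith
  · have e1 : ((M + 1 : ℕ) * (n * a)) ^ d * f N t + ((M + 1 : ℕ) * (n * a)) ^ d * (C' * x) ≤
        K ^ d * (f N t + ε) := by
      have e2 : (((M + 1 : ℕ) : ℝ) * (n * a)) ^ d * f N t ≤ K ^ d * (1 + x) ^ d * f N t := by gcongr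
      have e3 : (((M + 1 : ℕ) : ℝ) * (n * a)) ^ d * (C' * x) ≤ K ^ d * (1 + x) ^ d * (C' * x) := by
        gcongr
      have e4 : K ^ d * ((1 + x) ^ d * f N t + (1 + x) ^ d * (C' * x)) ≤ K ^ d * (f N t + ε) :=
        mul_le_mul_of_nonneg_left (by linarith) hKd.le
      linarith
    have e5 := mul_le_mul_of_nonneg_left e1 hψ.le
    linarith

/-- Asymptotics for small cubes, uniformly over sets on which `r` is bounded away from `0`, together
with the existence and positivity of the limit constants. -/
theorem exists_cube_asymptotics (h : LocallyStationaryField P D δ X α L r)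
    {T : Set (EuclideanSpace ℝ (Fin d))} (hT : T ⊆ D) {r₀ : ℝ} (hr₀ : 0 < r₀)
    (hr : ∀ t ∈ T, ∀ v ∈ Metric.sphere 0 1, r₀ ≤ r t v) :
    (∀ t ∈ T, Tendsto (fun K : ℝ => (pickCube α (r t) K).toReal / K ^ d) atTop
      (𝓝 (pickands α (r t)))) ∧
    (∃ B₀ > 0, ∃ B₁, ∀ t ∈ T, B₀ ≤ pickands α (r t) ∧ pickands α (r t) ≤ B₁) ∧
    (∀ ε > 0, ∃ K > 0, ∀ t ∈ T, |(pickCube α (r t) K).toReal / K ^ d - pickands α (r t)| ≤ ε) ∧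
    ∀ ε > 0, ∃ K₀ > 0, ∃ η > 0, ∀ᶠ c in atTop, ∀ t ∈ T, ∀ t', dist t' t < η → ∀ K, K₀ ≤ K →
      K * scale α L c ≤ η →
      |P.real {ω | ∃ u ∈ cube t' (K * scale α L c), c < X u ω} -
        gaussTail c * (K ^ d * pickands α (r t))| ≤ ε * K ^ d * gaussTail c := by
  have hP := h.field.isProbabilityMeasure
  obtain ⟨B, hB0, f, hfB, happrox⟩ := h.exists_cube_approx_block hT hr₀ hr
  set A : ℝ → EuclideanSpace ℝ (Fin d) → ℝ := fun K t => (pickCube α (r t) K).toReal / K ^ d with hA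
  -- `A K t` and `f N t` both approximate the same cube probability divided by `ψ(c) K^d`;
  -- evaluating at one suitable `c` eliminates the probability.
  have hAf : ∀ ε > 0, ∃ N, ∃ K₀ > 0, ∀ K, K₀ ≤ K → ∀ t ∈ T, |A K t - f N t| ≤ ε := by
    intro ε hε
    obtain ⟨N, K₀, hK₀, η, hη, hev⟩ := happrox (ε / 2) (half_pos hε)
    refine ⟨N, K₀, hK₀, fun K hK t ht => ?_⟩
    have hK0 := hK₀.trans_le hK
    have hKd : 0 < K ^ d := by positivity
    obtain ⟨-, η', hη', hev'⟩ := h.exists_pickCube_approx (K := K) (ε := ε / 2 * K ^ d) hK0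
      (by positivity)
    obtain ⟨c, h1, h2, hΔ, hc⟩ := (hev.and (hev'.and ((h.eventually_mul_scale_le K hη).and
      (eventually_gt_atTop 0)))).exists
    have hψ := gaussTail_pos hc
    have k1 := abs_le.1 (h1 t ht t (by simpa using hη) K hK hΔ)
    have k2 := abs_le.1 (h2 t (hT ht) t (by simpa using hη'))
    have e : (pickCube α (r t) K).toReal = K ^ d * A K t := by
      simp only [hA]; field_simp
    rw [e] at k2
    have hpos : 0 < gaussTail c * K ^ d := by positivity
    rw [abs_le]
    constructor
    · refine le_of_mul_le_mul_left (a := gaussTail c * K ^ d) ?_ hpos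
      linarith
    · refine le_of_mul_le_mul_left (a := gaussTail c * K ^ d) ?_ hpos
      linarith
  -- Since `f N t` does not involve `K`, all `A K t` with `K ≥ K₀` lie close to one number. This is
  -- the Cauchy property, so `limUnder` is a genuine limit.
  have htends : ∀ t ∈ T, Tendsto (fun K => A K t) atTop (𝓝 (pickands α (r t))) := by
    intro t ht
    refine tendsto_nhds_limUnder ?_
    refine cauchySeq_tendsto_of_complete (Metric.cauchySeq_iff'.2 fun ε hε => ?_)
    obtain ⟨N, K₀, -, hK₀⟩ := hAf (ε / 4) (by positivity)
    refine ⟨K₀, fun K hK => ?_⟩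
    have k1 := abs_le.1 (hK₀ K hK t ht)
    have k2 := abs_le.1 (hK₀ K₀ le_rfl t ht)
    rw [Real.dist_eq, abs_lt]
    constructor <;> linarith
  have hlimf : ∀ ε > 0, ∀ N K₀, (∀ K, K₀ ≤ K → ∀ t ∈ T, |A K t - f N t| ≤ ε) →
      ∀ t ∈ T, |pickands α (r t) - f N t| ≤ ε := by
    intro ε hε N K₀ hK t ht
    refine le_of_tendsto ((htends t ht).sub_const (f N t)).abs ?_
    filter_upwards [eventually_ge_atTop K₀] with K hK' using hK K hK' t ht
  refine ⟨htends, ?_, ?_, ?_⟩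
  · obtain ⟨K₁, hK₁, η, hη, hev⟩ := h.exists_le_measure_cube hT hr₀ hr
    obtain ⟨N, K₀, -, hK₀⟩ := hAf 1 one_pos
    refine ⟨1 / 8 / K₁ ^ d, by positivity, B + 1, fun t ht => ⟨?_, ?_⟩⟩
    · have hsub : Tendsto (fun M : ℕ => ((M : ℝ) + 1) * K₁) atTop atTop :=
        (tendsto_natCast_atTop_atTop.atTop_add tendsto_const_nhds).atTop_mul_const hK₁
      refine ge_of_tendsto ((htends t ht).comp hsub) (Eventually.of_forall fun M => ?_)
      have hM0 : (0 : ℝ) < (M : ℝ) + 1 := by positivity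
      obtain ⟨-, η', hη', hev'⟩ := h.exists_pickCube_approx (K := ((M : ℝ) + 1) * K₁)
        (ε := 1 / 8) (by positivity) (by norm_num)
      obtain ⟨c, h1, h2, hΔ, hc⟩ := (hev.and (hev'.and ((h.eventually_mul_scale_le
        (((M : ℝ) + 1) * K₁) hη).and (eventually_gt_atTop 0)))).exists
      have hψ := gaussTail_pos hc
      have k1 := h1 t ht t (by simpa using hη) (M + 1) (Nat.succ_pos M)
        (by push_cast; rw [← mul_assoc]; exact hΔ)
      have k2 := (abs_le.1 (h2 t (hT ht) t (by simpa using hη'))).2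
      push_cast at k1
      rw [← mul_assoc] at k1
      have hM1 : (1 : ℝ) ≤ ((M : ℝ) + 1) ^ d := one_le_pow₀ (by
        linarith [(Nat.cast_nonneg M : (0 : ℝ) ≤ M)])
      have k3 : gaussTail c * (((M : ℝ) + 1) ^ d / 8) ≤
          gaussTail c * (pickCube α (r t) (((M : ℝ) + 1) * K₁)).toReal := by
        have : gaussTail c * 1 ≤ gaussTail c * ((M : ℝ) + 1) ^ d := by gcongr
        linarith
      have k4 := le_of_mul_le_mul_left k3 hψ
      simp only [Function.comp, hA]
      rw [mul_pow, div_le_div_iff₀ (by positivity) (by positivity)]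
      have : 0 < K₁ ^ d := by positivity
      nlinarith
    · have := (abs_le.1 (hlimf 1 one_pos N K₀ hK₀ t ht)).2
      linarith [hfB N t ht]
  · intro ε hε
    obtain ⟨N, K₀, hK₀0, hK₀⟩ := hAf (ε / 2) (half_pos hε)
    refine ⟨K₀, hK₀0, fun t ht => ?_⟩
    have k1 := abs_le.1 (hlimf _ (half_pos hε) N K₀ hK₀ t ht)
    have k2 := abs_le.1 (hK₀ K₀ le_rfl t ht)
    change |A K₀ t - _| ≤ ε
    rw [abs_le]
    constructor <;> linarith
  · intro ε hε
    obtain ⟨N, K₀, hK₀, η, hη, hev⟩ := happrox (ε / 2) (half_pos hε)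
    refine ⟨K₀, hK₀, η, hη, ?_⟩
    -- Closeness is derived anew because `N` has to be the index already fixed for the cube
    -- probabilities in `hev`.
    have hAf' : ∀ t ∈ T, |pickands α (r t) - f N t| ≤ ε / 2 := by
      refine hlimf _ (half_pos hε) N K₀ fun K hK t ht => ?_
      have hK0 := hK₀.trans_le hK
      have hKd : 0 < K ^ d := by positivity
      refine le_of_forall_pos_le_add fun e he => ?_
      obtain ⟨-, η', hη', hev'⟩ := h.exists_pickCube_approx (K := K) (ε := e * K ^ d) hK0
        (by positivity)
      obtain ⟨c, h1, h2, hΔ, hc⟩ := (hev.and (hev'.and ((h.eventually_mul_scale_le K hη).and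
        (eventually_gt_atTop 0)))).exists
      have hψ := gaussTail_pos hc
      have k1 := abs_le.1 (h1 t ht t (by simpa using hη) K hK hΔ)
      have k2 := abs_le.1 (h2 t (hT ht) t (by simpa using hη'))
      have e : (pickCube α (r t) K).toReal = K ^ d * A K t := by
        simp only [hA]; field_simp
      rw [e] at k2
      have hpos : 0 < gaussTail c * K ^ d := by positivity
      rw [abs_le]
      constructor
      · refine le_of_mul_le_mul_left (a := gaussTail c * K ^ d) ?_ hpos
        linarith
      · refine le_of_mul_le_mul_left (a := gaussTail c * K ^ d) ?_ hpos
        linarith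
    filter_upwards [hev, eventually_gt_atTop 0] with c hc hc0 t ht t' htt K hK hKη
    have k1 := abs_le.1 (hc t ht t' htt K hK hKη)
    have k2 := abs_le.1 (hAf' t ht)
    have hK0 := hK₀.trans_le hK
    have hpos : 0 < gaussTail c * K ^ d := mul_pos (gaussTail_pos hc0) (by positivity)
    have k3 := mul_le_mul_of_nonneg_left k2.1 hpos.le
    have k4 := mul_le_mul_of_nonneg_left k2.2 hpos.le
    rw [abs_le]
    constructor <;> linarith

end LocallyStationaryField

/-! ### Regularity in the parameter, and asymptotics for local and for separated cubes. -/

lemma UnitGaussianField.corr_sub_sq_le {T Ω : Type*} [TopologicalSpace T] [MeasurableSpace Ω]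
    {P : Measure Ω} {X : T → Ω → ℝ} {U : Set T} (h : UnitGaussianField P X U) {s s' t : T}
    (hs : s ∈ U) (hs' : s' ∈ U) (ht : t ∈ U) :
    (corr P X s t - corr P X s' t) ^ 2 ≤ 2 * (1 - corr P X s s') := by
  -- The variance of `X s - X s' - b X t` equals `2(1 - ρ(s, s')) - b²`. Hence continuity of the
  -- correlation at the diagonal propagates to all pairs.
  set b := corr P X s t - corr P X s' t with hb
  have h1 := h.integral_comb_sq hs hs' ht 1 (-1) (-b)
  have h2 : 0 ≤ ∫ ω, (1 * X s ω + (-1) * X s' ω + (-b) * X t ω) ^ 2 ∂P :=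
    integral_nonneg fun ω => sq_nonneg _
  rw [h1] at h2
  have e : b * corr P X s t - b * corr P X s' t = b ^ 2 := by rw [hb]; ring
  nlinarith

namespace LocallyStationaryField

variable {d : ℕ} {Ω : Type*} [MeasurableSpace Ω] {P : Measure Ω}
  {D : Set (EuclideanSpace ℝ (Fin d))} {δ : ℝ} {X : EuclideanSpace ℝ (Fin d) → Ω → ℝ} {α : ℝ}
  {L : ℝ → ℝ} {r : EuclideanSpace ℝ (Fin d) → EuclideanSpace ℝ (Fin d) → ℝ}

/-- The variogram bound at one fixed `c` already is a modulus of continuity for the correlation. -/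
lemma tendsto_corr_self (h : LocallyStationaryField P D δ X α L r)
    {s : EuclideanSpace ℝ (Fin d)} (hs : s ∈ Metric.thickening δ D) :
    Tendsto (fun s' => corr P X s s') (𝓝[Metric.thickening δ D] s) (𝓝 1) := by
  obtain ⟨C, hC, hev⟩ := h.vario_le one_pos
  obtain ⟨c, hc, hΔ, hc0⟩ := (hev.and ((eventually_scale_pos h.isLeast).and
    (eventually_gt_atTop 0))).exists
  have hβ : 0 < α / 2 := half_pos h.alpha_pos
  have hcont : Tendsto (fun s' => C * (‖s' - s‖ / scale α L c) ^ (α / 2) / (2 * c ^ 2))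
      (𝓝[Metric.thickening δ D] s) (𝓝 0) := by
    have h1 : ContinuousAt (fun s' => C * (‖s' - s‖ / scale α L c) ^ (α / 2) / (2 * c ^ 2)) s := by
      refine ContinuousAt.div_const (ContinuousAt.const_mul ?_ _) _
      refine ContinuousAt.rpow_const (by fun_prop) (Or.inr hβ.le)
    have h2 := h1.tendsto
    simp only [sub_self, norm_zero, zero_div, Real.zero_rpow hβ.ne', mul_zero] at h2
    exact h2.mono_left nhdsWithin_le_nhds
  have hsq : Tendsto (fun s' => 1 - corr P X s s') (𝓝[Metric.thickening δ D] s) (𝓝 0) := by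
    refine squeeze_zero' ?_ ?_ hcont
    · filter_upwards [self_mem_nhdsWithin] with s' hs'
      linarith [h.field.corr_le_one hs hs']
    · have hball : Metric.closedBall s (1 * scale α L c) ∈ 𝓝[Metric.thickening δ D] s :=
        mem_nhdsWithin_of_mem_nhds (Metric.closedBall_mem_nhds _ (by positivity))
      filter_upwards [self_mem_nhdsWithin, hball] with s' hs' hd
      rw [mem_closedBall_iff_norm] at hd
      have h1 := hc s hs s' hs' hd
      rw [vario] at h1
      rw [le_div_iff₀ (by positivity)]
      linarith
  simpa using hsq.const_sub 1

lemma continuousOn_corr (h : LocallyStationaryField P D δ X α L r) :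
    ContinuousOn (fun z : EuclideanSpace ℝ (Fin d) × EuclideanSpace ℝ (Fin d) => corr P X z.1 z.2)
      (Metric.thickening δ D ×ˢ Metric.thickening δ D) := by
  rintro ⟨s, t⟩ ⟨hs, ht⟩
  set U := Metric.thickening δ D
  have h0 : ∀ s ∈ U, Tendsto (fun s' => √(2 * (1 - corr P X s s'))) (𝓝[U] s) (𝓝 0) := by
    intro s hs
    have := (((h.tendsto_corr_self hs).const_sub 1).const_mul 2).sqrt
    simpa using this
  have hle : ∀ s ∈ U, ∀ s' ∈ U, ∀ t ∈ U, |corr P X s' t - corr P X s t| ≤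
      √(2 * (1 - corr P X s s')) := by
    intro s hs s' hs' t ht
    rw [abs_sub_comm]
    exact Real.abs_le_sqrt (h.field.corr_sub_sq_le hs hs' ht)
  rw [ContinuousWithinAt, tendsto_iff_norm_sub_tendsto_zero, nhdsWithin_prod_eq]
  have h1 : Tendsto (fun z : EuclideanSpace ℝ (Fin d) × EuclideanSpace ℝ (Fin d) =>
      √(2 * (1 - corr P X s z.1)) + √(2 * (1 - corr P X t z.2))) (𝓝[U] s ×ˢ 𝓝[U] t) (𝓝 0) := by
    simpa using ((h0 s hs).comp tendsto_fst).add ((h0 t ht).comp tendsto_snd)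
  refine squeeze_zero' (Eventually.of_forall fun _ => norm_nonneg _) ?_ h1
  filter_upwards [prod_mem_prod self_mem_nhdsWithin self_mem_nhdsWithin] with z hz
  have k1 := hle s hs z.1 hz.1 z.2 hz.2
  have k2 := hle t ht z.2 hz.2 s hs
  rw [corr_comm P X z.2 s, corr_comm P X t s] at k2
  rw [Real.norm_eq_abs]
  calc |corr P X z.1 z.2 - corr P X s t|
      = |(corr P X z.1 z.2 - corr P X s z.2) + (corr P X s z.2 - corr P X s t)| := by ring_nf
    _ ≤ _ := (abs_add_le _ _).trans (add_le_add k1 k2)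

lemma exists_le_r_at (h : LocallyStationaryField P D δ X α L r) {t : EuclideanSpace ℝ (Fin d)}
    (ht : t ∈ Metric.thickening δ D) : ∃ r₀ > 0, ∀ v ∈ Metric.sphere 0 1, r₀ ≤ r t v := by
  rcases (Metric.sphere (0 : EuclideanSpace ℝ (Fin d)) 1).eq_empty_or_nonempty with he | hne
  · exact ⟨1, one_pos, by simp [he]⟩
  · obtain ⟨v, hv, hmin⟩ := (isCompact_sphere (0 : EuclideanSpace ℝ (Fin d)) 1).exists_isMinOn
      hne (h.r_cont t ht)
    exact ⟨r t v, h.r_pos t ht v hv, fun w hw => hmin hw⟩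

/-- On bounded sets `r` is bounded away from `0`. -/
lemma exists_le_r (h : LocallyStationaryField P D δ X α L r) (hD : Bornology.IsBounded D) :
    ∃ r₀ > 0, ∀ t ∈ D, ∀ v ∈ Metric.sphere 0 1, r₀ ≤ r t v := by
  have hclU : closure D ⊆ Metric.thickening δ D := Metric.closure_subset_thickening h.delta_pos D
  have hcomp : IsCompact (closure D) := hD.isCompact_closure
  -- A positive lower bound holds at each point by compactness of the sphere and persists nearby by
  -- uniform continuity of `r`. Compactness of `closure D`, which lies in the thickening, leaves
  -- finitely many bounds.
  obtain ⟨r₀, hr₀, hr⟩ := hcomp.induction_on (p := fun S => ∃ r₀ > 0, ∀ t ∈ S,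
      t ∈ Metric.thickening δ D → ∀ v ∈ Metric.sphere 0 1, r₀ ≤ r t v)
    ⟨1, one_pos, by simp⟩
    (fun S S' hSS ⟨r₀, h0, hr⟩ => ⟨r₀, h0, fun t ht => hr t (hSS ht)⟩)
    (fun S S' ⟨r₀, h0, hr⟩ ⟨r₁, h1, hr'⟩ => ⟨min r₀ r₁, lt_min h0 h1, fun t ht htU v hv => by
      rcases ht with ht | ht
      · exact (min_le_left _ _).trans (hr t ht htU v hv)
      · exact (min_le_right _ _).trans (hr' t ht htU v hv)⟩)
    (fun x hx => by
      obtain ⟨m, hm0, hm⟩ := h.exists_le_r_at (hclU hx)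
      obtain ⟨η, hη, hu⟩ := h.r_unif (m / 2) (by positivity)
      refine ⟨Metric.ball x η, mem_nhdsWithin_of_mem_nhds (Metric.ball_mem_nhds x hη), m / 2,
        by positivity, fun t ht htU v hv => ?_⟩
      have h1 := (abs_le.1 (hu x (hclU hx) t htU ht v hv)).2
      linarith [hm v hv])
  exact ⟨r₀, hr₀, fun t ht => hr t (subset_closure ht) (hclU (subset_closure ht))⟩

/-- The constants depend uniformly continuously on the parameter. -/
lemma exists_pickands_close (h : LocallyStationaryField P D δ X α L r) {r₀ : ℝ} (hr₀ : 0 < r₀)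
    (hr : ∀ t ∈ D, ∀ v ∈ Metric.sphere 0 1, r₀ ≤ r t v) {ε : ℝ} (hε : 0 < ε) :
    ∃ η > 0, ∀ s ∈ D, ∀ t ∈ D, dist s t < η → |pickands α (r s) - pickands α (r t)| ≤ ε := by
  obtain ⟨-, -, hlim, -⟩ := h.exists_cube_asymptotics le_rfl hr₀ hr
  obtain ⟨K, hK, hKt⟩ := hlim (ε / 4) (by positivity)
  have hKd : 0 < K ^ d := by positivity
  obtain ⟨-, η, hη, hev⟩ := h.exists_pickCube_approx (K := K) (ε := ε / 4 * K ^ d) hK (by positivity)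
  refine ⟨η, hη, fun s hs t ht hst => ?_⟩
  obtain ⟨c, h1, hc⟩ := (hev.and (eventually_gt_atTop 0)).exists
  have hψ := gaussTail_pos hc
  -- One probability, for the cube based at `s`, is approximated with the constant of the nearby `t`
  -- and with that of `s` itself; so the constants are close.
  have k1 := abs_le.1 (h1 t ht s hst)
  have k2 := abs_le.1 (h1 s hs s (by simpa using hη))
  have k3 := abs_le.1 (hKt s hs)
  have k4 := abs_le.1 (hKt t ht)
  set A : EuclideanSpace ℝ (Fin d) → ℝ := fun t => (pickCube α (r t) K).toReal / K ^ d with hA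
  have e : ∀ t, (pickCube α (r t) K).toReal = K ^ d * A t := fun t => by
    simp only [hA]; field_simp
  rw [e] at k1 k2
  have hpos : 0 < gaussTail c * K ^ d := by positivity
  have k5 : A s - A t ≤ ε / 2 := by
    refine le_of_mul_le_mul_left (a := gaussTail c * K ^ d) ?_ hpos
    linarith
  have k6 : A t - A s ≤ ε / 2 := by
    refine le_of_mul_le_mul_left (a := gaussTail c * K ^ d) ?_ hpos
    linarith
  have k3' : -(ε / 4) ≤ A s - pickands α (r s) ∧ A s - pickands α (r s) ≤ ε / 4 := k3
  have k4' : -(ε / 4) ≤ A t - pickands α (r t) ∧ A t - pickands α (r t) ≤ ε / 4 := k4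
  rw [abs_le]
  constructor <;> linarith

/-- Local asymptotics for cubes which are large compared with `Δ` and small in absolute terms. -/
theorem tendstoUniformlyOn_cube (h : LocallyStationaryField P D δ X α L r) {r₀ : ℝ} (hr₀ : 0 < r₀)
    (hr : ∀ t ∈ D, ∀ v ∈ Metric.sphere 0 1, r₀ ≤ r t v) {ℓ : ℝ → ℝ} (hℓ : Tendsto ℓ atTop atTop)
    (hℓo : ℓ =o[atTop] (fun c => (scale α L c)⁻¹)) :
    TendstoUniformlyOn (fun c t => P.real (supExceeds X (cube t (ℓ c * scale α L c)) c) /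
      (ℓ c ^ d * gaussTail c * pickands α (r t))) (fun _ => 1) atTop D := by
  obtain ⟨-, ⟨B₀, hB₀, B₁, hB⟩, -, hcube⟩ := h.exists_cube_asymptotics le_rfl hr₀ hr
  rw [Metric.tendstoUniformlyOn_iff]
  intro ε hε
  -- The factor `B₀`, a lower bound for the constants, converts the absolute error into a relative
  -- one. The condition `ℓ = o(Δ⁻¹)` enters as `ℓ Δ ≤ η`.
  obtain ⟨K₀, hK₀, η, hη, hev⟩ := hcube (ε / 2 * B₀) (by positivity)
  filter_upwards [hev, hℓ.eventually_ge_atTop K₀, hℓo.def hη, eventually_scale_pos h.isLeast,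
    eventually_gt_atTop 0] with c hc hK hℓη hΔ hc0 t ht
  have hK0 := hK₀.trans_le hK
  have hψ := gaussTail_pos hc0
  rw [Real.norm_of_nonneg hK0.le, Real.norm_of_nonneg (inv_nonneg.2 hΔ.le), ← div_eq_mul_inv,
    le_div_iff₀ hΔ] at hℓη
  have k1 := hc t ht t (by simpa using hη) (ℓ c) hK hℓη
  have hH : 0 < pickands α (r t) := hB₀.trans_le (hB t ht).1
  have hden : 0 < ℓ c ^ d * gaussTail c * pickands α (r t) := by positivity
  rw [dist_comm, Real.dist_eq, supExceeds_eq, div_sub_one hden.ne', abs_div, abs_of_pos hden,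
    div_lt_iff₀ hden]
  have e : gaussTail c * (ℓ c ^ d * pickands α (r t)) =
    ℓ c ^ d * gaussTail c * pickands α (r t) := by ring
  rw [e] at k1
  refine k1.trans_lt ?_
  have hpos : 0 < ℓ c ^ d * gaussTail c := by positivity
  calc ε / 2 * B₀ * ℓ c ^ d * gaussTail c = (ℓ c ^ d * gaussTail c) * (ε / 2 * B₀) := by ring
    _ ≤ (ℓ c ^ d * gaussTail c) * (ε / 2 * pickands α (r t)) := by gcongr; exact (hB t ht).1
    _ < (ℓ c ^ d * gaussTail c) * (ε * pickands α (r t)) := by gcongr; linarith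
    _ = _ := by ring

/-- Double exceedances in well separated cubes are negligible. -/
lemma eventually_separated_le (h : LocallyStationaryField P D δ X α L r) {ζ τ ε : ℝ} (hζ : 0 < ζ)
    (hτ : 0 < τ) (hε : 0 < ε) {p q : EuclideanSpace ℝ (Fin d)}
    (hp : cube p ζ ⊆ Metric.thickening δ D) (hq : cube q ζ ⊆ Metric.thickening δ D)
    (hcorr : ∀ u ∈ cube p ζ, ∀ v ∈ cube q ζ, corr P X u v ≤ 1 - τ) :
    ∀ᶠ c in atTop, P.real {ω | (∃ u ∈ cube p ζ, c < X u ω) ∧ ∃ u ∈ cube q ζ, c < X u ω} ≤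
      ε * (gaussTail c * (scale α L c ^ d)⁻¹) := by
  have hP := h.field.isProbabilityMeasure
  obtain ⟨a₀, ha₀, C, hC, hcells⟩ := h.exists_cell_size
  obtain ⟨C₁, hC₁, n, hinv⟩ := scale_inv_le h.alpha_pos h.slow h.isLeast h.tendsto_scale
  set B := ζ / a₀ + 1 with hB
  have hB0 : 0 < B := by positivity
  -- There are at most `(B/Δ)^{2d}` pairs of cells. One factor `Δ^{-d}` is kept in the bound; the
  -- other is polynomial in `c` and is beaten by the gain `exp(-τ c²/16)`, where `vario/32 ≥ τ
  -- c²/16`.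
  have hlim : Tendsto (fun c : ℝ => C * (B ^ d * B ^ d) * (C₁ * c ^ n) ^ d *
      Real.exp (-(τ / 16 * c ^ 2))) atTop (𝓝 0) := by
    have h1 : Tendsto (fun x : ℝ => x ^ (n * d) * Real.exp (-x)) atTop (𝓝 0) :=
      Real.tendsto_pow_mul_exp_neg_atTop_nhds_zero (n * d)
    have h2 : Tendsto (fun c : ℝ => τ / 16 * c ^ 2) atTop atTop :=
      (tendsto_pow_atTop two_ne_zero).const_mul_atTop (by positivity)
    have h3 := (h1.comp h2).const_mul (C * (B ^ d * B ^ d) * C₁ ^ d * ((τ / 16) ^ (n * d))⁻¹)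
    rw [mul_zero] at h3
    refine squeeze_zero' ?_ ?_ h3
    · filter_upwards [eventually_gt_atTop 0] with c hc
      positivity
    · filter_upwards [eventually_ge_atTop 1] with c hc
      have hc0 : 0 < c := by linarith
      simp only [Function.comp]
      have e : (C₁ * c ^ n) ^ d = C₁ ^ d * c ^ (n * d) := by rw [mul_pow, ← pow_mul]
      have e2 : c ^ (n * d) ≤ (c ^ 2) ^ (n * d) := by
        gcongr
        nlinarith
      rw [e, mul_pow (τ / 16)]
      calc _ ≤ C * (B ^ d * B ^ d) * (C₁ ^ d * (c ^ 2) ^ (n * d)) * Real.exp (-(τ / 16 * c ^ 2)) := by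
            gcongr
        _ = _ := by
            field_simp
  filter_upwards [hcells, hinv, eventually_scale_pos h.isLeast, hlim.eventually (ge_mem_nhds hε),
    eventually_gt_atTop 0, h.eventually_mul_scale_le 1 one_pos] with c hcells hinv hΔ hsmall hc hΔ1
  rw [one_mul] at hΔ1
  have hψ := gaussTail_pos hc
  set Δ := scale α L c with hΔd
  -- The number of cells per direction is rounded up, so that cells of side exactly `ζ/N ≤ a₀ Δ`
  -- tile the cube.
  set N := ⌈ζ / (a₀ * Δ)⌉₊ with hN
  have hN0 : 0 < N := Nat.ceil_pos.2 (by positivity)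
  have hN0' : (0 : ℝ) < N := by exact_mod_cast hN0
  have hNle : (N : ℝ) ≤ B * Δ⁻¹ := by
    have h1 := (Nat.ceil_lt_add_one (by positivity : 0 ≤ ζ / (a₀ * Δ))).le
    have h2 : 1 ≤ Δ⁻¹ := (one_le_inv₀ hΔ).2 hΔ1
    calc (N : ℝ) ≤ ζ / (a₀ * Δ) + 1 := h1
      _ ≤ ζ / a₀ * Δ⁻¹ + Δ⁻¹ := by
          gcongr
          apply le_of_eq
          field_simp
      _ = _ := by rw [hB]; ring
  set a := ζ / (N * Δ) with ha
  have ha0 : 0 < a := by positivity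
  have haa : a ≤ a₀ := by
    have h1 := Nat.le_ceil (ζ / (a₀ * Δ))
    rw [div_le_iff₀ (by positivity)] at h1
    rw [ha, div_le_iff₀ (by positivity)]
    calc ζ ≤ N * (a₀ * Δ) := h1
      _ = _ := by ring
  have haΔ : N * (a * Δ) = ζ := by rw [ha]; field_simp
  have hdec : ∀ p : EuclideanSpace ℝ (Fin d), cube p ζ =
      ⋃ n : Fin d → Fin N, cube (gridPoint p (a * Δ) fun k => n k) (a * Δ) := fun p => by
    rw [← haΔ]
    exact cube_eq_iUnion p (by positivity) hN0
  have hsub : ∀ p (n : Fin d → Fin N), cube (gridPoint p (a * Δ) fun k => n k) (a * Δ) ⊆ cube p ζ :=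
    fun p n => by
      rw [hdec p]
      exact Set.subset_iUnion (fun n : Fin d → Fin N =>
        cube (gridPoint p (a * Δ) fun k => n k) (a * Δ)) n
  have hincl : {ω | (∃ u ∈ cube p ζ, c < X u ω) ∧ ∃ u ∈ cube q ζ, c < X u ω} ⊆
      ⋃ m : Fin d → Fin N, ⋃ n : Fin d → Fin N,
        {ω | (∃ u ∈ cube (gridPoint p (a * Δ) fun k => m k) (a * Δ), c < X u ω) ∧
          ∃ u ∈ cube (gridPoint q (a * Δ) fun k => n k) (a * Δ), c < X u ω} := by
    rintro ω ⟨⟨u, hu, hcu⟩, v, hv, hcv⟩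
    rw [hdec, Set.mem_iUnion] at hu hv
    obtain ⟨m, hm⟩ := hu
    obtain ⟨n, hn⟩ := hv
    exact Set.mem_iUnion.2 ⟨m, Set.mem_iUnion.2 ⟨n, ⟨u, hm, hcu⟩, v, hn, hcv⟩⟩
  have hpair : ∀ m n : Fin d → Fin N,
      P.real {ω | (∃ u ∈ cube (gridPoint p (a * Δ) fun k => m k) (a * Δ), c < X u ω) ∧
          ∃ u ∈ cube (gridPoint q (a * Δ) fun k => n k) (a * Δ), c < X u ω} ≤
        C * gaussTail c * Real.exp (-(τ / 16 * c ^ 2)) := by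
    intro m n
    refine ((hcells a ha0 haa).2 _ _ ((hsub p m).trans hp) ((hsub q n).trans hq)).trans ?_
    gcongr
    have := hcorr _ (hsub p m (base_mem_cube _ (by positivity))) _
      (hsub q n (base_mem_cube _ (by positivity)))
    rw [vario]
    nlinarith [sq_nonneg c]
  have htot : P.real {ω | (∃ u ∈ cube p ζ, c < X u ω) ∧ ∃ u ∈ cube q ζ, c < X u ω} ≤
      (N : ℝ) ^ d * ((N : ℝ) ^ d * (C * gaussTail c * Real.exp (-(τ / 16 * c ^ 2)))) := by
    refine (measureReal_mono hincl).trans ((measureReal_iUnion_fintype_le _).trans ?_)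
    refine (Finset.sum_le_sum fun m _ => (measureReal_iUnion_fintype_le _).trans
      (Finset.sum_le_sum fun n _ => hpair m n)).trans (le_of_eq ?_)
    simp
  refine htot.trans ?_
  calc (N : ℝ) ^ d * ((N : ℝ) ^ d * (C * gaussTail c * Real.exp (-(τ / 16 * c ^ 2))))
      ≤ (B * Δ⁻¹) ^ d * ((B * Δ⁻¹) ^ d * (C * gaussTail c * Real.exp (-(τ / 16 * c ^ 2)))) := by
        gcongr
    _ = C * (B ^ d * B ^ d) * (Δ⁻¹) ^ d * Real.exp (-(τ / 16 * c ^ 2)) *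
        (gaussTail c * (Δ ^ d)⁻¹) := by
        rw [mul_pow, inv_pow]; ring
    _ ≤ C * (B ^ d * B ^ d) * (C₁ * c ^ n) ^ d * Real.exp (-(τ / 16 * c ^ 2)) *
        (gaussTail c * (Δ ^ d)⁻¹) := by gcongr
    _ ≤ _ := by gcongr

end LocallyStationaryField

/-- For cells, which are convex: a cell meeting `D` without being contained in it touches the
frontier, so it lies in a thin neighbourhood of a null set. -/
lemma inter_frontier_nonempty {T : Type*} [TopologicalSpace T] {s t : Set T}
    (hs : IsPreconnected s) (h1 : (s ∩ t).Nonempty) (h2 : (s ∩ tᶜ).Nonempty) :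
    (s ∩ frontier t).Nonempty := by
  by_contra hne
  rw [Set.not_nonempty_iff_eq_empty, Set.eq_empty_iff_forall_notMem] at hne
  have hmem : ∀ x ∈ s, x ∈ closure t → x ∈ interior t := fun x hx hxt => by
    by_contra hc
    exact hne x ⟨hx, hxt, hc⟩
  obtain ⟨a, ha, hat⟩ := h1
  obtain ⟨b, hb, hbt⟩ := h2
  obtain ⟨y, -, hy1, hy2⟩ := hs (interior t) (closure t)ᶜ isOpen_interior isClosed_closure.isOpen_compl
    (fun x hx => by
      by_cases hc : x ∈ closure t
      · exact Or.inl (hmem x hx hc)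
      · exact Or.inr hc)
    ⟨a, ha, hmem a ha (subset_closure hat)⟩
    ⟨b, hb, fun hc => hbt (interior_subset (hmem b hb hc))⟩
  exact hy2 (subset_closure (interior_subset hy1))

/-! ### Partitions into cubes and Riemann sums. -/

section CubePartition

variable {d : ℕ}

lemma cube_eq_iInter (t : EuclideanSpace ℝ (Fin d)) (ζ : ℝ) :
    cube t ζ = ⋂ i, (fun u : EuclideanSpace ℝ (Fin d) => u i) ⁻¹' Set.Ico (t i) (t i + ζ) := by
  ext u
  simp [cube]

lemma measurableSet_cube (t : EuclideanSpace ℝ (Fin d)) (ζ : ℝ) : MeasurableSet (cube t ζ) := by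
  rw [cube_eq_iInter]
  exact MeasurableSet.iInter fun i => measurableSet_Ico.preimage (by fun_prop)

lemma convex_cube (t : EuclideanSpace ℝ (Fin d)) (ζ : ℝ) : Convex ℝ (cube t ζ) := by
  rw [cube_eq_iInter]
  exact convex_iInter fun i => (convex_Ico _ _).linear_preimage
    (EuclideanSpace.proj (𝕜 := ℝ) i : EuclideanSpace ℝ (Fin d) →L[ℝ] ℝ).toLinearMap

lemma volume_cube (t : EuclideanSpace ℝ (Fin d)) {ζ : ℝ} (hζ : 0 ≤ ζ) :
    volume (cube t ζ) = ENNReal.ofReal (ζ ^ d) := by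
  have h := (PiLp.volume_preserving_ofLp (Fin d)).measure_preimage
    (s := Set.univ.pi fun i => Set.Ico (t i) (t i + ζ))
    (MeasurableSet.univ_pi fun i => measurableSet_Ico).nullMeasurableSet
  have e : cube t ζ = (WithLp.ofLp : EuclideanSpace ℝ (Fin d) → Fin d → ℝ) ⁻¹'
      (Set.univ.pi fun i => Set.Ico (t i) (t i + ζ)) := by
    ext u
    simp [cube]
  rw [e, h, Real.volume_pi_Ico]
  simp [ENNReal.ofReal_pow hζ]

lemma volume_real_cube (t : EuclideanSpace ℝ (Fin d)) {ζ : ℝ} (hζ : 0 ≤ ζ) :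
    volume.real (cube t ζ) = ζ ^ d := by
  rw [measureReal_def, volume_cube t hζ, ENNReal.toReal_ofReal (by positivity)]

lemma disjoint_cube_gridPoint (t : EuclideanSpace ℝ (Fin d)) {ζ : ℝ} (hζ : 0 < ζ) {m n : Fin d → ℕ}
    (hmn : m ≠ n) : Disjoint (cube (gridPoint t ζ m) ζ) (cube (gridPoint t ζ n) ζ) := by
  rw [Set.disjoint_left]
  intro u hu hv
  refine hmn (funext fun i => ?_)
  have h1 := hu i
  have h2 := hv i
  simp only [gridPoint_apply] at h1 h2
  have h3 : (m i : ℝ) < n i + 1 := by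
    by_contra hc
    push Not at hc
    nlinarith
  have h4 : (n i : ℝ) < m i + 1 := by
    by_contra hc
    push Not at hc
    nlinarith
  have h3' : m i < n i + 1 := by exact_mod_cast h3
  have h4' : n i < m i + 1 := by exact_mod_cast h4
  omega

lemma exists_subset_cube {D : Set (EuclideanSpace ℝ (Fin d))} (hD : Bornology.IsBounded D) :
    ∃ (o : EuclideanSpace ℝ (Fin d)) (R : ℝ), 0 < R ∧ D ⊆ cube o R := by
  obtain ⟨R, hR, hsub⟩ := hD.subset_ball_lt 0 0
  refine ⟨WithLp.toLp 2 fun _ => -R, 2 * R, by positivity, fun u hu i => ?_⟩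
  have h1 := hsub hu
  rw [mem_ball_zero_iff] at h1
  have h2 := (PiLp.norm_apply_le u i).trans_lt h1
  rw [Real.norm_eq_abs, abs_lt] at h2
  change -R ≤ u i ∧ u i < -R + 2 * R
  constructor <;> linarith

/-- `D` need not be Borel; since its frontier is null it may be replaced by its interior. -/
lemma integrableOn_of_null_frontier {D : Set (EuclideanSpace ℝ (Fin d))}
    (hD : Bornology.IsBounded D) (hfr : volume (frontier D) = 0)
    {H : EuclideanSpace ℝ (Fin d) → ℝ} {B : ℝ} (hB : ∀ t ∈ D, |H t| ≤ B) (hH : ContinuousOn H D) :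
    IntegrableOn H D volume := by
  have hint : interior D =ᵐ[volume] D := interior_ae_eq_of_null_frontier hfr
  have hbdd := hD.subset interior_subset
  refine IntegrableOn.congr_set_ae ?_ hint.symm
  have : IsFiniteMeasure (volume.restrict (interior D)) :=
    ⟨by rw [Measure.restrict_apply_univ]; exact hbdd.measure_lt_top⟩
  refine Integrable.of_bound ((hH.mono interior_subset).aestronglyMeasurable
    isOpen_interior.measurableSet) B ?_
  filter_upwards [ae_restrict_mem isOpen_interior.measurableSet] with t ht
  exact hB t (interior_subset ht)

/-- Riemann sums over the cells of a fine grid, either all cells which meet `D` or only those which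
are contained in `D`. -/
theorem exists_riemann_partition {D : Set (EuclideanSpace ℝ (Fin d))}
    (hD : Bornology.IsBounded D) (hfr : volume (frontier D) = 0)
    {H : EuclideanSpace ℝ (Fin d) → ℝ} {B : ℝ} (hB0 : 0 ≤ B) (hB : ∀ t ∈ D, |H t| ≤ B)
    (hH : ∀ ε > 0, ∃ η > 0, ∀ s ∈ D, ∀ t ∈ D, dist s t < η → |H s - H t| ≤ ε)
    (hHi : IntegrableOn H D volume) :
    ∃ V ≥ 0, ∀ ε > 0, ∀ ζ₀ > 0, ∃ ζ > 0, ζ ≤ ζ₀ ∧ ∃ (N : ℕ)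
      (x τ : (Fin d → Fin N) → EuclideanSpace ℝ (Fin d)) (meet good : Finset (Fin d → Fin N)),
      (∀ n ∈ meet, τ n ∈ D ∧ τ n ∈ cube (x n) ζ) ∧ good ⊆ meet ∧ (∀ n ∈ good, cube (x n) ζ ⊆ D) ∧
      D ⊆ (⋃ n ∈ meet, cube (x n) ζ) ∧
      (∀ m n, m ≠ n → Disjoint (cube (x m) ζ) (cube (x n) ζ)) ∧
      |∑ n ∈ meet, ζ ^ d * H (τ n) - ∫ t in D, H t| ≤ ε ∧
      |∑ n ∈ good, ζ ^ d * H (τ n) - ∫ t in D, H t| ≤ ε ∧ (meet.card : ℝ) * ζ ^ d ≤ V := by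
  classical
  obtain ⟨o, R, hR, hDR⟩ := exists_subset_cube hD
  -- The volume of an enclosing cube bounds the total volume of the cells for every mesh.
  refine ⟨R ^ d, by positivity, fun ε hε ζ₀ hζ₀ => ?_⟩
  obtain ⟨η, hη, hHη⟩ := hH (ε / (2 * (R ^ d + 1))) (by positivity)
  have hfb : Bornology.IsBounded (frontier D) := hD.closure.subset frontier_subset_closure
  have hthick : Tendsto (fun ρ => volume (Metric.cthickening ρ (frontier D))) (𝓝 0) (𝓝 0) := by
    have := tendsto_measure_cthickening_of_isClosed (μ := volume) (s := frontier D)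
      ⟨1, one_pos, (hfb.cthickening).measure_lt_top.ne⟩ isClosed_frontier
    rwa [hfr] at this
  have hz : Tendsto (fun N : ℕ => R / (N + 1 : ℕ)) atTop (𝓝 0) :=
    (tendsto_const_div_atTop_nhds_zero_nat R).comp (tendsto_add_atTop_nat 1)
  have hz1 : Tendsto (fun N : ℕ => √d * (R / (N + 1 : ℕ))) atTop (𝓝 0) := by
    simpa using hz.const_mul (√d)
  have hε₁ : 0 < ε / (4 * (B + 1)) := by positivity
  obtain ⟨N', hN1, hN2, hN3⟩ := ((hz.eventually (ge_mem_nhds hζ₀)).and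
    ((hz1.eventually (gt_mem_nhds hη)).and ((hthick.comp hz1).eventually
      (ge_mem_nhds (ENNReal.ofReal_pos.2 hε₁))))).exists
  set N := N' + 1 with hN
  have hNpos : 0 < N := Nat.succ_pos _
  have hNR : (0 : ℝ) < N := by exact_mod_cast hNpos
  set ζ := R / N with hζ
  have hζ0 : 0 < ζ := by positivity
  set x : (Fin d → Fin N) → EuclideanSpace ℝ (Fin d) := fun n => gridPoint o ζ fun k => n k with hx
  have hdisj : ∀ m n, m ≠ n → Disjoint (cube (x m) ζ) (cube (x n) ζ) := fun m n hmn =>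
    disjoint_cube_gridPoint o hζ0 fun he => hmn (funext fun k => Fin.ext (congrFun he k))
  set meet : Finset (Fin d → Fin N) := Finset.univ.filter fun n => ∃ t, t ∈ D ∧ t ∈ cube (x n) ζ
    with hmeet
  have hex : ∀ n ∈ meet, ∃ t, t ∈ D ∧ t ∈ cube (x n) ζ := fun n hn => (Finset.mem_filter.1 hn).2
  choose! τ hτ using hex
  set good := meet.filter fun n => cube (x n) ζ ⊆ D with hgood
  have hcover : D ⊆ ⋃ n ∈ meet, cube (x n) ζ := by
    intro t ht
    have h1 := hDR ht
    have e : R = N * ζ := by rw [hζ]; field_simp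
    rw [e, cube_eq_iUnion o hζ0 hNpos, Set.mem_iUnion] at h1
    obtain ⟨n, hn⟩ := h1
    exact Set.mem_iUnion₂.2 ⟨n, Finset.mem_filter.2 ⟨Finset.mem_univ _, t, ht, hn⟩, hn⟩
  have hcard : (meet.card : ℝ) * ζ ^ d ≤ R ^ d := by
    have h1 : meet.card ≤ N ^ d := by
      refine (Finset.card_le_univ _).trans ?_
      simp
    have h2 : (meet.card : ℝ) ≤ (N : ℝ) ^ d := by exact_mod_cast h1
    calc _ ≤ (N : ℝ) ^ d * ζ ^ d := by gcongr
      _ = R ^ d := by rw [← mul_pow, hζ]; congr 1; field_simp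
  have hfin : ∀ n, volume (cube (x n) ζ ∩ D) < ∞ := fun n =>
    (measure_mono Set.inter_subset_left).trans_lt
      (by rw [volume_cube _ hζ0.le]; exact ENNReal.ofReal_lt_top)
  -- The decomposition is done inside `volume.restrict D`, so only the cells need to be measurable.
  have hint : ∫ t in D, H t = ∑ n ∈ meet, ∫ t in cube (x n) ζ ∩ D, H t := by
    have h1 := integral_biUnion_finset (μ := volume.restrict D) (f := H) meet
      (fun n _ => measurableSet_cube (x n) ζ) (fun m _ n _ hmn => hdisj m n hmn)
      (fun n _ => hHi.integrableOn)
    rw [Measure.restrict_restrict (Finset.measurableSet_biUnion _ fun n _ =>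
      measurableSet_cube (x n) ζ), Set.inter_eq_right.2 hcover] at h1
    rw [h1]
    exact Finset.sum_congr rfl fun n _ => by
      rw [Measure.restrict_restrict (measurableSet_cube (x n) ζ)]
  have hgoodterm : ∀ n ∈ good, |ζ ^ d * H (τ n) - ∫ t in cube (x n) ζ ∩ D, H t| ≤
      ε / (2 * (R ^ d + 1)) * ζ ^ d := by
    intro n hn
    obtain ⟨hn1, hn2⟩ := Finset.mem_filter.1 hn
    rw [Set.inter_eq_left.2 hn2]
    have hv : volume (cube (x n) ζ) < ∞ := by
      rw [volume_cube _ hζ0.le]; exact ENNReal.ofReal_lt_top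
    have h1 : ∫ t in cube (x n) ζ, (H (τ n) - H t) =
        ζ ^ d * H (τ n) - ∫ t in cube (x n) ζ, H t := by
      have : IsFiniteMeasure (volume.restrict (cube (x n) ζ)) :=
        ⟨by rwa [Measure.restrict_apply_univ]⟩
      rw [integral_sub (integrable_const _) (hHi.mono_set hn2), setIntegral_const,
        volume_real_cube _ hζ0.le, smul_eq_mul]
    rw [← h1, ← Real.norm_eq_abs, ← volume_real_cube (x n) hζ0.le]
    refine norm_setIntegral_le_of_norm_le_const hv fun t ht => ?_
    refine hHη _ (hτ n hn1).1 _ (hn2 ht) ?_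
    rw [dist_eq_norm]
    exact (dist_le_of_mem_cube hζ0.le (hτ n hn1).2 ht).trans_lt hN2
  have hbadterm : ∀ n ∈ meet \ good, |ζ ^ d * H (τ n) - ∫ t in cube (x n) ζ ∩ D, H t| ≤
      2 * B * ζ ^ d := by
    intro n hn
    have hn1 := (Finset.mem_sdiff.1 hn).1
    have h1 : |∫ t in cube (x n) ζ ∩ D, H t| ≤ B * ζ ^ d := by
      rw [← Real.norm_eq_abs]
      refine (norm_setIntegral_le_of_norm_le_const (hfin n) fun t ht => hB t ht.2).trans ?_
      rw [← volume_real_cube (x n) hζ0.le]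
      gcongr
      · rw [volume_cube _ hζ0.le]; exact ENNReal.ofReal_ne_top
      · exact Set.inter_subset_left
    have h2 : |ζ ^ d * H (τ n)| ≤ B * ζ ^ d := by
      rw [abs_mul, abs_of_pos (by positivity : 0 < ζ ^ d), mul_comm]
      gcongr
      exact hB _ (hτ n hn1).1
    calc _ ≤ |ζ ^ d * H (τ n)| + |∫ t in cube (x n) ζ ∩ D, H t| := abs_sub _ _
      _ ≤ _ := by linarith
  -- Bad cells are disjoint and lie within one cell diameter of the frontier; the volumes of such
  -- neighbourhoods decrease to that of the frontier, which is `0`.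
  have hbadcard : ((meet \ good).card : ℝ) * ζ ^ d ≤ ε / (4 * (B + 1)) := by
    have hsub : (⋃ n ∈ meet \ good, cube (x n) ζ) ⊆
        Metric.cthickening (√d * ζ) (frontier D) := by
      refine Set.iUnion₂_subset fun n hn u hu => ?_
      obtain ⟨hn1, hn2⟩ := Finset.mem_sdiff.1 hn
      have hnD : ¬ cube (x n) ζ ⊆ D := fun hc => hn2 (Finset.mem_filter.2 ⟨hn1, hc⟩)
      obtain ⟨w, hw, hwD⟩ := Set.not_subset.1 hnD
      obtain ⟨y, hy, hyf⟩ := inter_frontier_nonempty (convex_cube (x n) ζ).isPreconnected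
        ⟨τ n, (hτ n hn1).2, (hτ n hn1).1⟩ ⟨w, hw, hwD⟩
      refine Metric.mem_cthickening_of_dist_le u y _ _ hyf ?_
      rw [dist_eq_norm]
      exact dist_le_of_mem_cube hζ0.le hu hy
    have h1 : ∑ n ∈ meet \ good, volume (cube (x n) ζ) ≤ ENNReal.ofReal (ε / (4 * (B + 1))) := by
      rw [← measure_biUnion_finset (fun m _ n _ hmn => hdisj m n hmn)
        fun n _ => measurableSet_cube (x n) ζ]
      exact (measure_mono hsub).trans hN3
    simp only [volume_cube _ hζ0.le, Finset.sum_const, nsmul_eq_mul] at h1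
    rw [← ENNReal.ofReal_natCast, ← ENNReal.ofReal_mul (by positivity)] at h1
    exact (ENNReal.ofReal_le_ofReal_iff hε₁.le).1 h1
  have hsub : good ⊆ meet := Finset.filter_subset _ _
  have hBε : B * (ε / (4 * (B + 1))) ≤ ε / 4 := by
    rw [mul_div_assoc', div_le_div_iff₀ (by positivity) (by positivity)]
    nlinarith
  have hmain : |∑ n ∈ good, (ζ ^ d * H (τ n) - ∫ t in cube (x n) ζ ∩ D, H t)| ≤ ε / 2 := by
    refine (Finset.abs_sum_le_sum_abs _ _).trans ((Finset.sum_le_sum hgoodterm).trans ?_)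
    rw [Finset.sum_const, nsmul_eq_mul]
    have h1 : (good.card : ℝ) * ζ ^ d ≤ R ^ d := by
      refine le_trans ?_ hcard
      gcongr
    calc (good.card : ℝ) * (ε / (2 * (R ^ d + 1)) * ζ ^ d)
        = ε / (2 * (R ^ d + 1)) * (good.card * ζ ^ d) := by ring
      _ ≤ ε / (2 * (R ^ d + 1)) * (R ^ d + 1) := by gcongr; linarith
      _ = ε / 2 := by field_simp
  have hbadI : ∀ n ∈ meet \ good, |∫ t in cube (x n) ζ ∩ D, H t| ≤ B * ζ ^ d := by
    intro n hn
    rw [← Real.norm_eq_abs]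
    refine (norm_setIntegral_le_of_norm_le_const (hfin n) fun t ht => hB t ht.2).trans ?_
    rw [← volume_real_cube (x n) hζ0.le]
    gcongr
    · rw [volume_cube _ hζ0.le]; exact ENNReal.ofReal_ne_top
    · exact Set.inter_subset_left
  refine ⟨ζ, hζ0, hN1, N, x, τ, meet, good, hτ, hsub, fun n hn => (Finset.mem_filter.1 hn).2,
    hcover, hdisj, ?_, ?_, hcard⟩
  · rw [hint, ← Finset.sum_sub_distrib, ← Finset.sum_sdiff hsub]
    have h1 : |∑ n ∈ meet \ good, (ζ ^ d * H (τ n) - ∫ t in cube (x n) ζ ∩ D, H t)| ≤ ε / 2 := by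
      refine (Finset.abs_sum_le_sum_abs _ _).trans ((Finset.sum_le_sum hbadterm).trans ?_)
      rw [Finset.sum_const, nsmul_eq_mul]
      calc ((meet \ good).card : ℝ) * (2 * B * ζ ^ d) = 2 * (B * ((meet \ good).card * ζ ^ d)) := by
            ring
        _ ≤ 2 * (B * (ε / (4 * (B + 1)))) := by gcongr
        _ ≤ ε / 2 := by linarith
    exact (abs_add_le _ _).trans (by linarith)
  · rw [hint, ← Finset.sum_sdiff hsub, sub_add_eq_sub_sub_swap, ← Finset.sum_sub_distrib]
    have h1 : |∑ n ∈ meet \ good, ∫ t in cube (x n) ζ ∩ D, H t| ≤ ε / 2 := by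
      refine (Finset.abs_sum_le_sum_abs _ _).trans ((Finset.sum_le_sum hbadI).trans ?_)
      rw [Finset.sum_const, nsmul_eq_mul]
      calc ((meet \ good).card : ℝ) * (B * ζ ^ d) = B * ((meet \ good).card * ζ ^ d) := by ring
        _ ≤ B * (ε / (4 * (B + 1))) := by gcongr
        _ ≤ ε / 2 := by linarith
    exact (abs_sub _ _).trans (by linarith)

end CubePartition

/-! ### Global asymptotics on a bounded Jordan measurable set. -/

namespace LocallyStationaryField

variable {d : ℕ} {Ω : Type*} [MeasurableSpace Ω] {P : Measure Ω}
  {D : Set (EuclideanSpace ℝ (Fin d))} {δ : ℝ} {X : EuclideanSpace ℝ (Fin d) → Ω → ℝ} {α : ℝ}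
  {L : ℝ → ℝ} {r : EuclideanSpace ℝ (Fin d) → EuclideanSpace ℝ (Fin d) → ℝ}

/-- The correlation is bounded away from `1` on a pair of disjoint, slightly shrunk cells. -/
lemma exists_corr_le_of_disjoint (h : LocallyStationaryField P D δ X α L r)
    (hcorr : ∀ s ∈ D, ∀ t ∈ D, s ≠ t → corr P X s t < 1) {p q : EuclideanSpace ℝ (Fin d)}
    {ζ ζ' : ℝ} (hζ' : 0 < ζ') (hζ : ζ' < ζ) (hp : cube p ζ ⊆ D) (hq : cube q ζ ⊆ D)
    (hpq : Disjoint (cube p ζ) (cube q ζ)) :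
    ∃ τ > 0, ∀ u ∈ cube p ζ', ∀ v ∈ cube q ζ', corr P X u v ≤ 1 - τ := by
  -- Closed cells of the smaller side are compact and still inside the larger half-open cells, hence
  -- disjoint. The correlation attains its maximum over their product at a pair of distinct points
  -- of `D`.
  set cl : EuclideanSpace ℝ (Fin d) → Set (EuclideanSpace ℝ (Fin d)) := fun t =>
    ⋂ i, (fun u : EuclideanSpace ℝ (Fin d) => u i) ⁻¹' Set.Icc (t i) (t i + ζ') with hcl
  have hmem : ∀ t u, u ∈ cl t ↔ ∀ i, t i ≤ u i ∧ u i ≤ t i + ζ' := fun t u => by simp [hcl]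
  have hsub : ∀ t, cl t ⊆ cube t ζ := fun t u hu i => by
    have := (hmem t u).1 hu i
    exact ⟨this.1, by linarith⟩
  have hcub : ∀ t, cube t ζ' ⊆ cl t := fun t u hu => (hmem t u).2 fun i => ⟨(hu i).1, (hu i).2.le⟩
  have hbd : ∀ t, Bornology.IsBounded (cube t ζ) := fun t =>
    Metric.isBounded_iff.2 ⟨√d * ζ, fun u hu v hv => by
      rw [dist_eq_norm]
      exact dist_le_of_mem_cube (hζ'.trans hζ).le hu hv⟩
  have hcomp : ∀ t, IsCompact (cl t) := fun t => Metric.isCompact_of_isClosed_isBounded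
    (isClosed_iInter fun i => isClosed_Icc.preimage (by fun_prop)) ((hbd t).subset (hsub t))
  have hDU : D ⊆ Metric.thickening δ D := Metric.self_subset_thickening h.delta_pos D
  obtain ⟨z, ⟨hz1, hz2⟩, hmax⟩ := ((hcomp p).prod (hcomp q)).exists_isMaxOn
    ⟨(p, q), hcub p (base_mem_cube p hζ'), hcub q (base_mem_cube q hζ')⟩
    (h.continuousOn_corr.mono (Set.prod_mono ((hsub p).trans (hp.trans hDU))
      ((hsub q).trans (hq.trans hDU))))
  have hlt := hcorr z.1 (hp (hsub p hz1)) z.2 (hq (hsub q hz2)) fun he =>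
    Set.disjoint_left.1 hpq (hsub p hz1) (he ▸ hsub q hz2)
  refine ⟨1 - corr P X z.1 z.2, by linarith, fun u hu v hv => ?_⟩
  have := hmax (show (u, v) ∈ cl p ×ˢ cl q from ⟨hcub p hu, hcub q hv⟩)
  simp only [Set.mem_ofPred_eq] at this
  linarith

lemma exists_pickands_bound (h : LocallyStationaryField P D δ X α L r) {r₀ : ℝ} (hr₀ : 0 < r₀)
    (hr : ∀ t ∈ D, ∀ v ∈ Metric.sphere 0 1, r₀ ≤ r t v) :
    ∃ B₀ > 0, ∃ B > 0, ∀ t ∈ D, B₀ ≤ pickands α (r t) ∧ pickands α (r t) ≤ B := by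
  obtain ⟨-, ⟨B₀, hB₀, B₁, hB⟩, -, -⟩ := h.exists_cube_asymptotics le_rfl hr₀ hr
  exact ⟨B₀, hB₀, max B₁ 1, by positivity, fun t ht =>
    ⟨(hB t ht).1, (hB t ht).2.trans (le_max_left _ _)⟩⟩

lemma integrableOn_pickands (h : LocallyStationaryField P D δ X α L r)
    (hD : Bornology.IsBounded D) (hfr : volume (frontier D) = 0) :
    IntegrableOn (fun t => pickands α (r t)) D volume := by
  obtain ⟨r₀, hr₀, hr⟩ := h.exists_le_r hD
  obtain ⟨B₀, hB₀, B, hB0, hB⟩ := h.exists_pickands_bound hr₀ hr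
  refine integrableOn_of_null_frontier hD hfr (B := B) (fun t ht => ?_) ?_
  · rw [abs_of_pos (hB₀.trans_le (hB t ht).1)]
    exact (hB t ht).2
  · rw [Metric.continuousOn_iff]
    intro t ht ε hε
    obtain ⟨η, hη, hc⟩ := h.exists_pickands_close hr₀ hr (half_pos hε)
    exact ⟨η, hη, fun s hs hst => by
      rw [Real.dist_eq]
      exact (hc s hs t ht hst).trans_lt (half_lt_self hε)⟩

lemma setIntegral_pickands_pos (h : LocallyStationaryField P D δ X α L r)
    (hD : Bornology.IsBounded D) (hfr : volume (frontier D) = 0) (hpos : 0 < volume D) :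
    0 < ∫ t in D, pickands α (r t) := by
  obtain ⟨r₀, hr₀, hr⟩ := h.exists_le_r hD
  obtain ⟨B₀, hB₀, B, hB0, hB⟩ := h.exists_pickands_bound hr₀ hr
  have hint : interior D =ᵐ[volume] D := interior_ae_eq_of_null_frontier hfr
  rw [← setIntegral_congr_set hint]
  have hv : volume (interior D) ≠ ∞ := (hD.subset interior_subset).measure_lt_top.ne
  have h1 := setIntegral_ge_of_const_le_real (μ := volume) (f := fun t => pickands α (r t))
    (c := B₀) isOpen_interior.measurableSet hv
    (fun t ht => (hB t (interior_subset ht)).1)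
    ((h.integrableOn_pickands hD hfr).mono_set interior_subset)
  refine lt_of_lt_of_le ?_ h1
  have : 0 < volume.real (interior D) := by
    rw [measureReal_def]
    exact ENNReal.toReal_pos (by rw [measure_congr hint]; exact hpos.ne') hv
  positivity

end LocallyStationaryField

namespace LocallyStationaryField

variable {d : ℕ} {Ω : Type*} [MeasurableSpace Ω] {P : Measure Ω}
  {D : Set (EuclideanSpace ℝ (Fin d))} {δ : ℝ} {X : EuclideanSpace ℝ (Fin d) → Ω → ℝ} {α : ℝ}
  {L : ℝ → ℝ} {r : EuclideanSpace ℝ (Fin d) → EuclideanSpace ℝ (Fin d) → ℝ}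

set_option maxHeartbeats 1000000 in
-- From above, a union bound over the cells that meet `D`. From below, Bonferroni over the cells
-- contained in `D`, shrunk by a factor `θ` close to `1`: neighbouring cells share boundary points,
-- and shrinking separates them so that joint exceedances are negligible. Both Riemann sums tend to
-- the integral.
lemma exists_eventually_abs_global_le (h : LocallyStationaryField P D δ X α L r)
    (hD : Bornology.IsBounded D) (hfr : volume (frontier D) = 0)
    (hcorr : ∀ s ∈ D, ∀ t ∈ D, s ≠ t → corr P X s t < 1) :
    ∃ C > 0, ∀ ε > 0, ∀ᶠ c in atTop, |P.real {ω | ∃ u ∈ D, c < X u ω} -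
      gaussTail c * (scale α L c ^ d)⁻¹ * ∫ t in D, pickands α (r t)| ≤
        C * ε * (gaussTail c * (scale α L c ^ d)⁻¹) := by
  classical
  have hP := h.field.isProbabilityMeasure
  obtain ⟨r₀, hr₀, hr⟩ := h.exists_le_r hD
  obtain ⟨B₀, hB₀, B, hB0, hB⟩ := h.exists_pickands_bound hr₀ hr
  obtain ⟨-, -, -, hcube⟩ := h.exists_cube_asymptotics le_rfl hr₀ hr
  have hpos : ∀ t ∈ D, 0 < pickands α (r t) := fun t ht => hB₀.trans_le (hB t ht).1
  obtain ⟨V, hV, hR⟩ := exists_riemann_partition hD hfr hB0.le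
    (fun t ht => by rw [abs_of_pos (hpos t ht)]; exact (hB t ht).2)
    (fun ε hε => h.exists_pickands_close hr₀ hr hε) (h.integrableOn_pickands hD hfr)
  set I := ∫ t in D, pickands α (r t) with hI
  -- `V` accounts for the errors of the local asymptotics summed over all cells. The rest covers the
  -- Riemann sum, the shrinking and the double exceedances.
  refine ⟨V + 4, by positivity, fun ε hε => ?_⟩
  obtain ⟨K₀, hK₀, η, hη, hev⟩ := hcube ε hε
  have hδ := h.delta_pos
  have hDU : D ⊆ Metric.thickening δ D := Metric.self_subset_thickening hδ D
  set ζ₀ := η / 2 / (√d + 1) with hζ₀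
  have hsd : 0 ≤ √(d : ℝ) := Real.sqrt_nonneg _
  obtain ⟨ζ, hζ, hζle, N, x, τ, meet, good, hτ, hgm, hgood, hcover, hdisj, hRm, hRg, hcard⟩ :=
    hR ε hε ζ₀ (by positivity)
  have hζη : (√d + 1) * ζ ≤ η / 2 := by
    rw [hζ₀, le_div_iff₀ (by positivity)] at hζle
    linarith
  have hsζ : 0 ≤ √d * ζ := by positivity
  have hdist : ∀ n ∈ meet, dist (x n) (τ n) ≤ √d * ζ := fun n hn => by
    rw [dist_eq_norm]
    exact dist_le_of_mem_cube hζ.le (base_mem_cube _ hζ) (hτ n hn).2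
  -- the shrunk cells
  obtain ⟨θ, hθ0, hθ1, hθ⟩ : ∃ θ : ℝ, 0 < θ ∧ θ < 1 ∧ |θ ^ d * I - I| ≤ ε := by
    have h1 : Tendsto (fun θ : ℝ => |θ ^ d * I - I|) (𝓝[<] 1) (𝓝 0) := by
      have h2 : Continuous fun θ : ℝ => |θ ^ d * I - I| := by fun_prop
      have h3 := (h2.tendsto 1).mono_left (nhdsWithin_le_nhds (s := Set.Iio 1))
      simpa using h3
    obtain ⟨θ, h2, h3, h4⟩ := ((h1.eventually (ge_mem_nhds hε)).and
      ((eventually_mem_nhdsWithin (a := (1 : ℝ)) (s := Set.Iio 1)).and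
      (nhdsWithin_le_nhds (Ioi_mem_nhds one_pos)))).exists
    exact ⟨θ, h4, h3, h2⟩
  set ζ' := θ * ζ with hζ'
  have hζ'0 : 0 < ζ' := by positivity
  have hζ'lt : ζ' < ζ := by rw [hζ']; nlinarith
  -- The error is shared among all pairs; the added `1` avoids division by zero when no cell is
  -- good.
  have hpair : ∀ m ∈ good, ∀ n ∈ good, m ≠ n → ∀ᶠ c in atTop,
      P.real {ω | (∃ u ∈ cube (x m) ζ', c < X u ω) ∧ ∃ u ∈ cube (x n) ζ', c < X u ω} ≤
        ε / (good.card * good.card + 1) * (gaussTail c * (scale α L c ^ d)⁻¹) := by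
    intro m hm n hn hmn
    obtain ⟨σ, hσ, hle⟩ := h.exists_corr_le_of_disjoint hcorr hζ'0 hζ'lt (hgood m hm) (hgood n hn)
      (hdisj m n hmn)
    exact h.eventually_separated_le hζ'0 hσ (by positivity)
      (((cube_mono_side hζ'lt.le).trans (hgood m hm)).trans hDU)
      (((cube_mono_side hζ'lt.le).trans (hgood n hn)).trans hDU) hle
  have hpair' : ∀ᶠ c in atTop, ∀ m ∈ good, ∀ n ∈ good, m ≠ n →
      P.real {ω | (∃ u ∈ cube (x m) ζ', c < X u ω) ∧ ∃ u ∈ cube (x n) ζ', c < X u ω} ≤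
        ε / (good.card * good.card + 1) * (gaussTail c * (scale α L c ^ d)⁻¹) := by
    rw [Finset.eventually_all]
    intro m hm
    rw [Finset.eventually_all]
    intro n hn
    by_cases hmn : m = n
    · exact Eventually.of_forall fun _ hne => absurd hmn hne
    · filter_upwards [hpair m hm n hn hmn] with c hc _ using hc
  filter_upwards [hev, hpair', h.eventually_mul_scale_le K₀ hζ'0, eventually_scale_pos h.isLeast,
    eventually_gt_atTop 0] with c hc hpc hKc hΔ hc0
  have hψ := gaussTail_pos hc0
  set Δ := scale α L c with hΔd
  set A := gaussTail c * (Δ ^ d)⁻¹ with hA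
  have hA0 : 0 < A := by positivity
  have hcell : ∀ n ∈ meet, ∀ z, ζ' ≤ z → z ≤ ζ →
      |P.real {ω | ∃ u ∈ cube (x n) z, c < X u ω} - A * (z ^ d * pickands α (r (τ n)))| ≤
        ε * z ^ d * A := by
    intro n hn z hz1 hz2
    have h1 := hc (τ n) (hτ n hn).1 (x n) ((hdist n hn).trans_lt (by linarith)) (z / Δ)
      (by rw [le_div_iff₀ hΔ]; linarith) (by rw [div_mul_cancel₀ _ hΔ.ne']; nlinarith)
    rw [div_mul_cancel₀ _ hΔ.ne', div_pow] at h1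
    calc _ = _ := by rw [hA]; ring_nf
      _ ≤ _ := h1
      _ = _ := by rw [hA]; ring
  have hzd : 0 < ζ ^ d := by positivity
  rw [abs_le]
  constructor
  · -- lower bound
    set E : (Fin d → Fin N) → Set Ω := fun n => {ω | ∃ u ∈ cube (x n) ζ', c < X u ω} with hE
    have hEsub : ∀ n ∈ good, cube (x n) ζ' ⊆ D := fun n hn =>
      (cube_mono_side hζ'lt.le).trans (hgood n hn)
    have hBon := sum_measureReal_le_add (P := P) good (E := E) fun n hn =>
      h.field.nullMeasurableSet_exists_lt ((hEsub n hn).trans hDU) c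
    have hun : P.real (⋃ n ∈ good, E n) ≤ P.real {ω | ∃ u ∈ D, c < X u ω} := by
      refine measureReal_mono (Set.iUnion₂_subset fun n hn ω hω => ?_)
      obtain ⟨u, hu, hcu⟩ := hω
      exact ⟨u, hEsub n hn hu, hcu⟩
    have hdouble : ∑ m ∈ good, ∑ n ∈ good, (if m = n then 0 else P.real (E m ∩ E n)) ≤ ε * A := by
      have h1 : ∀ m ∈ good, ∀ n ∈ good, (if m = n then 0 else P.real (E m ∩ E n)) ≤
          ε / (good.card * good.card + 1) * A := by
        intro m hm n hn
        split_ifs with hmn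
        · positivity
        · exact hpc m hm n hn hmn
      refine (Finset.sum_le_sum fun m hm => Finset.sum_le_sum fun n hn => h1 m hm n hn).trans ?_
      simp only [Finset.sum_const, nsmul_eq_mul]
      have h2 : (good.card * good.card : ℝ) * (ε / (good.card * good.card + 1)) ≤ ε := by
        rw [mul_div_assoc', div_le_iff₀ (by positivity)]
        nlinarith
      calc _ = (good.card * good.card : ℝ) * (ε / (good.card * good.card + 1)) * A := by ring
        _ ≤ ε * A := by gcongr
    have hsum : A * (θ ^ d * ∑ n ∈ good, ζ ^ d * pickands α (r (τ n))) - ε * V * A ≤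
        ∑ n ∈ good, P.real (E n) := by
      have h1 : ∀ n ∈ good, A * (ζ' ^ d * pickands α (r (τ n))) - ε * ζ ^ d * A ≤
          P.real (E n) := by
        intro n hn
        have h2 := (abs_le.1 (hcell n (hgm hn) ζ' le_rfl hζ'lt.le)).1
        have h3 : ε * ζ' ^ d * A ≤ ε * ζ ^ d * A := by gcongr
        simp only [hE]
        linarith
      refine le_trans ?_ (Finset.sum_le_sum h1)
      rw [Finset.sum_sub_distrib, Finset.sum_const, nsmul_eq_mul, hζ', mul_pow]
      have h4 : (good.card : ℝ) * (ε * ζ ^ d * A) ≤ ε * V * A := by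
        have h5 : (good.card : ℝ) * ζ ^ d ≤ V := le_trans (by gcongr) hcard
        calc _ = ε * (good.card * ζ ^ d) * A := by ring
          _ ≤ _ := by gcongr
      have h6 : ∑ n ∈ good, A * (θ ^ d * ζ ^ d * pickands α (r (τ n))) =
          A * (θ ^ d * ∑ n ∈ good, ζ ^ d * pickands α (r (τ n))) := by
        rw [Finset.mul_sum, Finset.mul_sum]
        exact Finset.sum_congr rfl fun n _ => by ring
      linarith
    have hθd0 : 0 ≤ θ ^ d := by positivity
    have hθd1 : θ ^ d ≤ 1 := pow_le_one₀ hθ0.le hθ1.le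
    have k1 := (abs_le.1 hRg).1
    have k2 := (abs_le.1 hθ).1
    have k3 : I - 2 * ε ≤ θ ^ d * ∑ n ∈ good, ζ ^ d * pickands α (r (τ n)) := by
      have : θ ^ d * (I - ε) ≤ θ ^ d * ∑ n ∈ good, ζ ^ d * pickands α (r (τ n)) :=
        mul_le_mul_of_nonneg_left (by linarith) hθd0
      nlinarith
    have k4 := mul_le_mul_of_nonneg_left k3 hA0.le
    nlinarith [mul_pos hε hA0]
  · -- upper bound
    have hun : P.real {ω | ∃ u ∈ D, c < X u ω} ≤
        ∑ n ∈ meet, P.real {ω | ∃ u ∈ cube (x n) ζ, c < X u ω} := by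
      refine le_trans (measureReal_mono ?_ (measure_ne_top _ _)) (measureReal_biUnion_finset_le meet _)
      rintro ω ⟨u, hu, hcu⟩
      obtain ⟨n, hn, hun⟩ := Set.mem_iUnion₂.1 (hcover hu)
      exact Set.mem_iUnion₂.2 ⟨n, hn, u, hun, hcu⟩
    have hsum : ∑ n ∈ meet, P.real {ω | ∃ u ∈ cube (x n) ζ, c < X u ω} ≤
        A * ∑ n ∈ meet, ζ ^ d * pickands α (r (τ n)) + ε * V * A := by
      have h1 : ∀ n ∈ meet, P.real {ω | ∃ u ∈ cube (x n) ζ, c < X u ω} ≤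
          A * (ζ ^ d * pickands α (r (τ n))) + ε * ζ ^ d * A := by
        intro n hn
        have h2 := (abs_le.1 (hcell n hn ζ hζ'lt.le le_rfl)).2
        linarith
      refine (Finset.sum_le_sum h1).trans ?_
      rw [Finset.sum_add_distrib, Finset.sum_const, nsmul_eq_mul, ← Finset.mul_sum]
      have h4 : (meet.card : ℝ) * (ε * ζ ^ d * A) ≤ ε * V * A := by
        calc _ = ε * (meet.card * ζ ^ d) * A := by ring
          _ ≤ _ := by gcongr
      linarith
    have k1 := mul_le_mul_of_nonneg_left (abs_le.1 hRm).2 hA0.le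
    nlinarith [mul_pos hε hA0]

/-- Asymptotics for the supremum over a bounded Jordan measurable set. -/
theorem isEquivalent_global (h : LocallyStationaryField P D δ X α L r)
    (hD : Bornology.IsBounded D) (hfr : volume (frontier D) = 0) (hpos : 0 < volume D)
    (hcorr : ∀ s ∈ D, ∀ t ∈ D, s ≠ t → corr P X s t < 1) :
    (fun c => P.real (supExceeds X D c)) ~[atTop]
      fun c => gaussTail c * (scale α L c ^ d)⁻¹ * ∫ t in D, pickands α (r t) := by
  obtain ⟨C, hC, hev⟩ := h.exists_eventually_abs_global_le hD hfr hcorr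
  have hI := h.setIntegral_pickands_pos hD hfr hpos
  rw [IsEquivalent, isLittleO_iff]
  intro ε hε
  filter_upwards [hev (ε * (∫ t in D, pickands α (r t)) / C) (by positivity),
    eventually_scale_pos h.isLeast, eventually_gt_atTop 0] with c hc hΔ hc0
  have hψ := gaussTail_pos hc0
  rw [Pi.sub_apply, supExceeds_eq, Real.norm_eq_abs, Real.norm_eq_abs, abs_of_pos
    (by positivity : 0 < gaussTail c * (scale α L c ^ d)⁻¹ * ∫ t in D, pickands α (r t))]
  refine hc.trans (le_of_eq ?_)
  field_simp

end LocallyStationaryField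

/-! ### Gaussian processes on countable index sets. -/

/-- A positive semidefinite kernel on `ℕ` is a Gram matrix. -/
lemma exists_gram_representation (K : Matrix ℕ ℕ ℝ) (hK : K.PosSemidef) :
    ∃ (H : Type) (_ : NormedAddCommGroup H) (_ : InnerProductSpace ℝ H) (k : ℕ → H),
      ∀ m n, inner ℝ (k m) (k n) = K m n := by
  -- The scalar kernel is read as an operator-valued one on the line, to obtain vectors in its
  -- reproducing kernel Hilbert space.
  set K' : Matrix ℕ ℕ (ℝ →L[ℝ] ℝ) := fun m n => K m n • ContinuousLinearMap.id ℝ ℝ with hK'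
  have hherm : K'.IsHermitian := by
    refine Matrix.IsHermitian.ext fun m n => ?_
    have := hK.isHermitian.apply m n
    simp only [star_trivial] at this
    have hid : star (ContinuousLinearMap.id ℝ ℝ) = ContinuousLinearMap.id ℝ ℝ := star_one _
    simp only [hK', star_smul, star_trivial, hid, this]
  have hpsd : K'.PosSemidef := by
    have htfae := (RKHS.posSemidef_tfae (K := K')).out 0 2
    refine htfae.mpr ⟨hherm, fun v => ?_⟩
    have h1 := hK.2 v
    refine h1.trans_eq ?_
    simp only [Finsupp.sum, hK', RCLike.re_to_real, star_trivial]
    refine Finset.sum_congr rfl fun i _ => Finset.sum_congr rfl fun j _ => ?_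
    have := hK.isHermitian.apply i j
    simp only [star_trivial] at this
    simp [this]
    ring
  have : Fact K'.PosSemidef := ⟨hpsd⟩
  refine ⟨RKHS.OfKernel K', inferInstance, inferInstance,
    fun n => RKHS.kerFun (RKHS.OfKernel K') n (1 : ℝ), fun m n => ?_⟩
  rw [← RKHS.kernel_inner, RKHS.OfKernel.kernel_ofKernel]
  have := hK.isHermitian.apply m n
  simp only [star_trivial] at this
  simp [hK', this]

/-- A triangular factorization of a positive semidefinite kernel on `ℕ`. -/
lemma exists_triangular_factorization (K : Matrix ℕ ℕ ℝ) (hK : K.PosSemidef) :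
    ∃ c : ℕ → ℕ → ℝ, (∀ n j, n < j → c n j = 0) ∧
      ∀ m n N, m < N → n < N → K m n = ∑ j ∈ Finset.range N, c m j * c n j := by
  obtain ⟨H, _, _, f, hf⟩ := exists_gram_representation K hK
  -- Gram–Schmidt is left unnormalised, since a degenerate kernel produces zero vectors.
  set g := InnerProductSpace.gramSchmidt ℝ f with hg
  have htri : ∀ n j, n < j → inner ℝ (g j) (f n) = 0 := fun n j hnj =>
    InnerProductSpace.gramSchmidt_inv_triangular ℝ f hnj
  have horth : ∀ i j, i ≠ j → inner ℝ (g i) (g j) = 0 := fun i j hij =>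
    InnerProductSpace.gramSchmidt_orthogonal ℝ f hij
  have hdiag : ∀ n, inner ℝ (g n) (f n) = ‖g n‖ ^ 2 := by
    intro n
    rw [InnerProductSpace.gramSchmidt_def'' ℝ f n, inner_add_right, inner_sum,
      real_inner_self_eq_norm_sq, Finset.sum_eq_zero, add_zero]
    intro i hi
    rw [inner_smul_right, horth n i (Finset.mem_Iio.1 hi).ne', mul_zero]
  have hexp : ∀ n N, n < N → f n = ∑ j ∈ Finset.range N, (inner ℝ (g j) (f n) / ‖g j‖ ^ 2) • g j := by
    intro n N hn
    have h1 : ∑ j ∈ Finset.range N, (inner ℝ (g j) (f n) / ‖g j‖ ^ 2) • g j =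
        ∑ j ∈ Finset.range (n + 1), (inner ℝ (g j) (f n) / ‖g j‖ ^ 2) • g j := by
      refine (Finset.sum_subset (Finset.range_mono hn) fun j _ hj => ?_).symm
      rw [htri n j (by simpa using hj), zero_div, zero_smul]
    rw [h1, Finset.sum_range_succ, hdiag]
    have h2 : (‖g n‖ ^ 2 / ‖g n‖ ^ 2) • g n = g n := by
      rcases eq_or_ne (g n) 0 with h0 | h0
      · simp [h0]
      · rw [div_self (by simpa using h0), one_smul]
    rw [h2]
    conv_lhs => rw [InnerProductSpace.gramSchmidt_def'' ℝ f n, add_comm]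
    congr 1
    refine Finset.sum_congr ?_ fun i _ => by simp [hg]
    ext i
    simp
  -- Coordinates along the normalised directions; division by zero gives `0` along vanishing ones.
  refine ⟨fun n j => inner ℝ (g j) (f n) / ‖g j‖, fun n j hnj => by simp [htri n j hnj],
    fun m n N hm hn => ?_⟩
  rw [← hf]
  conv_lhs => rw [hexp m N hm, sum_inner]
  refine Finset.sum_congr rfl fun j _ => ?_
  rw [inner_smul_left]
  simp only [conj_trivial]
  rcases eq_or_ne (g j) 0 with h0 | h0
  · simp [h0]
  · have : ‖g j‖ ≠ 0 := by simpa using h0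
    field_simp

/-- The standard Gaussian measure on `ℝ ^ ℕ`. -/
noncomputable def whiteNoise : Measure (ℕ → ℝ) := Measure.infinitePi fun _ => gaussianReal 0 1

instance : IsProbabilityMeasure whiteNoise := by unfold whiteNoise; infer_instance

lemma whiteNoise_hasLaw (n : ℕ) : HasLaw (fun ω : ℕ → ℝ => ω n) (gaussianReal 0 1) whiteNoise where
  aemeasurable := (measurable_pi_apply n).aemeasurable
  map_eq := Measure.infinitePi_map_eval (fun _ : ℕ => gaussianReal 0 1) n

lemma whiteNoise_hasGaussianLaw (n : ℕ) : HasGaussianLaw (fun ω : ℕ → ℝ => ω n) whiteNoise :=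
  (whiteNoise_hasLaw n).hasGaussianLaw

lemma whiteNoise_iIndepFun : iIndepFun (fun n (ω : ℕ → ℝ) => ω n) whiteNoise :=
  iIndepFun_infinitePi (X := fun _ x => x) fun _ => measurable_id

lemma whiteNoise_isGaussianProcess : IsGaussianProcess (fun n (ω : ℕ → ℝ) => ω n) whiteNoise where
  hasGaussianLaw I := iIndepFun.hasGaussianLaw (fun i : I => whiteNoise_hasGaussianLaw i)
    (whiteNoise_iIndepFun.precomp Subtype.val_injective)

lemma whiteNoise_memLp (n : ℕ) : MemLp (fun ω : ℕ → ℝ => ω n) 2 whiteNoise :=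
  (whiteNoise_hasGaussianLaw n).memLp_two

lemma whiteNoise_integral (n : ℕ) : ∫ ω : ℕ → ℝ, ω n ∂whiteNoise = 0 := by
  rw [(whiteNoise_hasLaw n).integral_eq]
  simp

lemma whiteNoise_covariance (m n : ℕ) :
    covariance (fun ω : ℕ → ℝ => ω m) (fun ω => ω n) whiteNoise = if m = n then 1 else 0 := by
  split_ifs with h
  · subst h
    rw [covariance_self (measurable_pi_apply m).aemeasurable, (whiteNoise_hasLaw m).variance_eq]
    simp
  · exact (whiteNoise_iIndepFun.indepFun h).covariance_eq_zero (whiteNoise_memLp m)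
      (whiteNoise_memLp n)

/-- A centred Gaussian process with a given positive semidefinite covariance, on a countable set. -/
theorem exists_gaussianProcess_of_countable {T : Type*} [Countable T] (K : T → T → ℝ)
    (hK : ∀ u : ℕ → T, (Matrix.of fun i j => K (u i) (u j)).PosSemidef) :
    ∃ Y : T → (ℕ → ℝ) → ℝ, IsGaussianProcess Y whiteNoise ∧ (∀ t, ∫ ω, Y t ω ∂whiteNoise = 0) ∧
      ∀ s t, covariance (Y s) (Y t) whiteNoise = K s t := by
  rcases isEmpty_or_nonempty T with hT | hT
  · refine ⟨fun t _ => 0, ⟨fun I => ?_⟩, fun t => hT.elim t, fun t => hT.elim t⟩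
    exact iIndepFun.hasGaussianLaw (fun i : I => hT.elim i) (iIndepFun.of_subsingleton)
  obtain ⟨g, hgs⟩ := exists_surjective_nat T
  -- By triangularity every value of the process is a finite linear combination of independent
  -- standard normals, so no convergence of random series is involved.
  obtain ⟨c, hc0, hc⟩ := exists_triangular_factorization _ (hK g)
  set idx := Function.surjInv hgs with hidx
  have hgi : ∀ t, g (idx t) = t := Function.surjInv_eq hgs
  have hmem : ∀ t, ∀ j ∈ Finset.range (idx t + 1),
      MemLp (fun ω : ℕ → ℝ => c (idx t) j * ω j) 2 whiteNoise := fun t j _ =>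
    (whiteNoise_memLp j).const_mul _
  refine ⟨fun t ω => ∑ j ∈ Finset.range (idx t + 1), c (idx t) j * ω j, ?_, fun t => ?_,
    fun s t => ?_⟩
  · refine whiteNoise_isGaussianProcess.of_isGaussianProcess fun t =>
      ⟨Finset.range (idx t + 1), ∑ j : Finset.range (idx t + 1), c (idx t) j •
        ContinuousLinearMap.proj (R := ℝ) (φ := fun _ : Finset.range (idx t + 1) => ℝ) j,
        fun ω => ?_⟩
    rw [← Finset.sum_coe_sort]
    simp [Finset.restrict]
  · rw [integral_finsetSum _ fun j hj => (hmem t j hj).integrable (by norm_num)]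
    simp [integral_const_mul, whiteNoise_integral]
  · rw [covariance_fun_sum_left' (hmem s) (memLp_finsetSum _ (hmem t))]
    have h1 : ∀ j ∈ Finset.range (idx s + 1), covariance (fun ω : ℕ → ℝ => c (idx s) j * ω j)
        (fun ω => ∑ i ∈ Finset.range (idx t + 1), c (idx t) i * ω i) whiteNoise =
        c (idx s) j * c (idx t) j := by
      intro j _
      rw [covariance_fun_sum_right' (hmem t) ((whiteNoise_memLp j).const_mul _)]
      simp only [covariance_const_mul_left, covariance_const_mul_right, whiteNoise_covariance]
      simp only [mul_ite, mul_one, mul_zero, Finset.sum_ite_eq, Finset.mem_range]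
      split_ifs with hj
      · rw [mul_comm]
      · rw [hc0 (idx t) j (by omega), mul_zero]
    rw [Finset.sum_congr rfl h1]
    have h2 := hc (idx s) (idx t) (max (idx s) (idx t) + 1) (by omega) (by omega)
    rw [Matrix.of_apply, hgi, hgi] at h2
    rw [h2]
    refine Finset.sum_subset (Finset.range_mono (by omega)) fun j _ hj => ?_
    rw [hc0 (idx s) j (by simpa using hj), zero_mul]

/-! ### Continuous extension of functions from dyadic points. -/

section DyadicPaths

variable {d : ℕ}

/-- The point with index `n` of the grid of mesh `2 ^ (-k)`. -/
noncomputable def dyadicPoint (k : ℕ) (n : Fin d → ℕ) : EuclideanSpace ℝ (Fin d) :=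
  gridPoint 0 (1 / (2 ^ k : ℕ)) n

/-- The point `u`, rounded down to the grid of mesh `2 ^ (-k)`. -/
noncomputable def dyadicFloor (k : ℕ) (u : EuclideanSpace ℝ (Fin d)) : EuclideanSpace ℝ (Fin d) :=
  dyadicPoint k (gridIndex 0 (1 / (2 ^ k : ℕ)) u)

lemma dyadicPoint_two_mul (k : ℕ) (n : Fin d → ℕ) :
    dyadicPoint (k + 1) (fun i => 2 * n i) = dyadicPoint k n := by
  ext i
  simp only [dyadicPoint, gridPoint_apply, PiLp.zero_apply]
  push_cast
  field_simp
  ring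

lemma norm_sub_dyadicFloor_le (k : ℕ) {u : EuclideanSpace ℝ (Fin d)} (hu : u ∈ orthant d) :
    ‖u - dyadicFloor k u‖ ≤ √d / 2 ^ k := by
  have hζ : (0 : ℝ) < 1 / (2 ^ k : ℕ) := by positivity
  have h1 := gridPoint_gridIndex_le (t := 0) hζ (u := u) fun i => hu i
  refine (dist_le_of_mem_cube hζ.le h1 (base_mem_cube _ hζ)).trans (le_of_eq ?_)
  push_cast
  ring

lemma norm_dyadicFloor_succ_sub_le (k : ℕ) (u : EuclideanSpace ℝ (Fin d)) :
    ‖dyadicFloor (k + 1) u - dyadicFloor k u‖ ≤ √d / 2 ^ k := by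
  have h1 := norm_gridPoint_sub_parent_le (0 : EuclideanSpace ℝ (Fin d)) one_pos k
    (gridIndex 0 (1 / (2 ^ (k + 1) : ℕ)) u)
  simp only [gridIndex_div_two] at h1
  refine h1.trans (le_of_eq ?_)
  ring

lemma gridIndex_dyadic_lt {K : ℕ} {u : EuclideanSpace ℝ (Fin d)} (hK : 0 < K) (hu : u ∈ cube 0 K)
    (k : ℕ) (i : Fin d) : gridIndex 0 (1 / (2 ^ k : ℕ)) u i < K * 2 ^ k := by
  have hK' : (0 : ℝ) < K := by exact_mod_cast hK
  have h1 := gridIndex_lt (t := 0) (ζ := (K : ℝ)) hK' hu (N := K * 2 ^ k) (by positivity) i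
  have e : (K : ℝ) / (K * 2 ^ k : ℕ) = 1 / (2 ^ k : ℕ) := by
    push_cast
    field_simp
  rwa [e] at h1

/-- Neighbouring values of `f` on fine dyadic grids differ by at most `θ ^ k`. -/
def DyadicRegular (d : ℕ) (θ : ℝ) (f : EuclideanSpace ℝ (Fin d) → ℝ) : Prop :=
  ∀ K : ℕ, ∀ᶠ k : ℕ in atTop, ∀ m n : Fin d → Fin (K * 2 ^ k),
    ‖dyadicPoint k (fun i => m i) - dyadicPoint k (fun i => n i)‖ ≤ (2 * √d + 1) / 2 ^ k →
      |f (dyadicPoint k fun i => m i) - f (dyadicPoint k fun i => n i)| ≤ θ ^ k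

/-- The extension of `f` from dyadic points to the orthant. -/
noncomputable def dyadicExtension (f : EuclideanSpace ℝ (Fin d) → ℝ)
    (u : EuclideanSpace ℝ (Fin d)) : ℝ :=
  limUnder atTop fun k => f (dyadicFloor k u)

lemma DyadicRegular.eventually_succ_le {θ : ℝ} {f : EuclideanSpace ℝ (Fin d) → ℝ}
    (hf : DyadicRegular d θ f) {K : ℕ} (hK : 0 < K) : ∃ k₀, ∀ k ≥ k₀, ∀ u ∈ cube 0 K,
      |f (dyadicFloor (k + 1) u) - f (dyadicFloor k u)| ≤ θ ^ (k + 1) := by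
  obtain ⟨k₀, hk₀⟩ := eventually_atTop.1 (hf K)
  refine ⟨k₀, fun k hk u hu => ?_⟩
  have hlt := gridIndex_dyadic_lt hK hu (k + 1)
  -- The coarser rounding is also a point of the finer grid, so regularity at level `k + 1` compares
  -- the two roundings.
  have hpar : dyadicFloor k u = dyadicPoint (k + 1) fun i =>
      2 * (gridIndex 0 (1 / (2 ^ (k + 1) : ℕ)) u i / 2) := by
    simp only [gridIndex_div_two]
    exact (dyadicPoint_two_mul k _).symm
  have hnorm := norm_dyadicFloor_succ_sub_le k u
  have h1 := hk₀ (k + 1) (by omega) (fun i => ⟨_, hlt i⟩)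
    (fun i => ⟨2 * (gridIndex 0 (1 / (2 ^ (k + 1) : ℕ)) u i / 2), by have := hlt i; omega⟩)
  simp only at h1
  rw [← hpar] at h1
  refine h1 (hnorm.trans ?_)
  rw [pow_succ, div_le_div_iff₀ (by positivity) (by positivity)]
  have h2 : (0 : ℝ) < 2 ^ k := by positivity
  nlinarith

/-- Successive roundings change `f` by at most a geometric term, with one starting level for the
whole cube. The extension is therefore a uniform limit with an explicit rate. -/
lemma DyadicRegular.exists_dist_le {θ : ℝ} (hθ0 : 0 < θ) (hθ1 : θ < 1)
    {f : EuclideanSpace ℝ (Fin d) → ℝ} (hf : DyadicRegular d θ f) {K : ℕ} (hK : 0 < K) :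
    ∃ k₀, ∀ u ∈ cube (0 : EuclideanSpace ℝ (Fin d)) K,
      Tendsto (fun k => f (dyadicFloor k u)) atTop (𝓝 (dyadicExtension f u)) ∧
        ∀ k ≥ k₀, |f (dyadicFloor k u) - dyadicExtension f u| ≤ θ ^ k / (1 - θ) := by
  obtain ⟨k₀, hk₀⟩ := hf.eventually_succ_le hK
  refine ⟨k₀, fun u hu => ?_⟩
  have hstep : ∀ k ≥ k₀, ∀ j, dist (f (dyadicFloor (j + k) u)) (f (dyadicFloor (j + 1 + k) u)) ≤
      θ ^ k * θ ^ j := by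
    intro k hk j
    rw [dist_comm, Real.dist_eq, add_right_comm, ← pow_add]
    refine (hk₀ (j + k) (by omega) u hu).trans ?_
    exact pow_le_pow_of_le_one hθ0.le hθ1.le (by omega)
  have hcau : CauchySeq fun j => f (dyadicFloor (j + k₀) u) :=
    cauchySeq_of_le_geometric θ (θ ^ k₀) hθ1 (hstep k₀ le_rfl)
  have hlim : Tendsto (fun k => f (dyadicFloor k u)) atTop (𝓝 (dyadicExtension f u)) := by
    obtain ⟨a, ha⟩ := cauchySeq_tendsto_of_complete hcau
    have ha' := (tendsto_add_atTop_iff_nat (f := fun k => f (dyadicFloor k u)) k₀).1 ha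
    rwa [dyadicExtension, ha'.limUnder_eq]
  refine ⟨hlim, fun k hk => ?_⟩
  have := dist_le_of_le_geometric_of_tendsto₀ θ (θ ^ k) hθ1 (hstep k hk)
    ((tendsto_add_atTop_iff_nat (f := fun k => f (dyadicFloor k u)) k).2 hlim)
  simpa [Real.dist_eq] using this

lemma mem_cube_of_mem_orthant {u : EuclideanSpace ℝ (Fin d)} (hu : u ∈ orthant d) {K : ℝ}
    (hK : ‖u‖ < K) : u ∈ cube 0 K := fun i => by
  have h1 := (le_abs_self (u i)).trans ((Real.norm_eq_abs (u i)).symm.le.trans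
    (PiLp.norm_apply_le u i))
  have h2 := hu i
  simp only [PiLp.zero_apply]
  constructor <;> linarith

lemma DyadicRegular.tendsto {θ : ℝ} (hθ0 : 0 < θ) (hθ1 : θ < 1)
    {f : EuclideanSpace ℝ (Fin d) → ℝ} (hf : DyadicRegular d θ f)
    {u : EuclideanSpace ℝ (Fin d)} (hu : u ∈ orthant d) :
    Tendsto (fun k => f (dyadicFloor k u)) atTop (𝓝 (dyadicExtension f u)) := by
  obtain ⟨K, hK⟩ := exists_nat_gt ‖u‖
  have hK0 : 0 < K := by exact_mod_cast (norm_nonneg u).trans_lt hK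
  obtain ⟨k₀, h1⟩ := hf.exists_dist_le hθ0 hθ1 hK0
  exact (h1 u (mem_cube_of_mem_orthant hu hK)).1

theorem DyadicRegular.continuousOn {θ : ℝ} (hθ0 : 0 < θ) (hθ1 : θ < 1)
    {f : EuclideanSpace ℝ (Fin d) → ℝ} (hf : DyadicRegular d θ f) :
    ContinuousOn (dyadicExtension f) (orthant d) := by
  rw [Metric.continuousOn_iff]
  intro u hu ε hε
  obtain ⟨K, hK⟩ := exists_nat_gt (‖u‖ + 1)
  have hK0 : 0 < K := by
    have : (0 : ℝ) < K := by linarith [norm_nonneg u]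
    exact_mod_cast this
  obtain ⟨k₀, h1⟩ := hf.exists_dist_le hθ0 hθ1 hK0
  have hsmall : Tendsto (fun k : ℕ => 2 * (θ ^ k / (1 - θ)) + θ ^ k) atTop (𝓝 0) := by
    have h0 := tendsto_pow_atTop_nhds_zero_of_lt_one hθ0.le hθ1
    simpa using ((h0.div_const (1 - θ)).const_mul 2).add h0
  obtain ⟨k, hk1, hk2, hk3⟩ := ((hsmall.eventually (gt_mem_nhds hε)).and
    ((eventually_ge_atTop k₀).and (hf K))).exists
  refine ⟨(2 ^ k)⁻¹, by positivity, fun v hv hvu => ?_⟩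
  have hle1 : ((2 : ℝ) ^ k)⁻¹ ≤ 1 := inv_le_one_of_one_le₀ (one_le_pow₀ (by norm_num))
  have huK := mem_cube_of_mem_orthant hu (K := K) (by linarith)
  have hvK : v ∈ cube 0 K := by
    refine mem_cube_of_mem_orthant hv ?_
    have h2 := norm_le_norm_add_norm_sub' v u
    rw [dist_eq_norm] at hvu
    linarith
  -- Two rounding errors `√d / 2^k` and the distance `2^{-k}` of the points: this is the origin of
  -- the radius in `DyadicRegular`.
  have hd : ‖dyadicFloor k v - dyadicFloor k u‖ ≤ (2 * √d + 1) / 2 ^ k := by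
    have e : dyadicFloor k v - dyadicFloor k u =
        (u - dyadicFloor k u) - (v - dyadicFloor k v) + (v - u) := by abel
    rw [e]
    refine (norm_add_le _ _).trans ?_
    have h2 := norm_sub_le (u - dyadicFloor k u) (v - dyadicFloor k v)
    have h3 := norm_sub_dyadicFloor_le k hu
    have h4 := norm_sub_dyadicFloor_le k hv
    rw [dist_eq_norm] at hvu
    calc _ ≤ √d / 2 ^ k + √d / 2 ^ k + (2 ^ k)⁻¹ := by linarith
      _ = _ := by ring
  have h5 := hk3 (fun i => ⟨_, gridIndex_dyadic_lt hK0 hvK k i⟩)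
    (fun i => ⟨_, gridIndex_dyadic_lt hK0 huK k i⟩) hd
  have h6 : |f (dyadicFloor k v) - f (dyadicFloor k u)| ≤ θ ^ k := h5
  have h7 := abs_le.1 h6
  have h8 := abs_le.1 ((h1 u huK).2 k hk2)
  have h9 := abs_le.1 ((h1 v hvK).2 k hk2)
  rw [Real.dist_eq, abs_lt]
  constructor <;> linarith

end DyadicPaths

/-! ### Kolmogorov's continuity criterion on dyadic points. -/

lemma measure_abs_gaussian_gt_le {Ω : Type*} [MeasurableSpace Ω] {P : Measure Ω} {N : Ω → ℝ}
    (hN : HasGaussianLaw N P) (hmean : ∫ ω, N ω ∂P = 0) {v x : ℝ} (hv : 0 < v)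
    (hvar : Var[N; P] ≤ v) (hx : 0 ≤ x) :
    P {ω | x < |N ω|} ≤ ENNReal.ofReal (2 * Real.exp (-(x ^ 2 / (2 * v)))) := by
  have := hN.isProbabilityMeasure
  have hmap := hN.map_eq_gaussianReal
  rw [hmean] at hmap
  set w := (Var[N; P]).toNNReal with hw
  have hwv : (w : ℝ) ≤ v := by
    rw [hw, Real.coe_toNNReal _ (variance_nonneg _ _)]
    exact hvar
  have hpre : P {ω | x < |N ω|} = gaussianReal 0 w {y | x < |y|} := by
    rw [← hmap, Measure.map_apply_of_aemeasurable hN.aemeasurable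
      (measurableSet_lt measurable_const (by fun_prop))]
    rfl
  -- `x / v` is the optimal Chernoff exponent for variance `v`.
  have ht : 0 ≤ x / v := by positivity
  have hexp : -(x / v) * x + (w : ℝ) * (x / v) ^ 2 / 2 ≤ -(x ^ 2 / (2 * v)) := by
    have h1 : (w : ℝ) * (x / v) ^ 2 / 2 ≤ v * (x / v) ^ 2 / 2 := by gcongr
    have h2 : v * (x / v) ^ 2 / 2 = x ^ 2 / (2 * v) := by field_simp
    have h3 : -(x / v) * x = -(2 * (x ^ 2 / (2 * v))) := by field_simp
    linarith
  have hge := measure_ge_le_exp_mul_mgf (μ := gaussianReal 0 w) (X := id) (t := x / v) x ht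
    (integrable_exp_mul_gaussianReal _)
  have hle := measure_le_le_exp_mul_mgf (μ := gaussianReal 0 w) (X := id) (t := -(x / v)) (-x)
    (by linarith) (integrable_exp_mul_gaussianReal _)
  rw [mgf_id_gaussianReal, ← Real.exp_add] at hge hle
  have hge' : (gaussianReal 0 w).real {y | x ≤ id y} ≤ Real.exp (-(x ^ 2 / (2 * v))) := by
    refine hge.trans (Real.exp_le_exp.2 (le_trans (le_of_eq ?_) hexp))
    ring
  have hle' : (gaussianReal 0 w).real {y | id y ≤ -x} ≤ Real.exp (-(x ^ 2 / (2 * v))) := by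
    refine hle.trans (Real.exp_le_exp.2 (le_trans (le_of_eq ?_) hexp))
    ring
  have hsub : {y : ℝ | x < |y|} ⊆ {y | x ≤ id y} ∪ {y | id y ≤ -x} := fun y hy => by
    rcases lt_abs.1 (show x < |y| from hy) with h | h
    · exact Or.inl h.le
    · exact Or.inr (by simp only [Set.mem_ofPred_eq, id]; linarith)
  rw [hpre, ← ofReal_measureReal]
  refine ENNReal.ofReal_le_ofReal ((measureReal_mono hsub).trans
    ((measureReal_union_le _ _).trans ?_))
  linarith

/-- Kolmogorov's continuity criterion on dyadic points, for centred Gaussian fields. -/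
theorem ae_dyadicRegular {d : ℕ} {Ω : Type*} [MeasurableSpace Ω] {P : Measure Ω}
    {Y : EuclideanSpace ℝ (Fin d) → Ω → ℝ} {θ V : ℝ} (hθ0 : 0 < θ) (hθ1 : θ < 1) (hV : 0 < V)
    (hG : ∀ k (m n : Fin d → ℕ),
      HasGaussianLaw (fun ω => Y (dyadicPoint k m) ω - Y (dyadicPoint k n) ω) P)
    (hmean : ∀ k (m n : Fin d → ℕ), ∫ ω, (Y (dyadicPoint k m) ω - Y (dyadicPoint k n) ω) ∂P = 0)
    (hvar : ∀ k (m n : Fin d → ℕ),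
      ‖dyadicPoint k m - dyadicPoint k n‖ ≤ (2 * √d + 1) / 2 ^ k →
        Var[fun ω => Y (dyadicPoint k m) ω - Y (dyadicPoint k n) ω; P] ≤ V * (θ ^ k) ^ 4) :
    ∀ᵐ ω ∂P, DyadicRegular d θ fun u => Y u ω := by
  simp only [DyadicRegular]
  rw [ae_all_iff]
  intro K
  set S : ∀ k : ℕ, (Fin d → Fin (K * 2 ^ k)) → (Fin d → Fin (K * 2 ^ k)) → Set Ω := fun k m n =>
    {ω | ‖dyadicPoint k (fun i => (m i : ℕ)) - dyadicPoint k (fun i => (n i : ℕ))‖ ≤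
        (2 * √d + 1) / 2 ^ k ∧
      θ ^ k < |Y (dyadicPoint k fun i => m i) ω - Y (dyadicPoint k fun i => n i) ω|} with hS
  -- At level `k` there are about `4^{dk}` pairs. The threshold `θ^k` against standard deviation of
  -- order `θ^{2k}` gives the exponent `θ^{-2k}/(2V)`; its `M`-th power beats `4^{dk}` with a factor
  -- `2^{-k}` to spare, as Borel–Cantelli requires.
  obtain ⟨M, hM⟩ : ∃ M : ℕ, 2 * (4 : ℝ) ^ d ≤ ((θ ^ 2)⁻¹) ^ M := by
    have h1 : 1 < (θ ^ 2)⁻¹ := (one_lt_inv₀ (by positivity)).2 (by nlinarith)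
    obtain ⟨M, hM⟩ := pow_unbounded_of_one_lt (2 * (4 : ℝ) ^ d) h1
    exact ⟨M, hM.le⟩
  set A : ℝ := (K : ℝ) ^ (2 * d) * (2 * (M.factorial * (2 * V) ^ M)) with hA
  have hbound : ∀ k, P (⋃ m, ⋃ n, S k m n) ≤ ENNReal.ofReal (A * (1 / 2) ^ k) := by
    intro k
    have h1 : ∀ m n, P (S k m n) ≤
        ENNReal.ofReal (2 * Real.exp (-((θ ^ k) ^ 2 / (2 * (V * (θ ^ k) ^ 4))))) := by
      intro m n
      by_cases hc : ‖dyadicPoint k (fun i => (m i : ℕ)) - dyadicPoint k (fun i => (n i : ℕ))‖ ≤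
          (2 * √d + 1) / 2 ^ k
      · refine le_trans (measure_mono fun ω hω => hω.2) (measure_abs_gaussian_gt_le (hG k _ _)
          (hmean k _ _) (by positivity) (hvar k _ _ hc) (by positivity))
      · have : S k m n = ∅ := Set.eq_empty_iff_forall_notMem.2 fun ω hω => hc hω.1
        rw [this, measure_empty]
        exact zero_le
    have h2 : P (⋃ m, ⋃ n, S k m n) ≤ ∑ _m : Fin d → Fin (K * 2 ^ k),
        ∑ _n : Fin d → Fin (K * 2 ^ k),
          ENNReal.ofReal (2 * Real.exp (-((θ ^ k) ^ 2 / (2 * (V * (θ ^ k) ^ 4))))) := by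
      refine (measure_iUnion_fintype_le P _).trans (Finset.sum_le_sum fun m _ => ?_)
      exact (measure_iUnion_fintype_le P _).trans (Finset.sum_le_sum fun n _ => h1 m n)
    refine h2.trans ?_
    simp only [Finset.sum_const, Finset.card_univ, Fintype.card_fun, Fintype.card_fin, nsmul_eq_mul]
    rw [← mul_assoc, ← Nat.cast_mul, ← ENNReal.ofReal_natCast, ← ENNReal.ofReal_mul (by positivity)]
    refine ENNReal.ofReal_le_ofReal ?_
    have hz : (θ ^ k) ^ 2 / (2 * (V * (θ ^ k) ^ 4)) = ((θ ^ 2)⁻¹) ^ k / (2 * V) := by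
      rw [inv_pow, ← pow_mul, ← pow_mul, ← pow_mul]
      have h0 : θ ^ (k * 4) = θ ^ (k * 2) * θ ^ (2 * k) := by rw [← pow_add]; congr 1; ring
      rw [h0]
      field_simp
    rw [hz]
    have h3 := exp_neg_le_factorial_div_pow (z := ((θ ^ 2)⁻¹) ^ k / (2 * V)) (by positivity) M
    have h4 : (M.factorial : ℝ) / (((θ ^ 2)⁻¹) ^ k / (2 * V)) ^ M ≤
        M.factorial * (2 * V) ^ M * (1 / (2 * 4 ^ d)) ^ k := by
      have hb : (2 * (4 : ℝ) ^ d) ^ k / (2 * V) ^ M ≤ (((θ ^ 2)⁻¹) ^ k / (2 * V)) ^ M := by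
        rw [div_pow, ← pow_mul, mul_comm k M, pow_mul]
        have := pow_le_pow_left₀ (by positivity) hM k
        gcongr
      calc _ ≤ (M.factorial : ℝ) / ((2 * (4 : ℝ) ^ d) ^ k / (2 * V) ^ M) :=
            div_le_div_of_nonneg_left (by positivity) (by positivity) hb
        _ = _ := by rw [one_div, inv_pow]; field_simp
    push_cast
    calc ((K : ℝ) * 2 ^ k) ^ d * ((K : ℝ) * 2 ^ k) ^ d *
          (2 * Real.exp (-(((θ ^ 2)⁻¹) ^ k / (2 * V))))
        ≤ ((K : ℝ) * 2 ^ k) ^ d * ((K : ℝ) * 2 ^ k) ^ d *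
          (2 * (M.factorial * (2 * V) ^ M * (1 / (2 * 4 ^ d)) ^ k)) := by
          refine mul_le_mul_of_nonneg_left ?_ (by positivity)
          linarith
      _ = A * (1 / 2) ^ k := by
          have e1 : ((K : ℝ) * 2 ^ k) ^ d * ((K : ℝ) * 2 ^ k) ^ d = (K : ℝ) ^ (2 * d) * (4 ^ d) ^ k := by
            have h4 : (4 : ℝ) = 2 * 2 := by norm_num
            rw [h4, mul_pow, mul_pow, mul_pow, two_mul, pow_add, ← pow_mul, ← pow_mul, mul_comm k d]
            ring
          have e2 : (1 / (2 * (4 : ℝ) ^ d)) ^ k * (4 ^ d) ^ k = (1 / 2) ^ k := by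
            rw [← mul_pow]
            congr 1
            field_simp
          rw [e1, hA, ← e2]
          ring
  have hsum : ∑' k, P (⋃ m, ⋃ n, S k m n) ≠ ∞ := by
    refine ne_top_of_le_ne_top ?_ (ENNReal.tsum_le_tsum hbound)
    exact (summable_geometric_two.mul_left A).tsum_ofReal_ne_top
  filter_upwards [ae_eventually_notMem hsum] with ω hω
  filter_upwards [hω] with k hk m n hmn
  by_contra hc
  exact hk (Set.mem_iUnion.2 ⟨m, Set.mem_iUnion.2 ⟨n, hmn, not_le.1 hc⟩⟩)

/-! ### Almost sure limits of Gaussian processes. -/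

section GaussianLimits

open scoped NNReal

variable {Ω : Type*} [MeasurableSpace Ω] {P : Measure Ω} [IsProbabilityMeasure P]

/-- Almost sure limits of centred Gaussian variables are Gaussian. -/
lemma hasLaw_gaussianReal_of_tendsto {Y : ℕ → Ω → ℝ} {Z : Ω → ℝ} {v : ℕ → ℝ≥0} {w : ℝ≥0}
    (hY : ∀ n, HasLaw (Y n) (gaussianReal 0 (v n)) P)
    (hlim : ∀ᵐ ω ∂P, Tendsto (fun n => Y n ω) atTop (𝓝 (Z ω))) (hv : Tendsto v atTop (𝓝 w)) :
    HasLaw Z (gaussianReal 0 w) P := by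
  have hZ : AEMeasurable Z P := aemeasurable_of_tendsto_metrizable_ae' (fun n => (hY n).aemeasurable)
    hlim
  have := Measure.isProbabilityMeasure_map hZ (μ := P)
  refine ⟨hZ, Measure.ext_of_charFun (funext fun s => ?_)⟩
  have hexp : Measurable fun x : ℝ => Complex.exp (s * x * Complex.I) := by fun_prop
  have h1 : Tendsto (fun n => ∫ ω, Complex.exp (s * Y n ω * Complex.I) ∂P) atTop
      (𝓝 (∫ ω, Complex.exp (s * Z ω * Complex.I) ∂P)) := by
    refine tendsto_integral_of_dominated_convergence (fun _ => 1)
      (fun n => (hexp.comp_aemeasurable (hY n).aemeasurable).aestronglyMeasurable)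
      (integrable_const _) (fun n => ae_of_all _ fun ω => ?_) ?_
    · rw [← Complex.ofReal_mul, Complex.norm_exp_ofReal_mul_I]
    · filter_upwards [hlim] with ω hω
      have hc : Continuous fun x : ℝ => Complex.exp (s * x * Complex.I) := by fun_prop
      exact (hc.tendsto _).comp hω
  have h2 : ∀ n, ∫ ω, Complex.exp (s * Y n ω * Complex.I) ∂P =
      Complex.exp (s * (0 : ℝ) * Complex.I - (v n : ℝ) * s ^ 2 / 2) := fun n => by
    have e := charFun_gaussianReal (μ := 0) (v := v n) s
    rw [← (hY n).map_eq, charFun_apply_real, integral_map (hY n).aemeasurable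
      hexp.aestronglyMeasurable] at e
    rw [e]
  rw [charFun_apply_real, integral_map hZ hexp.aestronglyMeasurable, charFun_gaussianReal]
  refine tendsto_nhds_unique h1 ?_
  simp_rw [h2]
  have hv' : Tendsto (fun n => (v n : ℝ)) atTop (𝓝 (w : ℝ)) :=
    (NNReal.continuous_coe.tendsto w).comp hv
  have hc : Continuous fun x : ℝ =>
      Complex.exp (s * (0 : ℝ) * Complex.I - (x : ℂ) * s ^ 2 / 2) := by fun_prop
  exact (hc.tendsto _).comp hv'

/-- Pointwise almost sure limits of centred Gaussian processes are Gaussian processes. -/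
theorem isGaussianProcess_of_tendsto {S : Type} {Y : ℕ → S → Ω → ℝ} {Z : S → Ω → ℝ}
    {C : S → S → ℝ} (hY : ∀ n, IsGaussianProcess (Y n) P) (hm : ∀ n s, ∫ ω, Y n s ω ∂P = 0)
    (hc : ∀ s t, Tendsto (fun n => covariance (Y n s) (Y n t) P) atTop (𝓝 (C s t)))
    (hlim : ∀ s, ∀ᵐ ω ∂P, Tendsto (fun n => Y n s ω) atTop (𝓝 (Z s ω))) :
    IsGaussianProcess Z P ∧ (∀ s, ∫ ω, Z s ω ∂P = 0) ∧
      ∀ s t, covariance (Z s) (Z t) P = C s t := by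
  classical
  have hL : ∀ n s, MemLp (Y n s) 2 P := fun n s => ((hY n).hasGaussianLaw_eval s).memLp_two
  have comb : ∀ (ι : Type) [Fintype ι] (u : ι → S) (a : ι → ℝ),
      0 ≤ ∑ i, ∑ j, a i * a j * C (u i) (u j) ∧
      HasLaw (fun ω => ∑ i, a i * Z (u i) ω)
        (gaussianReal 0 (∑ i, ∑ j, a i * a j * C (u i) (u j)).toNNReal) P := by
    intro ι _ u a
    have hvar : ∀ n, Var[fun ω => ∑ i, a i * Y n (u i) ω; P] =
        ∑ i, ∑ j, a i * a j * covariance (Y n (u i)) (Y n (u j)) P := fun n => by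
      rw [variance_fun_sum fun i => (hL n (u i)).const_mul (a i)]
      simp only [covariance_const_mul_left, covariance_const_mul_right, ← mul_assoc]
      simp only [mul_comm]
    have hlimv : Tendsto (fun n => Var[fun ω => ∑ i, a i * Y n (u i) ω; P]) atTop
        (𝓝 (∑ i, ∑ j, a i * a j * C (u i) (u j))) := by
      simp_rw [hvar]
      exact tendsto_finsetSum _ fun i _ => tendsto_finsetSum _ fun j _ => (hc _ _).const_mul _
    refine ⟨ge_of_tendsto' hlimv fun n => variance_nonneg _ _, ?_⟩
    refine hasLaw_gaussianReal_of_tendsto (Y := fun n ω => ∑ i, a i * Y n (u i) ω)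
      (v := fun n => Var[fun ω => ∑ i, a i * Y n (u i) ω; P].toNNReal) (fun n => ?_) ?_
      ((continuous_real_toNNReal.tendsto _).comp hlimv)
    · have hg : HasGaussianLaw (fun ω => ∑ i, a i * Y n (u i) ω) P :=
        (IsGaussianProcess.sum_mul (S := Unit) (hY n) u fun _ => a).hasGaussianLaw_eval ()
      have hint : ∫ ω, ∑ i, a i * Y n (u i) ω ∂P = 0 := by
        rw [integral_finsetSum _ fun i _ => ((hL n (u i)).integrable (by norm_num)).const_mul _]
        simp [integral_const_mul, hm]
      refine ⟨hg.aemeasurable, ?_⟩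
      rw [hg.map_eq_gaussianReal, hint]
    · filter_upwards [ae_all_iff.2 fun i => hlim (u i)] with ω hω
      exact tendsto_finsetSum _ fun i _ => (hω i).const_mul _
  have one : ∀ s, 0 ≤ C s s ∧ HasLaw (Z s) (gaussianReal 0 (C s s).toNNReal) P := fun s => by
    simpa using comb Unit (fun _ => s) fun _ => 1
  have hZL : ∀ s, MemLp (Z s) 2 P := fun s => by
    have hg : HasGaussianLaw (Z s) P := ⟨by rw [(one s).2.map_eq]; infer_instance⟩
    exact hg.memLp_two
  refine ⟨⟨fun I => ⟨?_⟩⟩, fun s => ?_, fun s t => ?_⟩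
  · have hm : AEMeasurable (fun ω => I.restrict fun s => Z s ω) P :=
      aemeasurable_pi_lambda _ fun i => (hZL i).aestronglyMeasurable.aemeasurable
    refine isGaussian_of_map_eq_gaussianReal fun l => ⟨0, _, Eq.trans ?_
      (comb I (fun i => i) fun i => l (Pi.single i 1)).2.map_eq⟩
    · rw [AEMeasurable.map_map_of_aemeasurable (by fun_prop) hm]
      have e : (l ∘ fun ω => I.restrict fun s => Z s ω) =
          fun ω => ∑ i : I, l (Pi.single i 1) * Z i ω := by
        funext ω
        have := LinearMap.pi_apply_eq_sum_univ l.toLinearMap (I.restrict fun s => Z s ω)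
        simp only [ContinuousLinearMap.coe_coe] at this
        simp only [Function.comp_apply, this, Finset.restrict, smul_eq_mul]
        refine Finset.sum_congr rfl fun i _ => ?_
        rw [mul_comm]
        congr 2
        funext j
        simp [Pi.single_apply, eq_comm]
      rw [e]
  · rw [(one s).2.integral_eq]
    simp
  · have hsymm : C t s = C s t := tendsto_nhds_unique (hc t s)
      ((hc s t).congr fun n => covariance_comm _ _)
    -- Covariances of the limit are recovered by polarisation from the variance of `Z s + Z t`.
    have h2 := comb (Fin 2) ![s, t] fun _ => 1
    simp only [Fin.sum_univ_two, one_mul, Matrix.cons_val_zero, Matrix.cons_val_one] at h2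
    have hv := h2.2.variance_eq
    have hs := (one s).2.variance_eq
    have ht := (one t).2.variance_eq
    rw [variance_fun_add (hZL s) (hZL t), hs, ht] at hv
    simp only [variance_id_gaussianReal, Real.coe_toNNReal _ (one s).1, Real.coe_toNNReal _ (one t).1,
      Real.coe_toNNReal _ h2.1] at hv
    linarith

end GaussianLimits

/-- Subtracting a deterministic function from a Gaussian process. -/
lemma IsGaussianProcess.sub_const {T Ω : Type*} [MeasurableSpace Ω] {P : Measure Ω}
    {Y : T → Ω → ℝ} (hY : IsGaussianProcess Y P) (m : T → ℝ) :
    IsGaussianProcess (fun t ω => Y t ω - m t) P := by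
  refine ⟨fun I => ⟨?_⟩⟩
  have h := hY.hasGaussianLaw I
  have := h.isGaussian_map
  have e := AEMeasurable.map_map_of_aemeasurable (μ := P)
    (g := fun x : I → ℝ => x - I.restrict m) (by fun_prop) h.aemeasurable
  have e' : ((fun x : I → ℝ => x - I.restrict m) ∘ fun ω => I.restrict fun t => Y t ω) =
      fun ω => I.restrict fun t => Y t ω - m t := rfl
  rw [← e', ← e]
  infer_instance

/-! ### Existence of the tangent field. -/

section TangentField

variable {d : ℕ}

/-- An infinite matrix is positive semidefinite if its finite principal submatrices are. -/
lemma posSemidef_of_submatrix {ι : Type*} {M : Matrix ι ι ℝ} (hsymm : ∀ i j, M i j = M j i)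
    (h : ∀ s : Finset ι, (M.submatrix ((↑) : s → ι) ((↑) : s → ι)).PosSemidef) :
    M.PosSemidef := by
  classical
  refine ⟨Matrix.IsHermitian.ext fun i j => hsymm j i, fun x => ?_⟩
  have h1 := (h x.support).dotProduct_mulVec_nonneg fun i => x i
  refine h1.trans_eq ?_
  simp only [dotProduct, Matrix.mulVec, Matrix.submatrix_apply, Pi.star_apply, star_trivial,
    Finsupp.sum, Finset.mul_sum, ← mul_assoc]
  rw [Finset.sum_coe_sort x.support
    fun i => ∑ j : x.support, x i * M i j * x j]
  exact Finset.sum_congr rfl fun i _ => Finset.sum_coe_sort x.support fun j => x i * M i j * x j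

/-- Existence of the tangent field, for an abstract kernel of the right form. -/
theorem exists_isTangentField {α M : ℝ} (hα : 0 < α) {ρ : EuclideanSpace ℝ (Fin d) → ℝ}
    (hpsd : ∀ (ι : Type) [Fintype ι] [DecidableEq ι] (u : ι → EuclideanSpace ℝ (Fin d)),
      (tangentCov α ρ u).PosSemidef)
    (hcont : Continuous (homog α ρ)) (hM : ∀ u, homog α ρ u ≤ M * ‖u‖ ^ α) :
    ∃ W : EuclideanSpace ℝ (Fin d) → (ℕ → ℝ) → ℝ, IsTangentField α ρ W whiteNoise := by
  classical
  set g := homog α ρ with hg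
  have hg0 : g 0 = 0 := homog_zero hα ρ
  set K : EuclideanSpace ℝ (Fin d) → EuclideanSpace ℝ (Fin d) → ℝ :=
    fun u v => (g u + g v - g (u - v)) / 2 with hK
  have hKsymm : ∀ u v, K u v = K v u := fun u v => by
    have := (hpsd (Fin 2) ![u, v]).isHermitian.apply 0 1
    simpa [tangentCov, hK] using this.symm
  set T := Set.range fun q : ℕ × (Fin d → ℕ) => dyadicPoint q.1 q.2 with hT
  have : Countable T := Set.countable_range _ |>.to_subtype
  obtain ⟨Y₀, hYG, hYm, hYc⟩ := exists_gaussianProcess_of_countable (T := T) (fun p q => K p q)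
    fun u => posSemidef_of_submatrix (fun i j => hKsymm _ _) fun s =>
      hpsd s fun i => (u i : EuclideanSpace ℝ (Fin d))
  set pt : ℕ → (Fin d → ℕ) → T := fun k n => ⟨dyadicPoint k n, ⟨(k, n), rfl⟩⟩ with hpt
  set Y : EuclideanSpace ℝ (Fin d) → (ℕ → ℝ) → ℝ :=
    fun p ω => if h : p ∈ T then Y₀ ⟨p, h⟩ ω else 0 with hY
  have hYpt : ∀ k n, Y (dyadicPoint k n) = Y₀ (pt k n) := fun k n => by
    funext ω
    exact dif_pos (pt k n).2
  have hL : ∀ p, MemLp (Y₀ p) 2 whiteNoise := fun p => (hYG.hasGaussianLaw_eval p).memLp_two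
  have hI : ∀ p, Integrable (Y₀ p) whiteNoise := fun p => (hL p).integrable (by norm_num)
  -- Increments over distance `2^{-k}` have variance of order `2^{-kα} = θ^{4k}`, as the dyadic
  -- criterion demands.
  set θ : ℝ := 2 ^ (-(α / 4)) with hθ
  have hθ0 : 0 < θ := by positivity
  have hθ1 : θ < 1 := Real.rpow_lt_one_of_one_lt_of_neg one_lt_two (by linarith)
  have hreg : ∀ᵐ ω ∂whiteNoise, DyadicRegular d θ fun u => Y u ω := by
    refine ae_dyadicRegular (V := max M 1 * (2 * √d + 1) ^ α) hθ0 hθ1 (by positivity)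
      (fun k m n => ?_) (fun k m n => ?_) (fun k m n hmn => ?_)
    · simp only [hYpt]
      have := (IsGaussianProcess.sum_mul (S := Unit) hYG ![pt k m, pt k n]
        fun _ => ![1, -1]).hasGaussianLaw_eval ()
      simpa [Fin.sum_univ_two, sub_eq_add_neg] using this
    · simp only [hYpt]
      rw [integral_sub (hI _) (hI _), hYm, hYm, sub_zero]
    · simp only [hYpt]
      rw [variance_fun_sub (hL _) (hL _), ← covariance_self (hL _).aemeasurable,
        ← covariance_self (hL _).aemeasurable, hYc, hYc, hYc]
      have e : K (dyadicPoint k m) (dyadicPoint k m) - 2 * K (dyadicPoint k m) (dyadicPoint k n) +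
          K (dyadicPoint k n) (dyadicPoint k n) = g (dyadicPoint k m - dyadicPoint k n) := by
        simp only [hK, sub_self, hg0]
        ring
      have e2 : (θ ^ k) ^ 4 = ((2 ^ k : ℝ)⁻¹) ^ α := by
        rw [← Real.rpow_natCast 2 k, ← Real.rpow_neg two_pos.le, hθ, ← Real.rpow_natCast,
          ← Real.rpow_natCast, ← Real.rpow_mul two_pos.le, ← Real.rpow_mul two_pos.le,
          ← Real.rpow_mul two_pos.le]
        congr 1
        push_cast
        ring
      refine e.le.trans ((hM _).trans ?_)
      rw [e2, mul_assoc, ← Real.mul_rpow (by positivity) (by positivity), ← div_eq_mul_inv]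
      gcongr
      exact le_max_left _ _
  have hfl : ∀ u : orthant d, Tendsto (fun k => dyadicFloor k (u : EuclideanSpace ℝ (Fin d)))
      atTop (𝓝 u) := fun u => by
    refine tendsto_iff_norm_sub_tendsto_zero.2 (squeeze_zero (fun _ => norm_nonneg _)
      (fun k => (norm_sub_rev _ _).trans_le (norm_sub_dyadicFloor_le k u.2)) ?_)
    have := (tendsto_pow_atTop_nhds_zero_of_lt_one (r := (1 / 2 : ℝ)) (by norm_num)
      (by norm_num)).const_mul √d
    simpa [div_eq_mul_inv] using this
  set Z : orthant d → (ℕ → ℝ) → ℝ := fun u ω => dyadicExtension (fun p => Y p ω) u with hZ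
  obtain ⟨hZG, hZm, hZc⟩ := isGaussianProcess_of_tendsto (P := whiteNoise) (Z := Z)
    (C := fun u v : orthant d => K u v)
    (Y := fun k (u : orthant d) => Y (dyadicFloor k (u : EuclideanSpace ℝ (Fin d))))
    (fun k => by
      simp only [dyadicFloor, hYpt]
      exact hYG.comp_right fun u : orthant d => pt k (gridIndex 0 (1 / (2 ^ k : ℕ)) u))
    (fun k u => by simp only [dyadicFloor, hYpt, hYm])
    (fun u v => by
      have hKc : Continuous fun q : EuclideanSpace ℝ (Fin d) × EuclideanSpace ℝ (Fin d) =>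
          K q.1 q.2 := by
        simp only [hK]
        fun_prop
      have := (hKc.tendsto (u, v)).comp ((hfl u).prodMk_nhds (hfl v))
      refine this.congr fun k => ?_
      simp only [Function.comp_apply, dyadicFloor, hYpt, hYc]
      rfl)
    (fun u => hreg.mono fun ω hω => hω.tendsto hθ0 hθ1 u.2)
  have hZint : ∀ u, Integrable (Z u) whiteNoise := fun u =>
    (hZG.hasGaussianLaw_eval u).memLp_two.integrable (by norm_num)
  refine ⟨fun u ω => dyadicExtension (fun p => Y p ω) u - g u / 2, inferInstance, ?_, ?_, ?_, ?_, ?_⟩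
  · exact IsGaussianProcess.sub_const hZG fun u => g u / 2
  · filter_upwards [hreg] with ω hω
    exact (hω.continuousOn hθ0 hθ1).sub (by fun_prop)
  · have h0 : (0 : EuclideanSpace ℝ (Fin d)) ∈ orthant d := fun i => le_rfl
    -- The kernel vanishes at the origin, so the limit field has law `δ₀` there and is almost surely
    -- `0`.
    have hv : Var[Z ⟨0, h0⟩; whiteNoise] = 0 := by
      rw [← covariance_self (hZint _).aemeasurable, hZc]
      simp [hK, hg0]
    have hlaw := (hZG.hasGaussianLaw_eval ⟨0, h0⟩).map_eq_gaussianReal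
    rw [hv, hZm, Real.toNNReal_zero, gaussianReal_zero_var] at hlaw
    have hlaw' : HasLaw (Z ⟨0, h0⟩) (Measure.dirac 0) whiteNoise := ⟨(hZint _).aemeasurable, hlaw⟩
    filter_upwards [hlaw'.ae_eq_of_dirac] with ω hω
    rw [hg0, zero_div, sub_zero]
    exact hω
  · intro u hu
    have e := hZm ⟨u, hu⟩
    simp only [hZ] at e
    rw [integral_sub (hZint ⟨u, hu⟩) (integrable_const _), e]
    simp
    ring
  · intro u hu v hv
    have e := hZc ⟨u, hu⟩ ⟨v, hv⟩
    rw [covariance_sub_const_left (hZint ⟨u, hu⟩), covariance_sub_const_right (hZint ⟨v, hv⟩)]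
    exact e

end TangentField

namespace LocallyStationaryField

variable {d : ℕ} {Ω : Type*} [MeasurableSpace Ω] {P : Measure Ω}
  {D : Set (EuclideanSpace ℝ (Fin d))} {δ : ℝ} {X : EuclideanSpace ℝ (Fin d) → Ω → ℝ} {α : ℝ}
  {L : ℝ → ℝ} {r : EuclideanSpace ℝ (Fin d) → EuclideanSpace ℝ (Fin d) → ℝ}

lemma homog_le (h : LocallyStationaryField P D δ X α L r) : ∃ M, ∀ t ∈ D, ∀ u,
    homog α (r t) u ≤ M * ‖u‖ ^ α := by
  obtain ⟨M, hM0, hM⟩ := h.exists_bound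
  refine ⟨M, fun t ht u => ?_⟩
  rcases eq_or_ne u 0 with rfl | hu
  · rw [homog_zero h.alpha_pos]
    positivity
  · rw [homog, mul_comm]
    gcongr
    exact hM t (mem_of_dist_lt ht (by simpa using h.delta_pos)) _ (dir_mem_sphere hu)

/-- Continuity of `r t` is known on the sphere only. Away from `0` it is composed with the direction
map; at `0` the bound `M ‖u‖^α` takes over. -/
lemma continuous_homog (h : LocallyStationaryField P D δ X α L r) {t : EuclideanSpace ℝ (Fin d)}
    (ht : t ∈ D) : Continuous (homog α (r t)) := by
  have htU : t ∈ Metric.thickening δ D := mem_of_dist_lt ht (by simpa using h.delta_pos)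
  obtain ⟨M, hM⟩ := h.homog_le
  refine continuous_iff_continuousAt.2 fun u => ?_
  rcases eq_or_ne u 0 with rfl | hu
  · rw [ContinuousAt, homog_zero h.alpha_pos]
    refine squeeze_zero (fun v => h.homog_nonneg ht v) (fun v => hM t ht v) ?_
    have : Continuous fun v : EuclideanSpace ℝ (Fin d) => M * ‖v‖ ^ α :=
      continuous_const.mul (continuous_norm.rpow_const fun _ => Or.inr h.alpha_pos.le)
    simpa [Real.zero_rpow h.alpha_pos.ne'] using this.tendsto 0
  · have hn : ‖u‖ ≠ 0 := norm_ne_zero_iff.2 hu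
    refine (continuous_norm.continuousAt.rpow_const (Or.inl hn)).mul ?_
    refine ContinuousOn.continuousAt (s := {0}ᶜ) ?_ (isOpen_compl_singleton.mem_nhds hu)
    refine (h.r_cont t htU).comp (fun v hv => ?_) fun v hv => dir_mem_sphere hv
    exact ((continuous_norm.continuousAt.inv₀ (norm_ne_zero_iff.2 hv)).smul
      continuousAt_id).continuousWithinAt

theorem exists_tangentField (h : LocallyStationaryField P D δ X α L r)
    {t : EuclideanSpace ℝ (Fin d)} (ht : t ∈ D) :
    ∃ W : EuclideanSpace ℝ (Fin d) → (ℕ → ℝ) → ℝ, IsTangentField α (r t) W whiteNoise := by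
  obtain ⟨M, hM⟩ := h.homog_le
  exact exists_isTangentField h.alpha_pos (fun ι _ _ u => h.tangentCov_posSemidef u ht)
    (h.continuous_homog ht) (hM t ht)

end LocallyStationaryField

/-! ### The Pickands constant and the theorem. -/

namespace LocallyStationaryField

variable {d : ℕ} {Ω : Type*} [MeasurableSpace Ω] {P : Measure Ω}
  {D : Set (EuclideanSpace ℝ (Fin d))} {δ : ℝ} {X : EuclideanSpace ℝ (Fin d) → Ω → ℝ} {α : ℝ}
  {L : ℝ → ℝ} {r : EuclideanSpace ℝ (Fin d) → EuclideanSpace ℝ (Fin d) → ℝ}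

/-- The limit theorem is applied to the single point `{t}`, where compactness of the sphere bounds
`r t` below without a uniform hypothesis on `D`. The cube constant is `1 + H_K`, and `1 / K^d`
disappears in the limit because `d > 0`. -/
theorem isPickandsValue_pickands (h : LocallyStationaryField P D δ X α L r) (hd : 0 < d)
    {t : EuclideanSpace ℝ (Fin d)} (ht : t ∈ D) :
    IsPickandsValue α (r t) (pickands α (r t)) ∧ 0 < pickands α (r t) := by
  obtain ⟨r₀, hr₀, hr⟩ := h.exists_le_r_at (Metric.self_subset_thickening h.delta_pos D ht)
  obtain ⟨hlim, ⟨B₀, hB₀, B₁, hB⟩, -, -⟩ := h.exists_cube_asymptotics (T := {t}) (by simpa using ht)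
    hr₀ (by simpa using hr)
  refine ⟨⟨?_, fun Ω' _ P' W hW => ?_⟩, hB₀.trans_le (hB t rfl).1⟩
  · obtain ⟨W, hW⟩ := h.exists_tangentField ht
    exact ⟨_, _, _, W, hW⟩
  have hfin : ∀ K : ℝ, 0 < K → pickandsIntegral W P' K ≠ ∞ := fun K hK => by
    obtain ⟨⟨B, hB'⟩, -⟩ := h.exists_pickCube_approx hK one_pos
    have h1 := hB' t ht
    rw [hW.pickCube_eq hK] at h1
    exact ne_top_of_le_ne_top ENNReal.ofReal_ne_top (le_add_self.trans h1)
  refine ⟨hfin, ?_⟩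
  have h0 : Tendsto (fun K : ℝ => 1 / K ^ d) atTop (𝓝 0) :=
    tendsto_const_nhds.div_atTop (tendsto_pow_atTop hd.ne')
  have h1 := (hlim t rfl).sub h0
  rw [sub_zero] at h1
  refine h1.congr' ?_
  filter_upwards [eventually_gt_atTop 0] with K hK
  rw [hW.pickCube_eq hK, ENNReal.toReal_add ENNReal.one_ne_top (hfin K hK), ENNReal.toReal_one]
  ring

end LocallyStationaryField

theorem theorem2p1 {d : ℕ} (hd : 0 < d)
    {Ω : Type*} [MeasurableSpace Ω] (P : Measure Ω) [IsProbabilityMeasure P]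
    -- the parameter set, and the field `X`, whose values matter only on `[D]_δ = thickening δ D`
    (D : Set (EuclideanSpace ℝ (Fin d))) (δ : ℝ) (hδ : 0 < δ)
    (X : EuclideanSpace ℝ (Fin d) → Ω → ℝ)
    (hgauss : IsGaussianProcess (fun t : Metric.thickening δ D => X t) P)
    (hcont : ∀ᵐ ω ∂P, ContinuousOn (fun t => X t ω) (Metric.thickening δ D))
    (hmean : ∀ t ∈ Metric.thickening δ D, ∫ ω, X t ω ∂P = 0)
    (hvar : ∀ t ∈ Metric.thickening δ D, ∫ ω, X t ω ^ 2 ∂P = 1)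
    -- the local structure of the covariance
    (α : ℝ) (hα0 : 0 < α) (hα2 : α ≤ 2)
    (L : ℝ → ℝ) (hL : SlowlyVaryingAtZero L)
    (hmin : ∀ᶠ c in atTop, IsLeast (scaleSet α L c) (scale α L c))
    (hscale : Tendsto (scale α L) atTop (𝓝 0))
    (r : EuclideanSpace ℝ (Fin d) → EuclideanSpace ℝ (Fin d) → ℝ)
    (hr_cont : ∀ t ∈ Metric.thickening δ D, ContinuousOn (r t) (Metric.sphere 0 1))
    (hr_pos : ∀ t ∈ Metric.thickening δ D, ∀ v ∈ Metric.sphere 0 1, 0 < r t v)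
    (hr_unif : ∀ ε > 0, ∃ η > 0, ∀ t ∈ Metric.thickening δ D, ∀ u ∈ Metric.thickening δ D,
      dist u t < η → ∀ v ∈ Metric.sphere 0 1, |r t v - r u v| ≤ ε)
    (hr_bdd : ∃ M : ℝ, ∀ t ∈ Metric.thickening δ D, ∀ v ∈ Metric.sphere 0 1, r t v ≤ M)
    (hcov : LocalCovariance P X (Metric.thickening δ D) α L r) :
    ∃ H : EuclideanSpace ℝ (Fin d) → ℝ,
      (∀ t ∈ D, IsPickandsValue α (r t) (H t) ∧ 0 < H t) ∧
      -- local cube asymptotics, uniformly over `t ∈ D`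
      ((∃ r₀ > 0, ∀ t ∈ D, ∀ v ∈ Metric.sphere 0 1, r₀ ≤ r t v) →
        ∀ ℓ : ℝ → ℝ, Tendsto ℓ atTop atTop → ℓ =o[atTop] (fun c => (scale α L c)⁻¹) →
          TendstoUniformlyOn
            (fun c t => P.real (supExceeds X (cube t (ℓ c * scale α L c)) c) /
              (ℓ c ^ d * gaussTail c * H t))
            (fun _ => 1) atTop D) ∧
      -- global asymptotics
      (BoundedJordanMeasurable D → 0 < volume D →
        (∀ s ∈ D, ∀ t ∈ D, s ≠ t → ∫ ω, X s ω * X t ω ∂P < 1) →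
          IntegrableOn H D volume ∧
          (fun c => P.real (supExceeds X D c)) ~[atTop]
            (fun c => gaussTail c * (scale α L c ^ d)⁻¹ * ∫ t in D, H t)) := by
  have h : LocallyStationaryField P D δ X α L r :=
    ⟨hδ, ⟨hgauss, hcont, hmean, hvar⟩, hα0, hL, hmin, hscale, hr_cont, hr_pos, hr_unif, hr_bdd, hcov⟩
  refine ⟨fun t => pickands α (r t), fun t ht => h.isPickandsValue_pickands hd ht, ?_, ?_⟩
  · rintro ⟨r₀, hr₀, hr⟩ ℓ hℓ hℓo
    exact h.tendstoUniformlyOn_cube hr₀ hr hℓ hℓo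
  · rintro ⟨hD, hfr⟩ hpos hcorr
    exact ⟨h.integrableOn_pickands hD hfr, h.isEquivalent_global hD hfr hpos hcorr⟩
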